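/- Let $C$ be a smooth (Hausdorff, second countable) manifold, $p\colon E\to C$ a smooth real vector bundle of finite rank, and let the total space $M=E$ carry a Poisson structure, with Poisson bracket $\{\cdot,\cdot\}$ on $C^\infty(M)$, bivector field $\pi$, and $\pi^\sharp\colon T^*M\to TM$, $\pi^\sharp(df)=\{f,\cdot\}$. Regard $C\subset M$ as the zero section, so that $NC=E$ and $N^*C=E^*$. Let $I(C)\subset C^\infty(M)$ be the ideal of functions vanishing on $C$, and assume that $C$ is coisotropic, i.e. $\{I(C),I(C)\}\subset I(C)$. *Notation.* Sections of $E^*$ are regarded as functions on $M$ that are linear on the fibres, and a section $v$ of $E$ as the vertical vector field $h\mapsto \frac{d}{dt}\big|_{0}h(\cdot+t\,v)$ on $M$. For a bilinear bracket $B$ on $C^\infty(M)$ let $(vB)(f,g)=v(B(f,g))-B(vf,g)-B(f,vg)$ (the Lie derivative), and write $v_1\cdots v_k\{\cdot,\cdot\}$ for the iterated Lie derivative of the Poisson bracket. The pairing of $\Gamma(C,\wedge^2E)$ with $u\otimes w$ is $\langle\alpha\wedge\beta,u\otimes w\rangle=\langle\alpha,u\rangle\langle\beta,w\rangle-\langle\beta,u\rangle\langle\alpha,w\rangle$.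 A *$P_\infty$-structure* on a graded commutative real algebra $A$ is a sequence of linear maps $\lambda_n\colon A^{\otimes n}\to A$ of degree $2-n$ ($n\ge 0$) such that, for homogeneous arguments, (i) $\lambda_n(\dots,a_i,a_{i+1},\dots)=-(-1)^{|a_i||a_{i+1}|}\lambda_n(\dots,a_{i+1},a_i,\dots)$; (ii) $a\mapsto\lambda_n(a_1,\dots,a_{n-1},a)$ is a graded derivation of degree $2-n+\sum_{i<n}|a_i|$; (iii) for all $n\ge0$ the map $a_1\otimes\cdots\otimes a_n\mapsto\sum_{q=0}^n\frac{(-1)^{q(n-q)}}{q!(n-q)!}\lambda_{n-q+1}(\lambda_q(a_1,\dots,a_q),a_{q+1},\dots,a_n)$ vanishes on the image of the (graded) alternation map $\frac{1}{n!}\sum_{\sigma\in S_n}\mathrm{sign}(\sigma)\,\sigma$. It is *flat* if $\lambda_0=0$. The *Lie algebroid* $N^*C$ has the bracket determined by $[dh|_C,dk|_C]=d\{h,k\}|_C$ for $h,k\in I(C)$ and the anchor $\pi^\sharp$. Its *differential* is the derivation $\delta$ of degree $1$ and square zero of $\Gamma(C,\wedge NC)$ with $\delta f=\pi^\sharp d\tilde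 f \bmod TC$ for $f\in C^\infty(C)$ and any extension $\tilde f$ of $f$ to $M$, and $\langle\delta v,u\otimes w\rangle=\langle v,[u,w]\rangle-\pi^\sharp(u)\langle v,w\rangle+\pi^\sharp(w)\langle v,u\rangle$ for $v\in\Gamma(C,NC)$, $u,w\in\Gamma(C,N^*C)$. The *algebra of functions on the reduced phase space* is $C^\infty(\underline C)=\{f\in C^\infty(C): \{h,\tilde f\}|_C=0 \text{ for all } h\in I(C) \text{ and all extensions } \tilde f \text{ of } f \text{ to } M\}$. **Theorem.** There is a unique $P_\infty$-structure $(\lambda_n)_{n\ge0}$ on $\Gamma(C,\wedge NC)=\Gamma(C,\wedge E)$ such that, for $v_i\in\Gamma(C,E)$, $f,g\in C^\infty(C)$, $u,w\in\Gamma(C,E^*)$ and with $\varepsilon_n=(-1)^{(n-1)(n-2)/2}$, $$\lambda_n(v_1,\dots,v_{n-2},f,g)=\varepsilon_n\,(v_1\cdots v_{n-2}\{\cdot,\cdot\})(p^*f,p^*g)|_C,$$ $$\langle\lambda_n(v_1,\dots,v_{n-1},f),u\rangle=\varepsilon_n\,(v_1\cdots v_{n-1}\{\cdot,\cdot\})(p^*f,u)|_C,$$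 $$\langle\lambda_n(v_1,\dots,v_n),u\otimes w\rangle=\varepsilon_n\,(v_1\cdots v_n\{\cdot,\cdot\})(u,w)|_C$$ (for $n\ge2$, $n\ge1$, $n\ge0$ respectively). This structure is flat: $\lambda_0=0$. The differential $\delta$ above exists and is unique, and $\lambda_1=\delta$. In degree zero the cohomology of $\lambda_1$ is $H^0_\pi(N^*C)=\ker(\lambda_1|_{C^\infty(C)})=C^\infty(\underline C)$, and $\lambda_2$ induces on it the Poisson bracket of the reduced phase space: if $f,g\in C^\infty(\underline C)$, then $\lambda_2(f,g)\in C^\infty(\underline C)$ and $\lambda_2(f,g)=\{\tilde f,\tilde g\}|_C$ for all extensions $\tilde f,\tilde g\in C^\infty(M)$ of $f,g$. -/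

import Mathlib

open Bundle Topology
open scoped Manifold ContDiff

/-! ## Graded commutative algebras and P∞-algebras -/

namespace PInfty

/-- `A = ⨁ 𝒜 j` is a (ℤ-)graded commutative real algebra: `a b = (-1)^{|a||b|} b a`. -/
structure IsGradedCommutative {A : Type*} [Ring A] [Algebra ℝ A] (𝒜 : ℤ → Submodule ℝ A) :
    Prop where
  one_mem : (1 : A) ∈ 𝒜 0
  mul_mem : ∀ {i j : ℤ} {a b : A}, a ∈ 𝒜 i → b ∈ 𝒜 j → a * b ∈ 𝒜 (i + j)
  isInternal : DirectSum.IsInternal 𝒜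
  graded_comm : ∀ {i j : ℤ} {a b : A}, a ∈ 𝒜 i → b ∈ 𝒜 j → a * b = (-1 : ℝ) ^ (i * j) • (b * a)

/-- The Koszul sign of `a₁ ⊗ ⋯ ⊗ aₙ ↦ a_{σ 1} ⊗ ⋯ ⊗ a_{σ n}`, where `aᵢ` has degree `d i`. -/
noncomputable def koszulSign {n : ℕ} (d : Fin n → ℤ) (σ : Equiv.Perm (Fin n)) : ℝ :=
  ∏ i : Fin n, ∏ j : Fin n, if i < j ∧ σ j < σ i then (-1 : ℝ) ^ (d (σ i) * d (σ j)) else 1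

/-- `∑_{q=0}^n (-1)^{q(n-q)} / (q! (n-q)!) λ_{n-q+1}(λ_q(a₁, …, a_q), a_{q+1}, …, a_n)`. -/
noncomputable def jacobiSum {A : Type*} [Ring A] [Algebra ℝ A]
    (lam : ∀ n : ℕ, MultilinearMap ℝ (fun _ : Fin n => A) A) {n : ℕ} (a : Fin n → A) : A :=
  ∑ q : Fin (n + 1),
    ((-1 : ℝ) ^ ((q : ℕ) * (n - q)) / (((q : ℕ).factorial : ℝ) * ((n - q).factorial : ℝ))) •
      lam (n - q + 1)
        (Fin.cons (lam q (fun i : Fin q => a ⟨i, by omega⟩))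
          (fun i : Fin (n - q) => a ⟨q + i, by omega⟩))

/-- The maps `λ_n : A^{⊗ n} → A` (of degree `2 - n`) make the graded algebra `A = ⨁ 𝒜 j` into a
`P∞`-algebra: they are graded skew-symmetric, derivations in the last (hence in every) argument,
and they satisfy the generalized Jacobi identities. -/
structure IsPInfty {A : Type*} [Ring A] [Algebra ℝ A] (𝒜 : ℤ → Submodule ℝ A)
    (lam : ∀ n : ℕ, MultilinearMap ℝ (fun _ : Fin n => A) A) : Prop where
  gradedCommutative : IsGradedCommutative 𝒜
  degree : ∀ (n : ℕ) (d : Fin n → ℤ) (a : Fin n → A), (∀ i, a i ∈ 𝒜 (d i)) →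
    lam n a ∈ 𝒜 (2 - (n : ℤ) + ∑ i, d i)
  skew : ∀ (n : ℕ) (d : Fin n → ℤ) (a : Fin n → A), (∀ i, a i ∈ 𝒜 (d i)) →
    ∀ i j : Fin n, (i : ℕ) + 1 = j →
      lam n a = -((-1 : ℝ) ^ (d i * d j) • lam n (a ∘ Equiv.swap i j))
  derivation : ∀ (n : ℕ) (d : Fin n → ℤ) (a : Fin n → A), (∀ i, a i ∈ 𝒜 (d i)) →
    ∀ (k : ℤ) (b c : A), b ∈ 𝒜 k →
      lam (n + 1) (Fin.snoc a (b * c)) = lam (n + 1) (Fin.snoc a b) * c +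
        (-1 : ℝ) ^ ((2 - ((n : ℤ) + 1) + ∑ i, d i) * k) • (b * lam (n + 1) (Fin.snoc a c))
  jacobi : ∀ (n : ℕ) (d : Fin n → ℤ) (a : Fin n → A), (∀ i, a i ∈ 𝒜 (d i)) →
    ∑ σ : Equiv.Perm (Fin n),
      (((Equiv.Perm.sign σ : ℤ) : ℝ) * koszulSign d σ) • jacobiSum lam (a ∘ σ) = 0

/-- A `P∞`-algebra is flat if `λ_0 = 0`. -/
def IsFlat {A : Type*} [Ring A] [Algebra ℝ A]
    (lam : ∀ n : ℕ, MultilinearMap ℝ (fun _ : Fin n => A) A) : Prop :=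
  lam 0 = 0

end PInfty

/-- A Poisson bracket on a commutative real algebra `R`. For `R = C^∞(M)` this is a Poisson
structure on the manifold `M`. -/
structure PoissonBracket (R : Type*) [CommRing R] [Algebra ℝ R] where
  bracket : R →ₗ[ℝ] R →ₗ[ℝ] R
  skew : ∀ f g, bracket f g = -bracket g f
  jacobi : ∀ f g h, bracket f (bracket g h) + bracket g (bracket h f) + bracket h (bracket f g) = 0
  leibniz : ∀ f g h, bracket f (g * h) = bracket f g * h + g * bracket f h

/-! ## Sections of the exterior algebra of a vector bundle -/

namespace Coiso

theorem finite_exteriorAlgebra (F : Type*) [AddCommGroup F] [Module ℝ F]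
    [FiniteDimensional ℝ F] : Module.Finite ℝ (ExteriorAlgebra ℝ F) := by
  have hbot : ∀ i : ℕ, Module.finrank ℝ F < i →
      (⋀[ℝ]^i F : Submodule ℝ (ExteriorAlgebra ℝ F)) = ⊥ := by
    intro i hi
    have h := exteriorPower.finrank_eq ℝ i (M := F)
    rw [Nat.choose_eq_zero_of_lt hi] at h
    exact Submodule.finrank_eq_zero.mp h
  have htop := (DirectSum.Decomposition.isInternal
    (fun i : ℕ => (⋀[ℝ]^i F : Submodule ℝ (ExteriorAlgebra ℝ F)))).submodule_iSup_eq_top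
  refine ⟨?_⟩
  have : (⊤ : Submodule ℝ (ExteriorAlgebra ℝ F)) =
      ⨆ i : Fin (Module.finrank ℝ F + 1), (⋀[ℝ]^(i : ℕ) F) := by
    rw [← htop]
    apply le_antisymm
    · refine iSup_le fun i => ?_
      by_cases hi : Module.finrank ℝ F < i
      · rw [hbot i hi]; exact bot_le
      · exact le_iSup (fun i : Fin (Module.finrank ℝ F + 1) => (⋀[ℝ]^(i : ℕ) F)) ⟨i, by omega⟩
    · exact iSup_le fun i =>
        le_iSup (fun i : ℕ => (⋀[ℝ]^i F : Submodule ℝ (ExteriorAlgebra ℝ F))) i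
  rw [this]
  exact Submodule.fg_iSup _ fun i => Module.Finite.iff_fg.mp inferInstance

theorem contMDiff_deriv_param {M H EM : Type*} [TopologicalSpace M] [TopologicalSpace H]
    [NormedAddCommGroup EM] [NormedSpace ℝ EM] (I : ModelWithCorners ℝ EM H) [ChartedSpace H M]
    [IsManifold I ∞ M] (Φ : M → ℝ → ℝ)
    (h : ContMDiff (I.prod 𝓘(ℝ, ℝ)) 𝓘(ℝ, ℝ) ∞ (Function.uncurry Φ)) :
    ContMDiff I 𝓘(ℝ, ℝ) ∞ (fun m => deriv (Φ m) 0) := by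
  intro m
  have : IsManifold I 1 M := IsManifold.of_le (n := ∞) (by simp)
  have := ContMDiffAt.mfderiv_apply (I := 𝓘(ℝ, ℝ)) (I' := 𝓘(ℝ, ℝ)) (J := I) (J' := I) (m := ∞)
    (n := ∞) (x₀ := m) Φ (fun _ => 0) id (fun _ => (1 : ℝ)) (h _) contMDiffAt_const contMDiffAt_id
    contMDiffAt_const (by simp)
  have h2 : ∀ x : M, (inTangentCoordinates 𝓘(ℝ, ℝ) 𝓘(ℝ, ℝ) (fun _ : M => (0 : ℝ))
      (fun x => Φ x 0) (fun x => mfderiv 𝓘(ℝ, ℝ) 𝓘(ℝ, ℝ) (Φ x) 0) (id m) (id x)) 1 =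
      deriv (Φ x) 0 := by
    intro x
    have := congrFun (inTangentCoordinates_model_space (I := 𝓘(ℝ, ℝ)) (I' := 𝓘(ℝ, ℝ))
      (fun _ : M => (0 : ℝ)) (fun x => Φ x 0)
      (fun x => mfderiv 𝓘(ℝ, ℝ) 𝓘(ℝ, ℝ) (Φ x) 0) (id m)) (id x)
    rw [this, id, mfderiv_eq_fderiv]
    rfl
  have h3 := funext h2
  rw [← h3]
  exact this

section Bundle

variable (EB F : Type*) {C : Type*} [NormedAddCommGroup EB] [NormedSpace ℝ EB]
  [NormedAddCommGroup F] [NormedSpace ℝ F] [TopologicalSpace C] [ChartedSpace EB C]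
  (E : C → Type*) [TopologicalSpace (TotalSpace F E)]
  [∀ x, AddCommGroup (E x)] [∀ x, Module ℝ (E x)] [∀ x, TopologicalSpace (E x)]
  [FiberBundle F E] [VectorBundle ℝ F E]

/-- `C^∞(C)`. -/
abbrev BaseFun (EB C : Type*) [NormedAddCommGroup EB] [NormedSpace ℝ EB] [TopologicalSpace C]
    [ChartedSpace EB C] : Type _ :=
  C^∞⟮𝓘(ℝ, EB), C; ℝ⟯

/-- `C^∞(M)`, where `M` is the total space of `E → C`. -/
abbrev TotFun : Type _ :=
  C^∞⟮𝓘(ℝ, EB).prod 𝓘(ℝ, F), TotalSpace F E; ℝ⟯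

/-- `Γ(C, E)`, the smooth sections of `E`. -/
abbrev Sec : Type _ :=
  Cₛ^∞⟮𝓘(ℝ, EB); F, E⟯

variable {E}

/-- A section `a` of the bundle with fibres `∧ E_x` is smooth if in the local trivializations
`∧ E_x ≃ ∧ F` all its coefficients (equivalently, all linear functionals of it) are smooth. -/
def IsSmoothExt (a : ∀ x, ExteriorAlgebra ℝ (E x)) : Prop :=
  ∀ (x₀ : C) (φ : Module.Dual ℝ (ExteriorAlgebra ℝ F)),
    ContMDiffAt 𝓘(ℝ, EB) 𝓘(ℝ, ℝ) ∞
      (fun x => φ (ExteriorAlgebra.map ((trivializationAt F E x₀).linearMapAt ℝ x) (a x))) x₀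

variable {EB F}

theorem IsSmoothExt.mul [FiniteDimensional ℝ F] {a b : ∀ x, ExteriorAlgebra ℝ (E x)}
    (ha : IsSmoothExt EB F a) (hb : IsSmoothExt EB F b) :
    IsSmoothExt EB F (fun x => a x * b x) := by
  intro x₀ φ
  have := finite_exteriorAlgebra F
  let B := Module.finBasis ℝ (ExteriorAlgebra ℝ F)
  have key : ∀ p q : ExteriorAlgebra ℝ F,
      φ (p * q) = ∑ i, ∑ j, B.coord i p * B.coord j q * φ (B i * B j) := by
    intro p q
    conv_lhs => rw [← B.sum_repr p, ← B.sum_repr q]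
    rw [Finset.sum_mul_sum]
    simp only [map_sum, smul_mul_smul_comm, map_smul, smul_eq_mul, Module.Basis.coord_apply]
  have hfun : (fun x => φ (ExteriorAlgebra.map ((trivializationAt F E x₀).linearMapAt ℝ x)
      (a x * b x))) = fun x => ∑ i, ∑ j,
      B.coord i (ExteriorAlgebra.map ((trivializationAt F E x₀).linearMapAt ℝ x) (a x)) *
      B.coord j (ExteriorAlgebra.map ((trivializationAt F E x₀).linearMapAt ℝ x) (b x)) *
      φ (B i * B j) := by
    funext x
    rw [map_mul, key]
  rw [hfun]
  refine contMDiffAt_finsetSum fun i _ => contMDiffAt_finsetSum fun j _ => ?_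
  exact ((ha x₀ (B.coord i)).mul (hb x₀ (B.coord j))).mul contMDiffAt_const

theorem contMDiff_fibre_affine {N H EM : Type*} [TopologicalSpace N] [TopologicalSpace H]
    [NormedAddCommGroup EM] [NormedSpace ℝ EM] (I : ModelWithCorners ℝ EM H) [ChartedSpace H N]
    (p : N → TotalSpace F E) (hp : ContMDiff I (𝓘(ℝ, EB).prod 𝓘(ℝ, F)) ∞ p)
    (a b : N → ℝ) (ha : ContMDiff I 𝓘(ℝ, ℝ) ∞ a) (hb : ContMDiff I 𝓘(ℝ, ℝ) ∞ b)
    (v : Sec EB F E) :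
    ContMDiff I (𝓘(ℝ, EB).prod 𝓘(ℝ, F)) ∞
      (fun y => (⟨(p y).1, a y • (p y).2 + b y • v (p y).1⟩ : TotalSpace F E)) := by
  intro y
  have hp1 := contMDiffAt_totalSpace.1 (hp y)
  have hv := contMDiffAt_totalSpace.1 ((v.contMDiff (p y).1).comp y hp1.1)
  refine contMDiffAt_totalSpace.2 ⟨hp1.1, ?_⟩
  have h := ((ha y).smul hp1.2).add ((hb y).smul hv.2)
  refine h.congr_of_eventuallyEq ?_
  have hc : ContinuousAt (fun y => (p y).1) y := hp1.1.continuousAt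
  filter_upwards [hc.preimage_mem_nhds ((trivializationAt F E (p y).1).open_baseSet.mem_nhds
    (FiberBundle.mem_baseSet_trivializationAt F E (p y).1))] with z hz
  have hlin := (trivializationAt F E (p y).1).linear ℝ hz
  have h1 := hlin.map_add (a z • (p z).2) (b z • v (p z).1)
  rw [hlin.map_smul, hlin.map_smul] at h1
  exact h1

variable [FiniteDimensional ℝ F]

variable (EB F E) in
/-- The algebra `Γ(C, ∧ E)` of smooth sections of the exterior algebra bundle, with pointwise
product. -/
noncomputable def ExtSec : Subalgebra ℝ (∀ x, ExteriorAlgebra ℝ (E x)) where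
  carrier := {a | IsSmoothExt EB F a}
  mul_mem' ha hb := ha.mul hb
  add_mem' ha hb x₀ φ := by
    simp only [Pi.add_apply, map_add]
    exact (ha x₀ φ).add (hb x₀ φ)
  algebraMap_mem' r x₀ φ := by
    simpa only [Pi.algebraMap_apply, AlgHom.commutes] using contMDiffAt_const

variable (EB F E) in
/-- The grading of `Γ(C, ∧ E)`: degree `k` is `Γ(C, ∧^k E)` for `k ≥ 0`, and `0` for `k < 0`. -/
noncomputable def extDeg : ℤ → Submodule ℝ (ExtSec EB F E)
  | Int.ofNat k =>
    { carrier := {a | ∀ x, a.1 x ∈ (⋀[ℝ]^k (E x) : Submodule ℝ (ExteriorAlgebra ℝ (E x)))}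
      add_mem' := fun ha hb x => Submodule.add_mem _ (ha x) (hb x)
      zero_mem' := fun _ => Submodule.zero_mem _
      smul_mem' := fun r _ ha x => Submodule.smul_mem _ r (ha x) }
  | Int.negSucc _ => ⊥

variable (F E) in
/-- A smooth function on `C` as an element of degree `0` of `Γ(C, ∧ E)`. -/
noncomputable def ofFun (f : BaseFun EB C) : ExtSec EB F E :=
  ⟨fun x => algebraMap ℝ _ (f x), fun x₀ φ => by
    simp only [Algebra.algebraMap_eq_smul_one, map_smul, smul_eq_mul, map_one]
    exact f.contMDiff.contMDiffAt.mul contMDiffAt_const⟩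

/-- A smooth section of `E` as an element of degree `1` of `Γ(C, ∧ E)`. -/
noncomputable def ofSec (s : Sec EB F E) : ExtSec EB F E :=
  ⟨fun x => ExteriorAlgebra.ι ℝ (s x), fun x₀ φ => by
    simp only [ExteriorAlgebra.map_apply_ι]
    have h1 := (contMDiffAt_section x₀).1 (s.contMDiff x₀)
    let L : F →L[ℝ] ℝ := LinearMap.toContinuousLinearMap (φ.comp (ExteriorAlgebra.ι ℝ))
    have h2 : ContMDiffAt 𝓘(ℝ, EB) 𝓘(ℝ, ℝ) ∞
      (fun x => L ((trivializationAt F E x₀ ⟨x, s x⟩).2)) x₀ :=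
      L.contMDiff.contMDiffAt.comp x₀ h1
    refine h2.congr_of_eventuallyEq ?_
    filter_upwards [(trivializationAt F E x₀).open_baseSet.mem_nhds
      (FiberBundle.mem_baseSet_trivializationAt F E x₀)] with x hx
    simp [L, Bundle.Trivialization.linearMapAt_apply, hx]⟩

/-! ## Functions on the total space -/

/-- `p^* f`, for `p : M = E → C` the bundle projection. -/
noncomputable def pull (f : BaseFun EB C) : TotFun EB F E :=
  ⟨fun m => f m.1, f.contMDiff.comp (contMDiff_proj E)⟩

/-- The restriction `h|_C` of a function on `M = E` to the zero section `C`. -/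
noncomputable def restr (h : TotFun EB F E) : BaseFun EB C :=
  ⟨fun x => h ⟨x, 0⟩, h.contMDiff.comp (contMDiff_zeroSection ℝ E)⟩

variable (EB F E) in
/-- `Γ(C, N^*C) = Γ(C, E^*)`: a smooth section of `E^*` is the same as a smooth function on the
total space `M` of `E` that is linear on the fibres. -/
structure Conormal where
  toFun : TotFun EB F E
  linear : ∀ x : C, IsLinearMap ℝ (fun e : E x => toFun ⟨x, e⟩)

/-- The linear form on the fibre `E x` defined by a section of `E^*`. -/
noncomputable def Conormal.form (u : Conormal EB F E) (x : C) : Module.Dual ℝ (E x) :=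
  IsLinearMap.mk' _ (u.linear x)

/-- The function `⟨v, u⟩` on `C`, for `v ∈ Γ(C, E)` and `u ∈ Γ(C, E^*)`. -/
noncomputable def pairing (v : Sec EB F E) (u : Conormal EB F E) : BaseFun EB C :=
  ⟨fun x => u.toFun ⟨x, v x⟩, u.toFun.contMDiff.comp v.contMDiff⟩

/-- `⟨a, u⟩(x)` for `a ∈ Γ(C, ∧¹ E)` and `u ∈ Γ(C, E^*)`. -/
noncomputable def pair₁ (a : ExtSec EB F E) (u : Conormal EB F E) (x : C) : ℝ :=
  ExteriorAlgebra.algebraMapInv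
    (CliffordAlgebra.contractLeft (Q := (0 : QuadraticForm ℝ (E x))) (u.form x) (a.1 x))

/-- `⟨a, u ⊗ w⟩(x)` for `a ∈ Γ(C, ∧² E)` and `u, w ∈ Γ(C, E^*)`, normalized by
`⟨α ∧ β, u ⊗ w⟩ = u(α) w(β) - u(β) w(α)`. -/
noncomputable def pair₂ (a : ExtSec EB F E) (u w : Conormal EB F E) (x : C) : ℝ :=
  ExteriorAlgebra.algebraMapInv
    (CliffordAlgebra.contractLeft (Q := (0 : QuadraticForm ℝ (E x))) (w.form x)
      (CliffordAlgebra.contractLeft (Q := (0 : QuadraticForm ℝ (E x))) (u.form x) (a.1 x)))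

variable [IsManifold 𝓘(ℝ, EB) ∞ C] [ContMDiffVectorBundle ∞ F E 𝓘(ℝ, EB)]

/-- A section `v` of `E` regarded as a vertical vector field on `M = E`, constant along the fibres,
acting on functions: `(v h)(x, e) = d/dt h(x, e + t v(x))` at `t = 0`. -/
noncomputable def vert (v : Sec EB F E) (h : TotFun EB F E) : TotFun EB F E :=
  ⟨fun m => deriv (fun t : ℝ => h ⟨m.1, m.2 + t • v m.1⟩) 0, by
    refine contMDiff_deriv_param (𝓘(ℝ, EB).prod 𝓘(ℝ, F))
      (fun (m : TotalSpace F E) (t : ℝ) => h ⟨m.1, m.2 + t • v m.1⟩) ?_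
    have := contMDiff_fibre_affine ((𝓘(ℝ, EB).prod 𝓘(ℝ, F)).prod 𝓘(ℝ, ℝ))
      (fun q : TotalSpace F E × ℝ => q.1) contMDiff_fst (fun _ => 1)
      (fun q => q.2) contMDiff_const contMDiff_snd v
    simp only [one_smul] at this
    exact h.contMDiff.comp this⟩

/-- The differential `dh|_C` of `h` along the zero section in the fibre directions, as a function
on `M = E` linear on the fibres: `(x, e) ↦ d/dt h(x, t e)` at `t = 0`. If `h` vanishes on `C`,
this is the section `dh|_C` of the conormal bundle `N^*C = E^*`. -/
noncomputable def fibreDifferential (h : TotFun EB F E) : TotFun EB F E :=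
  ⟨fun m => deriv (fun t : ℝ => h ⟨m.1, t • m.2⟩) 0, by
    refine contMDiff_deriv_param (𝓘(ℝ, EB).prod 𝓘(ℝ, F))
      (fun (m : TotalSpace F E) (t : ℝ) => h ⟨m.1, t • m.2⟩) ?_
    have := contMDiff_fibre_affine ((𝓘(ℝ, EB).prod 𝓘(ℝ, F)).prod 𝓘(ℝ, ℝ))
      (fun q : TotalSpace F E × ℝ => q.1) contMDiff_fst (fun q => q.2)
      (fun _ => 0) contMDiff_snd contMDiff_const (0 : Sec EB F E)
    simp only [zero_smul, add_zero] at this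
    exact h.contMDiff.comp this⟩

theorem fibreDifferential_linear (h : TotFun EB F E) (x : C) :
    IsLinearMap ℝ (fun e : E x => fibreDifferential h ⟨x, e⟩) := by
  let T : E x →ₗ[ℝ] F := (trivializationAt F E x).linearMapAt ℝ x
  have hx : x ∈ (trivializationAt F E x).baseSet := FiberBundle.mem_baseSet_trivializationAt F E x
  let k : F → ℝ := fun z => h ⟨x, (trivializationAt F E x).symm x z⟩
  have hk : ContMDiff 𝓘(ℝ, F) 𝓘(ℝ, ℝ) ∞ k := by
    refine h.contMDiff.comp (fun z => contMDiffAt_totalSpace.2 ⟨contMDiffAt_const, ?_⟩)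
    refine contMDiffAt_id.congr_of_eventuallyEq (Filter.Eventually.of_forall fun y => ?_)
    simp [Bundle.Trivialization.apply_mk_symm _ hx]
  have hd : DifferentiableAt ℝ k 0 :=
    (contMDiff_iff_contDiff.1 hk).contDiffAt.differentiableAt (by simp)
  have key : ∀ e : E x, fibreDifferential h ⟨x, e⟩ = fderiv ℝ k 0 (T e) := by
    intro e
    have h1 : (fun t : ℝ => h ⟨x, t • e⟩) = fun t : ℝ => k (t • T e) := by
      funext t
      have : (trivializationAt F E x).symm x (T (t • e)) = t • e := by
        simp only [T, Bundle.Trivialization.linearMapAt_apply, hx, if_true]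
        exact (trivializationAt F E x).symm_apply_apply_mk hx _
      simp only [k, ← map_smul, this]
    change deriv (fun t : ℝ => h ⟨x, t • e⟩) 0 = _
    rw [h1]
    have h2 : HasDerivAt (fun t : ℝ => t • T e) (T e) 0 := by
      simpa using (hasDerivAt_id (0 : ℝ)).smul_const (T e)
    have h3 : HasFDerivAt k (fderiv ℝ k 0) ((0 : ℝ) • T e) := by
      rw [zero_smul]; exact hd.hasFDerivAt
    exact (h3.comp_hasDerivAt (0 : ℝ) h2).deriv
  constructor
  · intro e e'; simp only [key, map_add]
  · intro c e; simp only [key, map_smul]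

/-! ## Coisotropic submanifolds -/

/-- The ideal `I(C)` of functions on `M` vanishing on the zero section `C`. -/
noncomputable def vanishingIdeal : Ideal (TotFun EB F E) where
  carrier := {h | ∀ x : C, h ⟨x, 0⟩ = 0}
  add_mem' {a b} ha hb x := by
    change a ⟨x, 0⟩ + b ⟨x, 0⟩ = 0
    rw [ha x, hb x, add_zero]
  zero_mem' _ := rfl
  smul_mem' c a ha x := by
    change c ⟨x, 0⟩ * a ⟨x, 0⟩ = 0
    rw [ha x, mul_zero]

/-- `C` is coisotropic: `π^♯` maps conormal vectors to tangent vectors, i.e. for `h ∈ I(C)` the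
hamiltonian vector field `{h, ·}` is tangent to `C`, i.e. annihilates `I(C)` along `C`. In other
words `I(C)` is closed under the Poisson bracket. -/
def IsCoisotropic (P : PoissonBracket (TotFun EB F E)) : Prop :=
  ∀ h ∈ vanishingIdeal (EB := EB) (F := F) (E := E),
    ∀ k ∈ vanishingIdeal (EB := EB) (F := F) (E := E),
      P.bracket h k ∈ vanishingIdeal (EB := EB) (F := F) (E := E)

/-- `C^∞` of the reduced phase space: the functions `f` on `C` with `X_h(f) = 0` for all `h ∈ I(C)`,
where `X_h(f) = {h, f'}|_C` for any extension `f'` of `f` to `M`. -/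
def reducedFunctions (P : PoissonBracket (TotFun EB F E)) : Set (BaseFun EB C) :=
  {f | ∀ h ∈ vanishingIdeal (EB := EB) (F := F) (E := E), ∀ f' : TotFun EB F E,
    restr f' = f → restr (P.bracket h f') = 0}

/-! ## The Lie algebroid `N^*C` and its differential -/

/-- The Lie bracket of `Γ(C, N^*C)`, determined by `[dh|_C, dk|_C] = d{h, k}|_C` for `h, k ∈ I(C)`
(a function `u` linear on the fibres is in `I(C)`, and represents the section `du|_C`). -/
noncomputable def conormalBracket (P : PoissonBracket (TotFun EB F E)) (u w : Conormal EB F E) :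
    Conormal EB F E :=
  ⟨fibreDifferential (P.bracket u.toFun w.toFun), fibreDifferential_linear _⟩

/-- The anchor `π^♯ : N^*C → TC`, as an action of `Γ(C, N^*C)` on `C^∞(C)`. -/
noncomputable def anchor (P : PoissonBracket (TotFun EB F E)) (u : Conormal EB F E) (f : BaseFun EB C) :
    BaseFun EB C :=
  restr (P.bracket u.toFun (pull f))

/-- `δ` is the differential of the Lie algebroid `N^*C` on `Γ(C, ∧ NC)`, `NC = E`: the derivation
of degree one given by `δ f = π^♯ d f' mod TC` for any extension `f'` of `f ∈ C^∞(C)` to `M`, and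
which on `Γ(C, NC)` is dual to the bracket of `Γ(C, N^*C)`. -/
structure IsLieAlgebroidDifferential (P : PoissonBracket (TotFun EB F E))
    (δ : ExtSec EB F E →ₗ[ℝ] ExtSec EB F E) : Prop where
  degree : ∀ (k : ℤ) (a : ExtSec EB F E), a ∈ extDeg EB F E k → δ a ∈ extDeg EB F E (k + 1)
  leibniz : ∀ (k : ℤ) (a b : ExtSec EB F E), a ∈ extDeg EB F E k →
    δ (a * b) = δ a * b + (-1 : ℝ) ^ k • (a * δ b)
  sq_zero : ∀ a, δ (δ a) = 0
  on_functions : ∀ (f : BaseFun EB C) (f' : TotFun EB F E), restr f' = f →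
    ∀ (u : Conormal EB F E) (x : C), pair₁ (δ (ofFun F E f)) u x = P.bracket f' u.toFun ⟨x, 0⟩
  on_sections : ∀ (v : Sec EB F E) (u w : Conormal EB F E) (x : C),
    pair₂ (δ (ofSec v)) u w x =
      pairing v (conormalBracket P u w) x - anchor P u (pairing v w) x + anchor P w (pairing v u) x

/-! ## The higher brackets on `Γ(C, ∧ NC)` -/

/-- The Lie derivative of a bracket `B` along the vertical vector field of `v`:
`(v B)(f, g) = v (B(f, g)) - B(v f, g) - B(f, v g)`. -/
noncomputable def lieD (v : Sec EB F E) (B : TotFun EB F E → TotFun EB F E → TotFun EB F E) :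
    TotFun EB F E → TotFun EB F E → TotFun EB F E :=
  fun f g => vert v (B f g) - B (vert v f) g - B f (vert v g)

/-- The iterated Lie derivative `v₁ ⋯ v_k {·, ·}` of the Poisson bracket. -/
noncomputable def iterLieD (P : PoissonBracket (TotFun EB F E)) {k : ℕ} (v : Fin k → Sec EB F E) :
    TotFun EB F E → TotFun EB F E → TotFun EB F E :=
  (List.ofFn v).foldr lieD (fun f g => P.bracket f g)

/-- The sign `(-1)^{(n-1)(n-2)/2}`. -/
noncomputable def bracketSign (n : ℕ) : ℝ :=
  (-1 : ℝ) ^ ((((n : ℤ) - 1) * ((n : ℤ) - 2)) / 2)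

/-- The values on generators of the `P∞`-structure on `Γ(C, ∧ NC)` induced by the Poisson
structure `P` of `M = E`. -/
structure IsInducedBy (P : PoissonBracket (TotFun EB F E))
    (lam : ∀ n : ℕ, MultilinearMap ℝ (fun _ : Fin n => ExtSec EB F E) (ExtSec EB F E)) :
    Prop where
  two_functions : ∀ (k : ℕ) (v : Fin k → Sec EB F E) (f g : BaseFun EB C),
    lam (k + 2) (Fin.snoc (Fin.snoc (fun i => ofSec (v i)) (ofFun F E f) : Fin (k + 1) → _)
        (ofFun F E g)) =
      bracketSign (k + 2) • ofFun F E (restr (iterLieD P v (pull f) (pull g)))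
  one_function : ∀ (k : ℕ) (v : Fin k → Sec EB F E) (f : BaseFun EB C) (u : Conormal EB F E)
    (x : C),
    pair₁ (lam (k + 1) (Fin.snoc (fun i => ofSec (v i)) (ofFun F E f))) u x =
      bracketSign (k + 1) * iterLieD P v (pull f) u.toFun ⟨x, 0⟩
  no_function : ∀ (k : ℕ) (v : Fin k → Sec EB F E) (u w : Conormal EB F E) (x : C),
    pair₂ (lam k (fun i => ofSec (v i))) u w x =
      bracketSign k * iterLieD P v u.toFun w.toFun ⟨x, 0⟩

end Bundle

end Coiso

/-! The brackets are higher derived brackets in the sense of Voronov. Near a point of the zero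
section, multivector fields on M form a graded Lie algebra under the Schouten bracket. Sections of
∧E sit inside as the vertical multivector fields that are constant along the fibres, and these form
an abelian subalgebra (`K_of_mem`). The projection p restricts coefficients to C and kills
horizontal vectors. It satisfies p[x,y] = p[x,py] + p[px,y] on even elements (`p_schouten`), so
brackets of elements of its kernel stay in the kernel. If ϖ is the Poisson bivector, λ_n(a_1,…,a_n)
is, up to sign, p[a_1,[a_2,…[a_n,ϖ]…]]. The operators K_a = [a,·] supercommute with one another,
which gives skew-symmetry (`lam_skew`), and K is a derivation in a, which gives the derivation
property (`lam_derivation`).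

The Jacobi identities come from [ϖ,ϖ] = 0. For a single odd a, apply K_a^n to [ϖ,ϖ], expand by the
Leibniz rule, and project (`derived_jacobi`). For several arguments, replace a by Σ ε_i a_i with
square-zero parameters ε_i of the parity that makes every ε_i a_i odd. Only words using each index
once survive, and their sum is a product of all parameters times the alternating sum of the identity
(`jacobi_lam`). The parameters are generators adjoined freely to the exterior algebra, so
contractions cancel them again.

All of this takes place in algebras of germs, one for each point of C (`LocalPhase`). To obtain
global brackets one must show that the germs of a bracket, taken at all points, are the germs of one
smooth section. A multiderivation is local, and Γ(∧E) is locally generated by functions and sections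
of E, so this has to be checked only on such generators (`mem_of_generators`,
`exists_local_decomposition`). There Cartan's formula `K_grad` shows that contracting
[v_1,[…[v_k,ϖ]]] with dh and dk gives the iterated Lie derivative of the Poisson bracket evaluated
on h and k (`grad_grad_word`). This yields both smoothness and the prescribed values.

Uniqueness rests on the same principle. The difference of two structures is a multiderivation, and
on generators including l functions it has degree 2 - l. It therefore vanishes for l ≥ 3, and for l
≤ 2 it is determined by the prescribed values.

Coisotropy makes λ_0, whose pairing with u ⊗ w is {u,w}|_C up to sign, vanish. The Jacobi identity
with one argument then becomes λ_1² = 0, and the values of λ_1 on generators are those defining δ.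
In degree zero, λ_1 f = 0 says that {f̃,u}|_C = 0 for all fibrewise linear u. A derivation at a
point of C that kills linear functions kills I(C) (`derivation_eq_zero`), so this is the condition
defining the reduced functions. The claims about λ_2 follow from the Jacobi identity of the Poisson
bracket. -/

namespace PInfty

/-! ### Schouten calculus in an abstract algebra of multivector fields -/

/-- A supercommutative algebra `T` with the operations of the algebra of multivector fields in
coordinates indexed by `m ⊕ r`: the parity involution `γ`, the partial derivatives `d A`, the
contractions `i A` with the coordinate differentials, the coordinate vector fields `e A`, and the
projection `p` which sets the coordinates indexed by `r` and the vector fields indexed by `m` to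
zero. -/
structure PhaseAlgebra (T : Type*) [Ring T] [Algebra ℝ T] (m r : Type*) [DecidableEq m]
    [DecidableEq r] where
  γ : T →ₐ[ℝ] T
  γ_γ : ∀ x, γ (γ x) = x
  comm_even : ∀ x y, γ x = x → x * y = y * x
  comm_odd : ∀ x y, γ x = -x → x * y = γ y * x
  d : m ⊕ r → T →ₗ[ℝ] T
  d_mul : ∀ A x y, d A (x * y) = d A x * y + x * d A y
  d_comm : ∀ A B x, d A (d B x) = d B (d A x)
  d_γ : ∀ A x, d A (γ x) = γ (d A x)
  i : m ⊕ r → T →ₗ[ℝ] T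
  i_mul : ∀ A x y, i A (x * y) = i A x * y + γ x * i A y
  i_comm : ∀ A B x, i A (i B x) = -i B (i A x)
  i_γ : ∀ A x, i A (γ x) = -γ (i A x)
  d_i : ∀ A B x, d A (i B x) = i B (d A x)
  p : T →ₐ[ℝ] T
  p_p : ∀ x, p (p x) = p x
  p_γ : ∀ x, p (γ x) = γ (p x)
  p_d : ∀ μ x, p (d (Sum.inl μ) x) = d (Sum.inl μ) (p x)
  p_i : ∀ j x, p (i (Sum.inr j) x) = i (Sum.inr j) (p x)
  i_p : ∀ μ x, i (Sum.inl μ) (p x) = 0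
  d_p : ∀ j x, d (Sum.inr j) (p x) = 0
  e : m ⊕ r → T
  γ_e : ∀ A, γ (e A) = -e A
  i_e : ∀ A B, i A (e B) = if A = B then 1 else 0
  d_e : ∀ A B, d A (e B) = 0
  p_e_inl : ∀ μ, p (e (Sum.inl μ)) = 0
  p_e_inr : ∀ j, p (e (Sum.inr j)) = e (Sum.inr j)

namespace PhaseAlgebra

variable {T : Type*} [Ring T] [Algebra ℝ T] {m r : Type*} [DecidableEq m]
    [DecidableEq r] (H : PhaseAlgebra T m r)

theorem i_inl_of_mem {a : T} (ha : H.p a = a) (μ : m) : H.i (Sum.inl μ) a = 0 := by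
  rw [← ha, H.i_p]

theorem d_inr_of_mem {a : T} (ha : H.p a = a) (j : r) : H.d (Sum.inr j) a = 0 := by
  rw [← ha, H.d_p]

theorem γ_mem {a : T} (ha : H.p a = a) : H.p (H.γ a) = H.γ a := by rw [H.p_γ, ha]

theorem i_mem {a : T} (ha : H.p a = a) (j : r) :
    H.p (H.i (Sum.inr j) a) = H.i (Sum.inr j) a := by rw [H.p_i, ha]

theorem d_mem {a : T} (ha : H.p a = a) (μ : m) :
    H.p (H.d (Sum.inl μ) a) = H.d (Sum.inl μ) a := by rw [H.p_d, ha]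

theorem γ_i_odd {a : T} (ha : H.γ a = -a) (A) : H.γ (H.i A a) = H.i A a := by
  have := H.i_γ A a
  rw [ha, map_neg, neg_inj] at this
  exact this.symm

theorem γ_i_even {a : T} (ha : H.γ a = a) (A) : H.γ (H.i A a) = -H.i A a := by
  have := H.i_γ A a
  rw [ha] at this
  rw [eq_neg_iff_add_eq_zero, add_comm]
  rwa [eq_neg_iff_add_eq_zero] at this

theorem γ_d_odd {a : T} (ha : H.γ a = -a) (A) : H.γ (H.d A a) = -H.d A a := by
  rw [← H.d_γ, ha, map_neg]

theorem γ_d_even {a : T} (ha : H.γ a = a) (A) : H.γ (H.d A a) = H.d A a := by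
  rw [← H.d_γ, ha]

variable [Fintype m] [Fintype r]

/-- The Schouten bracket with an element `a` of the range of `p`. -/
noncomputable def K : T →ₗ[ℝ] T →ₗ[ℝ] T :=
  LinearMap.mk₂ ℝ (fun a x => -(∑ j, H.i (Sum.inr j) (H.γ a) * H.d (Sum.inr j) x +
      ∑ μ, H.d (Sum.inl μ) a * H.i (Sum.inl μ) x))
    (fun a b x => by simp only [map_add, add_mul, Finset.sum_add_distrib]; abel)
    (fun c a x => by simp only [map_smul, smul_mul_assoc, ← Finset.smul_sum, smul_add, smul_neg])
    (fun a x y => by simp only [map_add, mul_add, Finset.sum_add_distrib]; abel)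
    (fun c a x => by simp only [map_smul, mul_smul_comm, ← Finset.smul_sum, smul_add, smul_neg])

theorem K_apply (a x : T) : H.K a x = -(∑ j, H.i (Sum.inr j) (H.γ a) * H.d (Sum.inr j) x +
      ∑ μ, H.d (Sum.inl μ) a * H.i (Sum.inl μ) x) := rfl

/-- `K` differentiates its second argument only along the fibre coordinates and contracts it only
with base differentials, and both operations vanish on the range of `p`. So the range of `p` is
abelian for the Schouten bracket, the first of the two conditions on which derived brackets rest. -/
theorem K_of_mem (a : T) {b : T} (hb : H.p b = b) : H.K a b = 0 := by
  simp [K_apply, H.i_inl_of_mem hb, H.d_inr_of_mem hb]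

theorem K_odd_apply {a : T} (ha : H.γ a = -a) (x : T) :
    H.K a x = ∑ j, H.i (Sum.inr j) a * H.d (Sum.inr j) x -
      ∑ μ, H.d (Sum.inl μ) a * H.i (Sum.inl μ) x := by
  rw [K_apply, ha]
  simp only [map_neg, neg_mul, Finset.sum_neg_distrib]
  abel

/-- The Schouten bracket is odd, so `K a` has the parity opposite to that of `a`: an ordinary
derivation for odd `a`, an odd derivation for even `a` (`K_even_mul`). -/
theorem K_odd_mul {a : T} (ha : H.γ a = -a) (x y : T) :
    H.K a (x * y) = H.K a x * y + x * H.K a y := by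
  have h1 : ∀ j, H.i (Sum.inr j) a * H.d (Sum.inr j) (x * y) =
      H.i (Sum.inr j) a * H.d (Sum.inr j) x * y +
        x * (H.i (Sum.inr j) a * H.d (Sum.inr j) y) := fun j => by
    rw [H.d_mul, mul_add, ← mul_assoc, ← mul_assoc, H.comm_even _ x (H.γ_i_odd ha _), mul_assoc x]
  have h2 : ∀ μ, H.d (Sum.inl μ) a * H.i (Sum.inl μ) (x * y) =
      H.d (Sum.inl μ) a * H.i (Sum.inl μ) x * y +
        x * (H.d (Sum.inl μ) a * H.i (Sum.inl μ) y) := fun μ => by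
    rw [H.i_mul, mul_add, ← mul_assoc, ← mul_assoc, H.comm_odd _ (H.γ x) (H.γ_d_odd ha _), H.γ_γ,
      mul_assoc x]
  simp only [H.K_odd_apply ha, h1, h2, Finset.sum_add_distrib, sub_mul, mul_sub, Finset.sum_mul,
    Finset.mul_sum]
  abel

theorem K_even_mul {a : T} (ha : H.γ a = a) (x y : T) :
    H.K a (x * y) = H.K a x * y + H.γ x * H.K a y := by
  have h1 : ∀ j, H.i (Sum.inr j) a * H.d (Sum.inr j) (x * y) =
      H.i (Sum.inr j) a * H.d (Sum.inr j) x * y +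
        H.γ x * (H.i (Sum.inr j) a * H.d (Sum.inr j) y) := fun j => by
    rw [H.d_mul, mul_add, ← mul_assoc, ← mul_assoc, H.comm_odd _ x (H.γ_i_even ha _),
      mul_assoc (H.γ x)]
  have h2 : ∀ μ, H.d (Sum.inl μ) a * H.i (Sum.inl μ) (x * y) =
      H.d (Sum.inl μ) a * H.i (Sum.inl μ) x * y +
        H.γ x * (H.d (Sum.inl μ) a * H.i (Sum.inl μ) y) := fun μ => by
    rw [H.i_mul, mul_add, ← mul_assoc, ← mul_assoc, H.comm_even _ (H.γ x) (H.γ_d_even ha _),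
      mul_assoc (H.γ x)]
  simp only [K_apply, ha, h1, h2, Finset.sum_add_distrib, neg_mul, mul_neg, add_mul, mul_add,
    Finset.sum_mul, Finset.mul_sum]
  abel

theorem γ_K (a x : T) : H.γ (H.K a x) = -H.K (H.γ a) (H.γ x) := by
  simp only [K_apply, map_neg, map_add, map_sum, map_mul, H.d_γ, H.i_γ, neg_mul, mul_neg,
    Finset.sum_neg_distrib]
  abel

theorem γ_K_odd {a x : T} (ha : H.γ a = -a) (hx : H.γ x = x) : H.γ (H.K a x) = H.K a x := by
  rw [γ_K, ha, hx, map_neg, LinearMap.neg_apply, neg_neg]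

theorem i_inl_K {a : T} (ha : H.p a = a) (μ : m) (x : T) :
    H.i (Sum.inl μ) (H.K a x) = -H.K (H.γ a) (H.i (Sum.inl μ) x) := by
  simp only [K_apply, map_neg, map_add, map_sum, H.i_mul, H.d_γ, ← H.d_i,
    H.i_comm (Sum.inl μ) (Sum.inr _), H.i_γ, H.i_inl_of_mem ha, map_zero, zero_mul, neg_zero,
    zero_add, H.i_comm (Sum.inl μ) (Sum.inl _), mul_neg, Finset.sum_neg_distrib, neg_neg, neg_mul,
    H.γ_γ]
  abel

theorem d_inr_K {a : T} (ha : H.p a = a) (j : r) (x : T) :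
    H.d (Sum.inr j) (H.K a x) = H.K a (H.d (Sum.inr j) x) := by
  simp only [K_apply, map_neg, map_add, map_sum, H.d_mul, H.d_i, H.d_γ, H.d_comm (Sum.inr j),
    H.d_inr_of_mem ha, map_zero, zero_mul, zero_add]

/-- In contrast to `d_inr_K` and `i_inl_K`, a base derivative also acts on the coefficients of `K
a`, as does a fibre contraction in `i_inr_K_odd`. The extra terms cancel in `schouten_correction`.
-/
theorem d_inl_K (a : T) (μ : m) (x : T) :
    H.d (Sum.inl μ) (H.K a x) =
      H.K a (H.d (Sum.inl μ) x) + H.K (H.d (Sum.inl μ) a) x := by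
  simp only [K_apply, map_neg, map_add, map_sum, H.d_mul, H.d_i, H.d_γ, H.d_comm (Sum.inl μ),
    Finset.sum_add_distrib]
  abel

theorem i_inr_K_odd {a : T} (ha : H.γ a = -a) (j : r) (x : T) :
    H.i (Sum.inr j) (H.K a x) =
      H.K a (H.i (Sum.inr j) x) + H.K (H.i (Sum.inr j) a) x := by
  have h1 : ∀ k, H.γ (H.i k a) = H.i k a := H.γ_i_odd ha
  have h2 : ∀ k, H.γ (H.d k a) = -H.d k a := H.γ_d_odd ha
  rw [K_odd_apply H ha, K_odd_apply H ha, K_apply, h1]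
  simp only [map_sub, map_sum, H.i_mul, h1, h2, H.d_i, H.i_comm (Sum.inr j), neg_mul, mul_neg,
    Finset.sum_add_distrib, Finset.sum_neg_distrib, neg_neg]
  abel

/-- Morally [K a, K b] = K [a,b] and [a,b] = 0. Directly: `K a` is a derivation that kills the
coefficients of `K b`, which lie in the range of `p`, and it commutes with the operations that
remain. -/
theorem K_comm_odd {a b : T} (ha : H.p a = a) (hb : H.p b = b) (ha' : H.γ a = -a) (x : T) :
    H.K a (H.K b x) = H.K b (H.K a x) := by
  have h1 : ∀ y, ∀ j, H.K a (H.i (Sum.inr j) (H.γ b) * y) =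
      H.i (Sum.inr j) (H.γ b) * H.K a y := fun y j => by
    rw [H.K_odd_mul ha', H.K_of_mem _ (H.i_mem (H.γ_mem hb) j), zero_mul, zero_add]
  have h2 : ∀ y, ∀ μ, H.K a (H.d (Sum.inl μ) b * y) =
      H.d (Sum.inl μ) b * H.K a y := fun y μ => by
    rw [H.K_odd_mul ha', H.K_of_mem _ (H.d_mem hb μ), zero_mul, zero_add]
  rw [K_apply H b, K_apply H b]
  simp only [map_neg, map_add, map_sum, h1, h2, H.d_inr_K ha, H.i_inl_K ha, ha',
    LinearMap.neg_apply, neg_neg]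

theorem K_comm_even {a b : T} (ha : H.p a = a) (hb : H.p b = b) (ha' : H.γ a = a)
    (hb' : H.γ b = b) (x : T) : H.K a (H.K b x) = -H.K b (H.K a x) := by
  have h1 : ∀ y, ∀ j, H.K a (H.i (Sum.inr j) (H.γ b) * y) =
      -(H.i (Sum.inr j) (H.γ b) * H.K a y) := fun y j => by
    rw [H.K_even_mul ha', H.K_of_mem _ (H.i_mem (H.γ_mem hb) j), zero_mul, zero_add, hb',
      H.γ_i_even hb', neg_mul]
  have h2 : ∀ y, ∀ μ, H.K a (H.d (Sum.inl μ) b * y) =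
      H.d (Sum.inl μ) b * H.K a y := fun y μ => by
    rw [H.K_even_mul ha', H.K_of_mem _ (H.d_mem hb μ), zero_mul, zero_add, H.γ_d_even hb']
  rw [K_apply H b, K_apply H b]
  simp only [map_neg, map_add, map_sum, h1, h2, H.d_inr_K ha, H.i_inl_K ha, ha',
    mul_neg, Finset.sum_neg_distrib]
  abel

/-- The Schouten bracket of two even elements. -/
noncomputable def schouten (x y : T) : T :=
  ∑ μ, (H.i (Sum.inl μ) x * H.d (Sum.inl μ) y + H.d (Sum.inl μ) x * H.i (Sum.inl μ) y) +
    ∑ j, (H.i (Sum.inr j) x * H.d (Sum.inr j) y + H.d (Sum.inr j) x * H.i (Sum.inr j) y)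

/-- Second base derivatives of `a` are symmetric in their indices and double contractions are
antisymmetric. Each kind occurs in both index orders, with signs that make the two sums cancel; the
mixed terms cancel in pairs. -/
theorem schouten_correction {a x y : T} (ha : H.γ a = -a) (hx : H.γ x = x) :
    ∑ μ, (H.i (Sum.inl μ) x * H.K (H.d (Sum.inl μ) a) y +
        H.K (H.d (Sum.inl μ) a) x * H.i (Sum.inl μ) y) +
      ∑ j, (H.K (H.i (Sum.inr j) a) x * H.d (Sum.inr j) y +
        H.d (Sum.inr j) x * H.K (H.i (Sum.inr j) a) y) = 0 := by
  have e1 : ∀ μ z, H.K (H.d (Sum.inl μ) a) z =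
      ∑ k, H.i (Sum.inr k) (H.d (Sum.inl μ) a) * H.d (Sum.inr k) z -
      ∑ ν, H.d (Sum.inl ν) (H.d (Sum.inl μ) a) * H.i (Sum.inl ν) z := fun μ z =>
    H.K_odd_apply (H.γ_d_odd ha _) z
  have e2 : ∀ j z, H.K (H.i (Sum.inr j) a) z =
      -(∑ k, H.i (Sum.inr k) (H.i (Sum.inr j) a) * H.d (Sum.inr k) z) -
      ∑ ν, H.i (Sum.inr j) (H.d (Sum.inl ν) a) * H.i (Sum.inl ν) z := fun j z => by
    rw [K_apply, H.γ_i_odd ha]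
    simp only [H.d_i]
    abel
  have c1 : ∀ μ k z, H.i (Sum.inl μ) x * (H.i (Sum.inr k) (H.d (Sum.inl μ) a) * z) =
      H.i (Sum.inr k) (H.d (Sum.inl μ) a) * (H.i (Sum.inl μ) x * z) := fun μ k z => by
    rw [← mul_assoc, ← H.comm_even _ _ (H.γ_i_odd (H.γ_d_odd ha _) _), mul_assoc]
  have c2 : ∀ μ ν z, H.i (Sum.inl μ) x * (H.d (Sum.inl ν) (H.d (Sum.inl μ) a) * z) =
      -(H.d (Sum.inl ν) (H.d (Sum.inl μ) a) * (H.i (Sum.inl μ) x * z)) := fun μ ν z => by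
    rw [← mul_assoc, H.comm_odd _ _ (H.γ_i_even hx _), H.γ_d_odd (H.γ_d_odd ha _), neg_mul,
      neg_mul, mul_assoc]
  have c3 : ∀ j y' z, H.d (Sum.inr j) x * (y' * z) = y' * (H.d (Sum.inr j) x * z) :=
    fun j y' z => by rw [← mul_assoc, H.comm_even _ _ (H.γ_d_even hx _), mul_assoc]
  simp only [e1, e2, mul_sub, sub_mul, mul_neg, neg_mul, Finset.mul_sum, Finset.sum_mul,
    Finset.sum_add_distrib, Finset.sum_sub_distrib, Finset.sum_neg_distrib, c1, c2, c3, mul_assoc]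
  have s1 : ∑ μ, ∑ ν, H.d (Sum.inl ν) (H.d (Sum.inl μ) a) *
        (H.i (Sum.inl ν) x * H.i (Sum.inl μ) y) =
      ∑ μ, ∑ ν, H.d (Sum.inl ν) (H.d (Sum.inl μ) a) *
        (H.i (Sum.inl μ) x * H.i (Sum.inl ν) y) := by
    rw [Finset.sum_comm]
    exact Finset.sum_congr rfl fun _ _ => Finset.sum_congr rfl fun _ _ => by rw [H.d_comm]
  have s2 : ∑ j, ∑ k, H.i (Sum.inr k) (H.i (Sum.inr j) a) *
        (H.d (Sum.inr k) x * H.d (Sum.inr j) y) =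
      -∑ j, ∑ k, H.i (Sum.inr k) (H.i (Sum.inr j) a) *
        (H.d (Sum.inr j) x * H.d (Sum.inr k) y) := by
    rw [Finset.sum_comm, ← Finset.sum_neg_distrib]
    refine Finset.sum_congr rfl fun _ _ => ?_
    rw [← Finset.sum_neg_distrib]
    exact Finset.sum_congr rfl fun _ _ => by rw [H.i_comm, neg_mul]
  rw [s1, s2, Finset.sum_comm (f := fun j ν => H.i (Sum.inr j) (H.d (Sum.inl ν) a) *
    (H.i (Sum.inl ν) x * H.d (Sum.inr j) y)), Finset.sum_comm (f := fun j ν =>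
    H.i (Sum.inr j) (H.d (Sum.inl ν) a) * (H.d (Sum.inr j) x * H.i (Sum.inl ν) y))]
  abel

/-- This is the Jacobi identity of the Schouten bracket, in the form that `K a` is a derivation of
the bracket. Its content is that the failure of `K a` to commute with half of the operations sums to
zero. -/
theorem K_schouten {a x y : T} (ha : H.γ a = -a) (hp : H.p a = a) (hx : H.γ x = x) :
    H.K a (H.schouten x y) = H.schouten (H.K a x) y + H.schouten x (H.K a y) := by
  have h := H.schouten_correction (y := y) ha hx
  have hi : ∀ μ z, H.i (Sum.inl μ) (H.K a z) = H.K a (H.i (Sum.inl μ) z) := fun μ z => by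
    rw [H.i_inl_K hp, ha, map_neg, LinearMap.neg_apply, neg_neg]
  simp only [schouten, map_add, map_sum, H.K_odd_mul ha, hi, H.d_inr_K hp, H.d_inl_K,
    H.i_inr_K_odd ha, add_mul, mul_add, Finset.sum_add_distrib] at h ⊢
  rw [← sub_eq_zero, ← neg_eq_zero]
  refine Eq.trans ?_ h
  abel

/-- `p` is multiplicative and intertwines base derivatives and fibre contractions, while the other
operations vanish on its range. Hence each of the four types of term in the bracket survives in
exactly one summand on the right. This is the second condition on which derived brackets rest. -/
theorem p_schouten (x y : T) :
    H.p (H.schouten x y) = H.p (H.schouten x (H.p y)) + H.p (H.schouten (H.p x) y) := by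
  simp only [schouten, map_add, map_sum, map_mul, H.p_d, H.p_i, H.i_p, H.d_p, H.p_p,
    mul_zero, zero_mul, add_zero, zero_add, Finset.sum_add_distrib]
  abel

theorem schouten_comm {x y : T} (hx : H.γ x = x) (hy : H.γ y = y) :
    H.schouten x y = H.schouten y x := by
  simp only [schouten]
  congr 1 <;> refine Finset.sum_congr rfl fun A _ => ?_ <;>
  rw [H.comm_even _ _ (H.γ_d_even hx _), ← H.comm_even _ _ (H.γ_d_even hy _), add_comm]

theorem schouten_mem {x b : T} (hx : H.γ x = x) (hb : H.γ b = b) (hp : H.p b = b) :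
    H.schouten x b = -H.K b x := by
  simp only [schouten, K_apply, H.i_inl_of_mem hp, H.d_inr_of_mem hp, mul_zero, zero_add, add_zero,
    neg_neg, hb]
  rw [add_comm]
  congr 1
  all_goals refine Finset.sum_congr rfl fun j _ => ?_
  · rw [H.comm_even _ _ (H.γ_d_even hx _)]
  · rw [H.comm_even _ _ (H.γ_d_even hb _)]

/-- The generalized Jacobi identity for the higher derived brackets of an even element `ϖ` with
`[ϖ, ϖ] = 0`, evaluated on one odd argument. -/
theorem derived_jacobi {a ϖ : T} (ha : H.γ a = -a) (hp : H.p a = a) (hϖ : H.γ ϖ = ϖ)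
    (h0 : H.schouten ϖ ϖ = 0) (n : ℕ) :
    ∑ ij ∈ Finset.HasAntidiagonal.antidiagonal n, n.choose ij.1 •
      H.p (H.K (H.p ((H.K a ^ ij.1) ϖ)) ((H.K a ^ ij.2) ϖ)) = 0 := by
  have hev : ∀ k, H.γ ((H.K a ^ k) ϖ) = (H.K a ^ k) ϖ := by
    intro k
    induction k with
    | zero => simpa using hϖ
    | succ k ih => rw [pow_succ', Module.End.mul_apply]; exact H.γ_K_odd ha ih
  have hpow : ∀ n, (H.K a ^ n) (H.schouten ϖ ϖ) = ∑ ij ∈ Finset.HasAntidiagonal.antidiagonal n, n.choose ij.1 •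
      H.schouten ((H.K a ^ ij.1) ϖ) ((H.K a ^ ij.2) ϖ) := by
    intro n
    induction n with
    | zero => simp
    | succ n ih =>
      rw [Finset.sum_antidiagonal_choose_succ_nsmul
        (fun i j => H.schouten ((H.K a ^ i) ϖ) ((H.K a ^ j) ϖ)), pow_succ', Module.End.mul_apply,
        ih, map_sum, ← Finset.sum_add_distrib]
      refine Finset.sum_congr rfl fun ij hij => ?_
      rw [Finset.HasAntidiagonal.mem_antidiagonal] at hij
      rw [map_nsmul, H.K_schouten ha hp (hev _), ← Module.End.mul_apply, ← Module.End.mul_apply,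
        ← pow_succ', ← pow_succ', nsmul_add, add_comm, ← Nat.choose_symm_of_eq_add hij.symm]
  -- Projecting leaves brackets with one entry in the range of `p`, and such a bracket is minus `K`
  -- of that entry.
  have key : ∀ i j, H.p (H.schouten ((H.K a ^ i) ϖ) ((H.K a ^ j) ϖ)) =
      -H.p (H.K (H.p ((H.K a ^ j) ϖ)) ((H.K a ^ i) ϖ)) +
      -H.p (H.K (H.p ((H.K a ^ i) ϖ)) ((H.K a ^ j) ϖ)) := by
    intro i j
    have hq : ∀ k, H.γ (H.p ((H.K a ^ k) ϖ)) = H.p ((H.K a ^ k) ϖ) := fun k => by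
      rw [← H.p_γ, hev]
    rw [p_schouten, H.schouten_mem (hev i) (hq j) (H.p_p _), H.schouten_comm (hq i) (hev j),
      H.schouten_mem (hev j) (hq i) (H.p_p _), map_neg, map_neg]
  have h := congrArg H.p (hpow n)
  rw [h0, map_zero, map_zero, map_sum] at h
  simp only [map_nsmul, key, nsmul_add, Finset.sum_add_distrib] at h
  -- Exchanging the two summation indices identifies both halves, so the projected identity is twice
  -- the claim.
  have hsw : ∑ ij ∈ Finset.HasAntidiagonal.antidiagonal n, n.choose ij.1 •
      -H.p (H.K (H.p ((H.K a ^ ij.2) ϖ)) ((H.K a ^ ij.1) ϖ)) =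
      ∑ ij ∈ Finset.HasAntidiagonal.antidiagonal n, n.choose ij.1 •
      -H.p (H.K (H.p ((H.K a ^ ij.1) ϖ)) ((H.K a ^ ij.2) ϖ)) := by
    rw [← Finset.Nat.sum_antidiagonal_swap]
    refine Finset.sum_congr rfl fun ij hij => ?_
    rw [Finset.HasAntidiagonal.mem_antidiagonal] at hij
    simp only [Prod.fst_swap, Prod.snd_swap, ← Nat.choose_symm_of_eq_add hij.symm]
  rw [hsw, ← two_nsmul] at h
  simp only [smul_neg, Finset.sum_neg_distrib] at h
  have h2 := neg_eq_zero.mp h.symm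
  rw [two_nsmul, ← two_smul ℝ] at h2
  exact (smul_eq_zero.mp h2).resolve_left two_ne_zero

end PhaseAlgebra
end PInfty

/-! ### Signs, parities and the multilinear derived brackets -/

namespace PInfty

theorem neg_one_zpow_congr {a b : ℤ} (h : Even (a - b)) : (-1 : ℝ) ^ a = (-1 : ℝ) ^ b := by
  have : a = (a - b) + b := by ring
  rw [this, zpow_add₀ (by norm_num), h.neg_one_zpow, one_mul]

theorem neg_one_zpow_mul (a b : ℤ) : (-1 : ℝ) ^ a * (-1 : ℝ) ^ b = (-1 : ℝ) ^ (a + b) :=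
  (zpow_add₀ (by norm_num) a b).symm

theorem neg_one_zpow_mul_self (a : ℤ) : (-1 : ℝ) ^ a * (-1 : ℝ) ^ a = 1 := by
  rw [neg_one_zpow_mul, Even.neg_one_zpow ⟨a, rfl⟩]

theorem neg_neg_one_zpow (a : ℤ) : -((-1 : ℝ) ^ a) = (-1 : ℝ) ^ (a + 1) := by
  rw [zpow_add₀ (by norm_num), zpow_one, mul_neg_one]

theorem ofFn_comp_swap {α : Type*} {n : ℕ} (a : Fin n → α) {i j : Fin n} (h : (i : ℕ) + 1 = j) :
    ∃ l₁ l₂ : List α, List.ofFn a = l₁ ++ a i :: a j :: l₂ ∧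
      List.ofFn (a ∘ Equiv.swap i j) = l₁ ++ a j :: a i :: l₂ := by
  refine ⟨(List.ofFn a).take i, (List.ofFn a).drop (i + 2), ?_, ?_⟩
  · refine List.ext_getElem (by simp; omega) fun k h1 h2 => ?_
    rcases lt_trichotomy k i with hk | hk | hk
    · rw [List.getElem_append_left (by simp; omega)]; simp
    · subst hk; rw [List.getElem_append_right (by simp)]; simp
    · rw [List.getElem_append_right (by simp; omega)]
      rcases eq_or_lt_of_le (Nat.succ_le_of_lt hk) with hk | hk
      · have : (⟨k, by simpa using h1⟩ : Fin n) = j := Fin.ext (by simp; omega)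
        have h3 : k - i.1 = 1 := by omega
        simp [h3, ← this]
      · obtain ⟨t, rfl⟩ : ∃ t, k = i + 2 + t := ⟨k - (i + 2), by omega⟩
        have h3 : i.1 + 2 + t - i.1 = t + 2 := by omega
        simp [h3]
  · refine List.ext_getElem (by simp; omega) fun k h1 h2 => ?_
    have hkn : k < n := by simpa using h1
    rcases lt_trichotomy k i with hk | hk | hk
    · rw [List.getElem_append_left (by simp; omega)]
      have : Equiv.swap i j ⟨k, hkn⟩ = ⟨k, hkn⟩ :=
        Equiv.swap_apply_of_ne_of_ne (by simp [Fin.ext_iff]; omega) (by simp [Fin.ext_iff]; omega)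
      simp [this]
    · subst hk; rw [List.getElem_append_right (by simp)]; simp
    · rw [List.getElem_append_right (by simp; omega)]
      rcases eq_or_lt_of_le (Nat.succ_le_of_lt hk) with hk | hk
      · have : (⟨k, by simpa using h1⟩ : Fin n) = j := Fin.ext (by simp; omega)
        have h3 : k - i.1 = 1 := by omega
        simp [h3, this]
      · obtain ⟨t, rfl⟩ : ∃ t, k = i + 2 + t := ⟨k - (i + 2), by omega⟩
        have h3 : i.1 + 2 + t - i.1 = t + 2 := by omega
        have : Equiv.swap i j ⟨i + 2 + t, hkn⟩ = ⟨i + 2 + t, hkn⟩ :=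
          Equiv.swap_apply_of_ne_of_ne (by simp [Fin.ext_iff]; omega)
            (by simp [Fin.ext_iff]; omega)
        simp [h3, this]

/-- The weights drop by one per position, so exchanging two neighbours changes the sum by a
difference of degrees. This is the décalage that turns brackets symmetric in shifted degrees into
graded skew-symmetric ones. -/
theorem sum_comp_swap {n : ℕ} (c : ℤ) (d : Fin n → ℤ) {i j : Fin n} (hij : (i : ℕ) + 1 = j) :
    ∑ k : Fin n, (c - k) * (d ∘ Equiv.swap i j) k =
      (∑ k : Fin n, (c - k) * d k) + (d j - d i) := by
  have hne : i ≠ j := fun h => by rw [h] at hij; omega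
  rw [← sub_eq_iff_eq_add', ← Finset.sum_sub_distrib,
    Finset.sum_eq_add_of_mem i j (Finset.mem_univ _) (Finset.mem_univ _) hne]
  · simp only [Function.comp, Equiv.swap_apply_left, Equiv.swap_apply_right, ← hij]
    push_cast
    ring
  · intro k _ hk
    rw [Function.comp, Equiv.swap_apply_of_ne_of_ne hk.1 hk.2, sub_self]

namespace PhaseAlgebra

variable {T : Type*} [Ring T] [Algebra ℝ T] {m r : Type*} [DecidableEq m]
    [DecidableEq r] (H : PhaseAlgebra T m r)

/-- `x` has parity `n`. -/
def Par (n : ℤ) (x : T) : Prop := H.γ x = (-1 : ℝ) ^ n • x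

variable {H}

theorem Par.cases {n : ℤ} {x : T} (h : H.Par n x) :
    (Even n ∧ H.γ x = x) ∨ (Odd n ∧ H.γ x = -x) := by
  rcases Int.even_or_odd n with hn | hn
  · exact Or.inl ⟨hn, by rw [Par] at h; rw [h, hn.neg_one_zpow, one_smul]⟩
  · exact Or.inr ⟨hn, by rw [Par] at h; rw [h, hn.neg_one_zpow, neg_one_smul]⟩

theorem par_of_odd {n : ℤ} {x : T} (hn : Odd n) (h : H.γ x = -x) : H.Par n x := by
  rw [Par, hn.neg_one_zpow, h, neg_one_smul]

theorem par_of_even {n : ℤ} {x : T} (hn : Even n) (h : H.γ x = x) : H.Par n x := by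
  rw [Par, hn.neg_one_zpow, h, one_smul]

theorem Par.mul {k n : ℤ} {x y : T} (hx : H.Par k x) (hy : H.Par n y) : H.Par (k + n) (x * y) := by
  rw [Par] at *
  rw [map_mul, hx, hy, smul_mul_smul_comm, neg_one_zpow_mul]

theorem Par.congr {k n : ℤ} {x : T} (hx : H.Par k x) (h : Even (k - n)) : H.Par n x := by
  rw [Par, ← neg_one_zpow_congr h]; exact hx

theorem Par.p {n : ℤ} {x : T} (hx : H.Par n x) : H.Par n (H.p x) := by
  rw [Par] at *
  rw [← H.p_γ, hx, map_smul]

theorem Par.γ {n : ℤ} {x : T} (hx : H.Par n x) : H.Par n (H.γ x) := by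
  rw [Par] at *
  rw [hx, map_smul, hx]

theorem Par.comm {k n : ℤ} {x y : T} (hx : H.Par k x) (hy : H.Par n y) :
    x * y = (-1 : ℝ) ^ (k * n) • (y * x) := by
  rcases hx.cases with ⟨hk, h⟩ | ⟨hk, h⟩
  · rw [H.comm_even _ _ h, (hk.mul_right n).neg_one_zpow, one_smul]
  · rw [H.comm_odd _ _ h, hy]
    rcases Int.even_or_odd n with hn | hn
    · rw [hn.neg_one_zpow, (hn.mul_left k).neg_one_zpow, one_smul, one_smul]
    · rw [hn.neg_one_zpow, (hk.mul hn).neg_one_zpow, smul_mul_assoc]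

variable [Fintype m] [Fintype r]

theorem Par.K {k n : ℤ} {a x : T} (ha : H.Par k a) (hx : H.Par n x) :
    H.Par (k - 1 + n) (H.K a x) := by
  rw [Par] at *
  rw [γ_K, ha, hx, map_smul, map_smul, LinearMap.smul_apply, smul_smul, neg_one_zpow_mul,
    ← neg_smul, neg_neg_one_zpow]
  congr 1
  exact neg_one_zpow_congr ⟨1, by ring⟩

theorem Par.K_comm {k n : ℤ} {a b : T} (ha : H.Par k a) (hb : H.Par n b) (hpa : H.p a = a)
    (hpb : H.p b = b) (x : T) :
    H.K a (H.K b x) = (-1 : ℝ) ^ ((k - 1) * (n - 1)) • H.K b (H.K a x) := by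
  rcases ha.cases with ⟨hk, h⟩ | ⟨hk, h⟩
  · rcases hb.cases with ⟨hn, h'⟩ | ⟨hn, h'⟩
    · rw [H.K_comm_even hpa hpb h h', ((hk.sub_odd odd_one).mul (hn.sub_odd odd_one)).neg_one_zpow,
        neg_one_smul]
    · rw [H.K_comm_odd hpb hpa h', ((hn.sub_odd odd_one).mul_left _).neg_one_zpow, one_smul]
  · rw [H.K_comm_odd hpa hpb h, ((hk.sub_odd odd_one).mul_right _).neg_one_zpow, one_smul]

theorem Par.K_mul_left {k n : ℤ} {a b : T} (ha : H.Par k a) (hb : H.Par n b) (hpb : H.p b = b)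
    (x : T) : H.K a (b * x) = (-1 : ℝ) ^ ((k - 1) * n) • (b * H.K a x) := by
  rcases ha.cases with ⟨hk, h⟩ | ⟨hk, h⟩
  · rw [H.K_even_mul h, H.K_of_mem _ hpb, zero_mul, zero_add, hb, smul_mul_assoc]
    congr 1
    refine neg_one_zpow_congr ?_
    have : n - (k - 1) * n = n * (2 - k) := by ring
    rw [this]
    exact (even_two.sub hk).mul_left n
  · rw [H.K_odd_mul h, H.K_of_mem _ hpb, zero_mul, zero_add,
      ((hk.sub_odd odd_one).mul_right _).neg_one_zpow, one_smul]

theorem Par.K_mul_right {k : ℤ} {a : T} (ha : H.Par k a) {b : T} (hpb : H.p b = b)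
    (x : T) : H.K a (x * b) = H.K a x * b := by
  rcases ha.cases with ⟨-, h⟩ | ⟨-, h⟩
  · rw [H.K_even_mul h, H.K_of_mem _ hpb, mul_zero, add_zero]
  · rw [H.K_odd_mul h, H.K_of_mem _ hpb, mul_zero, add_zero]

/-- `K` involves its first argument only through first-order operations, so it obeys a product rule
there too; this is the source of the derivation property of the brackets. The `γ` on `c` is undone
because `lam` applies `γ` once to its last argument. -/
theorem K_mul (b c : T) {x : T} (hx : H.γ x = x) :
    H.K (b * c) x = b * H.K c x + H.K b x * H.γ c := by
  have h1 : ∀ j, H.i (Sum.inr j) (H.γ (b * c)) * H.d (Sum.inr j) x =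
      b * (H.i (Sum.inr j) (H.γ c) * H.d (Sum.inr j) x) +
        H.i (Sum.inr j) (H.γ b) * H.d (Sum.inr j) x * H.γ c := fun j => by
    rw [map_mul, H.i_mul, add_mul, H.γ_γ, mul_assoc, ← H.comm_even _ (H.γ c) (H.γ_d_even hx _)]
    noncomm_ring
  have h2 : ∀ μ, H.d (Sum.inl μ) (b * c) * H.i (Sum.inl μ) x =
      b * (H.d (Sum.inl μ) c * H.i (Sum.inl μ) x) +
        H.d (Sum.inl μ) b * H.i (Sum.inl μ) x * H.γ c := fun μ => by
    rw [H.d_mul, add_mul, mul_assoc _ _ (H.γ c), H.comm_odd _ (H.γ c) (H.γ_i_even hx _), H.γ_γ]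
    noncomm_ring
  simp only [K_apply, h1, h2, Finset.sum_add_distrib, ← Finset.mul_sum, ← Finset.sum_mul, mul_neg,
    neg_mul, mul_add, add_mul]
  abel

variable (H) in
/-- The iterated bracket of `x` with the elements of a list. -/
noncomputable def word (l : List T) (x : T) : T := (l.map H.K).prod x

@[simp] theorem word_nil (x : T) : H.word [] x = x := rfl

@[simp] theorem word_cons (a : T) (l : List T) (x : T) :
    H.word (a :: l) x = H.K a (H.word l x) := by
  simp [word]

theorem word_append (l l' : List T) (x : T) : H.word (l ++ l') x = H.word l (H.word l' x) := by
  induction l with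
  | nil => rfl
  | cons a l ih => simp [ih]

theorem word_smul (l : List T) (c : ℝ) (x : T) : H.word l (c • x) = c • H.word l x :=
  map_smul _ _ _

variable (H) in
/-- The unsigned higher derived brackets. -/
noncomputable def derivedBracket (ϖ : T) (n : ℕ) : MultilinearMap ℝ (fun _ : Fin n => T) T :=
  (H.p.toLinearMap ∘ₗ LinearMap.applyₗ ϖ).compMultilinearMap
    ((MultilinearMap.mkPiAlgebraFin ℝ n (Module.End ℝ T)).compLinearMap fun _ => H.K)

theorem derivedBracket_apply (ϖ : T) {n : ℕ} (a : Fin n → T) :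
    H.derivedBracket ϖ n a = H.p (H.word (List.ofFn a) ϖ) := by
  simp [derivedBracket, word, List.map_ofFn, Function.comp_def]

variable (H) in
/-- The higher derived brackets, with the signs of a `P∞`-structure. -/
noncomputable def lam (ϖ : T) (n : ℕ) : MultilinearMap ℝ (fun _ : Fin n => T) T :=
  -(H.derivedBracket ϖ n).compLinearMap fun i : Fin n => H.γ.toLinearMap ^ (n - (i : ℕ))

theorem γ_pow_apply {k : ℤ} {x : T} (hx : H.Par k x) (n : ℕ) :
    (H.γ.toLinearMap ^ n) x = (-1 : ℝ) ^ (n * k) • x := by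
  induction n with
  | zero => simp
  | succ n ih =>
    rw [pow_succ', Module.End.mul_apply, ih, map_smul, AlgHom.toLinearMap_apply, hx, smul_smul,
      neg_one_zpow_mul]
    congr 2
    push_cast
    ring

theorem prod_neg_one_zpow {ι : Type*} (s : Finset ι) (f : ι → ℤ) :
    ∏ i ∈ s, (-1 : ℝ) ^ f i = (-1 : ℝ) ^ ∑ i ∈ s, f i := by
  classical
  induction s using Finset.induction_on with
  | empty => simp
  | insert a s ha ih => rw [Finset.prod_insert ha, Finset.sum_insert ha, ih, neg_one_zpow_mul]

theorem lam_apply (ϖ : T) {n : ℕ} {d : Fin n → ℤ} {a : Fin n → T} (ha : ∀ i, H.Par (d i) (a i)) :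
    H.lam ϖ n a = -((-1 : ℝ) ^ (∑ i : Fin n, ((n : ℤ) - i) * d i) • H.derivedBracket ϖ n a) := by
  have : ∀ i : Fin n, (H.γ.toLinearMap ^ (n - (i : ℕ))) (a i) =
      (-1 : ℝ) ^ (((n : ℤ) - i) * d i) • a i := fun i => by
    rw [γ_pow_apply (ha i), Nat.cast_sub i.2.le]
  rw [lam, neg_apply, MultilinearMap.compLinearMap_apply]
  simp only [this]
  rw [MultilinearMap.map_smul_univ, prod_neg_one_zpow]

theorem par_word {ϖ : T} (hϖ : H.γ ϖ = ϖ) {n : ℕ} {d : Fin n → ℤ} {a : Fin n → T}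
    (ha : ∀ i, H.Par (d i) (a i)) : H.Par (∑ i, (d i - 1)) (H.word (List.ofFn a) ϖ) := by
  induction n with
  | zero => simpa using par_of_even (by simp) hϖ
  | succ n ih =>
    rw [List.ofFn_succ, word_cons, Fin.sum_univ_succ]
    exact (ha 0).K (ih fun i => ha i.succ)

/-- Exchanging the neighbouring operators `K (a i)` and `K (a j)` costs the exponent (d i - 1)(d j -
1). The weights in `lam` contribute d j - d i, and together these are d i · d j + 1 modulo two. -/
theorem lam_skew {ϖ : T} {n : ℕ} {d : Fin n → ℤ} {a : Fin n → T} (hp : ∀ i, H.p (a i) = a i)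
    (ha : ∀ i, H.Par (d i) (a i)) {i j : Fin n} (hij : (i : ℕ) + 1 = j) :
    H.lam ϖ n a = -((-1 : ℝ) ^ (d i * d j) • H.lam ϖ n (a ∘ Equiv.swap i j)) := by
  rw [lam_apply ϖ ha, lam_apply ϖ (a := a ∘ Equiv.swap i j) (d := d ∘ Equiv.swap i j)
    (fun k => ha _)]
  have hb : H.derivedBracket ϖ n a =
      (-1 : ℝ) ^ ((d i - 1) * (d j - 1)) • H.derivedBracket ϖ n (a ∘ Equiv.swap i j) := by
    obtain ⟨l₁, l₂, h1, h2⟩ := ofFn_comp_swap a hij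
    rw [derivedBracket_apply, derivedBracket_apply, h1, h2, word_append, word_append, word_cons,
      word_cons, (ha i).K_comm (ha j) (hp i) (hp j), word_smul, map_smul]
    rfl
  rw [hb, sum_comp_swap _ _ hij]
  simp only [smul_neg, neg_neg, smul_smul, neg_one_zpow_mul]
  rw [← neg_smul, neg_neg_one_zpow]
  congr 1
  exact neg_one_zpow_congr ⟨1 - d j, by ring⟩

/-- The product is split by `K_mul` at the innermost bracket. The outer operators annihilate `b` and
`γ c`, which lie in the range of `p`: they pass `b` on the left with a sign and leave `γ c` on the
right without one. -/
theorem word_K_mul {ϖ : T} (hϖ : H.γ ϖ = ϖ) {n : ℕ} {d : Fin n → ℤ} {a : Fin n → T}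
    (ha : ∀ i, H.Par (d i) (a i)) {k : ℤ} {b c : T} (hb : H.Par k b)
    (hpb : H.p b = b) (hpc : H.p c = c) :
    H.word (List.ofFn a) (H.K (b * c) ϖ) =
      (-1 : ℝ) ^ ((∑ i, (d i - 1)) * k) • (b * H.word (List.ofFn a) (H.K c ϖ)) +
        H.word (List.ofFn a) (H.K b ϖ) * H.γ c := by
  induction n with
  | zero => simp [K_mul b c hϖ]
  | succ n ih =>
    rw [List.ofFn_succ, word_cons, word_cons, word_cons, ih fun i => ha i.succ, map_add,
      (ha 0).K_mul_right (H.γ_mem hpc), map_smul, (ha 0).K_mul_left hb hpb, smul_smul,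
      neg_one_zpow_mul, Fin.sum_univ_succ]
    congr 3
    ring

/-- The last argument carries exactly one `γ` and is not assumed homogeneous, so `lam_apply` does
not cover it; homogeneity serves only to extract the signs of the other arguments. -/
theorem lam_snoc {ϖ : T} {n : ℕ} {d : Fin n → ℤ} {a : Fin n → T}
    (ha : ∀ i, H.Par (d i) (a i)) (b : T) :
    H.lam ϖ (n + 1) (Fin.snoc a b) = -((-1 : ℝ) ^ (∑ i : Fin n, ((n : ℤ) + 1 - i) * d i) •
      H.p (H.word (List.ofFn a) (H.K (H.γ b) ϖ))) := by
  have : ∀ i : Fin n, (H.γ.toLinearMap ^ (n + 1 - (i : ℕ))) (a i) =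
      (-1 : ℝ) ^ (((n : ℤ) + 1 - i) * d i) • a i := fun i => by
    rw [γ_pow_apply (ha i), Nat.cast_sub (by omega)]
    norm_cast
  rw [lam, neg_apply, MultilinearMap.compLinearMap_apply]
  have h2 : (fun i : Fin (n + 1) => (H.γ.toLinearMap ^ (n + 1 - (i : ℕ)))
      ((Fin.snoc a b : Fin (n + 1) → T) i)) =
      Fin.snoc (fun i => (-1 : ℝ) ^ (((n : ℤ) + 1 - i) * d i) • a i) (H.γ b) := by
    funext i
    refine Fin.lastCases ?_ (fun i => ?_) i
    · simp
    · simp [← this]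
  have h3 : ∀ a' : Fin n → T, H.derivedBracket ϖ (n + 1) (Fin.snoc a' (H.γ b)) =
      H.p (H.word (List.ofFn a') (H.K (H.γ b) ϖ)) := fun a' => by
    rw [derivedBracket_apply, List.ofFn_succ']
    simp [word_append]
  rw [h2, h3]
  have h4 := (MultilinearMap.mkPiAlgebraFin ℝ n (Module.End ℝ T)).map_smul_univ
    (fun i : Fin n => (-1 : ℝ) ^ (((n : ℤ) + 1 - i) * d i)) (fun i => H.K (a i))
  rw [MultilinearMap.mkPiAlgebraFin_apply, MultilinearMap.mkPiAlgebraFin_apply,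
    prod_neg_one_zpow] at h4
  have h5 : ∀ y, H.word (List.ofFn fun i : Fin n => (-1 : ℝ) ^ (((n : ℤ) + 1 - i) * d i) • a i) y =
      (-1 : ℝ) ^ (∑ i : Fin n, ((n : ℤ) + 1 - i) * d i) • H.word (List.ofFn a) y := fun y => by
    rw [word, word, List.map_ofFn, List.map_ofFn]
    simp only [Function.comp_def, map_smul]
    rw [h4, LinearMap.smul_apply]
  rw [h5, map_smul]

theorem lam_derivation {ϖ : T} (hϖ : H.γ ϖ = ϖ) {n : ℕ} {d : Fin n → ℤ} {a : Fin n → T}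
    (ha : ∀ i, H.Par (d i) (a i)) {k : ℤ} {b c : T} (hb : H.Par k b)
    (hpb : H.p b = b) (hpc : H.p c = c) :
    H.lam ϖ (n + 1) (Fin.snoc a (b * c)) = H.lam ϖ (n + 1) (Fin.snoc a b) * c +
      (-1 : ℝ) ^ ((2 - ((n : ℤ) + 1) + ∑ i, d i) * k) •
        (b * H.lam ϖ (n + 1) (Fin.snoc a c)) := by
  rw [lam_snoc ha, lam_snoc ha, lam_snoc ha, map_mul, word_K_mul hϖ ha hb.γ (H.γ_mem hpb)
    (H.γ_mem hpc), map_add, map_smul, map_mul, map_mul, H.γ_γ, hpc, H.γ_mem hpb, hb]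
  simp only [smul_add, neg_add, mul_neg, smul_neg, neg_mul, smul_mul_assoc, mul_smul_comm,
    smul_smul]
  rw [add_comm]
  congr 3
  simp only [neg_one_zpow_mul]
  refine neg_one_zpow_congr ?_
  simp only [Finset.sum_sub_distrib, Finset.sum_const, Finset.card_univ, Fintype.card_fin,
    nsmul_eq_mul, mul_one]
  exact ⟨0, by ring⟩

end PhaseAlgebra
end PInfty

/-! ### The generalized Jacobi identities by polarization with nilpotent parameters -/

namespace PInfty

/-- An adjacent transposition creates or removes the single inversion between `σ i` and `σ j`; every
other pair keeps its relative order. Removing an inversion is again multiplication by its sign,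
since the sign squares to one. -/
theorem koszulSign_mul_swap {n : ℕ} (d : Fin n → ℤ) (σ : Equiv.Perm (Fin n)) {i j : Fin n}
    (h : (i : ℕ) + 1 = j) :
    koszulSign d (σ * Equiv.swap i j) = (-1 : ℝ) ^ (d (σ i) * d (σ j)) * koszulSign d σ := by
  classical
  have hlt : i < j := by rw [Fin.lt_def]; omega
  have hne : σ i ≠ σ j := fun e => hlt.ne (σ.injective e)
  set s := Equiv.swap i j with hs
  set c := (-1 : ℝ) ^ (d (σ i) * d (σ j)) with hc
  have hcc : c * c = 1 := neg_one_zpow_mul_self _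
  have hre : koszulSign d (σ * s) = ∏ k : Fin n, ∏ l : Fin n,
      if s k < s l ∧ σ l < σ k then (-1 : ℝ) ^ (d (σ k) * d (σ l)) else 1 := by
    rw [koszulSign, ← Equiv.prod_comp s]
    refine Finset.prod_congr rfl fun k _ => ?_
    rw [← Equiv.prod_comp s]
    simp [hs]
  -- After reindexing, only the index pairs (i, j) and (j, i) have changed order. The two correction
  -- factors record them, and at most one of the two products over all pairs differs from one.
  have hpt : ∀ k l : Fin n,
      (if s k < s l ∧ σ l < σ k then (-1 : ℝ) ^ (d (σ k) * d (σ l)) else 1) =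
      (if k < l ∧ σ l < σ k then (-1 : ℝ) ^ (d (σ k) * d (σ l)) else 1) *
      ((if k = i then (if l = j then (if σ j < σ i then c else 1) else 1) else 1) *
        (if k = j then (if l = i then (if σ i < σ j then c else 1) else 1) else 1)) := by
    intro k l
    have key : ∀ k : Fin n, (k = i ∧ s k = j) ∨ (k = j ∧ s k = i) ∨
        (k ≠ i ∧ k ≠ j ∧ s k = k) := by
      intro k
      by_cases h1 : k = i
      · subst h1; exact Or.inl ⟨rfl, Equiv.swap_apply_left _ _⟩
      · by_cases h2 : k = j
        · subst h2; exact Or.inr (Or.inl ⟨rfl, Equiv.swap_apply_right _ _⟩)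
        · exact Or.inr (Or.inr ⟨h1, h2, Equiv.swap_apply_of_ne_of_ne h1 h2⟩)
    rcases key k with ⟨hk, hk'⟩ | ⟨hk, hk'⟩ | ⟨hk1, hk2, hk'⟩ <;>
    rcases key l with ⟨hl, hl'⟩ | ⟨hl, hl'⟩ | ⟨hl1, hl2, hl'⟩ <;> rw [hk', hl']
    · subst hk hl; simp [hlt.ne]
    · subst hk hl
      by_cases hlt' : σ l < σ k <;> simp [hlt, hlt.ne, hlt', hlt.asymm, ← hc, hcc]
    · subst hk
      have : j < l ↔ k < l := by rw [Fin.lt_def, Fin.lt_def]; omega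
      simp [hlt.ne, hl2, this]
    · subst hk hl
      by_cases hlt' : σ l < σ k <;> simp [hlt, hlt.ne', hlt', hlt.asymm, hc, mul_comm]
    · subst hk hl; simp [hlt.ne']
    · subst hk
      have : i < l ↔ k < l := by rw [Fin.lt_def, Fin.lt_def]; omega
      simp [hlt.ne', hl1, this]
    · subst hl
      have : k < j ↔ k < l := by rw [Fin.lt_def, Fin.lt_def]; omega
      simp [hk1, hk2, this]
    · subst hl
      have : k < i ↔ k < l := by rw [Fin.lt_def, Fin.lt_def]; omega
      simp [hk1, hk2, this]
    · simp [hk1, hk2]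
  have hfac : ∀ a b : Fin n, ∀ u : ℝ,
      ∏ k : Fin n, ∏ l : Fin n, (if k = a then (if l = b then u else 1) else 1) = u := by
    intro a b u
    rw [Finset.prod_eq_single a (fun k _ hk => by simp [hk]) (by simp)]
    simp
  rw [hre]
  simp only [hpt, Finset.prod_mul_distrib, hfac]
  rw [mul_comm, ← koszulSign]
  congr 1
  rcases hne.lt_or_gt with h1 | h1 <;> simp [h1, h1.asymm]

/-- Adjacent transpositions generate the symmetric group, so the transformation law determines `f`
from `f 1`. In this way graded signs only ever have to be computed for exchanges of neighbours. -/
theorem eq_sign_koszulSign_smul {M : Type*} [AddCommGroup M] [Module ℝ M] {n : ℕ} (d : Fin n → ℤ)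
    (f : Equiv.Perm (Fin n) → M)
    (hf : ∀ σ : Equiv.Perm (Fin n), ∀ i j : Fin n, (i : ℕ) + 1 = j →
      f (σ * Equiv.swap i j) = -((-1 : ℝ) ^ (d (σ i) * d (σ j)) • f σ))
    (σ : Equiv.Perm (Fin n)) :
    f σ = (((Equiv.Perm.sign σ : ℤ) : ℝ) * koszulSign d σ) • f 1 := by
  cases n with
  | zero =>
    have : σ = 1 := Subsingleton.elim _ _
    subst this
    simp [koszulSign]
  | succ n =>
    have hσ : σ ∈ Submonoid.closure
        (Set.range fun i : Fin n => Equiv.swap i.castSucc i.succ) := by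
      rw [Equiv.Perm.mclosure_swap_castSucc_succ]; trivial
    induction hσ using Submonoid.closure_induction_right with
    | one =>
      have : koszulSign d 1 = 1 := Finset.prod_eq_one fun i _ => Finset.prod_eq_one fun j _ => by
        rw [if_neg]; rintro ⟨h1, h2⟩; exact lt_asymm h1 h2
      simp [this]
    | mul_right x hx y hy ih =>
      obtain ⟨i, rfl⟩ := hy
      have hne : i.castSucc ≠ i.succ := (Fin.castSucc_lt_succ (i := i)).ne
      simp only
      rw [hf _ _ _ (by simp), koszulSign_mul_swap _ _ (by simp), Equiv.Perm.sign_mul,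
        Equiv.Perm.sign_swap hne, ih, smul_smul, ← neg_smul]
      congr 1
      push_cast
      ring

namespace PhaseAlgebra

variable {T : Type*} [Ring T] [Algebra ℝ T] {m r : Type*} [DecidableEq m]
    [DecidableEq r] {H : PhaseAlgebra T m r}

variable (H) in
/-- The elements of `T` annihilated by all the operations. -/
structure IsConst (x : T) : Prop where
  d : ∀ A, H.d A x = 0
  i : ∀ A, H.i A x = 0
  p : H.p x = x

theorem isConst_one : H.IsConst 1 := by
  have hd : ∀ A, H.d A 1 = 0 := fun A => by simpa using H.d_mul A 1 1
  have hi : ∀ A, H.i A 1 = 0 := fun A => by simpa using H.i_mul A 1 1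
  exact ⟨hd, hi, map_one _⟩

theorem IsConst.mul {x y : T} (hx : H.IsConst x) (hy : H.IsConst y) : H.IsConst (x * y) :=
  ⟨fun A => by rw [H.d_mul, hx.d, hy.d]; simp, fun A => by rw [H.i_mul, hx.i, hy.i]; simp,
    by rw [map_mul, hx.p, hy.p]⟩

variable (H) in
/-- Square zero parameters of parity `d i - 1`. -/
structure IsNilSystem {n : ℕ} (d : Fin n → ℤ) (ε : Fin n → T) : Prop where
  par : ∀ i, H.Par (d i - 1) (ε i)
  sq : ∀ i, ε i * ε i = 0
  const : ∀ i, H.IsConst (ε i)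

/-- The product of the parameters in a list, in reverse order. -/
def revProd {n : ℕ} (ε : Fin n → T) (l : List (Fin n)) : T := (l.map ε).reverse.prod

@[simp] theorem revProd_nil {n : ℕ} (ε : Fin n → T) : revProd ε [] = 1 := rfl

@[simp] theorem revProd_cons {n : ℕ} (ε : Fin n → T) (k : Fin n) (l : List (Fin n)) :
    revProd ε (k :: l) = revProd ε l * ε k := by simp [revProd]

theorem revProd_append {n : ℕ} (ε : Fin n → T) (l l' : List (Fin n)) :
    revProd ε (l ++ l') = revProd ε l' * revProd ε l := by simp [revProd]

section

variable {n : ℕ} {d : Fin n → ℤ} {ε : Fin n → T} (hε : H.IsNilSystem d ε)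

include hε

theorem IsNilSystem.isConst_revProd (l : List (Fin n)) : H.IsConst (revProd ε l) := by
  induction l with
  | nil => exact isConst_one
  | cons k l ih => rw [revProd_cons]; exact ih.mul (hε.const k)

theorem IsNilSystem.par_revProd (l : List (Fin n)) :
    H.Par (l.map fun k => d k - 1).sum (revProd ε l) := by
  induction l with
  | nil => exact par_of_even (by simp) (map_one _)
  | cons k l ih =>
    rw [revProd_cons, List.map_cons, List.sum_cons, add_comm]; exact ih.mul (hε.par k)

theorem IsNilSystem.revProd_mul_of_mem {l : List (Fin n)} {k : Fin n} (hk : k ∈ l) :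
    revProd ε l * ε k = 0 := by
  induction l with
  | nil => simp at hk
  | cons h t ih =>
    rw [revProd_cons]
    by_cases hkh : k = h
    · subst hkh; rw [mul_assoc, hε.sq, mul_zero]
    · rw [mul_assoc, (hε.par h).comm (hε.par k), mul_smul_comm, ← mul_assoc,
        ih ((List.mem_cons.mp hk).resolve_left hkh), zero_mul, smul_zero]

/-- Two equal parameters can be brought together up to sign, and then their square vanishes. Hence
only words without repetition contribute to the polarization. -/
theorem IsNilSystem.revProd_eq_zero {l : List (Fin n)} (hl : ¬l.Nodup) : revProd ε l = 0 := by
  induction l with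
  | nil => simp at hl
  | cons h t ih =>
    rw [revProd_cons]
    by_cases hh : h ∈ t
    · exact hε.revProd_mul_of_mem hh
    · rw [ih fun ht => hl (List.nodup_cons.mpr ⟨hh, ht⟩), zero_mul]

/-- The parameters have the shifted parity d i - 1 precisely so that these products are odd, as
`derived_jacobi` requires. -/
theorem IsNilSystem.odd_mul {a : Fin n → T} (ha : ∀ i, H.Par (d i) (a i)) (i : Fin n) :
    H.γ (ε i * a i) = -(ε i * a i) := by
  have := (hε.par i).mul (ha i)
  rw [Par, Odd.neg_one_zpow ⟨d i - 1, by ring⟩, neg_one_smul] at this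
  exact this

theorem IsNilSystem.p_mul {a : Fin n → T} (ha : ∀ i, H.p (a i) = a i) (i : Fin n) :
    H.p (ε i * a i) = ε i * a i := by rw [map_mul, (hε.const i).p, ha]

variable [Fintype m] [Fintype r]

omit hε in
theorem IsConst.K_mul {x : T} (hx : H.IsConst x) (a y : T) : H.K (x * a) y = x * H.K a y := by
  have h1 : ∀ A, H.i A (H.γ x) = 0 := fun A => by rw [H.i_γ, hx.i, map_zero, neg_zero]
  simp only [K_apply, map_mul, H.i_mul, H.d_mul, h1, hx.d, zero_mul, zero_add, H.γ_γ, mul_assoc,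
    ← Finset.mul_sum, mul_neg, mul_add]

/-- Each letter acts as an even derivation that annihilates parameters, so its own parameter comes
out to the right of those of the later letters. This explains the reversed product. -/
theorem IsNilSystem.word_mul {ϖ : T} {a : Fin n → T} (ha : ∀ i, H.Par (d i) (a i))
    (l : List (Fin n)) :
    H.word (l.map fun i => ε i * a i) ϖ = revProd ε l * H.word (l.map a) ϖ := by
  induction l with
  | nil => simp
  | cons k l ih =>
    rw [List.map_cons, word_cons, ih, H.K_odd_mul (hε.odd_mul ha k),
      H.K_of_mem _ (hε.isConst_revProd l).p, zero_mul, zero_add, (hε.const k).K_mul, revProd_cons,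
      List.map_cons, word_cons, mul_assoc]

omit hε in
theorem par_word_map {ϖ : T} (hϖ : H.γ ϖ = ϖ) {a : Fin n → T} (ha : ∀ i, H.Par (d i) (a i))
    (l : List (Fin n)) : H.Par (l.map fun k => d k - 1).sum (H.word (l.map a) ϖ) := by
  induction l with
  | nil => exact par_of_even (by simp) hϖ
  | cons k l ih =>
    rw [List.map_cons, List.sum_cons, List.map_cons, word_cons]
    exact (ha k).K ih

/-- Let D and D' be the total shifted parities of `l` and `l'`. Moving the outer operator past the
parameters of `l'` costs (D - 1)D', and reordering the two products of parameters costs D D'. The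
sum is D' modulo two. -/
theorem IsNilSystem.nested_word {ϖ : T} (hϖ : H.γ ϖ = ϖ) {a : Fin n → T}
    (ha : ∀ i, H.Par (d i) (a i)) (l l' : List (Fin n)) :
    H.p (H.K (H.p (H.word (l.map fun i => ε i * a i) ϖ)) (H.word (l'.map fun i => ε i * a i) ϖ)) =
      (-1 : ℝ) ^ (l'.map fun k => d k - 1).sum • (revProd ε (l ++ l') *
        H.p (H.K (H.p (H.word (l.map a) ϖ)) (H.word (l'.map a) ϖ))) := by
  rw [hε.word_mul ha, hε.word_mul ha, map_mul H.p (revProd ε l), (hε.isConst_revProd l).p,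
    (hε.isConst_revProd l).K_mul, (par_word_map hϖ ha l).p.K_mul_left (hε.par_revProd l')
    (hε.isConst_revProd l').p, mul_smul_comm, ← mul_assoc,
    (hε.par_revProd l).comm (hε.par_revProd l'), smul_mul_assoc, smul_smul, neg_one_zpow_mul,
    ← revProd_append, map_smul, map_mul, (hε.isConst_revProd _).p]
  congr 1
  exact neg_one_zpow_congr ⟨(l.map fun k => d k - 1).sum * (l'.map fun k => d k - 1).sum -
    (l'.map fun k => d k - 1).sum, by ring⟩

end

theorem sum_pi_split {M X : Type*} [AddCommMonoid M] [Fintype X] {n : ℕ} (q : Fin (n + 1))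
    (f : (Fin q → X) → (Fin (n - q) → X) → M) :
    ∑ w₁, ∑ w₂, f w₁ w₂ = ∑ w : Fin n → X,
      f (fun i => w ⟨i, by omega⟩) (fun i => w ⟨q + i, by omega⟩) := by
  let e : Fin q ⊕ Fin (n - q) ≃ Fin n := finSumFinEquiv.trans (finCongr (by omega))
  rw [← Fintype.sum_prod_type']
  refine (Fintype.sum_equiv ((Equiv.arrowCongr e.symm (Equiv.refl X)).trans
    (Equiv.sumArrowEquivProdArrow _ _ _)) _ _ fun w => ?_).symm
  congr 1

theorem ofFn_append_split {X : Type*} {n : ℕ} (q : Fin (n + 1)) (w : Fin n → X) :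
    (List.ofFn fun i : Fin q => w ⟨i, by omega⟩) ++
      (List.ofFn fun i : Fin (n - q) => w ⟨q + i, by omega⟩) = List.ofFn w := by
  refine List.ext_getElem (by simp; omega) fun k h1 h2 => ?_
  by_cases hk : k < q
  · rw [List.getElem_append_left (by simpa using hk)]; simp
  · rw [List.getElem_append_right (by simpa using hk)]
    simp only [List.length_ofFn, List.getElem_ofFn]
    congr 1
    simp only [Fin.mk.injEq]
    omega

variable [Fintype m] [Fintype r]

theorem K_pow_sum {n : ℕ} (b : Fin n → T) (ϖ : T) (q : ℕ) :
    (H.K (∑ i, b i) ^ q) ϖ = ∑ w : Fin q → Fin n, H.word ((List.ofFn w).map b) ϖ := by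
  have h := (MultilinearMap.mkPiAlgebraFin ℝ q (Module.End ℝ T)).map_sum
    (fun (_ : Fin q) (j : Fin n) => H.K (b j))
  rw [MultilinearMap.mkPiAlgebraFin_apply_const] at h
  rw [map_sum, h, LinearMap.sum_apply]
  refine Finset.sum_congr rfl fun w _ => ?_
  rw [MultilinearMap.mkPiAlgebraFin_apply, word, List.map_map, List.map_ofFn]
  rfl

theorem sum_perm_of_not_injective {M : Type*} [AddCommMonoid M] {n : ℕ}
    (f : (Fin n → Fin n) → M) (hf : ∀ w, ¬Function.Injective w → f w = 0) :
    ∑ w, f w = ∑ σ : Equiv.Perm (Fin n), f σ := by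
  symm
  refine Finset.sum_of_injOn (fun σ => (σ : Fin n → Fin n))
    (fun _ _ _ _ h => Equiv.coe_fn_injective h) (by simp) (fun w _ hw => hf w fun hinj => hw ?_)
    (fun _ _ => rfl)
  exact ⟨Equiv.ofBijective w ((Fintype.bijective_iff_injective_and_card w).2 ⟨hinj, rfl⟩),
    by simp, rfl⟩

variable (H) in
/-- The sum of the nested unsigned derived brackets. -/
noncomputable def nestedSum (ϖ : T) {n : ℕ} (d : Fin n → ℤ) (a : Fin n → T) : T :=
  ∑ q : Fin (n + 1), (((q : ℕ).factorial : ℝ) * ((n - q).factorial : ℝ))⁻¹ •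
    ((-1 : ℝ) ^ (∑ i : Fin (n - q), (d ⟨q + i, by omega⟩ - 1)) •
      H.p (H.K (H.p (H.word (List.ofFn fun i : Fin q => a ⟨i, by omega⟩) ϖ))
        (H.word (List.ofFn fun i : Fin (n - q) => a ⟨q + i, by omega⟩) ϖ)))

/-- Apply `derived_jacobi` to the one odd element Σ ε i a i and expand both powers into words.
Concatenated words with a repeated index vanish, the others are permutations, and the binomial
coefficient divided by n! is 1/(q!(n-q)!). -/
theorem sum_perm_derivedBracket {ϖ : T} (hϖ : H.γ ϖ = ϖ) (h0 : H.schouten ϖ ϖ = 0) {n : ℕ}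
    {d : Fin n → ℤ} {ε a : Fin n → T} (hε : H.IsNilSystem d ε) (hp : ∀ i, H.p (a i) = a i)
    (ha : ∀ i, H.Par (d i) (a i)) :
    ∑ σ : Equiv.Perm (Fin n), revProd ε (List.ofFn σ) *
      H.nestedSum ϖ (d ∘ σ) (a ∘ σ) = 0 := by
  have hodd : H.γ (∑ i, ε i * a i) = -(∑ i, ε i * a i) := by
    rw [map_sum, ← Finset.sum_neg_distrib]
    exact Finset.sum_congr rfl fun i _ => hε.odd_mul ha i
  have hmem : H.p (∑ i, ε i * a i) = ∑ i, ε i * a i := by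
    rw [map_sum]
    exact Finset.sum_congr rfl fun i _ => hε.p_mul hp i
  have h := H.derived_jacobi hodd hmem hϖ h0 n
  rw [Finset.Nat.sum_antidiagonal_eq_sum_range_succ
    (fun i j => n.choose i • H.p (H.K (H.p ((H.K (∑ i, ε i * a i) ^ i) ϖ))
      ((H.K (∑ i, ε i * a i) ^ j) ϖ))), Finset.sum_range] at h
  have h2 := congrArg (fun x => ((n.factorial : ℝ))⁻¹ • x) h
  simp only [smul_zero, Finset.smul_sum] at h2
  rw [← h2]
  simp only [nestedSum, Finset.mul_sum]
  rw [Finset.sum_comm]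
  refine Finset.sum_congr rfl fun q _ => ?_
  rw [K_pow_sum, K_pow_sum]
  simp only [map_sum, LinearMap.sum_apply]
  rw [Finset.sum_comm, sum_pi_split q (fun w₁ w₂ => H.p (H.K (H.p (H.word ((List.ofFn w₁).map fun i => ε i * a i) ϖ))
    (H.word ((List.ofFn w₂).map fun i => ε i * a i) ϖ)))]
  rw [← Nat.cast_smul_eq_nsmul ℝ, smul_smul, sum_perm_of_not_injective, Finset.smul_sum]
  · refine Finset.sum_congr rfl fun σ _ => ?_
    rw [hε.nested_word hϖ ha, ofFn_append_split q σ, mul_smul_comm, mul_smul_comm]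
    simp only [List.map_ofFn, Function.comp_def, List.sum_ofFn]
    congr 1
    rw [Nat.cast_choose ℝ (Nat.lt_succ_iff.1 q.2)]
    have := Nat.factorial_ne_zero n
    field_simp
  · intro w hw
    rw [hε.nested_word hϖ ha, ofFn_append_split q w, hε.revProd_eq_zero, zero_mul, smul_zero]
    rwa [List.nodup_ofFn]

theorem sum_fin_split {M : Type*} [AddCommMonoid M] {n : ℕ} (q : Fin (n + 1)) (f : Fin n → M) :
    ∑ i, f i = ∑ i : Fin q, f ⟨i, by omega⟩ + ∑ i : Fin (n - q), f ⟨q + i, by omega⟩ := by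
  let e : Fin q ⊕ Fin (n - q) ≃ Fin n := finSumFinEquiv.trans (finCongr (by omega))
  rw [← Equiv.sum_comp e, Fintype.sum_sum_type]
  rfl

/-- The inner bracket enters the outer one as an argument of parity Σ (d i - 1) with weight n - q +
1. Combined with (-1)^{q(n-q)} and the weights of the remaining arguments, the sign depends on q
only through the factor in `nestedSum`. -/
theorem jacobiSum_lam {ϖ : T} (hϖ : H.γ ϖ = ϖ) {n : ℕ} {d : Fin n → ℤ} {a : Fin n → T}
    (ha : ∀ i, H.Par (d i) (a i)) :
    jacobiSum (H.lam ϖ) a = (-1 : ℝ) ^ (n + ∑ i : Fin n, ((n : ℤ) - 1 - i) * d i) •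
      H.nestedSum ϖ d a := by
  rw [jacobiSum, nestedSum, Finset.smul_sum]
  refine Finset.sum_congr rfl fun q _ => ?_
  have hpar := (par_word hϖ (a := fun i : Fin q => a ⟨i, by omega⟩)
    (d := fun i : Fin q => d ⟨i, by omega⟩) fun i => ha _).p
  rw [lam_apply ϖ (a := fun i : Fin q => a ⟨i, by omega⟩)
    (d := fun i : Fin q => d ⟨i, by omega⟩) fun i => ha _, ← neg_smul, MultilinearMap.cons_smul,
    derivedBracket_apply, lam_apply ϖ (d := Fin.cons (∑ i : Fin q, (d ⟨i, by omega⟩ - 1))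
      (fun i : Fin (n - q) => d ⟨q + i, by omega⟩)) (by
      intro i
      refine Fin.cases ?_ (fun i => ?_) i
      · exact hpar
      · exact ha _), derivedBracket_apply, List.ofFn_succ, word_cons]
  simp only [Fin.cons_zero, Fin.cons_succ]
  simp only [smul_neg, smul_smul]
  rw [← neg_smul]
  congr 1
  have hq : ((n - (q : ℕ) : ℕ) : ℤ) = (n : ℤ) - q := Nat.cast_sub (by omega)
  have e1 : (-1 : ℝ) ^ ((q : ℕ) * (n - q)) = (-1 : ℝ) ^ ((q : ℤ) * (n - q)) := by
    rw [← zpow_natCast]; push_cast; rw [hq]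
  rw [e1, Fin.sum_univ_succ, div_eq_mul_inv, sum_fin_split q fun i : Fin n =>
    ((n : ℤ) - 1 - i) * d i]
  simp only [neg_mul, mul_neg, neg_neg]
  rw [mul_right_comm, mul_left_comm, mul_comm]
  refine Eq.trans ?_ (mul_left_comm _ _ _)
  congr 1
  simp only [neg_one_zpow_mul]
  refine neg_one_zpow_congr ?_
  simp only [Fin.cons_zero, Fin.cons_succ, Fin.val_succ, Fin.val_zero]
  push_cast
  rw [hq]
  simp only [Finset.sum_sub_distrib, sub_mul, add_mul, Finset.sum_add_distrib, one_mul,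
    Finset.sum_const, Finset.card_univ, Fintype.card_fin, nsmul_eq_mul, mul_one, ← Finset.mul_sum,
    hq]
  refine ⟨(∑ i : Fin q, d ⟨i, by omega⟩) - q, ?_⟩
  ring

/-- The parameters in the order `σ`, weighted by the sign from `jacobiSum_lam`, transform under
adjacent transpositions as sign times Koszul sign. So `eq_sign_koszulSign_smul` extracts one common
product of parameters from the polarized identity, and the graded alternating sum is left. -/
theorem jacobi_lam {ϖ : T} (hϖ : H.γ ϖ = ϖ) (h0 : H.schouten ϖ ϖ = 0) {n : ℕ}
    {d : Fin n → ℤ} {ε a : Fin n → T} (hε : H.IsNilSystem d ε) (hp : ∀ i, H.p (a i) = a i)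
    (ha : ∀ i, H.Par (d i) (a i)) :
    revProd ε (List.ofFn id) * ∑ σ : Equiv.Perm (Fin n),
      (((Equiv.Perm.sign σ : ℤ) : ℝ) * koszulSign d σ) • jacobiSum (H.lam ϖ) (a ∘ σ) = 0 := by
  have hF := eq_sign_koszulSign_smul d (fun σ : Equiv.Perm (Fin n) =>
    (-1 : ℝ) ^ (∑ i : Fin n, ((n : ℤ) - 1 - i) * d (σ i)) • revProd ε (List.ofFn σ)) (by
    intro σ i j hij
    have hs := sum_comp_swap ((n : ℤ) - 1) (d ∘ σ) hij
    obtain ⟨l₁, l₂, h1, h2⟩ := ofFn_comp_swap (σ : Fin n → Fin n) hij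
    simp only [Function.comp_apply] at hs
    have h3 : revProd ε (List.ofFn (σ * Equiv.swap i j)) =
        (-1 : ℝ) ^ ((d (σ i) - 1) * (d (σ j) - 1)) • revProd ε (List.ofFn σ) := by
      rw [Equiv.Perm.coe_mul, h1, h2, revProd_append, revProd_append, revProd_cons, revProd_cons,
        revProd_cons, revProd_cons, mul_assoc _ (ε (σ i)), (hε.par (σ i)).comm (hε.par (σ j)),
        mul_smul_comm, smul_mul_assoc, ← mul_assoc]
    rw [h3]
    simp only [Equiv.Perm.coe_mul, Function.comp_apply, hs, smul_smul, neg_one_zpow_mul]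
    rw [← neg_smul, neg_neg_one_zpow]
    congr 1
    exact neg_one_zpow_congr ⟨- d (σ i), by ring⟩)
  have h := sum_perm_derivedBracket hϖ h0 hε hp ha
  have key : ∀ σ : Equiv.Perm (Fin n),
      revProd ε (List.ofFn σ) * H.nestedSum ϖ (d ∘ σ) (a ∘ σ) =
      (-1 : ℝ) ^ (n + ∑ i : Fin n, ((n : ℤ) - 1 - i) * d i) • (revProd ε (List.ofFn id) *
        (((Equiv.Perm.sign σ : ℤ) : ℝ) * koszulSign d σ) • jacobiSum (H.lam ϖ) (a ∘ σ)) := by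
    intro σ
    have h1 := congrArg (fun x => (-1 : ℝ) ^ (n : ℤ) • (x * jacobiSum (H.lam ϖ) (a ∘ σ))) (hF σ)
    simp only [smul_mul_assoc] at h1
    rw [smul_smul, neg_one_zpow_mul, jacobiSum_lam hϖ (a := a ∘ σ) (d := d ∘ σ) fun i => ha _,
      mul_smul_comm, smul_smul] at h1
    simp only [Function.comp_apply] at h1
    rw [neg_one_zpow_mul_self, one_smul] at h1
    rw [h1, jacobiSum_lam hϖ (a := a ∘ σ) (d := d ∘ σ) fun i => ha _]
    simp only [mul_smul_comm, smul_smul, Equiv.Perm.coe_one, Function.comp_apply, id]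
    congr 1
    rw [zpow_add₀ (by norm_num) (n : ℤ) (∑ i : Fin n, ((n : ℤ) - 1 - i) * d i)]
    generalize (-1 : ℝ) ^ (∑ i : Fin n, ((n : ℤ) - 1 - i) * d i) = A
    generalize (-1 : ℝ) ^ ((n : ℤ) + ∑ i : Fin n, ((n : ℤ) - 1 - i) * d (σ i)) = B
    ring
  simp only [key, ← Finset.smul_sum, ← Finset.mul_sum] at h
  exact (smul_eq_zero.mp h).resolve_left (zpow_ne_zero _ (by norm_num))

end PhaseAlgebra
end PInfty

/-! ### Degrees, and values of the brackets on functions and vector fields -/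

namespace PInfty

theorem two_mul_sum_sub (k : ℕ) (c : ℤ) :
    2 * ∑ i : Fin k, (c - i) = 2 * k * c - k * (k - 1) := by
  induction k with
  | zero => simp
  | succ k ih =>
    rw [Fin.sum_univ_castSucc, mul_add]
    simp only [Fin.val_castSucc, Fin.val_last]
    rw [ih]
    push_cast
    ring

theorem neg_one_zpow_eq_bracketSign {n : ℕ} {s : ℤ} (t : ℤ)
    (h : 2 * s = ((n : ℤ) - 1) * (n - 2) + 4 * t) : (-1 : ℝ) ^ s = Coiso.bracketSign n := by
  refine neg_one_zpow_congr ⟨t, ?_⟩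
  have : ((n : ℤ) - 1) * (n - 2) = (s - 2 * t) * 2 := by linarith
  rw [this, Int.mul_ediv_cancel _ two_ne_zero]
  ring

theorem neg_neg_one_zpow_eq_bracketSign {n : ℕ} {s : ℤ} (t : ℤ)
    (h : 2 * s = ((n : ℤ) - 1) * (n - 2) + 4 * t + 2) : -(-1 : ℝ) ^ s = Coiso.bracketSign n := by
  rw [neg_neg_one_zpow]
  exact neg_one_zpow_eq_bracketSign (t + 1) (by linarith)

namespace PhaseAlgebra

variable {T : Type*} [Ring T] [Algebra ℝ T] {m r : Type*} [DecidableEq m]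
    [DecidableEq r] {H : PhaseAlgebra T m r} [Fintype m] [Fintype r]

/-! ### The Euler operator -/

variable (H) in
/-- The derivation counting the number of vector fields. -/
noncomputable def euler : T →ₗ[ℝ] T := ∑ A, LinearMap.mulLeft ℝ (H.e A) ∘ₗ H.i A

theorem euler_apply (x : T) : H.euler x = ∑ A, H.e A * H.i A x := by
  simp [euler]

theorem euler_mul (x y : T) : H.euler (x * y) = H.euler x * y + x * H.euler y := by
  have : ∀ A, H.e A * H.i A (x * y) = H.e A * H.i A x * y + x * (H.e A * H.i A y) := fun A => by
    rw [H.i_mul, mul_add, ← mul_assoc, ← mul_assoc, H.comm_odd _ (H.γ x) (H.γ_e A), H.γ_γ,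
      mul_assoc x]
  simp only [euler_apply, this, Finset.sum_add_distrib, Finset.sum_mul, Finset.mul_sum]

theorem euler_i (B : m ⊕ r) (x : T) : H.euler (H.i B x) = H.i B (H.euler x) - H.i B x := by
  have : ∀ A, H.i B (H.e A * H.i A x) =
      (if B = A then H.i A x else 0) + H.e A * H.i A (H.i B x) := fun A => by
    rw [H.i_mul, H.i_e, H.γ_e, H.i_comm B A, ite_mul, one_mul, zero_mul, neg_mul, mul_neg, neg_neg]
  rw [euler_apply, euler_apply, map_sum, Finset.sum_congr rfl fun A _ => this A,
    Finset.sum_add_distrib, Finset.sum_ite_eq, if_pos (Finset.mem_univ _), add_sub_cancel_left]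

theorem euler_d (B : m ⊕ r) (x : T) : H.euler (H.d B x) = H.d B (H.euler x) := by
  simp [euler_apply, map_sum, H.d_mul, H.d_e, H.d_i]

theorem euler_γ (x : T) : H.euler (H.γ x) = H.γ (H.euler x) := by
  simp only [euler_apply, map_sum, map_mul, H.i_γ, H.γ_e, mul_neg, neg_mul]

theorem euler_p (x : T) : H.euler (H.p x) = H.p (H.euler x) := by
  simp [euler_apply, map_sum, H.i_p, H.p_e_inl, H.p_e_inr, H.p_i]

/-- The Euler operator commutes with derivatives, and each contraction lowers its eigenvalue by one.
The Schouten bracket therefore has degree -1. -/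
theorem euler_K (a x : T) :
    H.euler (H.K a x) = H.K (H.euler a) x + H.K a (H.euler x) - H.K a x := by
  simp only [K_apply, map_neg, map_add, map_sum, euler_mul, euler_i, euler_d, ← euler_γ, sub_mul,
    mul_sub, Finset.sum_add_distrib, Finset.sum_sub_distrib]
  abel

variable (H) in
/-- `x` has degree `k`. -/
def Deg (k : ℤ) (x : T) : Prop := H.euler x = (k : ℝ) • x

theorem Deg.p {k : ℤ} {x : T} (h : H.Deg k x) : H.Deg k (H.p x) := by
  rw [Deg] at *; rw [euler_p, h, map_smul]

theorem Deg.smul {k : ℤ} {x : T} (h : H.Deg k x) (c : ℝ) : H.Deg k (c • x) := by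
  rw [Deg] at *; rw [map_smul, h, smul_comm]

theorem Deg.sum {k : ℤ} {ι : Type*} {s : Finset ι} {x : ι → T} (h : ∀ i ∈ s, H.Deg k (x i)) :
    H.Deg k (∑ i ∈ s, x i) := by
  rw [Deg, map_sum, Finset.smul_sum]; exact Finset.sum_congr rfl h

theorem Deg.sub {k : ℤ} {x y : T} (h : H.Deg k x) (h' : H.Deg k y) : H.Deg k (x - y) := by
  rw [Deg] at *; rw [map_sub, h, h', smul_sub]

theorem Deg.mul {k n : ℤ} {x y : T} (h : H.Deg k x) (h' : H.Deg n y) : H.Deg (k + n) (x * y) := by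
  rw [Deg] at *
  rw [euler_mul, h, h', smul_mul_assoc, mul_smul_comm, ← add_smul, Int.cast_add]

theorem deg_e (A : m ⊕ r) : H.Deg 1 (H.e A) := by
  simp [Deg, euler_apply, H.i_e]

theorem Deg.i {k : ℤ} {x : T} (h : H.Deg k x) (A : m ⊕ r) : H.Deg (k - 1) (H.i A x) := by
  rw [Deg] at *
  rw [euler_i, h, map_smul, Int.cast_sub, sub_smul, Int.cast_one, one_smul]

theorem Deg.K {k n : ℤ} {a x : T} (h : H.Deg k a) (h' : H.Deg n x) :
    H.Deg (k - 1 + n) (H.K a x) := by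
  rw [Deg] at *
  rw [euler_K, h, h', map_smul, map_smul, LinearMap.smul_apply, Int.cast_add, Int.cast_sub,
    Int.cast_one, add_smul, sub_smul, one_smul]
  abel

theorem Deg.word {ϖ : T} (hϖ : H.Deg 2 ϖ) {n : ℕ} {d : Fin n → ℤ} {a : Fin n → T}
    (ha : ∀ i, H.Deg (d i) (a i)) : H.Deg (2 - n + ∑ i, d i) (H.word (List.ofFn a) ϖ) := by
  induction n with
  | zero => simpa using hϖ
  | succ n ih =>
    rw [List.ofFn_succ, word_cons, Fin.sum_univ_succ]
    have := (ha 0).K (ih fun i => ha i.succ)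
    convert this using 1
    push_cast
    ring

theorem Deg.lam {ϖ : T} (hϖ : H.Deg 2 ϖ) {n : ℕ} {d : Fin n → ℤ} {a : Fin n → T}
    (ha : ∀ i, H.Deg (d i) (a i)) (hp : ∀ i, H.Par (d i) (a i)) :
    H.Deg (2 - n + ∑ i, d i) (H.lam ϖ n a) := by
  rw [lam_apply ϖ hp, derivedBracket_apply, ← neg_smul]
  exact (Deg.word hϖ ha).p.smul _

/-- Euler's formula recovers k x from the contractions of x, and on the range of `p` only fibre
contractions can be nonzero. -/
theorem Deg.eq_zero {k : ℤ} (hk : k ≠ 0) {x : T} (h : H.Deg k x) (hp : H.p x = x)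
    (hi : ∀ j, H.i (Sum.inr j) x = 0) : x = 0 := by
  rw [Deg, euler_apply] at h
  simp only [Fintype.sum_sum_type, H.i_inl_of_mem hp, hi, mul_zero, Finset.sum_const_zero,
    add_zero] at h
  exact (smul_eq_zero.mp h.symm).resolve_left (by exact_mod_cast hk)

/-! ### Functions and vector fields -/

variable (H) in
/-- Functions. -/
structure IsFn (f : T) : Prop where
  γ : H.γ f = f
  i : ∀ A, H.i A f = 0

variable (H) in
/-- Vertical vector fields constant along the fibres. -/
structure IsVec (v : T) : Prop where
  γ : H.γ v = -v
  p : H.p v = v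
  i : ∀ A B, H.i A (H.i B v) = 0

theorem IsFn.par {f : T} (hf : H.IsFn f) : H.Par 0 f := par_of_even (by simp) hf.γ

theorem IsVec.par {v : T} (hv : H.IsVec v) : H.Par 1 v := par_of_odd (by simp) hv.γ

theorem IsFn.d {f : T} (hf : H.IsFn f) (A : m ⊕ r) : H.IsFn (H.d A f) :=
  ⟨H.γ_d_even hf.γ A, fun B => by rw [← H.d_i, hf.i, map_zero]⟩

theorem IsFn.comm {f : T} (hf : H.IsFn f) (x : T) : f * x = x * f := H.comm_even _ _ hf.γ

variable (H) in
/-- Contraction with the differential of a function. -/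
noncomputable def grad (f : T) : T →ₗ[ℝ] T := ∑ A, LinearMap.mulLeft ℝ (H.d A f) ∘ₗ H.i A

theorem grad_apply (f x : T) : H.grad f x = ∑ A, H.d A f * H.i A x := by
  simp [grad]

theorem grad_of_isFn (f : T) {g : T} (hg : H.IsFn g) : H.grad f g = 0 := by
  simp [grad_apply, hg.i]

theorem i_grad {f : T} (hf : H.IsFn f) (A : m ⊕ r) (x : T) :
    H.i A (H.grad f x) = -H.grad f (H.i A x) := by
  simp only [grad_apply, map_sum, H.i_mul, (hf.d _).i, (hf.d _).γ, zero_mul, zero_add,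
    ← Finset.sum_neg_distrib]
  refine Finset.sum_congr rfl fun B _ => ?_
  rw [H.i_comm A B, mul_neg]

theorem grad_mul_left (f : T) {g : T} (hg : H.IsFn g) (x : T) :
    H.grad f (g * x) = g * H.grad f x := by
  simp only [grad_apply, H.i_mul, hg.i, hg.γ, zero_mul, zero_add, Finset.mul_sum]
  refine Finset.sum_congr rfl fun B _ => ?_
  rw [← mul_assoc, ← mul_assoc, hg.comm]

theorem grad_anticomm {f g : T} (hf : H.IsFn f) (hg : H.IsFn g) (x : T) :
    H.grad f (H.grad g x) = -H.grad g (H.grad f x) := by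
  rw [grad_apply g, grad_apply g, map_sum, ← Finset.sum_neg_distrib]
  refine Finset.sum_congr rfl fun B _ => ?_
  rw [grad_mul_left f (hg.d B), i_grad hf, mul_neg, neg_neg]

/-- For a function pulled back from the base, the fibre part of `K` drops out. Function arguments of
a derived bracket thereby become contractions with their differentials. -/
theorem K_eq_grad {f : T} (hf : H.IsFn f) (hp : H.p f = f) (x : T) : H.K f x = -H.grad f x := by
  rw [K_apply, grad_apply, Fintype.sum_sum_type]
  simp [hf.γ, hf.i, H.d_inr_of_mem hp]

theorem K_vec_apply_isFn {v f : T} (hv : H.IsVec v) (hf : H.IsFn f) :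
    H.K v f = ∑ j, H.i (Sum.inr j) v * H.d (Sum.inr j) f := by
  rw [K_odd_apply H hv.γ]
  simp [hf.i]

theorem K_vec_isFn {v f : T} (hv : H.IsVec v) (hf : H.IsFn f) : H.IsFn (H.K v f) := by
  refine ⟨H.γ_K_odd hv.γ hf.γ, fun A => ?_⟩
  rw [K_vec_apply_isFn hv hf, map_sum]
  exact Finset.sum_eq_zero fun j _ => by rw [H.i_mul, hv.i, (hf.d _).i, zero_mul, mul_zero, add_zero]

/-- Cartan's formula: the Lie derivative along `v` of the contraction with df is the contraction
with d(vf) plus the contraction of the Lie derivative. The terms that differentiate the components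
of `v` cancel by `h4`. -/
theorem K_grad {v f : T} (hv : H.IsVec v) (hf : H.IsFn f) (x : T) :
    H.K v (H.grad f x) = H.grad (H.K v f) x + H.grad f (H.K v x) := by
  have h1 : ∀ μ, H.K (H.d (Sum.inl μ) v) f =
      ∑ j, H.d (Sum.inr j) f * H.d (Sum.inl μ) (H.i (Sum.inr j) v) := fun μ => by
    rw [K_odd_apply H (H.γ_d_odd hv.γ _)]
    simp only [hf.i, mul_zero, Finset.sum_const_zero, sub_zero, ← H.d_i]
    exact Finset.sum_congr rfl fun j _ => ((hf.d _).comm _).symm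
  have h2 : ∀ j, H.K (H.i (Sum.inr j) v) x =
      -∑ μ, H.d (Sum.inl μ) (H.i (Sum.inr j) v) * H.i (Sum.inl μ) x := fun j => by
    rw [K_apply, H.γ_i_odd hv.γ]
    simp only [hv.i, zero_mul, Finset.sum_const_zero, zero_add]
  have h3 : ∀ μ, H.i (Sum.inl μ) (H.K v x) = H.K v (H.i (Sum.inl μ) x) := fun μ => by
    rw [H.i_inl_K hv.p, hv.γ, map_neg, LinearMap.neg_apply, neg_neg]
  have h4 : ∑ μ, H.K (H.d (Sum.inl μ) v) f * H.i (Sum.inl μ) x =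
      -∑ j, H.d (Sum.inr j) f * H.K (H.i (Sum.inr j) v) x := by
    simp only [h1, h2, Finset.sum_mul, Finset.mul_sum, mul_neg, Finset.sum_neg_distrib, neg_neg,
      mul_assoc]
    exact Finset.sum_comm
  simp only [grad_apply, Fintype.sum_sum_type, map_add, map_sum, H.K_odd_mul hv.γ, H.d_inl_K,
    H.d_inr_K hv.p, h3, H.i_inr_K_odd hv.γ, add_mul, mul_add, Finset.sum_add_distrib, h4]
  abel

/-! ### Values on functions and vector fields -/

theorem word_comm {l : List T} (hl : ∀ v ∈ l, H.IsVec v) {b : T} (hb : H.p b = b) (x : T) :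
    H.word l (H.K b x) = H.K b (H.word l x) := by
  induction l with
  | nil => rfl
  | cons v l ih =>
    have hv := hl v (by simp)
    rw [word_cons, word_cons, ih fun w hw => hl w (by simp [hw]), H.K_comm_odd hv.p hb hv.γ]

section

variable {ϖ : T} {k : ℕ} {v : Fin k → T} (hv : ∀ i, H.IsVec (v i))

include hv

theorem lam_two_functions {f g : T} (hf : H.IsFn f) (hg : H.IsFn g) (hpf : H.p f = f)
    (hpg : H.p g = g) :
    H.lam ϖ (k + 2) (Fin.snoc (Fin.snoc v f : Fin (k + 1) → T) g) =
      Coiso.bracketSign (k + 2) • H.p (H.grad g (H.grad f (H.word (List.ofFn v) ϖ))) := by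
  have hl : ∀ w ∈ List.ofFn v, H.IsVec w := by simpa [List.forall_mem_ofFn_iff] using hv
  rw [lam_snoc (d := Fin.snoc (fun _ => 1) 0) (by
    intro i
    refine Fin.lastCases ?_ (fun i => ?_) i
    · simpa using hf.par
    · simpa using (hv i).par), hg.γ, List.ofFn_succ', List.concat_eq_append, word_append]
  simp only [Fin.snoc_castSucc, Fin.snoc_last, word_cons, word_nil]
  rw [word_comm hl hpf, word_comm hl hpg, K_eq_grad hf hpf, K_eq_grad hg hpg, map_neg,
    map_neg, map_neg, neg_neg, grad_anticomm hf hg, map_neg, smul_neg, neg_neg]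
  congr 1
  have := two_mul_sum_sub k (k + 2)
  -- The vector fields have weights k + 2, …, 3, whose sum is k(k + 1)/2 + 2k; functions have degree
  -- zero and contribute nothing.
  refine neg_one_zpow_eq_bracketSign k ?_
  rw [Fin.sum_univ_castSucc]
  simp only [Fin.snoc_castSucc, Fin.snoc_last, mul_zero, add_zero, mul_one, Fin.val_castSucc]
  push_cast
  simp only [add_assoc, one_add_one_eq_two]
  rw [this]
  ring

theorem lam_one_function {f : T} (hf : H.IsFn f) (hpf : H.p f = f) :
    H.lam ϖ (k + 1) (Fin.snoc v f) =
      Coiso.bracketSign (k + 1) • H.p (H.grad f (H.word (List.ofFn v) ϖ)) := by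
  have hl : ∀ w ∈ List.ofFn v, H.IsVec w := by simpa [List.forall_mem_ofFn_iff] using hv
  rw [lam_snoc (d := fun _ => 1) fun i => (hv i).par, hf.γ, word_comm hl hpf, K_eq_grad hf hpf,
    map_neg, smul_neg, neg_neg]
  congr 1
  have := two_mul_sum_sub k (k + 1)
  refine neg_one_zpow_eq_bracketSign k ?_
  simp only [mul_one]
  rw [this]
  push_cast
  ring

theorem lam_no_function :
    H.lam ϖ k v = Coiso.bracketSign k • H.p (H.word (List.ofFn v) ϖ) := by
  rw [lam_apply ϖ (d := fun _ => 1) fun i => (hv i).par, derivedBracket_apply, ← neg_smul]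
  congr 1
  have := two_mul_sum_sub k k
  refine neg_neg_one_zpow_eq_bracketSign (k - 1) ?_
  simp only [mul_one]
  rw [this]
  ring

-- Two contractions already leave a function, and the contraction with a third differential kills
-- it.
omit hv in
theorem word_many_functions {x : T} {l : List T} (hl : ∀ f ∈ l, H.IsFn f ∧ H.p f = f)
    (hl3 : 3 ≤ l.length)
    (hx : ∀ f g : T, H.IsFn f → H.p f = f → H.IsFn g → H.p g = g →
      H.IsFn (H.grad f (H.grad g x))) : H.word l x = 0 := by
  induction l with
  | nil => simp at hl3
  | cons f l ih =>
    rw [word_cons]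
    have hl' : ∀ f ∈ l, H.IsFn f ∧ H.p f = f := fun g hg => hl g (by simp [hg])
    rcases Nat.lt_or_ge l.length 3 with h3 | h3
    · obtain ⟨g, h, rfl⟩ : ∃ g h, l = [g, h] := List.length_eq_two.mp (by simp at hl3; omega)
      obtain ⟨hf, hf'⟩ := hl f (by simp)
      obtain ⟨hg, hg'⟩ := hl' g (by simp)
      obtain ⟨hh, hh'⟩ := hl' h (by simp)
      rw [word_cons, word_cons, word_nil, K_eq_grad hh hh', K_eq_grad hg hg', map_neg, map_neg,
        map_neg, neg_neg, K_eq_grad hf hf', grad_of_isFn f (hx g h hg hg' hh hh'), neg_zero]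
    · rw [ih hl' h3, map_zero]

/-- The brackets of vector fields and at least three functions vanish. -/
theorem lam_many_functions {n : ℕ} {a : Fin n → T} {l : List T}
    (ha : List.ofFn a = List.ofFn v ++ l) (hl : ∀ f ∈ l, H.IsFn f ∧ H.p f = f)
    (hl3 : 3 ≤ l.length)
    (hϖ : ∀ f g : T, H.IsFn f → H.p f = f → H.IsFn g → H.p g = g →
      H.IsFn (H.grad f (H.grad g (H.word (List.ofFn v) ϖ)))) :
    H.lam ϖ n a = 0 := by
  have hv' : ∀ w ∈ List.ofFn v, H.IsVec w := by simpa [List.forall_mem_ofFn_iff] using hv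
  have hpar : ∀ i, ∃ d, H.Par d (a i) := fun i => by
    have : a i ∈ List.ofFn v ++ l := by rw [← ha, List.mem_ofFn]; exact ⟨i, rfl⟩
    rcases List.mem_append.mp this with h | h
    · exact ⟨1, (hv' _ h).par⟩
    · exact ⟨0, (hl _ h).1.par⟩
  choose d hd using hpar
  have hcomm : ∀ l : List T, (∀ f ∈ l, H.IsFn f ∧ H.p f = f) → ∀ x,
      H.word (List.ofFn v) (H.word l x) = H.word l (H.word (List.ofFn v) x) := by
    intro l hl x
    induction l with
    | nil => rfl
    | cons f l ih =>
      rw [word_cons, word_cons, word_comm hv' (hl f (by simp)).2,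
        ih fun g hg => hl g (by simp [hg])]
  rw [lam_apply ϖ hd, derivedBracket_apply, ha, word_append, hcomm l hl,
    word_many_functions hl hl3 hϖ, map_zero, smul_zero, neg_zero]

end

/-- Since `u` vanishes on the zero section, so do its base derivatives there. Only the vertical
derivatives, which form the conormal covector, survive the restriction. -/
theorem p_grad {u : T} (hu : H.p u = 0) (x : T) :
    H.p (H.grad u x) = ∑ j, H.p (H.d (Sum.inr j) u) * H.i (Sum.inr j) (H.p x) := by
  rw [grad_apply, Fintype.sum_sum_type, map_add, map_sum, map_sum]
  simp only [map_mul, H.p_d, hu, map_zero, zero_mul, Finset.sum_const_zero, zero_add, H.p_i]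

/-! ### Additional contractions -/

variable (H) in
/-- An odd derivation of `T` commuting with the operations. -/
structure IsContraction (c : T →ₗ[ℝ] T) : Prop where
  mul : ∀ x y, c (x * y) = c x * y + H.γ x * c y
  γ : ∀ x, c (H.γ x) = -H.γ (c x)
  i : ∀ A x, c (H.i A x) = -H.i A (c x)
  d : ∀ A x, c (H.d A x) = H.d A (c x)
  p : ∀ x, c (H.p x) = H.p (c x)

section

variable {c : T →ₗ[ℝ] T} (hc : H.IsContraction c)

include hc

theorem IsContraction.K {a x : T} (ha : c a = 0) (hx : c x = 0) : c (H.K a x) = 0 := by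
  simp [K_apply, hc.mul, hc.i, hc.γ, hc.d, ha, hx]

theorem IsContraction.word {ϖ : T} (hϖ : c ϖ = 0) {l : List T} (hl : ∀ a ∈ l, c a = 0) :
    c (H.word l ϖ) = 0 := by
  induction l with
  | nil => exact hϖ
  | cons a l ih =>
    rw [word_cons]
    exact hc.K (hl a (by simp)) (ih fun b hb => hl b (by simp [hb]))

theorem IsContraction.γ_pow {x : T} (hx : c x = 0) (k : ℕ) : c ((H.γ.toLinearMap ^ k) x) = 0 := by
  induction k with
  | zero => simpa using hx
  | succ k ih =>
    rw [pow_succ', Module.End.mul_apply, AlgHom.toLinearMap_apply, hc.γ, ih, map_zero, neg_zero]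

/-- Brackets are assembled from operations compatible with the contraction, so arguments free of a
parameter have brackets free of it. This is what later allows parameters to be cancelled. -/
theorem IsContraction.lam {ϖ : T} (hϖ : c ϖ = 0) {n : ℕ} {a : Fin n → T} (ha : ∀ i, c (a i) = 0) :
    c (H.lam ϖ n a) = 0 := by
  rw [PhaseAlgebra.lam, neg_apply, map_neg, MultilinearMap.compLinearMap_apply,
    derivedBracket_apply, hc.p, hc.word hϖ, map_zero, neg_zero]
  intro b hb
  obtain ⟨i, rfl⟩ := List.mem_ofFn.mp hb
  exact hc.γ_pow (ha i) _

theorem IsContraction.jacobiSum {ϖ : T} (hϖ : c ϖ = 0) {n : ℕ} {a : Fin n → T}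
    (ha : ∀ i, c (a i) = 0) : c (jacobiSum (H.lam ϖ) a) = 0 := by
  rw [PInfty.jacobiSum, map_sum]
  refine Finset.sum_eq_zero fun q _ => ?_
  rw [map_smul, hc.lam hϖ, smul_zero]
  intro i
  refine Fin.cases ?_ (fun i => ?_) i
  · exact hc.lam hϖ fun i => ha _
  · exact ha _

end

end PhaseAlgebra
end PInfty

/-! ## Hadamard's lemma -/

section Hadamard

variable {V : Type*} [NormedAddCommGroup V] [NormedSpace ℝ V]

-- The integral is the value at 0 of the convolution of the indicator of (0, 1] with s ↦ χ s · g (z,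
-- -s), so the smoothness theorem for convolutions with parameters applies. The cutoff χ supplies
-- the compact support required there and is one near [-1, 0], the only range that is sampled.
open MeasureTheory in
theorem contDiff_integral_param {g : V × ℝ → ℝ} (hg : ContDiff ℝ ∞ g) :
    ContDiff ℝ ∞ fun z => ∫ t in (0 : ℝ)..1, g (z, t) := by
  obtain ⟨χ, hχ1, hχ2, -⟩ := exists_contMDiffMap_one_nhds_of_subset_interior
    (I := 𝓘(ℝ, ℝ)) (n := ⊤) (s := Set.Icc (-1 : ℝ) 0) (t := Set.Icc (-2) 1) isClosed_Icc (by
      rw [interior_Icc]; intro x hx; exact ⟨by linarith [hx.1], by linarith [hx.2]⟩)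
  have hχ : ContDiff ℝ ∞ χ := contMDiff_iff_contDiff.1 χ.contMDiff
  have hf : LocallyIntegrable ((Set.Ioc (0 : ℝ) 1).indicator fun _ => (1 : ℝ)) volume :=
    ((integrableOn_const (by simp)).integrable_indicator measurableSet_Ioc).locallyIntegrable
  have h := contDiffOn_convolution_right_with_param_comp (n := ⊤) (μ := volume)
    (ContinuousLinearMap.mul ℝ ℝ) (s := (Set.univ : Set V)) (v := fun _ => (0 : ℝ))
    contDiffOn_const (f := (Set.Ioc (0 : ℝ) 1).indicator fun _ => (1 : ℝ))
    (g := fun z s => χ s * g (z, -s)) (k := Set.Icc (-2) 1) isOpen_univ isCompact_Icc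
    (fun p x _ hx => by simp only [hχ2 x hx, zero_mul]) hf
    (ContDiff.contDiffOn ((hχ.comp contDiff_snd).mul
      (hg.comp (contDiff_fst.prodMk contDiff_snd.neg))))
  rw [contDiffOn_univ] at h
  convert h using 2 with z
  rw [convolution_def, intervalIntegral.integral_of_le zero_le_one,
    ← integral_indicator measurableSet_Ioc]
  refine integral_congr_ae (Filter.Eventually.of_forall fun t => ?_)
  by_cases ht : t ∈ Set.Ioc (0 : ℝ) 1
  · have : χ (-t) = 1 := (hχ1.self_of_nhdsSet (-t) ⟨by linarith [ht.2], by linarith [ht.1]⟩)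
    simp [ht, this]
  · simp [ht]

/-- Hadamard's lemma. -/
theorem exists_contDiff_hadamard {K : V → ℝ} (hK : ContDiff ℝ ∞ K) (z₁ : V) {ι : Type*}
    [Fintype ι] (b : Module.Basis ι ℝ V) :
    ∃ G : ι → V → ℝ, (∀ A, ContDiff ℝ ∞ (G A)) ∧ (∀ A, G A z₁ = fderiv ℝ K z₁ (b A)) ∧
      ∀ z, K z = K z₁ + ∑ A, (b.repr z A - b.repr z₁ A) * G A z := by
  have hd : ContDiff ℝ ∞ (fderiv ℝ K) := hK.fderiv_right (by simp)
  have hcd : ∀ A, ContDiff ℝ ∞ fun q : V × ℝ => fderiv ℝ K (z₁ + q.2 • (q.1 - z₁)) (b A) :=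
    fun A => (hd.comp (contDiff_const.add (contDiff_snd.smul (contDiff_fst.sub
      contDiff_const)))).clm_apply contDiff_const
  refine ⟨fun A z => ∫ t in (0 : ℝ)..1, fderiv ℝ K (z₁ + t • (z - z₁)) (b A),
    fun A => contDiff_integral_param (hcd A), fun A => by simp, fun z => ?_⟩
  have hline : ∀ t : ℝ, HasDerivAt (fun t : ℝ => z₁ + t • (z - z₁)) (z - z₁) t := fun t => by
    simpa using ((hasDerivAt_id t).smul_const (z - z₁)).const_add z₁
  have hderiv : ∀ t : ℝ, HasDerivAt (fun t : ℝ => K (z₁ + t • (z - z₁)))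
      (fderiv ℝ K (z₁ + t • (z - z₁)) (z - z₁)) t := fun t =>
    ((hK.differentiable (by simp) _).hasFDerivAt).comp_hasDerivAt t (hline t)
  have hcont : ∀ v, Continuous fun t : ℝ => fderiv ℝ K (z₁ + t • (z - z₁)) v := fun v =>
    (hd.continuous.comp (by fun_prop)).clm_apply continuous_const
  have hint := intervalIntegral.integral_eq_sub_of_hasDerivAt (fun t _ => hderiv t)
    ((hcont _).intervalIntegrable 0 1)
  simp only [one_smul, zero_smul, add_zero, add_sub_cancel] at hint
  have hsum : z - z₁ = ∑ A, (b.repr z A - b.repr z₁ A) • b A := by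
    conv_lhs => rw [← b.sum_repr z, ← b.sum_repr z₁]
    simp only [sub_smul, Finset.sum_sub_distrib]
  rw [← sub_eq_iff_eq_add', ← hint]
  conv_lhs => enter [1, t]; rw [hsum, map_sum]
  simp only [map_smul, smul_eq_mul, ← hsum]
  rw [intervalIntegral.integral_finsetSum fun A _ =>
    ((hcont (b A)).const_mul _).intervalIntegrable 0 1]
  simp only [intervalIntegral.integral_const_mul]

end Hadamard

/-! ## Exterior algebras -/

namespace ExtAlg

variable {V V' : Type*} [AddCommGroup V] [Module ℝ V] [AddCommGroup V'] [Module ℝ V']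

/-- Contraction with a linear form. -/
noncomputable abbrev contract (φ : Module.Dual ℝ V) :
    ExteriorAlgebra ℝ V →ₗ[ℝ] ExteriorAlgebra ℝ V :=
  CliffordAlgebra.contractLeft (Q := (0 : QuadraticForm ℝ V)) φ

theorem contract_ι_mul (φ : Module.Dual ℝ V) (v : V) (x : ExteriorAlgebra ℝ V) :
    contract φ (ExteriorAlgebra.ι ℝ v * x) = φ v • x - ExteriorAlgebra.ι ℝ v * contract φ x :=
  CliffordAlgebra.contractLeft_ι_mul (Q := (0 : QuadraticForm ℝ V)) φ v x

theorem contract_ι (φ : Module.Dual ℝ V) (v : V) :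
    contract φ (ExteriorAlgebra.ι ℝ v) = algebraMap ℝ _ (φ v) :=
  CliffordAlgebra.contractLeft_ι (Q := (0 : QuadraticForm ℝ V)) φ v

theorem contract_algebraMap (φ : Module.Dual ℝ V) (c : ℝ) :
    contract φ (algebraMap ℝ (ExteriorAlgebra ℝ V) c) = 0 :=
  CliffordAlgebra.contractLeft_algebraMap (Q := (0 : QuadraticForm ℝ V)) φ c

theorem contract_comm (φ ψ : Module.Dual ℝ V) (x : ExteriorAlgebra ℝ V) :
    contract φ (contract ψ x) = -contract ψ (contract φ x) :=
  CliffordAlgebra.contractLeft_comm (Q := (0 : QuadraticForm ℝ V)) φ ψ x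

theorem left_induction {P : ExteriorAlgebra ℝ V → Prop} (algebraMap : ∀ c, P (algebraMap ℝ _ c))
    (add : ∀ x y, P x → P y → P (x + y)) (ι_mul : ∀ v x, P x → P (ExteriorAlgebra.ι ℝ v * x))
    (x : ExteriorAlgebra ℝ V) : P x :=
  CliffordAlgebra.left_induction (Q := (0 : QuadraticForm ℝ V)) algebraMap add
    (fun x v => ι_mul v x) x

theorem map_map {V'' : Type*} [AddCommGroup V''] [Module ℝ V''] (f : V →ₗ[ℝ] V')
    (g : V' →ₗ[ℝ] V'') (x : ExteriorAlgebra ℝ V) :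
    ExteriorAlgebra.map g (ExteriorAlgebra.map f x) = ExteriorAlgebra.map (g ∘ₗ f) x :=
  DFunLike.congr_fun (ExteriorAlgebra.map_comp_map f g) x

theorem map_contract (f : V →ₗ[ℝ] V') (φ : Module.Dual ℝ V') (x : ExteriorAlgebra ℝ V) :
    contract φ (ExteriorAlgebra.map f x) = ExteriorAlgebra.map f (contract (φ ∘ₗ f) x) := by
  induction x using left_induction with
  | algebraMap c => simp only [AlgHom.commutes, contract_algebraMap, map_zero]
  | add x y hx hy => simp only [map_add, hx, hy]
  | ι_mul v x hx =>
    rw [map_mul, ExteriorAlgebra.map_apply_ι, contract_ι_mul, contract_ι_mul, map_sub, map_mul,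
      hx, map_smul, ExteriorAlgebra.map_apply_ι, LinearMap.comp_apply]

/-- The parity involution. -/
noncomputable def parity : ExteriorAlgebra ℝ V →ₐ[ℝ] ExteriorAlgebra ℝ V :=
  ExteriorAlgebra.map (-LinearMap.id)

theorem parity_ι (v : V) :
    parity (ExteriorAlgebra.ι ℝ v) = -ExteriorAlgebra.ι ℝ v := by
  simp [parity]

theorem parity_parity (x : ExteriorAlgebra ℝ V) : parity (parity x) = x := by
  rw [parity, map_map]
  have : (-LinearMap.id : V →ₗ[ℝ] V) ∘ₗ (-LinearMap.id) = LinearMap.id := by ext; simp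
  rw [this, ExteriorAlgebra.map_id, AlgHom.id_apply]

theorem map_parity (f : V →ₗ[ℝ] V') (x : ExteriorAlgebra ℝ V) :
    ExteriorAlgebra.map f (parity x) = parity (ExteriorAlgebra.map f x) := by
  rw [parity, parity, map_map, map_map]
  congr 2
  ext
  simp

theorem contract_parity (φ : Module.Dual ℝ V) (x : ExteriorAlgebra ℝ V) :
    contract φ (parity x) = -parity (contract φ x) := by
  rw [parity, map_contract]
  have : φ ∘ₗ (-LinearMap.id) = -φ := by ext; simp
  rw [this, contract, map_neg, LinearMap.neg_apply, map_neg]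

theorem contract_mul (φ : Module.Dual ℝ V) (x y : ExteriorAlgebra ℝ V) :
    contract φ (x * y) = contract φ x * y + parity x * contract φ y := by
  induction x using left_induction with
  | algebraMap c =>
    rw [contract_algebraMap, zero_mul, zero_add, AlgHom.commutes, ← Algebra.smul_def, map_smul,
      Algebra.smul_def]
  | add x x' hx hx' => simp only [add_mul, map_add, hx, hx']; abel
  | ι_mul v x hx =>
    rw [mul_assoc, contract_ι_mul, hx, contract_ι_mul, map_mul, parity_ι, sub_mul, smul_mul_assoc,
      mul_add, ← mul_assoc, ← mul_assoc]
    noncomm_ring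

theorem ι_mul_eq (v : V) (x : ExteriorAlgebra ℝ V) :
    ExteriorAlgebra.ι ℝ v * x = parity x * ExteriorAlgebra.ι ℝ v := by
  induction x using left_induction with
  | algebraMap c => rw [AlgHom.commutes, Algebra.commutes]
  | add x x' hx hx' => simp only [add_mul, mul_add, map_add, hx, hx']
  | ι_mul w x hx =>
    rw [map_mul, parity_ι, ← mul_assoc, eq_neg_of_add_eq_zero_left
      (ExteriorAlgebra.ι_add_mul_swap v w), neg_mul, mul_assoc, hx, neg_mul, neg_mul, mul_assoc]

/-- `x + parity x` and, in `sub_parity_mul`, `x - parity x` are twice the even and the odd part of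
`x`. Phrased in this way supercommutation is linear in `x` and assumes no homogeneity, so it passes
to the tensor product with functions. -/
theorem add_parity_mul (x y : ExteriorAlgebra ℝ V) :
    (x + parity x) * y = y * (x + parity x) := by
  induction y using left_induction with
  | algebraMap c => rw [Algebra.commutes]
  | add y y' h h' => rw [mul_add, h, h', add_mul]
  | ι_mul v y h =>
    have : (x + parity x) * ExteriorAlgebra.ι ℝ v = ExteriorAlgebra.ι ℝ v * (x + parity x) := by
      rw [ι_mul_eq, map_add, parity_parity, add_comm]
    rw [← mul_assoc, this, mul_assoc, h, mul_assoc]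

theorem sub_parity_mul (x y : ExteriorAlgebra ℝ V) :
    (x - parity x) * y = parity y * (x - parity x) := by
  induction y using left_induction with
  | algebraMap c => rw [AlgHom.commutes, Algebra.commutes]
  | add y y' h h' => rw [mul_add, h, h', map_add, add_mul]
  | ι_mul v y h =>
    have : (x - parity x) * ExteriorAlgebra.ι ℝ v = -ExteriorAlgebra.ι ℝ v * (x - parity x) := by
      rw [neg_mul, ι_mul_eq, map_sub, parity_parity, ← neg_mul, neg_sub]
    rw [← mul_assoc, this, mul_assoc, h, map_mul, parity_ι, mul_assoc]

/-! ### The grading -/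

theorem power_induction {k : ℕ} {P : ℕ → ExteriorAlgebra ℝ V → Prop}
    (algebraMap : ∀ c, P 0 (algebraMap ℝ _ c)) (add : ∀ k x y, P k x → P k y → P k (x + y))
    (ι_mul : ∀ k v x, P k x → P (k + 1) (ExteriorAlgebra.ι ℝ v * x))
    {x : ExteriorAlgebra ℝ V} (hx : x ∈ ⋀[ℝ]^k V) : P k x := by
  refine Submodule.pow_induction_on_left' (LinearMap.range (ExteriorAlgebra.ι ℝ (M := V)))
    (C := fun k x _ => P k x) algebraMap (fun x y k _ _ => add k x y) ?_ hx
  rintro _ ⟨v, rfl⟩ k x _ h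
  exact ι_mul k v x h

theorem parity_of_mem {k : ℕ} {x : ExteriorAlgebra ℝ V} (hx : x ∈ ⋀[ℝ]^k V) :
    parity x = (-1 : ℝ) ^ (k : ℤ) • x := by
  refine power_induction (P := fun k x => parity x = (-1 : ℝ) ^ (k : ℤ) • x) (fun c => by simp)
    (fun k x y hx hy => by rw [map_add, hx, hy, smul_add]) (fun k v x hx => ?_) hx
  rw [map_mul, parity_ι, hx, mul_smul_comm, Nat.cast_succ, zpow_add₀ (by norm_num), zpow_one,
    mul_neg_one, neg_smul, neg_mul, smul_neg]

variable {ι : Type*} [Fintype ι]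

/-- The Euler operator, whose eigenspaces are the exterior powers. -/
noncomputable def euler (b : Module.Basis ι ℝ V) :
    ExteriorAlgebra ℝ V →ₗ[ℝ] ExteriorAlgebra ℝ V :=
  ∑ A, LinearMap.mulLeft ℝ (ExteriorAlgebra.ι ℝ (b A)) ∘ₗ contract (b.coord A)

theorem euler_apply (b : Module.Basis ι ℝ V) (x : ExteriorAlgebra ℝ V) :
    euler b x = ∑ A, ExteriorAlgebra.ι ℝ (b A) * contract (b.coord A) x := by
  simp [euler]

theorem euler_ι_mul (b : Module.Basis ι ℝ V) (v : V) (x : ExteriorAlgebra ℝ V) :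
    euler b (ExteriorAlgebra.ι ℝ v * x) =
      ExteriorAlgebra.ι ℝ v * x + ExteriorAlgebra.ι ℝ v * euler b x := by
  have h1 : ∀ A, ExteriorAlgebra.ι ℝ (b A) * (ExteriorAlgebra.ι ℝ v * contract (b.coord A) x) =
      -(ExteriorAlgebra.ι ℝ v * (ExteriorAlgebra.ι ℝ (b A) * contract (b.coord A) x)) := fun A => by
    rw [← mul_assoc, eq_neg_of_add_eq_zero_left (ExteriorAlgebra.ι_add_mul_swap (b A) v), neg_mul,
      mul_assoc]
  have h2 : ∑ A, ExteriorAlgebra.ι ℝ (b A) * (b.coord A v • x) = ExteriorAlgebra.ι ℝ v * x := by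
    simp only [mul_smul_comm, ← smul_mul_assoc, ← Finset.sum_mul, ← map_smul, ← map_sum]
    congr 2
    exact b.sum_repr v
  simp only [euler_apply, contract_ι_mul, mul_sub, h1, Finset.mul_sum, sub_neg_eq_add,
    Finset.sum_add_distrib, h2]

theorem euler_of_mem (b : Module.Basis ι ℝ V) {k : ℕ} {x : ExteriorAlgebra ℝ V}
    (hx : x ∈ ⋀[ℝ]^k V) : euler b x = (k : ℝ) • x := by
  refine power_induction (P := fun k x => euler b x = (k : ℝ) • x)
    (fun c => by simp [euler_apply])
    (fun k x y hx hy => by rw [map_add, hx, hy, smul_add]) (fun k v x hx => ?_) hx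
  rw [euler_ι_mul, hx, mul_smul_comm, Nat.cast_succ, add_smul, one_smul, add_comm]

/-- The Euler operator is the scalar k on the k-th exterior power. Membership in a given power can
therefore be tested by an eigenvalue equation, as in `mem_of_euler`. -/
theorem decompose_euler (b : Module.Basis ι ℝ V) (x : ExteriorAlgebra ℝ V) (k : ℕ) :
    (DirectSum.decompose (fun i : ℕ => ⋀[ℝ]^i V) (euler b x) k : ExteriorAlgebra ℝ V) =
      (k : ℝ) • (DirectSum.decompose (fun i : ℕ => ⋀[ℝ]^i V) x k : ExteriorAlgebra ℝ V) := by
  classical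
  induction x using DirectSum.Decomposition.inductionOn (fun i : ℕ => ⋀[ℝ]^i V) with
  | zero => simp
  | @homogeneous i y =>
    rw [euler_of_mem b y.2, DirectSum.decompose_smul, DirectSum.smul_apply, Submodule.coe_smul,
      DirectSum.decompose_coe]
    by_cases h : i = k
    · subst h; rfl
    · rw [DirectSum.of_eq_of_ne _ _ _ (Ne.symm h)]; simp
  | add x y hx hy =>
    rw [map_add, DirectSum.decompose_add, DirectSum.decompose_add, DirectSum.add_apply,
      DirectSum.add_apply, Submodule.coe_add, Submodule.coe_add, hx, hy, smul_add]

theorem decompose_eq_zero_of_euler {b : Module.Basis ι ℝ V} {x : ExteriorAlgebra ℝ V} {c : ℤ}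
    (h : euler b x = (c : ℝ) • x) {k : ℕ} (hk : (k : ℤ) ≠ c) :
    (DirectSum.decompose (fun i : ℕ => ⋀[ℝ]^i V) x k : ExteriorAlgebra ℝ V) = 0 := by
  have h1 := decompose_euler b x k
  rw [h, DirectSum.decompose_smul, DirectSum.smul_apply, Submodule.coe_smul, ← sub_eq_zero,
    ← sub_smul] at h1
  refine (smul_eq_zero.mp h1).resolve_left (sub_ne_zero.mpr ?_)
  exact_mod_cast Ne.symm hk

theorem mem_of_euler {b : Module.Basis ι ℝ V} {x : ExteriorAlgebra ℝ V} {k : ℕ}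
    (h : euler b x = ((k : ℤ) : ℝ) • x) : x ∈ ⋀[ℝ]^k V := by
  classical
  rw [← DirectSum.sum_support_decompose (fun i : ℕ => ⋀[ℝ]^i V) x]
  refine Submodule.sum_mem _ fun i _ => ?_
  by_cases hi : i = k
  · subst hi; exact SetLike.coe_mem _
  · rw [decompose_eq_zero_of_euler h (by exact_mod_cast hi)]; exact Submodule.zero_mem _

theorem eq_zero_of_euler_neg {b : Module.Basis ι ℝ V} {x : ExteriorAlgebra ℝ V} {c : ℤ}
    (hc : c < 0) (h : euler b x = (c : ℝ) • x) : x = 0 := by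
  classical
  rw [← DirectSum.sum_support_decompose (fun i : ℕ => ⋀[ℝ]^i V) x]
  exact Finset.sum_eq_zero fun i _ => decompose_eq_zero_of_euler h (by omega)

theorem eq_zero_of_contract {b : Module.Basis ι ℝ V} {x : ExteriorAlgebra ℝ V} {k : ℕ}
    (hk : k ≠ 0) (hx : x ∈ ⋀[ℝ]^k V) (h : ∀ φ, contract φ x = 0) : x = 0 := by
  have h1 := euler_of_mem b hx
  simp only [euler_apply, h, mul_zero, Finset.sum_const_zero] at h1
  exact (smul_eq_zero.mp h1.symm).resolve_left (by exact_mod_cast hk)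

theorem eq_algebraMap_of_mem {x : ExteriorAlgebra ℝ V} (hx : x ∈ ⋀[ℝ]^0 V) :
    x = algebraMap ℝ _ (ExteriorAlgebra.algebraMapInv x) := by
  rw [ExteriorAlgebra.exteriorPower, pow_zero, Submodule.mem_one] at hx
  obtain ⟨c, rfl⟩ := hx
  rw [ExteriorAlgebra.algebraMap_leftInverse]

end ExtAlg

/-! ## Germs of smooth functions -/

section Germ

variable {V : Type*} [NormedAddCommGroup V] [NormedSpace ℝ V]

/-- The functions which are smooth at a point. -/
def smoothAt (z₀ : V) : Subalgebra ℝ (V → ℝ) where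
  carrier := {f | ContDiffAt ℝ ∞ f z₀}
  mul_mem' {f g} (hf : ContDiffAt ℝ ∞ f z₀) (hg : ContDiffAt ℝ ∞ g z₀) := hf.mul hg
  add_mem' {f g} (hf : ContDiffAt ℝ ∞ f z₀) (hg : ContDiffAt ℝ ∞ g z₀) := hf.add hg
  algebraMap_mem' c := (contDiffAt_const : ContDiffAt ℝ ∞ (fun _ : V => c) z₀)

theorem smoothAt_contDiffAt {z₀ : V} (f : smoothAt z₀) : ContDiffAt ℝ ∞ f.1 z₀ := f.2

/-- The functions which vanish near a point. -/
def nullIdeal (z₀ : V) : Ideal (smoothAt z₀) where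
  carrier := {f | f.1 =ᶠ[𝓝 z₀] 0}
  add_mem' {f g} hf hg := by
    filter_upwards [hf, hg] with z h1 h2
    change f.1 z + g.1 z = 0
    rw [h1, h2]; exact add_zero _
  zero_mem' := Filter.EventuallyEq.rfl
  smul_mem' c f hf := by
    filter_upwards [hf] with z h1
    change c.1 z * f.1 z = 0
    rw [h1]; exact mul_zero _

/-- The algebra of germs of smooth functions at a point. -/
def SmoothGerm (z₀ : V) : Type _ := smoothAt z₀ ⧸ nullIdeal z₀

noncomputable instance (z₀ : V) : CommRing (SmoothGerm z₀) :=
  inferInstanceAs (CommRing (smoothAt z₀ ⧸ nullIdeal z₀))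

noncomputable instance (z₀ : V) : Algebra ℝ (SmoothGerm z₀) :=
  inferInstanceAs (Algebra ℝ (smoothAt z₀ ⧸ nullIdeal z₀))

/-- The germ of a function. -/
noncomputable def germ (z₀ : V) : smoothAt z₀ →ₐ[ℝ] SmoothGerm z₀ := Ideal.Quotient.mkₐ ℝ (nullIdeal z₀)

namespace SmoothGerm

variable {z₀ : V}

theorem germ_eq {f g : smoothAt z₀} : germ z₀ f = germ z₀ g ↔ f.1 =ᶠ[𝓝 z₀] g.1 := by
  refine Ideal.Quotient.eq.trans ?_
  change (f.1 - g.1 =ᶠ[𝓝 z₀] 0) ↔ _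
  rw [← Filter.eventuallyEq_iff_sub]

theorem exists_germ (s : SmoothGerm z₀) : ∃ f, s = germ z₀ f :=
  (Ideal.Quotient.mk_surjective s).imp fun _ => Eq.symm

/-- A representative of a germ. -/
noncomputable def rep (s : SmoothGerm z₀) : smoothAt z₀ := s.exists_germ.choose

theorem germ_rep (s : SmoothGerm z₀) : germ z₀ s.rep = s := s.exists_germ.choose_spec.symm

/-- The value of a germ. -/
noncomputable def eval (z₀ : V) : SmoothGerm z₀ →ₐ[ℝ] ℝ :=
  Ideal.Quotient.liftₐ (nullIdeal z₀) ((Pi.evalAlgHom ℝ (fun _ : V => ℝ) z₀).comp (smoothAt z₀).val)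
    fun f hf => by
      have : f.1 =ᶠ[𝓝 z₀] 0 := hf
      exact this.self_of_nhds

theorem contDiffAt_fderiv (f : smoothAt z₀) (v : V) :
    ContDiffAt ℝ ∞ (fun z => fderiv ℝ f.1 z v) z₀ :=
  ((smoothAt_contDiffAt f).fderiv_right (m := ∞) (by simp)).clm_apply
    (contDiffAt_const (c := v))

/-- The directional derivative of a function. -/
noncomputable def derivFun (v : V) (f : smoothAt z₀) : smoothAt z₀ :=
  ⟨fun z => fderiv ℝ f.1 z v, contDiffAt_fderiv f v⟩

/-- Functions that agree near the point have derivatives that agree near the point; this makes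
`deriv` independent of the chosen representative. -/
theorem derivFun_congr (v : V) {f g : smoothAt z₀} (h : germ z₀ f = germ z₀ g) :
    germ z₀ (derivFun v f) = germ z₀ (derivFun v g) := by
  rw [germ_eq] at *
  filter_upwards [h.fderiv (𝕜 := ℝ)] with z hz
  exact DFunLike.congr_fun hz v

theorem eventually_differentiableAt (f : smoothAt z₀) :
    ∀ᶠ z in 𝓝 z₀, DifferentiableAt ℝ f.1 z := by
  have h : ContDiffAt ℝ 1 f.1 z₀ := contDiffAt_infty.1 (smoothAt_contDiffAt f) 1
  filter_upwards [h.eventually (by simp)] with z hz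
  exact hz.differentiableAt (by simp)

/-- The directional derivative of a germ. -/
noncomputable def deriv (v : V) : SmoothGerm z₀ →ₗ[ℝ] SmoothGerm z₀ where
  toFun s := germ z₀ (derivFun v s.rep)
  map_add' s t := by
    rw [← map_add, ← derivFun_congr v (f := s.rep + t.rep)
      (by rw [germ_rep, map_add, germ_rep, germ_rep]), germ_eq]
    filter_upwards [eventually_differentiableAt s.rep, eventually_differentiableAt t.rep]
      with z hs ht
    change fderiv ℝ (s.rep.1 + t.rep.1) z v = _
    rw [fderiv_add hs ht]; rfl
  map_smul' c s := by
    rw [RingHom.id_apply, ← map_smul, ← derivFun_congr v (f := c • s.rep)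
      (by rw [germ_rep, map_smul, germ_rep]), germ_eq]
    filter_upwards [eventually_differentiableAt s.rep] with z hs
    change fderiv ℝ (c • s.rep.1) z v = _
    rw [fderiv_const_smul hs]; rfl

theorem deriv_germ (v : V) (f : smoothAt z₀) :
    deriv v (germ z₀ f) = germ z₀ (derivFun v f) :=
  derivFun_congr v (germ_rep _)

theorem deriv_mul (v : V) (s t : SmoothGerm z₀) :
    deriv v (s * t) = deriv v s * t + s * deriv v t := by
  obtain ⟨f, rfl⟩ := s.exists_germ
  obtain ⟨g, rfl⟩ := t.exists_germ
  rw [← map_mul, deriv_germ, deriv_germ, deriv_germ, ← map_mul, ← map_mul, ← map_add, germ_eq]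
  filter_upwards [eventually_differentiableAt f, eventually_differentiableAt g] with z hf hg
  change fderiv ℝ (f.1 * g.1) z v = fderiv ℝ f.1 z v * g.1 z + f.1 z * fderiv ℝ g.1 z v
  rw [fderiv_mul hf hg]
  simp only [add_apply, smul_apply, smul_eq_mul]
  ring

theorem deriv_one (v : V) : deriv v (1 : SmoothGerm z₀) = 0 := by
  simpa using deriv_mul v (1 : SmoothGerm z₀) 1

theorem deriv_comm (v w : V) (s : SmoothGerm z₀) : deriv v (deriv w s) = deriv w (deriv v s) := by
  obtain ⟨f, rfl⟩ := s.exists_germ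
  rw [deriv_germ, deriv_germ, deriv_germ, deriv_germ, germ_eq]
  have h : ContDiffAt ℝ 2 f.1 z₀ := contDiffAt_infty.1 (smoothAt_contDiffAt f) 2
  filter_upwards [h.eventually (by simp)] with z hz
  have hd : DifferentiableAt ℝ (fderiv ℝ f.1) z :=
    (hz.fderiv_right (m := 1) (by norm_num)).differentiableAt (by simp)
  change fderiv ℝ (fun y => fderiv ℝ f.1 y w) z v = fderiv ℝ (fun y => fderiv ℝ f.1 y v) z w
  rw [fderiv_clm_apply hd (differentiableAt_const _), fderiv_clm_apply hd (differentiableAt_const _)]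
  simpa using hz.isSymmSndFDerivAt (by simp) v w

/-- The composition of a function with a linear map fixing the point. -/
def compFun (L : V →L[ℝ] V) (hL : L z₀ = z₀) (f : smoothAt z₀) : smoothAt z₀ :=
  ⟨f.1 ∘ L, by
    have hf : ContDiffAt ℝ ∞ f.1 (L z₀) := by rw [hL]; exact smoothAt_contDiffAt f
    exact (hf.comp z₀ L.contDiff.contDiffAt :)⟩

/-- The composition of a germ with a linear map fixing the point. -/
noncomputable def comp (L : V →L[ℝ] V) (hL : L z₀ = z₀) : SmoothGerm z₀ →ₐ[ℝ] SmoothGerm z₀ :=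
  Ideal.Quotient.liftₐ (nullIdeal z₀)
    { toFun := fun f => germ z₀ (compFun L hL f)
      map_one' := rfl
      map_mul' := fun _ _ => rfl
      map_zero' := rfl
      map_add' := fun _ _ => rfl
      commutes' := fun _ => rfl }
    fun f hf => by
      have hf : f.1 =ᶠ[𝓝 z₀] 0 := hf
      change germ z₀ _ = 0
      rw [← map_zero (germ z₀), germ_eq]
      have := L.continuous.tendsto z₀
      rw [hL] at this
      exact this.eventually hf

theorem comp_germ (L : V →L[ℝ] V) (hL : L z₀ = z₀) (f : smoothAt z₀) :
    comp L hL (germ z₀ f) = germ z₀ (compFun L hL f) := rfl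

theorem comp_comp {L : V →L[ℝ] V} {hL : L z₀ = z₀} (hLL : ∀ z, L (L z) = L z) (s : SmoothGerm z₀) :
    comp L hL (comp L hL s) = comp L hL s := by
  obtain ⟨f, rfl⟩ := s.exists_germ
  rw [comp_germ, comp_germ, germ_eq]
  exact Filter.Eventually.of_forall fun z => congrArg f.1 (hLL z)

theorem deriv_comp {L : V →L[ℝ] V} {hL : L z₀ = z₀} (v : V) (s : SmoothGerm z₀) :
    deriv v (comp L hL s) = comp L hL (deriv (L v) s) := by
  obtain ⟨f, rfl⟩ := s.exists_germ
  rw [comp_germ, deriv_germ, deriv_germ, comp_germ, germ_eq]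
  have := L.continuous.tendsto z₀
  rw [hL] at this
  filter_upwards [this.eventually (eventually_differentiableAt f)] with z hz
  change fderiv ℝ (f.1 ∘ L) z v = fderiv ℝ f.1 (L z) (L v)
  rw [fderiv_comp z hz L.differentiableAt, L.fderiv]
  rfl

end SmoothGerm

end Germ

/-! ## The algebra of germs of multivector fields at a point of the zero section -/

open scoped TensorProduct

section LocalPhase

variable {EB F : Type*} [NormedAddCommGroup EB] [NormedSpace ℝ EB] [NormedAddCommGroup F]
  [NormedSpace ℝ F]

variable (F) in
/-- Germs of multivector fields on `EB × F` at the point `(x₁, 0)`, with additional odd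
parameters. -/
def LocalPhase (x₁ : EB) : Type _ :=
  ExteriorAlgebra ℝ ((EB × F) × (ℕ →₀ ℝ)) ⊗[ℝ] SmoothGerm (x₁, (0 : F))

namespace LocalPhase

variable {x₁ : EB}

noncomputable instance : Ring (LocalPhase F x₁) :=
  inferInstanceAs (Ring (ExteriorAlgebra ℝ ((EB × F) × (ℕ →₀ ℝ)) ⊗[ℝ] SmoothGerm (x₁, (0 : F))))

noncomputable instance : Algebra ℝ (LocalPhase F x₁) :=
  inferInstanceAs
    (Algebra ℝ (ExteriorAlgebra ℝ ((EB × F) × (ℕ →₀ ℝ)) ⊗[ℝ] SmoothGerm (x₁, (0 : F))))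

/-- A multivector with constant coefficients times a function. -/
noncomputable def tmul :
    ExteriorAlgebra ℝ ((EB × F) × (ℕ →₀ ℝ)) →ₗ[ℝ] SmoothGerm (x₁, (0 : F)) →ₗ[ℝ] LocalPhase F x₁ :=
  TensorProduct.mk ℝ _ _

theorem tmul_mul_tmul (q q' : ExteriorAlgebra ℝ ((EB × F) × (ℕ →₀ ℝ)))
    (s s' : SmoothGerm (x₁, (0 : F))) : tmul q s * tmul q' s' = tmul (q * q') (s * s') :=
  Algebra.TensorProduct.tmul_mul_tmul _ _ _ _

theorem one_def : (1 : LocalPhase F x₁) = tmul 1 1 := rfl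

theorem induction {P : LocalPhase F x₁ → Prop} (tmul : ∀ q s, P (tmul q s))
    (add : ∀ x y, P x → P y → P (x + y)) (x : LocalPhase F x₁) : P x :=
  TensorProduct.induction_on x (by have h := tmul 0 0; rw [map_zero] at h; exact h) tmul add

/-- The action of a linear map on the multivectors. -/
noncomputable def mapLeft
    (f : ExteriorAlgebra ℝ ((EB × F) × (ℕ →₀ ℝ)) →ₗ[ℝ] ExteriorAlgebra ℝ ((EB × F) × (ℕ →₀ ℝ))) :
    LocalPhase F x₁ →ₗ[ℝ] LocalPhase F x₁ :=
  f.rTensor _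

/-- The action of a linear map on the functions. -/
noncomputable def mapRight (f : SmoothGerm (x₁, (0 : F)) →ₗ[ℝ] SmoothGerm (x₁, (0 : F))) :
    LocalPhase F x₁ →ₗ[ℝ] LocalPhase F x₁ :=
  f.lTensor _

/-- The action of algebra homomorphisms on the multivectors and on the functions. -/
noncomputable def mapAlg
    (f : ExteriorAlgebra ℝ ((EB × F) × (ℕ →₀ ℝ)) →ₐ[ℝ] ExteriorAlgebra ℝ ((EB × F) × (ℕ →₀ ℝ)))
    (g : SmoothGerm (x₁, (0 : F)) →ₐ[ℝ] SmoothGerm (x₁, (0 : F))) :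
    LocalPhase F x₁ →ₐ[ℝ] LocalPhase F x₁ :=
  Algebra.TensorProduct.map f g

@[simp] theorem mapLeft_tmul (f) (q) (s : SmoothGerm (x₁, (0 : F))) :
    mapLeft f (tmul q s) = tmul (f q) s := rfl

@[simp] theorem mapRight_tmul (f) (q) (s : SmoothGerm (x₁, (0 : F))) :
    mapRight f (tmul q s) = tmul q (f s) := rfl

@[simp] theorem mapAlg_tmul (f g) (q) (s : SmoothGerm (x₁, (0 : F))) :
    mapAlg f g (tmul q s) = tmul (f q) (g s) := rfl

/-- The parity involution. -/
noncomputable def γ : LocalPhase F x₁ →ₐ[ℝ] LocalPhase F x₁ :=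
  mapAlg ExtAlg.parity (AlgHom.id ℝ _)

/-- Contraction with a linear form. -/
noncomputable def contract (φ : Module.Dual ℝ ((EB × F) × (ℕ →₀ ℝ))) :
    LocalPhase F x₁ →ₗ[ℝ] LocalPhase F x₁ :=
  mapLeft (ExtAlg.contract φ)

theorem γ_tmul (q) (s : SmoothGerm (x₁, (0 : F))) : γ (tmul q s) = tmul (ExtAlg.parity q) s := rfl

theorem contract_tmul (φ) (q) (s : SmoothGerm (x₁, (0 : F))) :
    contract φ (tmul q s) = tmul (ExtAlg.contract φ q) s := rfl

theorem γ_γ (x : LocalPhase F x₁) : γ (γ x) = x := by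
  induction x using induction with
  | tmul q s => rw [γ_tmul, γ_tmul, ExtAlg.parity_parity]
  | add x y hx hy => rw [map_add, map_add, hx, hy]

theorem add_γ_mul (x y : LocalPhase F x₁) : (x + γ x) * y = y * (x + γ x) := by
  induction x using induction with
  | tmul q s =>
    induction y using induction with
    | tmul q' s' =>
      rw [γ_tmul, ← LinearMap.add_apply, ← map_add, tmul_mul_tmul, tmul_mul_tmul,
        ExtAlg.add_parity_mul, mul_comm s]
    | add y y' h h' => rw [mul_add, h, h', add_mul]
  | add x x' h h' =>
    rw [map_add, add_add_add_comm, add_mul, h, h', ← mul_add]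

theorem sub_γ_mul (x y : LocalPhase F x₁) : (x - γ x) * y = γ y * (x - γ x) := by
  induction x using induction with
  | tmul q s =>
    induction y using induction with
    | tmul q' s' =>
      rw [γ_tmul, γ_tmul, ← LinearMap.sub_apply, ← map_sub, tmul_mul_tmul, tmul_mul_tmul,
        ExtAlg.sub_parity_mul, mul_comm s]
    | add y y' h h' => rw [mul_add, h, h', map_add, add_mul]
  | add x x' h h' =>
    rw [map_add, add_sub_add_comm, add_mul, h, h', ← mul_add]

theorem comm_even (x y : LocalPhase F x₁) (hx : γ x = x) : x * y = y * x := by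
  have h := add_γ_mul x y
  rw [hx, ← two_smul ℝ x, smul_mul_assoc, mul_smul_comm] at h
  exact smul_right_injective _ two_ne_zero h

theorem comm_odd (x y : LocalPhase F x₁) (hx : γ x = -x) : x * y = γ y * x := by
  have h := sub_γ_mul x y
  rw [hx, sub_neg_eq_add, ← two_smul ℝ x, smul_mul_assoc, mul_smul_comm] at h
  exact smul_right_injective _ two_ne_zero h

theorem contract_mul (φ) (x y : LocalPhase F x₁) :
    contract φ (x * y) = contract φ x * y + γ x * contract φ y := by
  induction x using induction with
  | tmul q s =>
    induction y using induction with
    | tmul q' s' =>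
      rw [tmul_mul_tmul, contract_tmul, contract_tmul, contract_tmul, γ_tmul, tmul_mul_tmul,
        tmul_mul_tmul, ExtAlg.contract_mul, map_add, LinearMap.add_apply]
    | add y y' h h' => simp only [mul_add, map_add, h, h']; abel
  | add x x' h h' => simp only [add_mul, map_add, h, h']; abel

theorem contract_comm (φ ψ) (x : LocalPhase F x₁) :
    contract φ (contract ψ x) = -contract ψ (contract φ x) := by
  induction x using induction with
  | tmul q s =>
    rw [contract_tmul, contract_tmul, contract_tmul, contract_tmul, ExtAlg.contract_comm, map_neg,
      LinearMap.neg_apply]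
  | add x x' h h' => simp only [map_add, h, h', neg_add]

theorem contract_γ (φ) (x : LocalPhase F x₁) : contract φ (γ x) = -γ (contract φ x) := by
  induction x using induction with
  | tmul q s =>
    rw [γ_tmul, contract_tmul, contract_tmul, γ_tmul, ExtAlg.contract_parity, map_neg,
      LinearMap.neg_apply]
  | add x x' h h' => simp only [map_add, h, h', neg_add]

/-- The action of a derivation of the algebra of functions. -/
noncomputable def deriv (v : EB × F) : LocalPhase F x₁ →ₗ[ℝ] LocalPhase F x₁ :=
  mapRight (SmoothGerm.deriv v)

theorem deriv_tmul (v) (q) (s : SmoothGerm (x₁, (0 : F))) :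
    deriv v (tmul q s) = tmul q (SmoothGerm.deriv v s) := rfl

theorem deriv_mul (v) (x y : LocalPhase F x₁) :
    deriv v (x * y) = deriv v x * y + x * deriv v y := by
  induction x using induction with
  | tmul q s =>
    induction y using induction with
    | tmul q' s' =>
      rw [tmul_mul_tmul, deriv_tmul, deriv_tmul, deriv_tmul, tmul_mul_tmul,
        tmul_mul_tmul, SmoothGerm.deriv_mul, map_add]
    | add y y' h h' => simp only [mul_add, map_add, h, h']; abel
  | add x x' h h' => simp only [add_mul, map_add, h, h']; abel

theorem deriv_comm (v w) (x : LocalPhase F x₁) : deriv v (deriv w x) = deriv w (deriv v x) := by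
  induction x using induction with
  | tmul q s => rw [deriv_tmul, deriv_tmul, deriv_tmul, deriv_tmul, SmoothGerm.deriv_comm]
  | add x x' h h' => simp only [map_add, h, h']

theorem deriv_γ (v) (x : LocalPhase F x₁) : deriv v (γ x) = γ (deriv v x) := by
  induction x using induction with
  | tmul q s => rfl
  | add x x' h h' => simp only [map_add, h, h']

theorem deriv_contract (v φ) (x : LocalPhase F x₁) :
    deriv v (contract φ x) = contract φ (deriv v x) := by
  induction x using induction with
  | tmul q s => rfl
  | add x x' h h' => simp only [map_add, h, h']

/-- The projection which kills the horizontal vectors. -/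
noncomputable def killBase : ((EB × F) × (ℕ →₀ ℝ)) →ₗ[ℝ] ((EB × F) × (ℕ →₀ ℝ)) :=
  LinearMap.prodMap (LinearMap.prodMap 0 LinearMap.id) LinearMap.id

/-- The projection to the zero section. -/
def toZeroSection : EB × F →L[ℝ] EB × F :=
  (ContinuousLinearMap.id ℝ EB).prodMap 0

theorem toZeroSection_apply (z : EB × F) : toZeroSection z = (z.1, 0) := rfl

theorem toZeroSection_base (x : EB) : toZeroSection (x, (0 : F)) = (x, 0) := rfl

/-- Restriction of functions to the zero section, and projection of vectors to the fibre. -/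
noncomputable def proj : LocalPhase F x₁ →ₐ[ℝ] LocalPhase F x₁ :=
  mapAlg (ExteriorAlgebra.map killBase) (SmoothGerm.comp toZeroSection (toZeroSection_base x₁))

theorem proj_tmul (q) (s : SmoothGerm (x₁, (0 : F))) :
    proj (tmul q s) = tmul (ExteriorAlgebra.map killBase q)
      (SmoothGerm.comp toZeroSection (toZeroSection_base x₁) s) := rfl

theorem proj_proj (x : LocalPhase F x₁) : proj (proj x) = proj x := by
  induction x using induction with
  | tmul q s =>
    rw [proj_tmul, proj_tmul, ExtAlg.map_map, SmoothGerm.comp_comp fun _ => by rfl]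
    rfl
  | add x x' h h' => simp only [map_add, h, h']

theorem proj_γ (x : LocalPhase F x₁) : proj (γ x) = γ (proj x) := by
  induction x using induction with
  | tmul q s => rw [proj_tmul, γ_tmul, proj_tmul, γ_tmul, ExtAlg.map_parity]
  | add x x' h h' => simp only [map_add, h, h']

theorem contract_proj (φ) (x : LocalPhase F x₁) :
    contract φ (proj x) = proj (contract (φ ∘ₗ killBase) x) := by
  induction x using induction with
  | tmul q s => rw [proj_tmul, contract_tmul, contract_tmul, proj_tmul, ExtAlg.map_contract]
  | add x x' h h' => simp only [map_add, h, h']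

theorem deriv_proj (v) (x : LocalPhase F x₁) :
    deriv v (proj x) = proj (deriv (toZeroSection v) x) := by
  induction x using induction with
  | tmul q s => rw [proj_tmul, deriv_tmul, deriv_tmul, proj_tmul, SmoothGerm.deriv_comp]
  | add x x' h h' => simp only [map_add, h, h']

theorem contract_zero_left (x : LocalPhase F x₁) : contract 0 x = 0 := by
  induction x using induction with
  | tmul q s => rw [contract_tmul, ExtAlg.contract, map_zero]; simp
  | add x x' h h' => simp only [map_add, h, h', add_zero]

theorem deriv_zero_left (x : LocalPhase F x₁) : deriv 0 x = 0 := by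
  induction x using induction with
  | tmul q s =>
    obtain ⟨f, rfl⟩ := s.exists_germ
    rw [deriv_tmul, SmoothGerm.deriv_germ]
    have : SmoothGerm.derivFun 0 f = 0 := by ext z; simp [SmoothGerm.derivFun]
    rw [this, map_zero, map_zero]
  | add x x' h h' => simp only [map_add, h, h', add_zero]

/-- A constant vector. -/
noncomputable def vec : ((EB × F) × (ℕ →₀ ℝ)) →ₗ[ℝ] LocalPhase F x₁ :=
  tmul.flip 1 ∘ₗ ExteriorAlgebra.ι ℝ

theorem vec_eq (v) : vec (x₁ := x₁) (F := F) v = tmul (ExteriorAlgebra.ι ℝ v) 1 := rfl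

theorem γ_vec (v) : γ (vec (x₁ := x₁) (F := F) v) = -vec v := by
  rw [vec_eq, γ_tmul, ExtAlg.parity_ι, map_neg, LinearMap.neg_apply]

theorem contract_vec (φ) (v) :
    contract φ (vec (x₁ := x₁) (F := F) v) = φ v • (1 : LocalPhase F x₁) := by
  rw [vec_eq, contract_tmul, ExtAlg.contract_ι, Algebra.algebraMap_eq_smul_one, map_smul,
    LinearMap.smul_apply, one_def]

theorem deriv_vec (w) (v) : deriv w (vec (x₁ := x₁) (F := F) v) = 0 := by
  rw [vec_eq, deriv_tmul, SmoothGerm.deriv_one, map_zero]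

theorem proj_vec (v) : proj (vec (x₁ := x₁) (F := F) v) = vec (killBase v) := by
  rw [vec_eq, proj_tmul, ExteriorAlgebra.map_apply_ι, map_one, vec_eq]

theorem vec_mul_self (v) : vec (x₁ := x₁) (F := F) v * vec v = 0 := by
  rw [vec_eq, tmul_mul_tmul, ExteriorAlgebra.ι_sq_zero, map_zero, LinearMap.zero_apply]

variable {m r : Type*} [DecidableEq m] [DecidableEq r] (bm : Module.Basis m ℝ EB)
  (br : Module.Basis r ℝ F)

/-- The phase algebra structure defined by coordinates. -/
noncomputable def phaseAlgebra : PInfty.PhaseAlgebra (LocalPhase F x₁) m r where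
  γ := γ
  γ_γ := γ_γ
  comm_even := comm_even
  comm_odd := comm_odd
  d A := deriv (bm.prod br A)
  d_mul _ := deriv_mul _
  d_comm _ _ := deriv_comm _ _
  d_γ _ := deriv_γ _
  i A := contract ((bm.prod br).coord A ∘ₗ LinearMap.fst ℝ _ _)
  i_mul _ := contract_mul _
  i_comm _ _ := contract_comm _ _
  i_γ _ := contract_γ _
  d_i _ _ := deriv_contract _ _
  p := proj
  p_p := proj_proj
  p_γ := proj_γ
  p_d μ x := by
    rw [deriv_proj]
    congr 2
    simp [toZeroSection_apply]
  p_i j x := by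
    rw [contract_proj]
    rfl
  -- A base covector composed with `killBase` is the zero form.
  i_p μ x := by
    have : ((bm.prod br).coord (Sum.inl μ) ∘ₗ LinearMap.fst ℝ _ (ℕ →₀ ℝ)) ∘ₗ killBase = 0 := by
      ext <;> simp [killBase]
    rw [contract_proj, this, contract_zero_left, map_zero]
  d_p j x := by
    have : toZeroSection (bm.prod br (Sum.inr j)) = 0 := by
      simp [toZeroSection_apply]
    rw [deriv_proj, this, deriv_zero_left, map_zero]
  e A := vec (bm.prod br A, 0)
  γ_e _ := γ_vec _
  i_e A B := by
    rw [contract_vec]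
    simp only [LinearMap.comp_apply, LinearMap.fst_apply, Module.Basis.coord_apply,
      Module.Basis.repr_self, Finsupp.single_apply, eq_comm (a := A)]
    split_ifs <;> simp
  d_e _ _ := deriv_vec _ _
  p_e_inl μ := by
    rw [proj_vec]
    have : killBase (bm.prod br (Sum.inl μ), (0 : ℕ →₀ ℝ)) = 0 := by
      simp [killBase]
    rw [this, map_zero]
  p_e_inr j := by
    rw [proj_vec]
    congr 1
    simp [killBase]

/-! ### Odd parameters -/

/-- Contraction with a coordinate of the space of parameters. -/
noncomputable def paramContract (k : ℕ) : LocalPhase F x₁ →ₗ[ℝ] LocalPhase F x₁ :=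
  contract (Finsupp.lapply k ∘ₗ LinearMap.snd ℝ (EB × F) (ℕ →₀ ℝ))

/-- The odd parameters. -/
noncomputable def param (k : ℕ) : LocalPhase F x₁ := vec (0, Finsupp.single k 1)

/-- The creation-annihilation relation: on elements free of the parameter, contraction undoes
multiplication by it. -/
theorem paramContract_param_mul (k l : ℕ) (y : LocalPhase F x₁) :
    paramContract k (param l * y) = (if l = k then y else 0) - param l * paramContract k y := by
  rw [paramContract, contract_mul, param, contract_vec, γ_vec, neg_mul, ← sub_eq_add_neg,
    smul_mul_assoc, one_mul]
  congr 1
  simp only [LinearMap.comp_apply, LinearMap.snd_apply, Finsupp.lapply_apply, Finsupp.single_apply]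
  split_ifs <;> simp

theorem isContraction_paramContract (k : ℕ) :
    (phaseAlgebra (x₁ := x₁) bm br).IsContraction (paramContract k) where
  mul := contract_mul _
  γ := contract_γ _
  i _ := contract_comm _ _
  d _ x := (deriv_contract _ _ x).symm
  p x := contract_proj _ x

theorem isConst_param (k : ℕ) : (phaseAlgebra (x₁ := x₁) bm br).IsConst (param k) where
  d _ := deriv_vec _ _
  i A := by
    refine (contract_vec _ _).trans ?_
    simp
  p := by
    refine (proj_vec _).trans ?_
    simp only [killBase, param, LinearMap.prodMap_apply, map_zero, LinearMap.id_apply]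

/-- A parameter of parity `n - 1`. -/
noncomputable def nilParam (n : ℤ) (k : ℕ) : LocalPhase F x₁ :=
  if Even n then param (2 * k) else param (2 * k) * param (2 * k + 1)

/-- One generator is odd, as needed for even `d i`; a product of two generators is even, as needed
for odd `d i`. The indices 2k and 2k + 1 are reserved for slot k, so different slots never share a
generator. -/
theorem isNilSystem_nilParam {n : ℕ} (d : Fin n → ℤ) :
    (phaseAlgebra (x₁ := x₁) bm br).IsNilSystem d fun i => nilParam (d i) i where
  par i := by
    have hp : ∀ k, (phaseAlgebra (x₁ := x₁) bm br).Par 1 (param k) := fun k =>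
      PInfty.PhaseAlgebra.par_of_odd odd_one (γ_vec _)
    rw [nilParam]
    split_ifs with h
    · exact (hp _).congr (by obtain ⟨t, ht⟩ := h; exact ⟨1 - t, by rw [ht]; ring⟩)
    · obtain ⟨t, ht⟩ := Int.not_even_iff_odd.mp h
      exact ((hp _).mul (hp _)).congr ⟨1 - t, by rw [ht]; ring⟩
  sq i := by
    simp only [nilParam]
    split_ifs with h
    · exact vec_mul_self _
    · rw [mul_assoc, ← mul_assoc (param (2 * (i : ℕ) + 1)), comm_odd (param (2 * (i : ℕ) + 1)) _
        (γ_vec _), ← mul_assoc, ← mul_assoc, param, γ_vec, mul_neg, vec_mul_self, neg_zero,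
        zero_mul, zero_mul]
  const i := by
    simp only [nilParam]
    split_ifs with h
    · exact isConst_param bm br _
    · exact (isConst_param bm br _).mul (isConst_param bm br _)

theorem eq_zero_of_nilParam_mul {n : ℤ} {k : ℕ} {y : LocalPhase F x₁}
    (h0 : paramContract (2 * k) y = 0) (h1 : paramContract (2 * k + 1) y = 0)
    (h : nilParam n k * y = 0) : y = 0 := by
  rw [nilParam] at h
  split_ifs at h
  · have := congrArg (paramContract (2 * k)) h
    rwa [paramContract_param_mul, if_pos rfl, h0, mul_zero, sub_zero, map_zero] at this
  · have := congrArg (paramContract (2 * k)) h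
    rw [mul_assoc, paramContract_param_mul, if_pos rfl, paramContract_param_mul, if_neg (by omega),
      h0, mul_zero, sub_zero, mul_zero, sub_zero, map_zero] at this
    have := congrArg (paramContract (2 * k + 1)) this
    rwa [paramContract_param_mul, if_pos rfl, h1, mul_zero, sub_zero, map_zero] at this

theorem paramContract_nilParam_mul {n : ℤ} {k l : ℕ} {y : LocalPhase F x₁}
    (hl : l ≠ 2 * k) (hl' : l ≠ 2 * k + 1) (h : paramContract l y = 0) :
    paramContract l (nilParam n k * y) = 0 := by
  rw [nilParam]
  split_ifs
  · rw [paramContract_param_mul, if_neg hl.symm, h, mul_zero, sub_zero]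
  · rw [mul_assoc, paramContract_param_mul, if_neg hl.symm, paramContract_param_mul,
      if_neg hl'.symm, h, mul_zero, sub_zero, mul_zero, sub_zero]

/-- The parameters are removed one at a time by contraction. Absence of repetitions ensures that the
product of `y` with one parameter is still free of the parameters in the rest of the list. -/
theorem eq_zero_of_revProd_mul {n : ℕ} (d : Fin n → ℤ) {l : List (Fin n)} (hl : l.Nodup)
    {y : LocalPhase F x₁} (hy : ∀ i ∈ l, paramContract (2 * (i : ℕ)) y = 0 ∧
      paramContract (2 * (i : ℕ) + 1) y = 0)
    (h : PInfty.PhaseAlgebra.revProd (fun i => nilParam (d i) i) l * y = 0) : y = 0 := by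
  induction l generalizing y with
  | nil => simpa using h
  | cons k l ih =>
    obtain ⟨hk, hl⟩ := List.nodup_cons.mp hl
    rw [PInfty.PhaseAlgebra.revProd_cons, mul_assoc] at h
    refine eq_zero_of_nilParam_mul (hy k (by simp)).1 (hy k (by simp)).2 (ih hl (fun i hi => ?_) h)
    have hik : (i : ℕ) ≠ k := fun h => hk (Fin.ext h ▸ hi)
    exact ⟨paramContract_nilParam_mul (by omega) (by omega) (hy i (by simp [hi])).1,
      paramContract_nilParam_mul (by omega) (by omega) (hy i (by simp [hi])).2⟩

variable [Fintype m] [Fintype r]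

/-- The Jacobi sum of parameter-free arguments is itself parameter-free, so the product of
parameters multiplying it in the polarized identity can be cancelled. -/
theorem jacobi_lam {ϖ : LocalPhase F x₁} (hϖ : γ ϖ = ϖ)
    (h0 : (phaseAlgebra bm br).schouten ϖ ϖ = 0) (hc : ∀ k, paramContract k ϖ = 0) {n : ℕ}
    {d : Fin n → ℤ} {a : Fin n → LocalPhase F x₁} (hp : ∀ i, proj (a i) = a i)
    (ha : ∀ i, (phaseAlgebra bm br).Par (d i) (a i)) (hac : ∀ i k, paramContract k (a i) = 0) :
    ∑ σ : Equiv.Perm (Fin n), (((Equiv.Perm.sign σ : ℤ) : ℝ) * PInfty.koszulSign d σ) •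
      PInfty.jacobiSum ((phaseAlgebra bm br).lam ϖ) (a ∘ σ) = 0 := by
  have h := PInfty.PhaseAlgebra.jacobi_lam hϖ h0 (isNilSystem_nilParam bm br d) hp ha
  have hk : ∀ k, paramContract k (∑ σ : Equiv.Perm (Fin n),
      (((Equiv.Perm.sign σ : ℤ) : ℝ) * PInfty.koszulSign d σ) •
        PInfty.jacobiSum ((phaseAlgebra bm br).lam ϖ) (a ∘ σ)) = 0 := fun k => by
    rw [map_sum]
    refine Finset.sum_eq_zero fun σ _ => ?_
    rw [map_smul, (isContraction_paramContract bm br k).jacobiSum (a := a ∘ σ) (hc k)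
      fun i => hac _ k, smul_zero]
  exact eq_zero_of_revProd_mul d (List.nodup_ofFn_ofInjective Function.injective_id)
    (fun i _ => ⟨hk _, hk _⟩) h

end LocalPhase

end LocalPhase

namespace PInfty.PhaseAlgebra

variable {T : Type*} [Ring T] [Algebra ℝ T] {m r : Type*} [DecidableEq m]
    [DecidableEq r] {H : PhaseAlgebra T m r} [Fintype m] [Fintype r]

/-! ### Bivector fields -/

variable (H) in
/-- The bivector field with the given components. -/
noncomputable def bivector (Q : m ⊕ r → m ⊕ r → T) : T :=
  (1 / 2 : ℝ) • ∑ A, ∑ B, Q A B * (H.e A * H.e B)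

theorem IsFn.mul {f g : T} (hf : H.IsFn f) (hg : H.IsFn g) : H.IsFn (f * g) :=
  ⟨by rw [map_mul, hf.γ, hg.γ], fun A => by rw [H.i_mul, hf.i, hg.i, zero_mul, mul_zero, add_zero]⟩

theorem IsFn.sum {ι : Type*} {s : Finset ι} {f : ι → T} (hf : ∀ i ∈ s, H.IsFn (f i)) :
    H.IsFn (∑ i ∈ s, f i) :=
  ⟨by rw [map_sum]; exact Finset.sum_congr rfl fun i hi => (hf i hi).γ,
    fun A => by rw [map_sum]; exact Finset.sum_eq_zero fun i hi => (hf i hi).i A⟩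

section

variable {Q : m ⊕ r → m ⊕ r → T} (hQ : ∀ A B, H.IsFn (Q A B)) 

include hQ

theorem γ_bivector : H.γ (H.bivector Q) = H.bivector Q := by
  simp only [bivector, map_smul, map_sum, map_mul, H.γ_e, neg_mul_neg, (hQ _ _).γ]

theorem deg_bivector : H.Deg 2 (H.bivector Q) := by
  refine Deg.smul (Deg.sum fun A _ => Deg.sum fun B _ => ?_) _
  have h : H.Deg 0 (Q A B) := by simp [Deg, euler_apply, (hQ A B).i]
  exact h.mul ((deg_e A).mul (deg_e B))

theorem d_bivector (C : m ⊕ r) :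
    H.d C (H.bivector Q) = H.bivector fun A B => H.d C (Q A B) := by
  simp [bivector, H.d_mul, H.d_e]

variable (hskew : ∀ A B, Q A B = -Q B A)

include hskew

theorem i_bivector (C : m ⊕ r) : H.i C (H.bivector Q) = ∑ B, Q C B * H.e B := by
  have h1 : ∀ A B, H.i C (Q A B * (H.e A * H.e B)) =
      (if C = A then Q A B * H.e B else 0) + (if C = B then Q B A * H.e A else 0) := fun A B => by
    rw [H.i_mul, (hQ A B).i, (hQ A B).γ, H.i_mul, H.i_e, H.i_e, H.γ_e, zero_mul, zero_add]
    rw [hskew B A]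
    split_ifs <;> simp [mul_add]
  rw [bivector, map_smul, map_sum]
  simp only [map_sum, h1, Finset.sum_add_distrib]
  rw [Finset.sum_comm]
  simp only [Finset.sum_ite_eq, Finset.mem_univ, if_true]
  rw [← two_smul ℝ, smul_smul]
  norm_num

theorem grad_grad_bivector {f : T} (hf : H.IsFn f) (g : T) :
    H.grad g (H.grad f (H.bivector Q)) = ∑ A, ∑ B, Q A B * H.d A f * H.d B g := by
  have he : ∀ B, H.grad g (H.e B) = H.d B g := fun B => by simp [grad_apply, H.i_e]
  rw [grad_apply f, map_sum]
  refine Finset.sum_congr rfl fun A _ => ?_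
  rw [grad_mul_left g (hf.d A), i_bivector hQ hskew, map_sum, Finset.mul_sum]
  refine Finset.sum_congr rfl fun B _ => ?_
  rw [grad_mul_left g (hQ A B), he, ← mul_assoc, ← (hQ A B).comm]

/-- The bracket equals Σ J D A B · e D e A e B with J D A B = Σ_C Q C D ∂_C (Q A B). A product of
three odd vectors is invariant under cyclic rotation, so only the cyclic sum of J matters, and that
is the Jacobi identity. -/
theorem schouten_bivector (hjac : ∀ A B D, ∑ C, (Q C D * H.d C (Q A B) +
    Q C A * H.d C (Q B D) + Q C B * H.d C (Q D A)) = 0) :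
    H.schouten (H.bivector Q) (H.bivector Q) = 0 := by
  have hs : H.schouten (H.bivector Q) (H.bivector Q) =
      ∑ C, (2 : ℝ) • (H.i C (H.bivector Q) * H.d C (H.bivector Q)) := by
    rw [schouten, Fintype.sum_sum_type]
    congr 1 <;> refine Finset.sum_congr rfl fun A _ => ?_ <;>
    rw [H.comm_even _ _ (H.γ_d_even (γ_bivector hQ) _), two_smul]
  let J : m ⊕ r → m ⊕ r → m ⊕ r → T := fun D A B => ∑ C, Q C D * H.d C (Q A B)
  let f : m ⊕ r → m ⊕ r → m ⊕ r → T := fun D A B => J D A B * (H.e D * (H.e A * H.e B))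
  have hC : ∀ C, (2 : ℝ) • (H.i C (H.bivector Q) * H.d C (H.bivector Q)) =
      ∑ D, ∑ A, ∑ B, Q C D * H.d C (Q A B) * (H.e D * (H.e A * H.e B)) := fun C => by
    rw [i_bivector hQ hskew, d_bivector hQ, bivector, mul_smul_comm, smul_smul,
      mul_one_div_cancel two_ne_zero, one_smul, Finset.sum_mul]
    refine Finset.sum_congr rfl fun D _ => ?_
    rw [Finset.mul_sum]
    refine Finset.sum_congr rfl fun A _ => ?_
    rw [Finset.mul_sum]
    refine Finset.sum_congr rfl fun B _ => ?_
    rw [mul_assoc, ← mul_assoc (H.e D), ← ((hQ A B).d C).comm (H.e D)]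
    noncomm_ring
  have h1 : H.schouten (H.bivector Q) (H.bivector Q) = ∑ D, ∑ A, ∑ B, f D A B := by
    rw [hs]
    simp only [hC, f, J, Finset.sum_mul]
    rw [Finset.sum_comm]
    refine Finset.sum_congr rfl fun D _ => ?_
    rw [Finset.sum_comm]
    refine Finset.sum_congr rfl fun A _ => ?_
    rw [Finset.sum_comm]
  have hcyc : ∀ D A B, H.e D * (H.e A * H.e B) = H.e A * (H.e B * H.e D) := fun D A B => by
    rw [H.comm_odd (H.e D) _ (H.γ_e D), map_mul, H.γ_e, H.γ_e, neg_mul_neg, mul_assoc]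
  have h2' : ∀ f : m ⊕ r → m ⊕ r → m ⊕ r → T,
      ∑ D, ∑ A, ∑ B, f A B D = ∑ D, ∑ A, ∑ B, f D A B := fun f => by
    rw [Finset.sum_comm]
    exact Finset.sum_congr rfl fun A _ => Finset.sum_comm
  have h2 := h2' f
  have h3 := (h2' fun X Y Z => f Z X Y).symm
  -- Three times the sum is the sum over its cyclic rotations, in which the coefficient of every
  -- monomial vanishes by `hjac`.
  have h4 : (3 : ℝ) • ∑ D, ∑ A, ∑ B, f D A B = 0 := by
    have h5 : (3 : ℝ) • ∑ D, ∑ A, ∑ B, f D A B =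
        ∑ D, ∑ A, ∑ B, f D A B + ∑ D, ∑ A, ∑ B, f A B D + ∑ D, ∑ A, ∑ B, f B D A := by
      rw [h2, h3]
      module
    rw [h5]
    simp only [← Finset.sum_add_distrib]
    refine Finset.sum_eq_zero fun D _ => Finset.sum_eq_zero fun A _ => Finset.sum_eq_zero
      fun B _ => ?_
    have := hjac A B D
    simp only [Finset.sum_add_distrib] at this
    simp only [f, ← hcyc D A B, hcyc B D A, ← add_mul, J]
    rw [this, zero_mul]
  rw [h1]
  exact (smul_eq_zero.mp h4).resolve_left (by norm_num)

end

end PInfty.PhaseAlgebra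

namespace Coiso

variable {EB F C : Type*} [NormedAddCommGroup EB] [NormedSpace ℝ EB]
    [NormedAddCommGroup F] [NormedSpace ℝ F]
    [TopologicalSpace C] [ChartedSpace EB C]
    {E : C → Type*} [TopologicalSpace (TotalSpace F E)]
    [∀ x, AddCommGroup (E x)] [∀ x, Module ℝ (E x)] [∀ x, TopologicalSpace (E x)]
    [FiberBundle F E] [VectorBundle ℝ F E]

/-! ## Local coordinates -/

variable (F E) in
/-- The domain of the local coordinates at a point. -/
def patch (x₀ : C) : Set C := (chartAt EB x₀).source ∩ (trivializationAt F E x₀).baseSet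

theorem isOpen_patch (x₀ : C) : IsOpen (patch (EB := EB) F E x₀) :=
  (chartAt EB x₀).open_source.inter (trivializationAt F E x₀).open_baseSet

theorem mem_patch (x₀ : C) : x₀ ∈ patch (EB := EB) F E x₀ :=
  ⟨mem_chart_source EB x₀, FiberBundle.mem_baseSet_trivializationAt F E x₀⟩

theorem patch_mem_nhds (x₀ : C) : patch (EB := EB) F E x₀ ∈ 𝓝 x₀ :=
  (isOpen_patch x₀).mem_nhds (mem_patch x₀)

/-- The local coordinates of a point of the total space. -/
noncomputable def coord (x₀ : C) (m : TotalSpace F E) : EB × F :=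
  (extChartAt 𝓘(ℝ, EB) x₀ m.1, (trivializationAt F E x₀ m).2)

variable (F E) in
/-- The point of the total space with given local coordinates. -/
noncomputable def coordInv (x₀ : C) (z : EB × F) : TotalSpace F E :=
  (trivializationAt F E x₀).toOpenPartialHomeomorph.symm
    ((extChartAt 𝓘(ℝ, EB) x₀).symm z.1, z.2)

variable (F E) in
/-- The range of the coordinates on the base. -/
def patchTarget (x₀ : C) : Set EB :=
  (extChartAt 𝓘(ℝ, EB) x₀).target ∩
    (extChartAt 𝓘(ℝ, EB) x₀).symm ⁻¹' (trivializationAt F E x₀).baseSet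

theorem isOpen_patchTarget (x₀ : C) : IsOpen (patchTarget (EB := EB) F E x₀) :=
  (continuousOn_extChartAt_symm x₀).isOpen_inter_preimage (isOpen_extChartAt_target x₀)
    (trivializationAt F E x₀).open_baseSet

theorem extChartAt_mem_patchTarget {x₀ x : C} (hx : x ∈ patch (EB := EB) F E x₀) :
    extChartAt 𝓘(ℝ, EB) x₀ x ∈ patchTarget F E x₀ := by
  have h : x ∈ (extChartAt 𝓘(ℝ, EB) x₀).source := by rw [extChartAt_source]; exact hx.1
  exact ⟨(extChartAt 𝓘(ℝ, EB) x₀).map_source h, by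
    rw [Set.mem_preimage, (extChartAt 𝓘(ℝ, EB) x₀).left_inv h]; exact hx.2⟩

theorem extChartAt_symm_mem_patch {x₀ : C} {z : EB} (hz : z ∈ patchTarget F E x₀) :
    (extChartAt 𝓘(ℝ, EB) x₀).symm z ∈ patch (EB := EB) F E x₀ :=
  ⟨by rw [← extChartAt_source 𝓘(ℝ, EB)]; exact (extChartAt 𝓘(ℝ, EB) x₀).map_target hz.1, hz.2⟩

theorem coordInv_coord {x₀ : C} {m : TotalSpace F E} (hm : m.1 ∈ patch (EB := EB) F E x₀) :
    coordInv F E x₀ (coord (EB := EB) x₀ m) = m := by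
  have h : m.1 ∈ (extChartAt 𝓘(ℝ, EB) x₀).source := by rw [extChartAt_source]; exact hm.1
  simp only [coordInv, coord, (extChartAt 𝓘(ℝ, EB) x₀).left_inv h]
  exact (trivializationAt F E x₀).symm_apply_mk_proj
    ((trivializationAt F E x₀).mem_source.2 hm.2)

theorem coordInv_proj {x₀ : C} {z : EB × F} (hz : z.1 ∈ patchTarget F E x₀) :
    (coordInv F E x₀ z).1 = (extChartAt 𝓘(ℝ, EB) x₀).symm z.1 :=
  (trivializationAt F E x₀).proj_symm_apply ((trivializationAt F E x₀).mem_target.2 hz.2)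

theorem coordInv_eq {x₀ : C} {z : EB × F} (hz : z.1 ∈ patchTarget F E x₀) :
    coordInv F E x₀ z = ⟨(extChartAt 𝓘(ℝ, EB) x₀).symm z.1,
      (trivializationAt F E x₀).symm ((extChartAt 𝓘(ℝ, EB) x₀).symm z.1) z.2⟩ :=
  ((trivializationAt F E x₀).mk_symm hz.2 z.2).symm

theorem coord_coordInv {x₀ : C} {z : EB × F} (hz : z.1 ∈ patchTarget F E x₀) :
    coord x₀ (coordInv F E x₀ z) = z := by
  have h := (trivializationAt F E x₀).apply_symm_apply
    (x := ((extChartAt 𝓘(ℝ, EB) x₀).symm z.1, z.2)) ((trivializationAt F E x₀).mem_target.2 hz.2)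
  rw [coord, coordInv_proj hz, (extChartAt 𝓘(ℝ, EB) x₀).right_inv hz.1, coordInv, h]

theorem coordInv_proj_mem {x₀ : C} {z : EB × F} (hz : z.1 ∈ patchTarget F E x₀) :
    (coordInv F E x₀ z).1 ∈ patch (EB := EB) F E x₀ := by
  rw [coordInv_proj hz]; exact extChartAt_symm_mem_patch hz

theorem eventually_mem_patchTarget (x₀ : C) (y : F) :
    ∀ᶠ z in 𝓝 (extChartAt 𝓘(ℝ, EB) x₀ x₀, y), z.1 ∈ patchTarget F E x₀ :=
  continuousAt_fst.preimage_mem_nhds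
    ((isOpen_patchTarget x₀).mem_nhds (extChartAt_mem_patchTarget (mem_patch x₀)))

section

variable [IsManifold 𝓘(ℝ, EB) ∞ C] [ContMDiffVectorBundle ∞ F E 𝓘(ℝ, EB)]

theorem contMDiffAt_extChartAt_symm {x₀ : C} {z : EB} (hz : z ∈ (extChartAt 𝓘(ℝ, EB) x₀).target) :
    ContMDiffAt 𝓘(ℝ, EB) 𝓘(ℝ, EB) ∞ (extChartAt 𝓘(ℝ, EB) x₀).symm z :=
  (contMDiffOn_extChartAt_symm x₀).contMDiffAt ((isOpen_extChartAt_target x₀).mem_nhds hz)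

theorem contMDiffAt_coordInv {x₀ : C} {z : EB × F} (hz : z.1 ∈ patchTarget F E x₀) :
    ContMDiffAt 𝓘(ℝ, EB × F) (𝓘(ℝ, EB).prod 𝓘(ℝ, F)) ∞ (coordInv F E x₀) z := by
  have hev : ∀ᶠ w : EB × F in 𝓝 z, w.1 ∈ patchTarget F E x₀ :=
    continuousAt_fst.preimage_mem_nhds ((isOpen_patchTarget x₀).mem_nhds hz)
  rw [(trivializationAt F E x₀).contMDiffAt_iff
    ((trivializationAt F E x₀).mem_source.2 (coordInv_proj_mem hz).2)]
  constructor
  · have h1 : ContMDiffAt 𝓘(ℝ, EB × F) 𝓘(ℝ, EB) ∞ (Prod.fst : EB × F → EB) z :=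
      contMDiffAt_iff_contDiffAt.2 contDiffAt_fst
    refine ((contMDiffAt_extChartAt_symm hz.1).comp z h1).congr_of_eventuallyEq ?_
    filter_upwards [hev] with w hw
    exact coordInv_proj hw
  · have h1 : ContMDiffAt 𝓘(ℝ, EB × F) 𝓘(ℝ, F) ∞ (Prod.snd : EB × F → F) z :=
      contMDiffAt_iff_contDiffAt.2 contDiffAt_snd
    refine h1.congr_of_eventuallyEq ?_
    filter_upwards [hev] with w hw
    exact congrArg Prod.snd (coord_coordInv hw)

theorem contMDiffAt_coord {x₀ : C} {m : TotalSpace F E} (hm : m.1 ∈ patch (EB := EB) F E x₀) :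
    ContMDiffAt (𝓘(ℝ, EB).prod 𝓘(ℝ, F)) 𝓘(ℝ, EB × F) ∞ (coord (EB := EB) x₀) m := by
  have h1 : ContMDiffAt (𝓘(ℝ, EB).prod 𝓘(ℝ, F)) 𝓘(ℝ, EB) ∞
      (fun m : TotalSpace F E => extChartAt 𝓘(ℝ, EB) x₀ m.1) m :=
    (contMDiffAt_extChartAt' hm.1).comp m (contMDiff_proj E).contMDiffAt
  have h2 : ContMDiffAt (𝓘(ℝ, EB).prod 𝓘(ℝ, F)) 𝓘(ℝ, F) ∞
      (fun m : TotalSpace F E => (trivializationAt F E x₀ m).2) m :=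
    (((trivializationAt F E x₀).contMDiffAt_iff
      ((trivializationAt F E x₀).mem_source.2 hm.2)).1 contMDiffAt_id).2
  exact h1.prodMk_space h2

/-! ## Cutoff functions and extensions -/

variable [FiniteDimensional ℝ EB] [T2Space C]

theorem exists_cutoff {x : C} {U : Set C} (hU : U ∈ 𝓝 x) :
    ∃ χ : BaseFun EB C, (∀ᶠ y in 𝓝 x, χ y = 1) ∧ tsupport χ ⊆ U := by
  obtain ⟨f, -, hf⟩ := (SmoothBumpFunction.nhds_basis_tsupport (I := 𝓘(ℝ, EB)) x).mem_iff.1 hU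
  exact ⟨⟨f, f.contMDiff⟩, f.eventuallyEq_one, hf⟩

omit [IsManifold 𝓘(ℝ, EB) ∞ C] [FiniteDimensional ℝ EB] [T2Space C] in
/-- The product of a cutoff function and a locally defined function on the base. -/
theorem contMDiff_cutoff_mul {χ : BaseFun EB C} {f : C → ℝ}
    (hf : ∀ x ∈ tsupport χ, ContMDiffAt 𝓘(ℝ, EB) 𝓘(ℝ, ℝ) ∞ f x) :
    ContMDiff 𝓘(ℝ, EB) 𝓘(ℝ, ℝ) ∞ fun x => χ x * f x :=
  contMDiff_of_tsupport fun x hx =>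
    χ.contMDiff.contMDiffAt.mul (hf x (tsupport_mul_subset_left hx))

omit [IsManifold 𝓘(ℝ, EB) ∞ C] [ContMDiffVectorBundle ∞ F E 𝓘(ℝ, EB)]
  [FiniteDimensional ℝ EB] [T2Space C] in
/-- The product of a cutoff function and a locally defined function on the total space. -/
theorem contMDiff_cutoff_mul_total {χ : BaseFun EB C} {f : TotalSpace F E → ℝ}
    (hf : ∀ m : TotalSpace F E, m.1 ∈ tsupport χ →
      ContMDiffAt (𝓘(ℝ, EB).prod 𝓘(ℝ, F)) 𝓘(ℝ, ℝ) ∞ f m) :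
    ContMDiff (𝓘(ℝ, EB).prod 𝓘(ℝ, F)) 𝓘(ℝ, ℝ) ∞ fun m : TotalSpace F E => χ m.1 * f m := by
  refine contMDiff_of_tsupport fun m hm => ?_
  refine ContMDiffAt.mul (χ.contMDiff.contMDiffAt.comp m (contMDiff_proj E).contMDiffAt)
    (hf m ?_)
  have h1 : m ∈ tsupport fun m : TotalSpace F E => χ m.1 := tsupport_mul_subset_left hm
  exact tsupport_comp_subset_preimage χ (FiberBundle.continuous_proj F E) h1

end

end Coiso

namespace Coiso

variable {EB F C : Type*} [NormedAddCommGroup EB] [NormedSpace ℝ EB] [FiniteDimensional ℝ EB]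
    [NormedAddCommGroup F] [NormedSpace ℝ F] [FiniteDimensional ℝ F]
    [TopologicalSpace C] [ChartedSpace EB C] [T2Space C]
    {E : C → Type*} [TopologicalSpace (TotalSpace F E)]
    [∀ x, AddCommGroup (E x)] [∀ x, Module ℝ (E x)] [∀ x, TopologicalSpace (E x)]
    [FiberBundle F E] [VectorBundle ℝ F E]
    [IsManifold 𝓘(ℝ, EB) ∞ C] [ContMDiffVectorBundle ∞ F E 𝓘(ℝ, EB)]

/-! ## Coordinate functions and frames -/

variable (F E) in
/-- A cutoff function supported in the domain of the local coordinates. -/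
noncomputable def bump (x₀ : C) : BaseFun EB C :=
  (exists_cutoff (patch_mem_nhds (EB := EB) (F := F) (E := E) x₀)).choose

theorem eventually_bump (x₀ : C) : ∀ᶠ y in 𝓝 x₀, bump (EB := EB) F E x₀ y = 1 :=
  (exists_cutoff (patch_mem_nhds (EB := EB) (F := F) (E := E) x₀)).choose_spec.1

theorem tsupport_bump (x₀ : C) : tsupport (bump (EB := EB) F E x₀) ⊆ patch (EB := EB) F E x₀ :=
  (exists_cutoff (patch_mem_nhds (EB := EB) (F := F) (E := E) x₀)).choose_spec.2

variable (EB F E) in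
/-- The domain where the cutoff function is one. -/
def core (x₀ : C) : Set C := interior {y | bump (EB := EB) F E x₀ y = 1}

theorem isOpen_core (x₀ : C) : IsOpen (core EB F E x₀) := isOpen_interior

theorem mem_core (x₀ : C) : x₀ ∈ core EB F E x₀ :=
  mem_interior_iff_mem_nhds.2 (eventually_bump x₀)

theorem core_mem_nhds (x₀ : C) : core EB F E x₀ ∈ 𝓝 x₀ := (isOpen_core x₀).mem_nhds (mem_core x₀)

theorem bump_of_mem_core {x₀ x : C} (hx : x ∈ core EB F E x₀) : bump (EB := EB) F E x₀ x = 1 :=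
  interior_subset (s := {y | bump (EB := EB) F E x₀ y = 1}) hx

theorem core_subset_patch (x₀ : C) : core EB F E x₀ ⊆ patch (EB := EB) F E x₀ := fun x hx =>
  tsupport_bump x₀ (subset_tsupport _ (by
    rw [Function.mem_support, bump_of_mem_core hx]; exact one_ne_zero))

theorem bump_eq_zero {x₀ x : C} (hx : x ∉ patch (EB := EB) F E x₀) :
    bump (EB := EB) F E x₀ x = 0 :=
  image_eq_zero_of_notMem_tsupport fun h => hx (tsupport_bump x₀ h)

variable (F E) in
/-- A coordinate function on the base, cut off away from a point. -/
noncomputable def baseCoord (x₀ : C) (μ : Fin (Module.finrank ℝ EB)) : BaseFun EB C :=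
  ⟨fun x => bump (EB := EB) F E x₀ x *
      (Module.finBasis ℝ EB).coord μ (extChartAt 𝓘(ℝ, EB) x₀ x),
    contMDiff_cutoff_mul fun x hx =>
      ((LinearMap.toContinuousLinearMap ((Module.finBasis ℝ EB).coord μ)).contMDiff.contMDiffAt).comp
        x (contMDiffAt_extChartAt' (tsupport_bump x₀ hx).1)⟩

variable (EB E) in
/-- A linear coordinate function on the fibres, cut off away from a point. -/
noncomputable def fibreCoord (x₀ : C) (j : Fin (Module.finrank ℝ F)) : Conormal EB F E where
  toFun := ⟨fun m => bump (EB := EB) F E x₀ m.1 *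
      (Module.finBasis ℝ F).coord j (coord (EB := EB) x₀ m).2,
    contMDiff_cutoff_mul_total fun m hm =>
      ((LinearMap.toContinuousLinearMap ((Module.finBasis ℝ F).coord j ∘ₗ
        LinearMap.snd ℝ EB F)).contMDiff.contMDiffAt).comp m
        (contMDiffAt_coord (tsupport_bump x₀ hm))⟩
  linear x := by
    by_cases hx : x ∈ patch (EB := EB) F E x₀
    · have hlin := (trivializationAt F E x₀).linear ℝ hx.2
      constructor
      · intro e e'
        change bump (EB := EB) F E x₀ x *
          (Module.finBasis ℝ F).coord j (trivializationAt F E x₀ ⟨x, e + e'⟩).2 = bump (EB := EB) F E x₀ x *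
          (Module.finBasis ℝ F).coord j (trivializationAt F E x₀ ⟨x, e⟩).2 + bump (EB := EB) F E x₀ x *
          (Module.finBasis ℝ F).coord j (trivializationAt F E x₀ ⟨x, e'⟩).2
        rw [hlin.map_add, map_add, mul_add]
      · intro c e
        change bump (EB := EB) F E x₀ x *
          (Module.finBasis ℝ F).coord j (trivializationAt F E x₀ ⟨x, c • e⟩).2 = c * (bump (EB := EB) F E x₀ x *
          (Module.finBasis ℝ F).coord j (trivializationAt F E x₀ ⟨x, e⟩).2)
        rw [hlin.map_smul, map_smul, smul_eq_mul]
        ring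
    · constructor
      · intro e e'
        change bump (EB := EB) F E x₀ x *
          (Module.finBasis ℝ F).coord j (trivializationAt F E x₀ ⟨x, e + e'⟩).2 = bump (EB := EB) F E x₀ x *
          (Module.finBasis ℝ F).coord j (trivializationAt F E x₀ ⟨x, e⟩).2 + bump (EB := EB) F E x₀ x *
          (Module.finBasis ℝ F).coord j (trivializationAt F E x₀ ⟨x, e'⟩).2
        simp only [bump_eq_zero hx, zero_mul, add_zero]
      · intro c e
        change bump (EB := EB) F E x₀ x *
          (Module.finBasis ℝ F).coord j (trivializationAt F E x₀ ⟨x, c • e⟩).2 = c * (bump (EB := EB) F E x₀ x *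
          (Module.finBasis ℝ F).coord j (trivializationAt F E x₀ ⟨x, e⟩).2)
        simp only [bump_eq_zero hx, zero_mul, mul_zero]

variable (EB E) in
/-- A local frame of the vector bundle, cut off away from a point. -/
noncomputable def frame (x₀ : C) (j : Fin (Module.finrank ℝ F)) : Sec EB F E :=
  ⟨fun x => bump (EB := EB) F E x₀ x •
      (trivializationAt F E x₀).symm x (Module.finBasis ℝ F j), fun x => by
    by_cases hx : x ∈ tsupport (bump (EB := EB) F E x₀)
    · have hp := tsupport_bump x₀ hx
      rw [(trivializationAt F E x₀).contMDiffAt_section_iff hp.2]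
      refine ((bump (EB := EB) F E x₀).contMDiff.contMDiffAt.smul
        (contMDiffAt_const (c := Module.finBasis ℝ F j))).congr_of_eventuallyEq ?_
      filter_upwards [(isOpen_patch x₀).mem_nhds hp] with y hy
      rw [((trivializationAt F E x₀).linear ℝ hy.2).map_smul,
        (trivializationAt F E x₀).apply_mk_symm hy.2]
      rfl
    · refine (contMDiff_zeroSection ℝ E x).congr_of_eventuallyEq ?_
      filter_upwards [(isClosed_tsupport _).isOpen_compl.mem_nhds hx] with y hy
      rw [image_eq_zero_of_notMem_tsupport hy, zero_smul]
      rfl⟩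

variable (EB F E) in
/-- The basis of the coordinate space. -/
noncomputable def coordBasis :
    Module.Basis (Fin (Module.finrank ℝ EB) ⊕ Fin (Module.finrank ℝ F)) ℝ (EB × F) :=
  (Module.finBasis ℝ EB).prod (Module.finBasis ℝ F)

variable (F E) in
/-- The coordinate functions on the total space, cut off away from a point. -/
noncomputable def coordFun (x₀ : C) :
    Fin (Module.finrank ℝ EB) ⊕ Fin (Module.finrank ℝ F) → TotFun EB F E :=
  Sum.elim (fun μ => pull (baseCoord F E x₀ μ)) fun j => (fibreCoord EB E x₀ j).toFun

theorem coordFun_apply {x₀ : C} {m : TotalSpace F E} (hm : m.1 ∈ core EB F E x₀) (A) :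
    coordFun F E x₀ A m = (coordBasis EB F).repr (coord x₀ m) A := by
  rcases A with μ | j
  · change bump (EB := EB) F E x₀ m.1 * _ = _
    rw [bump_of_mem_core hm, one_mul, coordBasis, Module.Basis.prod_repr_inl]
    rfl
  · change bump (EB := EB) F E x₀ m.1 * _ = _
    rw [bump_of_mem_core hm, one_mul, coordBasis, Module.Basis.prod_repr_inr]
    rfl

/-! ## The Poisson bracket in coordinates -/

theorem derivation_one (D : TotFun EB F E →ₗ[ℝ] ℝ) (m : TotalSpace F E)
    (hD : ∀ f g, D (f * g) = D f * g m + f m * D g) : D 1 = 0 := by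
  have := hD 1 1
  have h1 : (1 : TotFun EB F E) m = 1 := rfl
  rw [mul_one, h1, mul_one, one_mul] at this
  linarith

/-- Take ψ equal to one near the point and supported where χ = 1. Then ψ(χ - 1) = 0, and the Leibniz
rule at the point, where ψ = 1 and χ - 1 = 0, gives D χ = D 1 = 0. -/
theorem derivation_pull_eq_zero (D : TotFun EB F E →ₗ[ℝ] ℝ) (m : TotalSpace F E)
    (hD : ∀ f g, D (f * g) = D f * g m + f m * D g) {χ : BaseFun EB C}
    (hχ : ∀ᶠ y in 𝓝 m.1, χ y = 1) : D (pull χ) = 0 := by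
  obtain ⟨ψ, hψ, hψ'⟩ := exists_cutoff (EB := EB) (C := C) hχ
  have h0 : (pull ψ : TotFun EB F E) * (pull χ - 1) = 0 := by
    ext m'
    change ψ m'.1 * (χ m'.1 - 1) = 0
    by_cases h : m'.1 ∈ tsupport ψ
    · rw [show χ m'.1 = 1 from hψ' h, sub_self, mul_zero]
    · rw [image_eq_zero_of_notMem_tsupport h, zero_mul]
  have h1 := hD (pull ψ) (pull χ - 1)
  have h2 : ((pull χ : TotFun EB F E) - 1) m = 0 := by
    change χ m.1 - 1 = 0
    rw [hχ.self_of_nhds, sub_self]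
  have h3 : (pull ψ : TotFun EB F E) m = 1 := hψ.self_of_nhds
  rw [h0, map_zero, h2, h3, mul_zero, zero_add, one_mul, map_sub, derivation_one D m hD,
    sub_zero] at h1
  exact h1.symm

/-- Derivations of the algebra of smooth functions at a point are tangent vectors. -/
theorem derivation_eq {x₀ : C} {m : TotalSpace F E} (hm : m.1 ∈ core EB F E x₀)
    (D : TotFun EB F E →ₗ[ℝ] ℝ) (hD : ∀ f g, D (f * g) = D f * g m + f m * D g)
    (k : TotFun EB F E) :
    D k = ∑ A, D (coordFun F E x₀ A) *
      fderiv ℝ (fun z => k (coordInv F E x₀ z)) (coord x₀ m) (coordBasis EB F A) := by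
  have hmp : m.1 ∈ patch (EB := EB) F E x₀ := core_subset_patch x₀ hm
  set z₁ : EB × F := coord x₀ m with hz₁
  have hz₁t : z₁.1 ∈ patchTarget F E x₀ := extChartAt_mem_patchTarget hmp
  -- The cutoff turns the coordinate expression of `k` into a smooth function on the whole
  -- coordinate space, as Hadamard's lemma requires.
  obtain ⟨β, hβ, hβ'⟩ := exists_cutoff (EB := EB) (C := EB) ((isOpen_patchTarget x₀).mem_nhds hz₁t)
  have hβd : ContDiff ℝ ∞ β := contMDiff_iff_contDiff.1 β.contMDiff
  let K : EB × F → ℝ := fun z => β z.1 * k (coordInv F E x₀ z)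
  have hK : ContDiff ℝ ∞ K := by
    refine contMDiff_iff_contDiff.1 (contMDiff_of_tsupport fun z hz => ?_)
    have hz1 : z.1 ∈ tsupport β :=
      tsupport_comp_subset_preimage β continuous_fst (tsupport_mul_subset_left hz)
    exact (contMDiffAt_iff_contDiffAt.2 (hβd.comp contDiff_fst).contDiffAt).mul
      (k.contMDiff.contMDiffAt.comp z (contMDiffAt_coordInv (hβ' hz1)))
  obtain ⟨G, hG, hG1, hGz⟩ := exists_contDiff_hadamard hK z₁ (coordBasis EB F)
  have hU : core EB F E x₀ ∩ {y | β (extChartAt 𝓘(ℝ, EB) x₀ y) = 1} ∈ 𝓝 m.1 := by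
    refine Filter.inter_mem ((isOpen_core x₀).mem_nhds hm) ?_
    exact (continuousAt_extChartAt' (I := 𝓘(ℝ, EB))
      (by rw [extChartAt_source]; exact hmp.1)).eventually hβ
  obtain ⟨χ, hχ, hχ'⟩ := exists_cutoff (EB := EB) hU
  let g : Fin (Module.finrank ℝ EB) ⊕ Fin (Module.finrank ℝ F) → TotFun EB F E := fun A =>
    ⟨fun m => χ m.1 * G A (coord x₀ m), contMDiff_cutoff_mul_total fun m hm =>
      (contMDiff_iff_contDiff.2 (hG A)).contMDiffAt.comp m
        (contMDiffAt_coord (core_subset_patch x₀ (hχ' hm).1))⟩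
  -- Hadamard's expansion moved back to M. One factor χ sits inside `g A` to make it globally
  -- defined, and the other is explicit, so every term carries χ². The derivation does not see these
  -- factors, by `derivation_pull_eq_zero`.
  have key : (pull χ * pull χ : TotFun EB F E) * k = k m • (pull χ * pull χ) +
      ∑ A, (coordFun F E x₀ A - ((coordBasis EB F).repr z₁ A) • 1) * (pull χ * g A) := by
    ext m'
    have hsum : ∀ f : Fin (Module.finrank ℝ EB) ⊕ Fin (Module.finrank ℝ F) → TotFun EB F E,
        (∑ A, f A) m' = ∑ A, f A m' := fun f =>
      map_sum (⟨⟨fun h => h m', rfl⟩, fun _ _ => rfl⟩ : TotFun EB F E →+ ℝ) f Finset.univ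
    change χ m'.1 * χ m'.1 * k m' = k m * (χ m'.1 * χ m'.1) + _
    rw [hsum]
    change _ = _ + ∑ A, (coordFun F E x₀ A m' - (coordBasis EB F).repr z₁ A * 1) *
      (χ m'.1 * (χ m'.1 * G A (coord x₀ m')))
    by_cases h : m'.1 ∈ tsupport χ
    · obtain ⟨h1, h2⟩ := hχ' h
      have h3 : K (coord x₀ m') = k m' := by
        change β (extChartAt 𝓘(ℝ, EB) x₀ m'.1) * _ = _
        rw [show β _ = 1 from h2, one_mul, coordInv_coord (core_subset_patch x₀ h1)]
      have h4 : K z₁ = k m := by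
        change β z₁.1 * k (coordInv F E x₀ (coord x₀ m)) = _
        rw [hβ.self_of_nhds, one_mul, coordInv_coord hmp]
      have h5 := hGz (coord x₀ m')
      rw [h3, h4] at h5
      simp only [coordFun_apply h1]
      rw [h5, mul_add, Finset.mul_sum]
      congr 1
      · ring
      · exact Finset.sum_congr rfl fun A _ => by ring
    · simp [image_eq_zero_of_notMem_tsupport h]
  have hχ0 := derivation_pull_eq_zero D m hD hχ
  have hχm : (pull χ : TotFun EB F E) m = 1 := hχ.self_of_nhds
  have hχ2 : D (pull χ * pull χ) = 0 := by rw [hD, hχ0]; simp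
  have h1 := congrArg D key
  have hχχm : (pull χ * pull χ : TotFun EB F E) m = 1 := by
    change (pull χ : TotFun EB F E) m * (pull χ : TotFun EB F E) m = 1
    rw [hχm, one_mul]
  rw [hD, hχ2, zero_mul, zero_add, hχχm, one_mul, map_add, map_smul, hχ2, smul_zero, zero_add,
    map_sum] at h1
  rw [h1]
  refine Finset.sum_congr rfl fun A _ => ?_
  have h2 : (coordFun F E x₀ A - ((coordBasis EB F).repr z₁ A) • 1) m = 0 := by
    change coordFun F E x₀ A m - (coordBasis EB F).repr z₁ A * 1 = 0
    rw [coordFun_apply hm, mul_one, sub_self]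
  have h3 : (pull χ * g A : TotFun EB F E) m = fderiv ℝ (fun z => k (coordInv F E x₀ z)) z₁
      (coordBasis EB F A) := by
    change (pull χ : TotFun EB F E) m * (χ m.1 * G A (coord x₀ m)) = _
    rw [hχm, show χ m.1 = 1 from hχm, one_mul, one_mul, ← hz₁, hG1]
    have : K =ᶠ[𝓝 z₁] fun z => k (coordInv F E x₀ z) := by
      filter_upwards [continuousAt_fst.eventually hβ] with z hz
      change β z.1 * _ = _
      rw [hz, one_mul]
    rw [this.fderiv_eq]
  rw [hD, h2, h3, zero_mul, add_zero, map_sub, map_smul, derivation_one D m hD, smul_zero, sub_zero]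

end Coiso

namespace Coiso

variable {EB F C : Type*} [NormedAddCommGroup EB] [NormedSpace ℝ EB] [FiniteDimensional ℝ EB]
    [NormedAddCommGroup F] [NormedSpace ℝ F] [FiniteDimensional ℝ F]
    [TopologicalSpace C] [ChartedSpace EB C] [T2Space C]
    {E : C → Type*} [TopologicalSpace (TotalSpace F E)]
    [∀ x, AddCommGroup (E x)] [∀ x, Module ℝ (E x)] [∀ x, TopologicalSpace (E x)]
    [FiberBundle F E] [VectorBundle ℝ F E]
    [IsManifold 𝓘(ℝ, EB) ∞ C] [ContMDiffVectorBundle ∞ F E 𝓘(ℝ, EB)]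

/-! ## Germs of functions on the total space -/

variable (EB) in
/-- The coordinates of a point of the base in the chart at that point. -/
noncomputable def center (x₀ : C) : EB := extChartAt 𝓘(ℝ, EB) x₀ x₀

theorem eventually_patchTarget (x₀ : C) :
    ∀ᶠ z in 𝓝 (center EB x₀, (0 : F)), z.1 ∈ patchTarget F E x₀ :=
  eventually_mem_patchTarget x₀ 0

theorem eventually_coordInv {x₀ : C} {p : C → Prop} (hp : ∀ᶠ x in 𝓝 x₀, p x) :
    ∀ᶠ z in 𝓝 (center EB x₀, (0 : F)), z.1 ∈ patchTarget F E x₀ ∧ p (coordInv F E x₀ z).1 := by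
  have h1 : ContinuousAt (fun z : EB × F => (extChartAt 𝓘(ℝ, EB) x₀).symm z.1)
      (center EB x₀, (0 : F)) :=
    ContinuousAt.comp (f := Prod.fst) (continuousAt_extChartAt_symm x₀) continuousAt_fst
  have h2 := h1.eventually (p := p) (by
    change ∀ᶠ x in 𝓝 ((extChartAt 𝓘(ℝ, EB) x₀).symm (extChartAt 𝓘(ℝ, EB) x₀ x₀)), p x
    rwa [extChartAt_to_inv])
  filter_upwards [h2, eventually_patchTarget (E := E) x₀] with z hz hz'
  exact ⟨hz', by rwa [coordInv_proj hz']⟩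

variable (E) in
/-- A function on the total space in local coordinates. -/
noncomputable def toCoord (x₀ : C) : TotFun EB F E →ₐ[ℝ] smoothAt (center EB x₀, (0 : F)) where
  toFun h := ⟨fun z => h (coordInv F E x₀ z), contMDiffAt_iff_contDiffAt.1
    (h.contMDiff.contMDiffAt.comp _
      (contMDiffAt_coordInv (extChartAt_mem_patchTarget (mem_patch x₀))))⟩
  map_one' := rfl
  map_mul' _ _ := rfl
  map_zero' := rfl
  map_add' _ _ := rfl
  commutes' _ := rfl

variable (E) in
/-- The germ of a function on the total space in local coordinates. -/
noncomputable def gm (x₀ : C) : TotFun EB F E →ₐ[ℝ] SmoothGerm (center EB x₀, (0 : F)) :=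
  (germ _).comp (toCoord E x₀)

theorem gm_congr {x₀ : C} {h k : TotFun EB F E} (hk : ∀ᶠ x in 𝓝 x₀, ∀ e : E x, h ⟨x, e⟩ = k ⟨x, e⟩) :
    gm E x₀ h = gm E x₀ k := by
  refine SmoothGerm.germ_eq.2 ?_
  filter_upwards [eventually_coordInv (EB := EB) (F := F) (E := E) hk] with z hz
  exact hz.2 _

theorem eval_gm (x₀ : C) (h : TotFun EB F E) :
    SmoothGerm.eval _ (gm E x₀ h) = h ⟨x₀, 0⟩ := by
  have h0 := extChartAt_mem_patchTarget (mem_patch (EB := EB) (F := F) (E := E) x₀)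
  refine congrArg h ((coordInv_eq (z := (center EB x₀, (0 : F))) h0).trans ?_)
  have : (extChartAt 𝓘(ℝ, EB) x₀).symm (center EB x₀) = x₀ := extChartAt_to_inv x₀
  dsimp only
  rw [this, ← Bundle.Trivialization.coe_symmₗ (R := ℝ) _ (mem_patch (EB := EB) x₀).2, map_zero]

theorem contDiffAt_coordBasis_coord (B) (z : EB × F) :
    ContDiffAt ℝ ∞ (fun z => LinearMap.toContinuousLinearMap ((coordBasis EB F).coord B) z) z :=
  (LinearMap.toContinuousLinearMap ((coordBasis EB F).coord B)).contDiff.contDiffAt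

/-- Near the centre the cutoff is one, so the germ of `coordFun` is the linear coordinate itself. -/
theorem deriv_gm_coordFun (x₀ : C) (A B) :
    SmoothGerm.deriv (coordBasis EB F A) (gm E x₀ (coordFun F E x₀ B)) =
      if A = B then 1 else 0 := by
  have h1 : gm E x₀ (coordFun F E x₀ B) = germ (center EB x₀, (0 : F))
      ⟨fun z => LinearMap.toContinuousLinearMap ((coordBasis EB F).coord B) z,
        contDiffAt_coordBasis_coord B _⟩ := by
    refine SmoothGerm.germ_eq.2 ?_
    filter_upwards [eventually_coordInv (EB := EB) (F := F) (E := E)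
      (core_mem_nhds (EB := EB) (F := F) (E := E) x₀)] with z hz
    exact (coordFun_apply hz.2 B).trans (by rw [coord_coordInv hz.1]; rfl)
  rw [h1, SmoothGerm.deriv_germ]
  have h2 : SmoothGerm.derivFun (coordBasis EB F A)
      (⟨fun z => LinearMap.toContinuousLinearMap ((coordBasis EB F).coord B) z,
        contDiffAt_coordBasis_coord B _⟩ :
        smoothAt (center EB x₀, (0 : F))) = if A = B then 1 else 0 := by
    ext z
    change fderiv ℝ (LinearMap.toContinuousLinearMap ((coordBasis EB F).coord B)) z _ = _
    rw [ContinuousLinearMap.fderiv]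
    change (coordBasis EB F).repr (coordBasis EB F A) B = _
    rw [Module.Basis.repr_self, Finsupp.single_apply]
    split_ifs <;> rfl
  rw [h2]
  split_ifs <;> simp

/-- The Poisson bracket in local coordinates. -/
theorem gm_bracket (P : PoissonBracket (TotFun EB F E)) (x₀ : C) (h k : TotFun EB F E) :
    gm E x₀ (P.bracket h k) = ∑ A, ∑ B,
      gm E x₀ (P.bracket (coordFun F E x₀ A) (coordFun F E x₀ B)) *
        SmoothGerm.deriv (coordBasis EB F A) (gm E x₀ h) *
        SmoothGerm.deriv (coordBasis EB F B) (gm E x₀ k) := by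
  simp only [gm, AlgHom.comp_apply, SmoothGerm.deriv_germ, ← map_mul, ← map_sum]
  refine SmoothGerm.germ_eq.2 ?_
  filter_upwards [eventually_coordInv (EB := EB) (F := F) (E := E)
    (core_mem_nhds (EB := EB) (F := F) (E := E) x₀)] with z hz
  let evm : TotFun EB F E →ₗ[ℝ] ℝ :=
    ⟨⟨fun h => h (coordInv F E x₀ z), fun _ _ => rfl⟩, fun _ _ => rfl⟩
  -- The bracket is a derivation in its second argument at each nearby point; `h2` then uses
  -- skew-symmetry to expand the first argument as well.
  have h1 := fun h => derivation_eq hz.2 (evm ∘ₗ P.bracket h)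
    (fun f g => by
      change (P.bracket h (f * g)) (coordInv F E x₀ z) = _
      rw [P.leibniz]; rfl)
  have h2 : ∀ B, evm (P.bracket h (coordFun F E x₀ B)) = ∑ A, evm (P.bracket (coordFun F E x₀ A)
      (coordFun F E x₀ B)) * fderiv ℝ (fun z => h (coordInv F E x₀ z)) z (coordBasis EB F A) :=
    fun B => by
      have := h1 (coordFun F E x₀ B) h
      simp only [LinearMap.comp_apply, coord_coordInv hz.1] at this
      rw [P.skew, map_neg, this, ← Finset.sum_neg_distrib]
      exact Finset.sum_congr rfl fun A _ => by
        rw [P.skew (coordFun F E x₀ A), map_neg, neg_mul]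
  have h3 := h1 h k
  simp only [LinearMap.comp_apply, coord_coordInv hz.1] at h3
  change evm (P.bracket h k) = (∑ A, ∑ B, _ : smoothAt (center EB x₀, (0 : F))).1 z
  rw [h3]
  simp only [h2, AddSubmonoidClass.coe_finsetSum, Finset.sum_apply, Finset.sum_mul]
  rw [Finset.sum_comm]
  rfl

/-- Restriction to the zero section. -/
theorem gm_pull_restr (x₀ : C) (h : TotFun EB F E) :
    gm E x₀ (pull (restr h)) = SmoothGerm.comp LocalPhase.toZeroSection
      (LocalPhase.toZeroSection_base (center EB x₀)) (gm E x₀ h) := by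
  rw [gm, AlgHom.comp_apply, AlgHom.comp_apply, SmoothGerm.comp_germ, SmoothGerm.germ_eq]
  filter_upwards [eventually_patchTarget (EB := EB) (F := F) (E := E) x₀] with z hz
  change h ⟨(coordInv F E x₀ z).1, 0⟩ = h (coordInv F E x₀ (z.1, 0))
  rw [coordInv_proj hz, coordInv_eq (z := (z.1, 0)) hz]
  dsimp only
  rw [← Bundle.Trivialization.coe_symmₗ (R := ℝ) _ hz.2, map_zero]

/-- Vertical derivatives in local coordinates. -/
theorem gm_vert (x₀ : C) (v : Sec EB F E) (h : TotFun EB F E) :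
    gm E x₀ (vert v h) = ∑ j, gm E x₀ (pull (pairing v (fibreCoord EB E x₀ j))) *
      SmoothGerm.deriv (coordBasis EB F (Sum.inr j)) (gm E x₀ h) := by
  simp only [gm, AlgHom.comp_apply, SmoothGerm.deriv_germ, ← map_mul, ← map_sum]
  refine SmoothGerm.germ_eq.2 ?_
  filter_upwards [eventually_coordInv (EB := EB) (F := F) (E := E)
    (core_mem_nhds (EB := EB) (F := F) (E := E) x₀)] with z hz
  set y : C := (extChartAt 𝓘(ℝ, EB) x₀).symm z.1 with hy
  have hyb : y ∈ (trivializationAt F E x₀).baseSet := hz.1.2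
  have hyc : y ∈ core EB F E x₀ := by have := hz.2; rwa [coordInv_proj hz.1] at this
  set w : F := (trivializationAt F E x₀ ⟨y, v y⟩).2 with hw
  have hvw : v y = (trivializationAt F E x₀).symmₗ ℝ y w :=
    by rw [Bundle.Trivialization.coe_symmₗ _ hyb]
       exact ((trivializationAt F E x₀).symm_apply_apply_mk hyb (v y)).symm
  let H : EB × F → ℝ := fun z => h (coordInv F E x₀ z)
  have hd : DifferentiableAt ℝ H z :=
    (contMDiffAt_iff_contDiffAt.1 (h.contMDiff.contMDiffAt.comp z
      (contMDiffAt_coordInv hz.1))).differentiableAt (by simp)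
  have h1 : vert v h (coordInv F E x₀ z) = fderiv ℝ H z (0, w) := by
    rw [coordInv_eq hz.1]
    change deriv (fun t : ℝ => h ⟨y, (trivializationAt F E x₀).symm y z.2 + t • v y⟩) 0 = _
    have h2 : (fun t : ℝ => h ⟨y, (trivializationAt F E x₀).symm y z.2 + t • v y⟩) =
        fun t : ℝ => H (z + t • (0, w)) := by
      funext t
      have hzt : (z + t • ((0 : EB), w)).1 = z.1 := by simp
      have hz' : (z + t • ((0 : EB), w)).1 ∈ patchTarget F E x₀ := by rw [hzt]; exact hz.1
      change _ = h (coordInv F E x₀ _)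
      rw [coordInv_eq hz', hzt, hvw, ← hy, ← Bundle.Trivialization.coe_symmₗ (R := ℝ) _ hyb, ← map_smul,
        ← map_add]
      rfl
    rw [h2]
    have h3 : HasDerivAt (fun t : ℝ => z + t • ((0 : EB), w)) (0, w) 0 := by
      simpa using ((hasDerivAt_id (0 : ℝ)).smul_const ((0 : EB), w)).const_add z
    have h4 : HasFDerivAt H (fderiv ℝ H z) (z + (0 : ℝ) • ((0 : EB), w)) := by
      rw [zero_smul, add_zero]; exact hd.hasFDerivAt
    exact (h4.comp_hasDerivAt (0 : ℝ) h3).deriv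
  have h5 : ((0 : EB), w) = ∑ j, (Module.finBasis ℝ F).repr w j • coordBasis EB F (Sum.inr j) := by
    have : coordBasis EB F ∘ Sum.inr = LinearMap.inr ℝ EB F ∘ Module.finBasis ℝ F := by
      ext j <;> simp [coordBasis]
    have h6 := congrArg (LinearMap.inr ℝ EB F) ((Module.finBasis ℝ F).sum_repr w)
    rw [map_sum] at h6
    refine h6.symm.trans (Finset.sum_congr rfl fun j _ => ?_)
    rw [map_smul]
    exact congrArg _ (congrFun this j).symm
  change vert v h (coordInv F E x₀ z) = (∑ j, _ : smoothAt (center EB x₀, (0 : F))).1 z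
  rw [h1, h5, map_sum]
  simp only [AddSubmonoidClass.coe_finsetSum, Finset.sum_apply]
  refine Finset.sum_congr rfl fun j _ => ?_
  rw [map_smul, smul_eq_mul]
  congr 1
  change _ = bump (EB := EB) F E x₀ (coordInv F E x₀ z).1 *
    (Module.finBasis ℝ F).coord j (trivializationAt F E x₀ ⟨(coordInv F E x₀ z).1, v _⟩).2
  rw [bump_of_mem_core hz.2, one_mul, coordInv_proj hz.1]
  rfl

end Coiso

namespace Coiso

variable {EB F C : Type*} [NormedAddCommGroup EB] [NormedSpace ℝ EB] [FiniteDimensional ℝ EB]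
    [NormedAddCommGroup F] [NormedSpace ℝ F] [FiniteDimensional ℝ F]
    [TopologicalSpace C] [ChartedSpace EB C] [T2Space C]
    {E : C → Type*} [TopologicalSpace (TotalSpace F E)]
    [∀ x, AddCommGroup (E x)] [∀ x, Module ℝ (E x)] [∀ x, TopologicalSpace (E x)]
    [FiberBundle F E] [VectorBundle ℝ F E]
    [IsManifold 𝓘(ℝ, EB) ∞ C] [ContMDiffVectorBundle ∞ F E 𝓘(ℝ, EB)]

/-! ## The phase algebra at a point -/

/-- The inclusion of the germs of functions into the germs of multivector fields. -/
noncomputable def ofGerm (x₁ : EB) : SmoothGerm (x₁, (0 : F)) →ₐ[ℝ] LocalPhase F x₁ :=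
  Algebra.TensorProduct.includeRight

variable (EB F) in
/-- The algebra of germs of multivector fields at a point of the zero section. -/
noncomputable abbrev phase (x₀ : C) : PInfty.PhaseAlgebra (LocalPhase F (center EB x₀))
    (Fin (Module.finrank ℝ EB)) (Fin (Module.finrank ℝ F)) :=
  LocalPhase.phaseAlgebra (Module.finBasis ℝ EB) (Module.finBasis ℝ F)

variable (E) in
/-- A function on the total space as an element of the phase algebra. -/
noncomputable def fn (x₀ : C) : TotFun EB F E →ₐ[ℝ] LocalPhase F (center EB x₀) :=
  (ofGerm _).comp (gm E x₀)

theorem fn_apply (x₀ : C) (h : TotFun EB F E) : fn E x₀ h = LocalPhase.tmul 1 (gm E x₀ h) := rfl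

theorem fn_congr {x₀ : C} {h k : TotFun EB F E} (hk : ∀ᶠ x in 𝓝 x₀, ∀ e : E x, h ⟨x, e⟩ = k ⟨x, e⟩) :
    fn E x₀ h = fn E x₀ k := by
  rw [fn_apply, fn_apply, gm_congr hk]

theorem isFn_tmul_one (x₀ : C) (s : SmoothGerm (center EB x₀, (0 : F))) :
    (phase EB F x₀).IsFn (LocalPhase.tmul 1 s) where
  γ := by
    change LocalPhase.γ _ = _
    rw [LocalPhase.γ_tmul, map_one]
  i A := by
    change LocalPhase.contract _ _ = _
    rw [LocalPhase.contract_tmul, ← map_one (algebraMap ℝ _), ExtAlg.contract_algebraMap, map_zero,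
      LinearMap.zero_apply]

theorem isFn_fn (x₀ : C) (h : TotFun EB F E) : (phase EB F x₀).IsFn (fn E x₀ h) :=
  isFn_tmul_one x₀ _

theorem p_fn (x₀ : C) (h : TotFun EB F E) :
    (phase EB F x₀).p (fn E x₀ h) = fn E x₀ (pull (restr h)) := by
  rw [fn_apply, fn_apply, gm_pull_restr]
  change LocalPhase.proj _ = _
  rw [LocalPhase.proj_tmul, map_one]

theorem restr_pull (f : BaseFun EB C) : restr (pull f : TotFun EB F E) = f := rfl

theorem p_fn_pull (x₀ : C) (f : BaseFun EB C) :
    (phase EB F x₀).p (fn E x₀ (pull f)) = fn E x₀ (pull f) := by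
  rw [p_fn, restr_pull]

theorem p_fn_conormal (x₀ : C) (u : Conormal EB F E) : (phase EB F x₀).p (fn E x₀ u.toFun) = 0 := by
  have : pull (restr u.toFun) = (0 : TotFun EB F E) := by
    ext m
    exact (u.linear m.1).map_zero
  rw [p_fn, this, map_zero]

theorem d_fn (x₀ : C) (h : TotFun EB F E) (A) :
    (phase EB F x₀).d A (fn E x₀ h) =
      LocalPhase.tmul 1 (SmoothGerm.deriv (coordBasis EB F A) (gm E x₀ h)) := rfl

theorem d_fn_coordFun (x₀ : C) (A B) :
    (phase EB F x₀).d A (fn E x₀ (coordFun F E x₀ B)) = if A = B then 1 else 0 := by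
  rw [d_fn, deriv_gm_coordFun]
  split_ifs
  · rfl
  · rw [map_zero]

theorem paramContract_fn (x₀ : C) (h : TotFun EB F E) (k : ℕ) :
    LocalPhase.paramContract k (fn E x₀ h) = 0 := by
  rw [fn_apply, LocalPhase.paramContract, LocalPhase.contract_tmul, ← map_one (algebraMap ℝ _),
    ExtAlg.contract_algebraMap, map_zero, LinearMap.zero_apply]

theorem paramContract_e (x₀ : C) (A) (k : ℕ) :
    LocalPhase.paramContract k ((phase EB F x₀).e A) = 0 := by
  refine (LocalPhase.contract_vec _ _).trans ?_
  simp

/-! ## The Poisson bivector field -/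

section

variable (P : PoissonBracket (TotFun EB F E)) (x₀ : C)

/-- The germ of the Poisson bivector field. -/
noncomputable def bivec : LocalPhase F (center EB x₀) :=
  (phase EB F x₀).bivector fun A B => fn E x₀ (P.bracket (coordFun F E x₀ A) (coordFun F E x₀ B))

theorem γ_bivec : (phase EB F x₀).γ (bivec P x₀) = bivec P x₀ :=
  PInfty.PhaseAlgebra.γ_bivector fun _ _ => isFn_fn _ _

theorem deg_bivec : (phase EB F x₀).Deg 2 (bivec P x₀) :=
  PInfty.PhaseAlgebra.deg_bivector fun _ _ => isFn_fn _ _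

theorem paramContract_bivec (k : ℕ) : LocalPhase.paramContract k (bivec P x₀) = 0 := by
  have hm : ∀ x y : LocalPhase F (center EB x₀), LocalPhase.paramContract k x = 0 →
      LocalPhase.paramContract k y = 0 → LocalPhase.paramContract k (x * y) = 0 := fun x y hx hy => by
    rw [LocalPhase.paramContract, LocalPhase.contract_mul]
    change LocalPhase.paramContract k x * y + _ * LocalPhase.paramContract k y = 0
    rw [hx, hy, zero_mul, mul_zero, add_zero]
  rw [bivec, PInfty.PhaseAlgebra.bivector, map_smul, map_sum]
  simp only [map_sum, hm _ _ (paramContract_fn _ _ _) (hm _ _ (paramContract_e _ _ _)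
    (paramContract_e _ _ _)), Finset.sum_const_zero, smul_zero]

theorem fn_bracket (h k : TotFun EB F E) :
    fn E x₀ (P.bracket h k) = ∑ A, ∑ B,
      fn E x₀ (P.bracket (coordFun F E x₀ A) (coordFun F E x₀ B)) *
        (phase EB F x₀).d A (fn E x₀ h) * (phase EB F x₀).d B (fn E x₀ k) := by
  have := congrArg (ofGerm _) (gm_bracket P x₀ h k)
  simp only [map_sum, map_mul] at this
  exact this

theorem skew_bivec (A B) : fn E x₀ (P.bracket (coordFun F E x₀ A) (coordFun F E x₀ B)) =
    -fn E x₀ (P.bracket (coordFun F E x₀ B) (coordFun F E x₀ A)) := by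
  rw [P.skew, map_neg]

theorem grad_grad_bivec (h k : TotFun EB F E) :
    (phase EB F x₀).grad (fn E x₀ k) ((phase EB F x₀).grad (fn E x₀ h) (bivec P x₀)) =
      fn E x₀ (P.bracket h k) := by
  rw [bivec, PInfty.PhaseAlgebra.grad_grad_bivector (fun _ _ => isFn_fn _ _) (skew_bivec P x₀)
    (isFn_fn _ _), fn_bracket]

theorem schouten_bivec : (phase EB F x₀).schouten (bivec P x₀) (bivec P x₀) = 0 := by
  refine PInfty.PhaseAlgebra.schouten_bivector (fun _ _ => isFn_fn _ _) (skew_bivec P x₀)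
    fun A B D => ?_
  have h := P.jacobi (coordFun F E x₀ A) (coordFun F E x₀ B) (coordFun F E x₀ D)
  -- For a bracket with a coordinate function the double sum collapses, because derivatives of
  -- coordinates are Kronecker deltas as germs.
  have h1 : ∀ A k, fn E x₀ (P.bracket (coordFun F E x₀ A) k) = ∑ C,
      fn E x₀ (P.bracket (coordFun F E x₀ A) (coordFun F E x₀ C)) *
        (phase EB F x₀).d C (fn E x₀ k) := fun A k => by
    rw [fn_bracket, Finset.sum_eq_single A]
    · simp only [d_fn_coordFun, if_true, mul_one]
    · intro B _ hB
      simp only [d_fn_coordFun, if_neg hB, mul_zero, zero_mul, Finset.sum_const_zero]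
    · simp
  have h2 := congrArg (fn E x₀) h
  simp only [map_add, map_zero] at h2
  rw [h1 A (P.bracket _ _), h1 B (P.bracket _ _), h1 D (P.bracket _ _)] at h2
  rw [← neg_eq_zero, ← h2, ← Finset.sum_add_distrib, ← Finset.sum_add_distrib,
    ← Finset.sum_neg_distrib]
  refine Finset.sum_congr rfl fun C _ => ?_
  rw [skew_bivec P x₀ C D, skew_bivec P x₀ C A, skew_bivec P x₀ C B]
  noncomm_ring

/-! ## Iterated Lie derivatives -/

/-- The germ of the vertical vector field of a section. -/
noncomputable def vecField (v : Sec EB F E) : LocalPhase F (center EB x₀) :=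
  ∑ j, fn E x₀ (pull (pairing v (fibreCoord EB E x₀ j))) * (phase EB F x₀).e (Sum.inr j)

theorem i_inr_vecField (v : Sec EB F E) (j) :
    (phase EB F x₀).i (Sum.inr j) (vecField x₀ v) =
      fn E x₀ (pull (pairing v (fibreCoord EB E x₀ j))) := by
  simp only [vecField, map_sum, PInfty.PhaseAlgebra.i_mul, (isFn_fn _ _).i, (isFn_fn _ _).γ,
    PInfty.PhaseAlgebra.i_e, zero_mul, zero_add, Sum.inr.injEq, mul_ite, mul_one, mul_zero,
    Finset.sum_ite_eq, Finset.mem_univ, if_true]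

theorem isVec_vecField (v : Sec EB F E) : (phase EB F x₀).IsVec (vecField x₀ v) where
  γ := by
    simp only [vecField, map_sum, map_mul, (isFn_fn _ _).γ, PInfty.PhaseAlgebra.γ_e, mul_neg,
      Finset.sum_neg_distrib]
  p := by
    simp only [vecField, map_sum, map_mul, p_fn_pull, PInfty.PhaseAlgebra.p_e_inr]
  i A B := by
    have h : ∀ j, (phase EB F x₀).i B (fn E x₀ (pull (pairing v (fibreCoord EB E x₀ j))) *
        (phase EB F x₀).e (Sum.inr j)) = if B = Sum.inr j then
          fn E x₀ (pull (pairing v (fibreCoord EB E x₀ j))) else 0 := fun j => by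
      rw [PInfty.PhaseAlgebra.i_mul, (isFn_fn _ _).i, (isFn_fn _ _).γ,
        PInfty.PhaseAlgebra.i_e, zero_mul, zero_add, mul_ite, mul_one, mul_zero]
    rw [vecField, map_sum, map_sum]
    refine Finset.sum_eq_zero fun j _ => ?_
    rw [h]
    split_ifs
    · exact (isFn_fn _ _).i A
    · exact map_zero _

theorem K_vecField (v : Sec EB F E) (h : TotFun EB F E) :
    (phase EB F x₀).K (vecField x₀ v) (fn E x₀ h) = fn E x₀ (vert v h) := by
  have := congrArg (ofGerm _) (gm_vert x₀ v h)
  simp only [map_sum, map_mul] at this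
  rw [PInfty.PhaseAlgebra.K_vec_apply_isFn (isVec_vecField _ _) (isFn_fn _ _)]
  simp only [i_inr_vecField]
  exact this.symm

/-- Solving Cartan's formula for the contraction of `K v X`, once for each of the two functions,
gives the same three-term recursion that defines `lieD`. -/
theorem grad_grad_word (l : List (Sec EB F E)) (h k : TotFun EB F E) :
    (phase EB F x₀).grad (fn E x₀ k) ((phase EB F x₀).grad (fn E x₀ h)
      ((phase EB F x₀).word (l.map (vecField x₀)) (bivec P x₀))) =
        fn E x₀ (l.foldr lieD (fun f g => P.bracket f g) h k) := by
  induction l generalizing h k with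
  | nil => exact grad_grad_bivec P x₀ h k
  | cons v l ih =>
    have hv := isVec_vecField x₀ v
    rw [List.map_cons, PInfty.PhaseAlgebra.word_cons, List.foldr_cons]
    have h1 : ∀ X, (phase EB F x₀).grad (fn E x₀ h) ((phase EB F x₀).K (vecField x₀ v) X) =
        (phase EB F x₀).K (vecField x₀ v) ((phase EB F x₀).grad (fn E x₀ h) X) -
          (phase EB F x₀).grad (fn E x₀ (vert v h)) X := fun X => by
      rw [PInfty.PhaseAlgebra.K_grad hv (isFn_fn _ _), K_vecField, add_sub_cancel_left]
    have h2 : ∀ X, (phase EB F x₀).grad (fn E x₀ k) ((phase EB F x₀).K (vecField x₀ v) X) =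
        (phase EB F x₀).K (vecField x₀ v) ((phase EB F x₀).grad (fn E x₀ k) X) -
          (phase EB F x₀).grad (fn E x₀ (vert v k)) X := fun X => by
      rw [PInfty.PhaseAlgebra.K_grad hv (isFn_fn _ _), K_vecField, add_sub_cancel_left]
    rw [h1, map_sub, h2, ih, ih, ih, K_vecField]
    simp only [lieD, map_sub]
    abel

theorem grad_grad_iterLieD {n : ℕ} (v : Fin n → Sec EB F E) (h k : TotFun EB F E) :
    (phase EB F x₀).grad (fn E x₀ k) ((phase EB F x₀).grad (fn E x₀ h)
      ((phase EB F x₀).word (List.ofFn fun i => vecField x₀ (v i)) (bivec P x₀))) =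
        fn E x₀ (iterLieD P v h k) := by
  rw [iterLieD, ← grad_grad_word, List.map_ofFn]
  rfl

end

end Coiso

/-! ## Germs of maps to an exterior algebra -/

section SmoothExt

variable {EB F : Type*} [NormedAddCommGroup EB] [NormedSpace ℝ EB] [NormedAddCommGroup F]
  [NormedSpace ℝ F] [FiniteDimensional ℝ F]

variable (F) in
/-- A basis of the exterior algebra. -/
noncomputable def extBasis :
    Module.Basis (Fin (Module.finrank ℝ (ExteriorAlgebra ℝ F))) ℝ (ExteriorAlgebra ℝ F) :=
  haveI := Coiso.finite_exteriorAlgebra F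
  Module.finBasis ℝ _

variable (F) in
/-- The maps to the exterior algebra which are smooth at a point. -/
def smoothExtAt (x₁ : EB) : Subalgebra ℝ (EB → ExteriorAlgebra ℝ F) where
  carrier := {q | ∀ φ : Module.Dual ℝ (ExteriorAlgebra ℝ F), ContDiffAt ℝ ∞ (fun z => φ (q z)) x₁}
  add_mem' {q q'} hq hq' φ := by
    simp only [Pi.add_apply, map_add]
    exact (hq φ).add (hq' φ)
  mul_mem' {q q'} hq hq' φ := by
    have key : ∀ z, φ (q z * q' z) = ∑ I, ∑ J, (extBasis F).coord I (q z) *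
        (extBasis F).coord J (q' z) * φ (extBasis F I * extBasis F J) := fun z => by
      conv_lhs => rw [← (extBasis F).sum_repr (q z), ← (extBasis F).sum_repr (q' z)]
      rw [Finset.sum_mul_sum]
      simp only [map_sum, smul_mul_smul_comm, map_smul, smul_eq_mul, Module.Basis.coord_apply]
    simp only [Pi.mul_apply, key]
    exact ContDiffAt.sum fun I _ => ContDiffAt.sum fun J _ =>
      ((hq _).mul (hq' _)).mul contDiffAt_const
  algebraMap_mem' c φ := by
    simp only [Pi.algebraMap_apply]
    exact contDiffAt_const

theorem contDiffAt_of_mem {x₁ : EB} (q : smoothExtAt F x₁)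
    (φ : Module.Dual ℝ (ExteriorAlgebra ℝ F)) : ContDiffAt ℝ ∞ (fun z => φ (q.1 z)) x₁ := q.2 φ

namespace SmoothExt

variable {x₁ : EB}

/-- The composition with a linear map. -/
def postcomp (Φ : ExteriorAlgebra ℝ F →ₗ[ℝ] ExteriorAlgebra ℝ F) :
    smoothExtAt F x₁ →ₗ[ℝ] smoothExtAt F x₁ where
  toFun q := ⟨fun z => Φ (q.1 z), fun φ => contDiffAt_of_mem q (φ ∘ₗ Φ)⟩
  map_add' _ _ := Subtype.ext (funext fun _ => map_add Φ _ _)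
  map_smul' c _ := Subtype.ext (funext fun _ => map_smul Φ c _)

/-- A coefficient. -/
def coeff (φ : Module.Dual ℝ (ExteriorAlgebra ℝ F)) : smoothExtAt F x₁ →ₗ[ℝ] smoothAt x₁ where
  toFun q := ⟨fun z => φ (q.1 z), contDiffAt_of_mem q φ⟩
  map_add' _ _ := Subtype.ext (funext fun _ => map_add φ _ _)
  map_smul' c _ := Subtype.ext (funext fun _ => map_smul φ c _)

variable (F x₁) in
/-- The pullback of functions on the base. -/
noncomputable def baseGerm : smoothAt x₁ →ₐ[ℝ] SmoothGerm (x₁, (0 : F)) :=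
  (germ _).comp
    { toFun := fun f => ⟨fun z => f.1 z.1,
        (ContDiffAt.comp (x₁, (0 : F)) (f := Prod.fst) (smoothAt_contDiffAt f) contDiffAt_fst :)⟩
      map_one' := rfl
      map_mul' := fun _ _ => rfl
      map_zero' := rfl
      map_add' := fun _ _ => rfl
      commutes' := fun _ => rfl }

theorem baseGerm_eq {f g : smoothAt x₁} (h : f.1 =ᶠ[𝓝 x₁] g.1) :
    baseGerm F x₁ f = baseGerm F x₁ g :=
  SmoothGerm.germ_eq.2 ((continuousAt_fst (p := (x₁, (0 : F)))).eventually h)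

theorem comp_baseGerm (f : smoothAt x₁) :
    SmoothGerm.comp LocalPhase.toZeroSection (LocalPhase.toZeroSection_base x₁) (baseGerm F x₁ f) =
      baseGerm F x₁ f := rfl

variable (EB F) in
/-- The inclusion of the vertical multivectors. -/
noncomputable def incl :
    ExteriorAlgebra ℝ F →ₐ[ℝ] ExteriorAlgebra ℝ ((EB × F) × (ℕ →₀ ℝ)) :=
  ExteriorAlgebra.map (LinearMap.inl ℝ (EB × F) (ℕ →₀ ℝ) ∘ₗ LinearMap.inr ℝ EB F)

/-- The germ of a map to the exterior algebra as a vertical multivector field. -/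
noncomputable def lcLin : smoothExtAt F x₁ →ₗ[ℝ] LocalPhase F x₁ :=
  ∑ I, LocalPhase.tmul (incl EB F (extBasis F I)) ∘ₗ (baseGerm F x₁).toLinearMap ∘ₗ
    coeff ((extBasis F).coord I)

theorem lcLin_apply (q : smoothExtAt F x₁) : lcLin q = ∑ I,
    LocalPhase.tmul (incl EB F (extBasis F I)) (baseGerm F x₁ (coeff ((extBasis F).coord I) q)) := by
  simp [lcLin]

/-- Any local expansion with constant multivectors computes the germ, not just the one in the fixed
basis. Multiplicativity and the identification of generators both use expansions other than the
basis one. -/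
theorem lcLin_eq_sum {ι : Type*} [Fintype ι] {q : smoothExtAt F x₁} {s : ι → smoothAt x₁}
    {c : ι → ExteriorAlgebra ℝ F} (h : ∀ᶠ z in 𝓝 x₁, q.1 z = ∑ k, (s k).1 z • c k) :
    lcLin q = ∑ k, LocalPhase.tmul (incl EB F (c k)) (baseGerm F x₁ (s k)) := by
  have h1 : ∀ I, baseGerm F x₁ (coeff ((extBasis F).coord I) q) =
      ∑ k, (extBasis F).repr (c k) I • baseGerm F x₁ (s k) := fun I => by
    simp only [← map_smul, ← map_sum]
    refine baseGerm_eq ?_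
    filter_upwards [h] with z hz
    change (extBasis F).coord I (q.1 z) = (∑ k, _ : smoothAt x₁).1 z
    rw [hz]
    simp only [map_sum, map_smul, AddSubmonoidClass.coe_finsetSum, Finset.sum_apply, smul_eq_mul,
      Module.Basis.coord_apply]
    exact Finset.sum_congr rfl fun k _ => mul_comm _ _
  have h2 : ∀ k, LocalPhase.tmul (incl EB F (c k)) (baseGerm F x₁ (s k)) =
      ∑ I, (extBasis F).repr (c k) I • LocalPhase.tmul (incl EB F (extBasis F I))
        (baseGerm F x₁ (s k)) := fun k => by
    conv_lhs => rw [← (extBasis F).sum_repr (c k)]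
    simp only [map_sum, map_smul, LinearMap.sum_apply, LinearMap.smul_apply]
  rw [lcLin_apply]
  simp only [h1, h2, map_sum, map_smul]
  rw [Finset.sum_comm]

theorem coeff_sum (q : smoothExtAt F x₁) (z : EB) :
    q.1 z = ∑ I, (coeff ((extBasis F).coord I) q).1 z • extBasis F I :=
  ((extBasis F).sum_repr (q.1 z)).symm

theorem lcLin_congr {q q' : smoothExtAt F x₁} (h : q.1 =ᶠ[𝓝 x₁] q'.1) : lcLin q = lcLin q' := by
  rw [lcLin_apply q']
  refine lcLin_eq_sum ?_
  filter_upwards [h] with z hz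
  rw [hz, coeff_sum]

theorem lcLin_one : lcLin (1 : smoothExtAt F x₁) = 1 := by
  have := lcLin_eq_sum (q := (1 : smoothExtAt F x₁)) (s := fun _ : Unit => 1) (c := fun _ => 1)
    (Filter.Eventually.of_forall fun z => by
      change (1 : ExteriorAlgebra ℝ F) = ∑ _ : Unit, (1 : ℝ) • (1 : ExteriorAlgebra ℝ F)
      simp)
  rw [this]
  simp [LocalPhase.one_def]

theorem lcLin_mul (q q' : smoothExtAt F x₁) : lcLin (q * q') = lcLin q * lcLin q' := by
  have := lcLin_eq_sum (q := q * q')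
    (s := fun k : Fin _ × Fin _ => coeff ((extBasis F).coord k.1) q * coeff ((extBasis F).coord k.2) q')
    (c := fun k => extBasis F k.1 * extBasis F k.2)
    (Filter.Eventually.of_forall fun z => by
      change q.1 z * q'.1 z = _
      rw [coeff_sum q, coeff_sum q', Finset.sum_mul_sum, Fintype.sum_prod_type]
      refine Finset.sum_congr rfl fun I _ => Finset.sum_congr rfl fun J _ => ?_
      rw [smul_mul_smul_comm]
      rfl)
  rw [this, lcLin_apply, lcLin_apply, Finset.sum_mul_sum, Fintype.sum_prod_type]
  refine Finset.sum_congr rfl fun I _ => Finset.sum_congr rfl fun J _ => ?_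
  rw [LocalPhase.tmul_mul_tmul, ← map_mul (incl EB F), ← map_mul (baseGerm F x₁)]

variable (F x₁) in
/-- The germ of a map to the exterior algebra as a vertical multivector field. -/
noncomputable def lc : smoothExtAt F x₁ →ₐ[ℝ] LocalPhase F x₁ :=
  AlgHom.ofLinearMap lcLin lcLin_one lcLin_mul

theorem lc_eq_sum {ι : Type*} [Fintype ι] {q : smoothExtAt F x₁} {s : ι → smoothAt x₁}
    {c : ι → ExteriorAlgebra ℝ F} (h : ∀ᶠ z in 𝓝 x₁, q.1 z = ∑ k, (s k).1 z • c k) :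
    lc F x₁ q = ∑ k, LocalPhase.tmul (incl EB F (c k)) (baseGerm F x₁ (s k)) :=
  lcLin_eq_sum h

theorem lc_congr {q q' : smoothExtAt F x₁} (h : q.1 =ᶠ[𝓝 x₁] q'.1) : lc F x₁ q = lc F x₁ q' :=
  lcLin_congr h

/-- Linear operations on the local phase algebra which act on the vertical multivectors. -/
theorem apply_lc {L : LocalPhase F x₁ →ₗ[ℝ] LocalPhase F x₁}
    {Φ : ExteriorAlgebra ℝ F →ₗ[ℝ] ExteriorAlgebra ℝ F}
    (h : ∀ y s, L (LocalPhase.tmul (incl EB F y) (baseGerm F x₁ s)) =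
      LocalPhase.tmul (incl EB F (Φ y)) (baseGerm F x₁ s)) (q : smoothExtAt F x₁) :
    L (lc F x₁ q) = lc F x₁ (postcomp Φ q) := by
  rw [lc_eq_sum (q := q) (Filter.Eventually.of_forall (coeff_sum q)), map_sum,
    lc_eq_sum (q := postcomp Φ q) (s := fun I => coeff ((extBasis F).coord I) q)
      (c := fun I => Φ (extBasis F I)) (Filter.Eventually.of_forall fun z => ?_)]
  · exact Finset.sum_congr rfl fun I _ => h _ _
  · refine (congrArg Φ (coeff_sum q z)).trans ?_
    rw [map_sum]
    exact Finset.sum_congr rfl fun I _ => map_smul Φ _ _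

theorem postcomp_zero (q : smoothExtAt F x₁) :
    postcomp (0 : ExteriorAlgebra ℝ F →ₗ[ℝ] ExteriorAlgebra ℝ F) q = 0 := rfl

theorem γ_lc (q : smoothExtAt F x₁) :
    LocalPhase.γ (lc F x₁ q) = lc F x₁ (postcomp (ExtAlg.parity (V := F)).toLinearMap q) :=
  apply_lc (L := LocalPhase.γ.toLinearMap) (Φ := (ExtAlg.parity (V := F)).toLinearMap) (fun y s => by
    change LocalPhase.γ (LocalPhase.tmul _ _) = _
    rw [LocalPhase.γ_tmul, incl, ← ExtAlg.map_parity]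
    rfl) q

theorem proj_lc (q : smoothExtAt F x₁) : LocalPhase.proj (lc F x₁ q) = lc F x₁ q :=
  apply_lc (L := LocalPhase.proj.toLinearMap) (Φ := (LinearMap.id : ExteriorAlgebra ℝ F →ₗ[ℝ] _))
    (fun y s => by
    change LocalPhase.proj (LocalPhase.tmul _ _) = _
    rw [LocalPhase.proj_tmul, comp_baseGerm, incl, ExtAlg.map_map, ← LinearMap.comp_assoc]
    congr 3) q

theorem contract_lc (φ : Module.Dual ℝ ((EB × F) × (ℕ →₀ ℝ))) (q : smoothExtAt F x₁) :
    LocalPhase.contract φ (lc F x₁ q) = lc F x₁ (postcomp (ExtAlg.contract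
      (φ ∘ₗ LinearMap.inl ℝ (EB × F) (ℕ →₀ ℝ) ∘ₗ LinearMap.inr ℝ EB F)) q) :=
  apply_lc (fun y s => by
    rw [LocalPhase.contract_tmul, incl, ExtAlg.map_contract]) q

theorem paramContract_lc (k : ℕ) (q : smoothExtAt F x₁) :
    LocalPhase.paramContract k (lc F x₁ q) = 0 := by
  rw [LocalPhase.paramContract, contract_lc]
  have : (Finsupp.lapply k ∘ₗ LinearMap.snd ℝ (EB × F) (ℕ →₀ ℝ)) ∘ₗ
      LinearMap.inl ℝ (EB × F) (ℕ →₀ ℝ) ∘ₗ LinearMap.inr ℝ EB F = 0 := by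
    ext; simp
  rw [this, ExtAlg.contract, map_zero, postcomp_zero, map_zero]

variable [FiniteDimensional ℝ EB]

theorem i_inl_lc (μ) (q : smoothExtAt F x₁) :
    (LocalPhase.phaseAlgebra (Module.finBasis ℝ EB) (Module.finBasis ℝ F)).i (Sum.inl μ)
      (lc F x₁ q) = 0 := by
  refine (contract_lc _ q).trans ?_
  have : (((Module.finBasis ℝ EB).prod (Module.finBasis ℝ F)).coord (Sum.inl μ) ∘ₗ
      LinearMap.fst ℝ _ _) ∘ₗ
      LinearMap.inl ℝ (EB × F) (ℕ →₀ ℝ) ∘ₗ LinearMap.inr ℝ EB F = 0 := by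
    ext; simp
  rw [this, ExtAlg.contract, map_zero, postcomp_zero, map_zero]

theorem i_inr_lc (j) (q : smoothExtAt F x₁) :
    (LocalPhase.phaseAlgebra (Module.finBasis ℝ EB) (Module.finBasis ℝ F)).i (Sum.inr j)
      (lc F x₁ q) = lc F x₁ (postcomp (ExtAlg.contract ((Module.finBasis ℝ F).coord j)) q) := by
  refine (contract_lc _ q).trans ?_
  have : (((Module.finBasis ℝ EB).prod (Module.finBasis ℝ F)).coord (Sum.inr j) ∘ₗ
      LinearMap.fst ℝ _ _) ∘ₗ
      LinearMap.inl ℝ (EB × F) (ℕ →₀ ℝ) ∘ₗ LinearMap.inr ℝ EB F =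
        (Module.finBasis ℝ F).coord j := by
    ext; simp
  rw [this]

theorem e_inr_eq (j) :
    (LocalPhase.phaseAlgebra (x₁ := x₁) (Module.finBasis ℝ EB) (Module.finBasis ℝ F)).e (Sum.inr j) =
      LocalPhase.tmul (incl EB F (ExteriorAlgebra.ι ℝ (Module.finBasis ℝ F j))) 1 := by
  change LocalPhase.vec _ = _
  rw [LocalPhase.vec_eq, incl, ExteriorAlgebra.map_apply_ι]
  congr 2
  simp

/-- Horizontal contractions vanish on vertical multivectors, so the Euler operator of the phase
algebra restricts to that of ∧F. Degrees of sections and of their germs therefore agree. -/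
theorem euler_lc (q : smoothExtAt F x₁) :
    (LocalPhase.phaseAlgebra (Module.finBasis ℝ EB) (Module.finBasis ℝ F)).euler (lc F x₁ q) =
      lc F x₁ (postcomp (ExtAlg.euler (Module.finBasis ℝ F)) q) := by
  have h1 : ∀ j, (LocalPhase.phaseAlgebra (x₁ := x₁) (Module.finBasis ℝ EB)
      (Module.finBasis ℝ F)).e (Sum.inr j) * lc F x₁ (postcomp (ExtAlg.contract
        ((Module.finBasis ℝ F).coord j)) q) =
      lc F x₁ (postcomp (LinearMap.mulLeft ℝ (ExteriorAlgebra.ι ℝ (Module.finBasis ℝ F j)))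
        (postcomp (ExtAlg.contract ((Module.finBasis ℝ F).coord j)) q)) := fun j =>
    apply_lc (L := LinearMap.mulLeft ℝ _) (fun y s => by
      rw [LinearMap.mulLeft_apply, e_inr_eq, LocalPhase.tmul_mul_tmul, one_mul, ← map_mul]
      rfl) _
  rw [PInfty.PhaseAlgebra.euler_apply, Fintype.sum_sum_type]
  simp only [i_inl_lc, mul_zero, Finset.sum_const_zero, zero_add, i_inr_lc, h1]
  rw [← map_sum]
  refine congrArg _ (Subtype.ext (funext fun z => ?_))
  simp only [AddSubmonoidClass.coe_finsetSum, Finset.sum_apply]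
  exact (ExtAlg.euler_apply _ _).symm

variable (F x₁) in
/-- The value of a multivector field at the base point, projected to the fibre. -/
noncomputable def ev : LocalPhase F x₁ →ₐ[ℝ] ExteriorAlgebra ℝ F :=
  Algebra.TensorProduct.lift (ExteriorAlgebra.map (LinearMap.snd ℝ EB F ∘ₗ LinearMap.fst ℝ _ _))
    ((Algebra.ofId ℝ _).comp (SmoothGerm.eval _)) fun y s =>
      (Algebra.commutes (SmoothGerm.eval _ s) (ExteriorAlgebra.map _ y)).symm

theorem ev_tmul (y) (s : SmoothGerm (x₁, (0 : F))) : ev F x₁ (LocalPhase.tmul y s) =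
    ExteriorAlgebra.map (LinearMap.snd ℝ EB F ∘ₗ LinearMap.fst ℝ _ _) y *
      algebraMap ℝ _ (SmoothGerm.eval _ s) := rfl

theorem ev_lc (q : smoothExtAt F x₁) : ev F x₁ (lc F x₁ q) = q.1 x₁ := by
  have h : (LinearMap.snd ℝ EB F ∘ₗ LinearMap.fst ℝ (EB × F) (ℕ →₀ ℝ)) ∘ₗ
      LinearMap.inl ℝ (EB × F) (ℕ →₀ ℝ) ∘ₗ LinearMap.inr ℝ EB F = LinearMap.id := by
    ext; simp
  rw [lc_eq_sum (Filter.Eventually.of_forall (coeff_sum q)), map_sum, coeff_sum q x₁]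
  refine Finset.sum_congr rfl fun I _ => ?_
  rw [ev_tmul, incl, ExtAlg.map_map, h, ExteriorAlgebra.map_id, ← Algebra.commutes,
    Algebra.algebraMap_eq_smul_one, smul_mul_assoc, one_mul]
  rfl

end SmoothExt

end SmoothExt

namespace Coiso

variable {EB F C : Type*} [NormedAddCommGroup EB] [NormedSpace ℝ EB] [FiniteDimensional ℝ EB]
    [NormedAddCommGroup F] [NormedSpace ℝ F] [FiniteDimensional ℝ F]
    [TopologicalSpace C] [ChartedSpace EB C] [T2Space C]
    {E : C → Type*} [TopologicalSpace (TotalSpace F E)]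
    [∀ x, AddCommGroup (E x)] [∀ x, Module ℝ (E x)] [∀ x, TopologicalSpace (E x)]
    [FiberBundle F E] [VectorBundle ℝ F E]
    [IsManifold 𝓘(ℝ, EB) ∞ C] [ContMDiffVectorBundle ∞ F E 𝓘(ℝ, EB)]

/-! ## Germs of sections of the exterior algebra bundle -/

theorem map_mem_exteriorPower {V V' : Type*} [AddCommGroup V] [Module ℝ V] [AddCommGroup V']
    [Module ℝ V'] (f : V →ₗ[ℝ] V') {k : ℕ} {x : ExteriorAlgebra ℝ V} (hx : x ∈ ⋀[ℝ]^k V) :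
    ExteriorAlgebra.map f x ∈ ⋀[ℝ]^k V' := by
  refine ExtAlg.power_induction (P := fun k x => ExteriorAlgebra.map f x ∈ ⋀[ℝ]^k V')
    (fun c => ?_) (fun k x y hx hy => ?_) (fun k v x hx => ?_) hx
  · rw [AlgHom.commutes, ExteriorAlgebra.exteriorPower, pow_zero, Submodule.mem_one]
    exact ⟨c, rfl⟩
  · rw [map_add]; exact Submodule.add_mem _ hx hy
  · rw [map_mul, ExteriorAlgebra.map_apply_ι, ExteriorAlgebra.exteriorPower, pow_succ']
    exact Submodule.mul_mem_mul ⟨f v, rfl⟩ hx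

variable (F) in
/-- The trivialization of the exterior algebra bundle. -/
noncomputable def extTriv (x₀ x : C) : ExteriorAlgebra ℝ (E x) →ₐ[ℝ] ExteriorAlgebra ℝ F :=
  ExteriorAlgebra.map ((trivializationAt F E x₀).linearMapAt ℝ x)

variable (F) in
/-- The inverse of the trivialization of the exterior algebra bundle. -/
noncomputable def extTrivSymm (x₀ x : C) : ExteriorAlgebra ℝ F →ₐ[ℝ] ExteriorAlgebra ℝ (E x) :=
  ExteriorAlgebra.map ((trivializationAt F E x₀).symmₗ ℝ x)

omit [FiniteDimensional ℝ F] in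
theorem extTrivSymm_extTriv {x₀ x : C} (hx : x ∈ (trivializationAt F E x₀).baseSet)
    (y : ExteriorAlgebra ℝ (E x)) : extTrivSymm F x₀ x (extTriv F x₀ x y) = y := by
  have : (trivializationAt F E x₀).symmₗ ℝ x ∘ₗ (trivializationAt F E x₀).linearMapAt ℝ x =
      LinearMap.id := LinearMap.ext fun v => Bundle.Trivialization.symmₗ_linearMapAt _ hx v
  rw [extTrivSymm, extTriv, ExtAlg.map_map, this, ExteriorAlgebra.map_id]
  rfl

omit [FiniteDimensional ℝ F] in
theorem extTriv_extTrivSymm {x₀ x : C} (hx : x ∈ (trivializationAt F E x₀).baseSet)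
    (y : ExteriorAlgebra ℝ F) : extTriv F x₀ x (extTrivSymm F x₀ x y : ExteriorAlgebra ℝ (E x)) = y := by
  have : (trivializationAt F E x₀).linearMapAt ℝ x ∘ₗ (trivializationAt F E x₀).symmₗ ℝ x =
      LinearMap.id := LinearMap.ext fun v => Bundle.Trivialization.linearMapAt_symmₗ _ hx v
  rw [extTrivSymm, extTriv, ExtAlg.map_map, this, ExteriorAlgebra.map_id]
  rfl

variable (F E) in
theorem mem_baseSet (x₀ : C) : x₀ ∈ (trivializationAt F E x₀).baseSet :=
  FiberBundle.mem_baseSet_trivializationAt F E x₀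

/-- A section of the exterior algebra bundle in local coordinates. -/
noncomputable def toSmoothExt (x₀ : C) : ExtSec EB F E →ₐ[ℝ] smoothExtAt F (center EB x₀) where
  toFun a := ⟨fun z => extTriv F x₀ _ (a.1 ((extChartAt 𝓘(ℝ, EB) x₀).symm z)), fun φ => by
    have h1 : ContMDiffAt 𝓘(ℝ, EB) 𝓘(ℝ, EB) ∞ (extChartAt 𝓘(ℝ, EB) x₀).symm (center EB x₀) :=
      contMDiffAt_extChartAt_symm (mem_extChartAt_target x₀)
    have h2 := a.2 x₀ φ
    rw [← extChartAt_to_inv (I := 𝓘(ℝ, EB)) x₀] at h2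
    have h3 := h2.comp (center EB x₀) h1
    rw [extChartAt_to_inv] at h3
    exact contMDiffAt_iff_contDiffAt.1 h3⟩
  map_one' := Subtype.ext (funext fun z => map_one (extTriv F x₀ _))
  map_mul' a b := Subtype.ext (funext fun z => map_mul (extTriv F x₀ _) _ _)
  map_zero' := Subtype.ext (funext fun z => map_zero (extTriv F x₀ _))
  map_add' a b := Subtype.ext (funext fun z => map_add (extTriv F x₀ _) _ _)
  commutes' c := Subtype.ext (funext fun z => AlgHom.commutes (extTriv F x₀ _) _)

/-- The germ of a section of the exterior algebra bundle. -/
noncomputable def loc (x₀ : C) : ExtSec EB F E →ₐ[ℝ] LocalPhase F (center EB x₀) :=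
  (SmoothExt.lc F _).comp (toSmoothExt x₀)

theorem eventually_extChartAt_symm {x₀ : C} {p : C → Prop} (hp : ∀ᶠ x in 𝓝 x₀, p x) :
    ∀ᶠ z in 𝓝 (center EB x₀), p ((extChartAt 𝓘(ℝ, EB) x₀).symm z) :=
  (continuousAt_extChartAt_symm (I := 𝓘(ℝ, EB)) x₀).eventually (p := p) (by
    rwa [extChartAt_to_inv])

theorem loc_congr {x₀ : C} {a b : ExtSec EB F E} (h : ∀ᶠ x in 𝓝 x₀, a.1 x = b.1 x) :
    loc x₀ a = loc x₀ b := by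
  refine SmoothExt.lc_congr ?_
  filter_upwards [eventually_extChartAt_symm h] with z hz
  exact congrArg (extTriv F x₀ _) hz

theorem ev_loc (x₀ : C) (a : ExtSec EB F E) :
    SmoothExt.ev F _ (loc x₀ a) = extTriv F x₀ x₀ (a.1 x₀) := by
  refine (SmoothExt.ev_lc _).trans ?_
  change extTriv F x₀ ((extChartAt 𝓘(ℝ, EB) x₀).symm (extChartAt 𝓘(ℝ, EB) x₀ x₀))
    (a.1 ((extChartAt 𝓘(ℝ, EB) x₀).symm (extChartAt 𝓘(ℝ, EB) x₀ x₀))) = _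
  rw [extChartAt_to_inv]

/-- The germ at a point determines the value there, by evaluation and the inverse trivialization.
Identities between sections can thus be checked in the phase algebras. -/
theorem apply_eq_of_loc_eq {x₀ : C} {a b : ExtSec EB F E} (h : loc x₀ a = loc x₀ b) :
    a.1 x₀ = b.1 x₀ := by
  rw [← extTrivSymm_extTriv (F := F) (mem_baseSet F E x₀) (a.1 x₀),
    ← extTrivSymm_extTriv (F := F) (mem_baseSet F E x₀) (b.1 x₀), ← ev_loc, ← ev_loc, h]

theorem baseGerm_eq_gm {x₀ : C} (f : BaseFun EB C) (s : smoothAt (center EB x₀))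
    (h : ∀ᶠ z in 𝓝 (center EB x₀), s.1 z = f ((extChartAt 𝓘(ℝ, EB) x₀).symm z)) :
    SmoothExt.baseGerm F _ s = gm E x₀ (pull f) := by
  refine SmoothGerm.germ_eq.2 ?_
  filter_upwards [(continuousAt_fst (p := (center EB x₀, (0 : F)))).eventually h,
    eventually_patchTarget (F := F) (E := E) x₀] with z hz hz'
  refine hz.trans ?_
  change _ = f (coordInv F E x₀ z).1
  rw [coordInv_proj hz']

theorem loc_ofFun (x₀ : C) (f : BaseFun EB C) : loc x₀ (ofFun F E f) = fn E x₀ (pull f) := by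
  have hs : ContDiffAt ℝ ∞ (fun z => f ((extChartAt 𝓘(ℝ, EB) x₀).symm z)) (center EB x₀) :=
    contMDiffAt_iff_contDiffAt.1 (f.contMDiff.contMDiffAt.comp _
      (contMDiffAt_extChartAt_symm (mem_extChartAt_target x₀)))
  let s : smoothAt (center EB x₀) := ⟨_, hs⟩
  have h := SmoothExt.lc_eq_sum (q := toSmoothExt x₀ (ofFun F E f)) (s := fun _ : Unit => s)
    (c := fun _ => 1) (Filter.Eventually.of_forall fun z => by
      change extTriv F x₀ _ (algebraMap ℝ _ _) = _
      rw [AlgHom.commutes, Algebra.algebraMap_eq_smul_one]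
      simp [s])
  refine h.trans ?_
  rw [Finset.univ_unique, Finset.sum_singleton, map_one, fn_apply,
    baseGerm_eq_gm (E := E) f s (Filter.Eventually.of_forall fun _ => rfl)]

theorem pairing_fibreCoord {x₀ x : C} (hx : x ∈ core EB F E x₀) (v : Sec EB F E) (j) :
    pairing v (fibreCoord EB E x₀ j) x =
      (Module.finBasis ℝ F).repr ((trivializationAt F E x₀).linearMapAt ℝ x (v x)) j := by
  change bump (EB := EB) F E x₀ x * (Module.finBasis ℝ F).coord j (trivializationAt F E x₀ ⟨x, v x⟩).2 = _
  rw [bump_of_mem_core hx, one_mul, Bundle.Trivialization.linearMapAt_apply,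
    if_pos (core_subset_patch x₀ hx).2]
  rfl

theorem loc_ofSec (x₀ : C) (v : Sec EB F E) : loc x₀ (ofSec v) = vecField x₀ v := by
  let f := fun j => pairing v (fibreCoord EB E x₀ j)
  have hs : ∀ j, ContDiffAt ℝ ∞ (fun z => f j ((extChartAt 𝓘(ℝ, EB) x₀).symm z)) (center EB x₀) :=
    fun j => contMDiffAt_iff_contDiffAt.1 ((f j).contMDiff.contMDiffAt.comp _
      (contMDiffAt_extChartAt_symm (mem_extChartAt_target x₀)))
  let s : ∀ _ : Fin (Module.finrank ℝ F), smoothAt (center EB x₀) := fun j => ⟨_, hs j⟩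
  have hev := eventually_extChartAt_symm (EB := EB) (core_mem_nhds (EB := EB) (F := F) (E := E) x₀)
  have h := SmoothExt.lc_eq_sum (q := toSmoothExt x₀ (ofSec v)) (s := s)
    (c := fun j => ExteriorAlgebra.ι ℝ (Module.finBasis ℝ F j)) (by
      filter_upwards [hev] with z hz
      change extTriv F x₀ _ (ExteriorAlgebra.ι ℝ _) = _
      rw [extTriv, ExteriorAlgebra.map_apply_ι,
        ← (Module.finBasis ℝ F).sum_repr ((trivializationAt F E x₀).linearMapAt ℝ _ _), map_sum]
      refine Finset.sum_congr rfl fun j _ => ?_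
      rw [map_smul]
      congr 1
      exact (pairing_fibreCoord hz v j).symm)
  refine h.trans (Finset.sum_congr rfl fun j _ => ?_)
  rw [SmoothExt.e_inr_eq, fn_apply, LocalPhase.tmul_mul_tmul, one_mul, mul_one,
    baseGerm_eq_gm (E := E) (f j) (s j) (Filter.Eventually.of_forall fun _ => rfl)]

theorem p_loc (x₀ : C) (a : ExtSec EB F E) : (phase EB F x₀).p (loc x₀ a) = loc x₀ a :=
  SmoothExt.proj_lc _

theorem paramContract_loc (x₀ : C) (a : ExtSec EB F E) (k : ℕ) :
    LocalPhase.paramContract k (loc x₀ a) = 0 :=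
  SmoothExt.paramContract_lc k _

theorem par_loc (x₀ : C) {k : ℤ} {a : ExtSec EB F E} (ha : a ∈ extDeg EB F E k) :
    (phase EB F x₀).Par k (loc x₀ a) := by
  rcases k with k | k
  · refine (SmoothExt.γ_lc _).trans ?_
    rw [← map_smul]
    refine congrArg (SmoothExt.lc F _) (Subtype.ext (funext fun z => ?_))
    refine (ExtAlg.parity_of_mem (map_mem_exteriorPower
      ((trivializationAt F E x₀).linearMapAt ℝ ((extChartAt 𝓘(ℝ, EB) x₀).symm z)) (ha _))).trans ?_
    exact (map_smul (extTriv F x₀ _) _ _).symm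
  · rw [show a = 0 from ha, map_zero, PInfty.PhaseAlgebra.Par, map_zero, smul_zero]

theorem deg_loc (x₀ : C) {k : ℤ} {a : ExtSec EB F E} (ha : a ∈ extDeg EB F E k) :
    (phase EB F x₀).Deg k (loc x₀ a) := by
  rcases k with k | k
  · refine (SmoothExt.euler_lc _).trans ?_
    rw [loc, AlgHom.comp_apply, ← map_smul]
    refine congrArg (SmoothExt.lc F _) (Subtype.ext (funext fun z => ?_))
    exact (ExtAlg.euler_of_mem _ (map_mem_exteriorPower _ (ha _))).trans (by simp; rfl)
  · rw [show a = 0 from ha, map_zero, PInfty.PhaseAlgebra.Deg, map_zero, smul_zero]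

theorem euler_of_deg_loc {x₀ : C} {k : ℤ} {a : ExtSec EB F E}
    (h : (phase EB F x₀).Deg k (loc x₀ a)) :
    ExtAlg.euler (Module.finBasis ℝ F) (extTriv F x₀ x₀ (a.1 x₀)) =
      (k : ℝ) • extTriv F x₀ x₀ (a.1 x₀) := by
  have h1 := congrArg (SmoothExt.ev F _) ((SmoothExt.euler_lc (toSmoothExt x₀ a)).symm.trans h)
  rw [map_smul, ev_loc, SmoothExt.ev_lc] at h1
  rw [← h1, ← ev_loc x₀ a]
  exact congrArg _ (SmoothExt.ev_lc _)

/-- Evaluating the germ at its centre gives an eigenvalue equation for the Euler operator of ∧F. Its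
eigenvalue picks out the exterior power, and a negative eigenvalue forces zero. -/
theorem mem_extDeg_of_deg_loc {k : ℤ} {a : ExtSec EB F E}
    (h : ∀ x₀, (phase EB F x₀).Deg k (loc x₀ a)) : a ∈ extDeg EB F E k := by
  rcases k with k | k
  · intro x
    have h1 : extTriv F x x (a.1 x) ∈ ⋀[ℝ]^k F := ExtAlg.mem_of_euler (euler_of_deg_loc (h x))
    rw [← extTrivSymm_extTriv (F := F) (mem_baseSet F E x) (a.1 x)]
    exact map_mem_exteriorPower _ h1
  · refine Subtype.ext (funext fun x => ?_)
    have h1 := ExtAlg.eq_zero_of_euler_neg (Int.negSucc_lt_zero k) (euler_of_deg_loc (h x))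
    rw [← extTrivSymm_extTriv (F := F) (mem_baseSet F E x) (a.1 x), h1, map_zero]
    rfl

end Coiso

/-! ### Contractions with differentials of functions -/

namespace PInfty.PhaseAlgebra

variable {T : Type*} [Ring T] [Algebra ℝ T] {m r : Type*} [DecidableEq m]
    [DecidableEq r] {H : PhaseAlgebra T m r} [Fintype m] [Fintype r]

theorem IsFn.sub {f g : T} (hf : H.IsFn f) (hg : H.IsFn g) : H.IsFn (f - g) :=
  ⟨by rw [map_sub, hf.γ, hg.γ], fun A => by rw [map_sub, hf.i, hg.i, sub_zero]⟩

/-- Cartan's formula reduces a longer word to shorter ones, contracted with the same functions or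
with their derivatives along the first vector field. -/
theorem isFn_grad_grad_word {x : T} (hx : ∀ f g, H.IsFn f → H.IsFn g → H.IsFn (H.grad f (H.grad g x)))
    {l : List T} (hl : ∀ v ∈ l, H.IsVec v) {f g : T} (hf : H.IsFn f) (hg : H.IsFn g) :
    H.IsFn (H.grad f (H.grad g (H.word l x))) := by
  induction l generalizing f g with
  | nil => exact hx f g hf hg
  | cons v l ih =>
    have hv : H.IsVec v := hl v (by simp)
    have ih := fun {f g} => ih (f := f) (g := g) fun w hw => hl w (by simp [hw])
    have h : ∀ {f}, H.IsFn f → ∀ y, H.grad f (H.K v y) = H.K v (H.grad f y) - H.grad (H.K v f) y :=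
      fun hf y => by rw [K_grad hv hf, add_sub_cancel_left]
    rw [word_cons, h hg, map_sub, h hf]
    exact ((K_vec_isFn hv (ih hf hg)).sub (ih (K_vec_isFn hv hf) hg)).sub
      (ih hf (K_vec_isFn hv hg))

theorem grad_mul_arg (f : T) {g : T} (hg : H.IsFn g) (x : T) :
    H.grad (f * g) x = f * H.grad g x + g * H.grad f x := by
  simp only [grad_apply, H.d_mul, add_mul, Finset.sum_add_distrib, Finset.mul_sum, mul_assoc]
  rw [add_comm]
  congr 1
  refine Finset.sum_congr rfl fun A _ => ?_
  rw [← mul_assoc, ← hg.comm, mul_assoc]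

theorem grad_sum_arg {ι : Type*} (s : Finset ι) (f : ι → T) (x : T) :
    H.grad (∑ i ∈ s, f i) x = ∑ i ∈ s, H.grad (f i) x := by
  simp only [grad_apply, map_sum, Finset.sum_mul]
  rw [Finset.sum_comm]

end PInfty.PhaseAlgebra

namespace Coiso

variable {EB F C : Type*} [NormedAddCommGroup EB] [NormedSpace ℝ EB] [FiniteDimensional ℝ EB]
    [NormedAddCommGroup F] [NormedSpace ℝ F] [FiniteDimensional ℝ F]
    [TopologicalSpace C] [ChartedSpace EB C] [T2Space C]
    {E : C → Type*} [TopologicalSpace (TotalSpace F E)]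
    [∀ x, AddCommGroup (E x)] [∀ x, Module ℝ (E x)] [∀ x, TopologicalSpace (E x)]
    [FiberBundle F E] [VectorBundle ℝ F E]
    [IsManifold 𝓘(ℝ, EB) ∞ C] [ContMDiffVectorBundle ∞ F E 𝓘(ℝ, EB)]

/-! ## Contractions with conormal sections -/

theorem restr_vert (v : Sec EB F E) (u : Conormal EB F E) : restr (vert v u.toFun) = pairing v u := by
  ext x
  change deriv (fun t : ℝ => u.toFun ⟨x, 0 + t • v x⟩) 0 = u.toFun ⟨x, v x⟩
  have : (fun t : ℝ => u.toFun ⟨x, 0 + t • v x⟩) = fun t : ℝ => t * u.toFun ⟨x, v x⟩ := by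
    funext t
    rw [zero_add]
    exact (u.linear x).map_smul t (v x)
  rw [this]
  simp

theorem frame_apply {x₀ x : C} (hx : x ∈ core EB F E x₀) (j) :
    frame EB E x₀ j x = (trivializationAt F E x₀).symmₗ ℝ x (Module.finBasis ℝ F j) := by
  change bump (EB := EB) F E x₀ x • (trivializationAt F E x₀).symm x _ = _
  rw [bump_of_mem_core hx, one_smul, Bundle.Trivialization.coe_symmₗ _ (core_subset_patch x₀ hx).2]

theorem sum_linearMapAt_smul_frame {x₀ x : C} (hx : x ∈ core EB F E x₀) (e : E x) :
    ∑ j, (Module.finBasis ℝ F).repr ((trivializationAt F E x₀).linearMapAt ℝ x e) j •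
      frame EB E x₀ j x = e := by
  simp only [frame_apply hx, ← map_smul, ← map_sum]
  rw [(Module.finBasis ℝ F).sum_repr]
  exact Bundle.Trivialization.symmₗ_linearMapAt _ (core_subset_patch x₀ hx).2 e

theorem pairing_frame_fibreCoord {x₀ x : C} (hx : x ∈ core EB F E x₀) (i j) :
    pairing (F := F) (frame EB E x₀ i) (fibreCoord EB E x₀ j) x = if i = j then 1 else 0 := by
  rw [pairing_fibreCoord hx, frame_apply hx,
    Bundle.Trivialization.linearMapAt_symmₗ _ (core_subset_patch x₀ hx).2, Module.Basis.repr_self,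
    Finsupp.single_apply]

theorem conormal_eq_sum {x₀ x : C} (hx : x ∈ core EB F E x₀) (u : Conormal EB F E) (e : E x) :
    u.toFun ⟨x, e⟩ = ∑ j, pairing (F := F) (frame EB E x₀ j) u x * (fibreCoord EB E x₀ j).toFun ⟨x, e⟩ := by
  have h1 : ∀ j, (fibreCoord EB E x₀ j).toFun ⟨x, e⟩ =
      (Module.finBasis ℝ F).repr ((trivializationAt F E x₀).linearMapAt ℝ x e) j := fun j => by
    change bump (EB := EB) F E x₀ x * (Module.finBasis ℝ F).coord j (trivializationAt F E x₀ ⟨x, e⟩).2 = _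
    rw [bump_of_mem_core hx, one_mul, Bundle.Trivialization.linearMapAt_apply,
      if_pos (core_subset_patch x₀ hx).2]
    rfl
  have h2 := congrArg (u.form x) (sum_linearMapAt_smul_frame hx e)
  rw [map_sum] at h2
  refine h2.symm.trans (Finset.sum_congr rfl fun j _ => ?_)
  rw [map_smul, h1, smul_eq_mul, mul_comm]
  rfl

section

variable (x₀ : C)

theorem fn_pull_eq_one {f : BaseFun EB C} (hf : ∀ᶠ x in 𝓝 x₀, f x = 1) :
    fn E x₀ (pull f : TotFun EB F E) = 1 := by
  rw [← map_one (fn E x₀)]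
  exact fn_congr (hf.mono fun x hx e => hx)

theorem fn_pairing_frame (i j : Fin (Module.finrank ℝ F)) :
    fn E x₀ (pull (pairing (frame EB E x₀ i) (fibreCoord EB E x₀ j)) : TotFun EB F E) =
      if i = j then 1 else 0 := by
  have h : ∀ᶠ x in 𝓝 x₀, pairing (F := F) (frame EB E x₀ i) (fibreCoord EB E x₀ j) x = if i = j then 1 else 0 :=
    Filter.mem_of_superset (core_mem_nhds x₀) fun x hx => pairing_frame_fibreCoord hx i j
  split_ifs at h ⊢ with hij
  · exact fn_pull_eq_one x₀ h
  · rw [← map_zero (fn E x₀)]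
    exact fn_congr (h.mono fun x hx e => hx)

/-- The cut-off frame is dual to the fibre coordinates near the point, so its j-th vector field acts
there as the j-th vertical derivative. On a fibrewise linear function this gives the pairing with
the frame. -/
theorem p_d_fn_conormal (u : Conormal EB F E) (j) :
    (phase EB F x₀).p ((phase EB F x₀).d (Sum.inr j) (fn E x₀ u.toFun)) =
      fn E x₀ (pull (pairing (frame EB E x₀ j) u)) := by
  have h := congrArg (phase EB F x₀).p (K_vecField x₀ (frame EB E x₀ j) u.toFun)
  rw [PInfty.PhaseAlgebra.K_vec_apply_isFn (isVec_vecField _ _) (isFn_fn _ _), p_fn, restr_vert] at h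
  simp only [i_inr_vecField, fn_pairing_frame, ite_mul, one_mul, zero_mul, Finset.sum_ite_eq,
    Finset.mem_univ, if_true] at h
  exact h

/-- Contraction with a section of the conormal bundle. -/
noncomputable def ctr (u : Conormal EB F E) :
    LocalPhase F (center EB x₀) →ₗ[ℝ] LocalPhase F (center EB x₀) :=
  ∑ j, LinearMap.mulLeft ℝ (fn E x₀ (pull (pairing (frame EB E x₀ j) u))) ∘ₗ
    (phase EB F x₀).i (Sum.inr j)

theorem ctr_apply (u : Conormal EB F E) (y) : ctr x₀ u y =
    ∑ j, fn E x₀ (pull (pairing (frame EB E x₀ j) u)) * (phase EB F x₀).i (Sum.inr j) y := by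
  simp [ctr]

/-- On the zero section the vertical derivatives of `u` are its frame components. Contracting a
projected multivector with `u` can therefore be done before the projection, where it yields Poisson
brackets with `u`. -/
theorem ctr_p (u : Conormal EB F E) (y) : ctr x₀ u ((phase EB F x₀).p y) =
    (phase EB F x₀).p ((phase EB F x₀).grad (fn E x₀ u.toFun) y) := by
  rw [PInfty.PhaseAlgebra.p_grad (p_fn_conormal _ _), ctr_apply]
  simp only [p_d_fn_conormal]

theorem ctr_fibreCoord (j) (y) :
    ctr x₀ (fibreCoord EB E x₀ j) y = (phase EB F x₀).i (Sum.inr j) y := by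
  rw [ctr_apply]
  simp only [fn_pairing_frame, ite_mul, one_mul, zero_mul, Finset.sum_ite_eq', Finset.mem_univ,
    if_true]

theorem ctr_mul (u : Conormal EB F E) (y y') :
    ctr x₀ u (y * y') = ctr x₀ u y * y' + (phase EB F x₀).γ y * ctr x₀ u y' := by
  simp only [ctr_apply, PInfty.PhaseAlgebra.i_mul, mul_add, Finset.sum_add_distrib, Finset.sum_mul,
    Finset.mul_sum, ← mul_assoc]
  congr 1
  refine Finset.sum_congr rfl fun j _ => ?_
  rw [(isFn_fn x₀ _).comm]

theorem ctr_fn_mul (u : Conormal EB F E) (h : TotFun EB F E) (y) :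
    ctr x₀ u (fn E x₀ h * y) = fn E x₀ h * ctr x₀ u y := by
  have : ctr x₀ u (fn E x₀ h) = 0 := by simp [ctr_apply, (isFn_fn x₀ h).i]
  rw [ctr_mul, this, zero_mul, zero_add, (isFn_fn x₀ h).γ]

theorem ctr_loc_ofSec (u : Conormal EB F E) (s : Sec EB F E) :
    ctr x₀ u (loc x₀ (ofSec s)) = fn E x₀ (pull (pairing s u)) := by
  have h := congrArg (phase EB F x₀).p (K_vecField x₀ s u.toFun)
  rw [PInfty.PhaseAlgebra.K_vec_apply_isFn (isVec_vecField _ _) (isFn_fn _ _), p_fn, restr_vert,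
    map_sum] at h
  rw [loc_ofSec, ctr_apply, ← h]
  refine Finset.sum_congr rfl fun j _ => ?_
  rw [map_mul, p_d_fn_conormal, i_inr_vecField, p_fn_pull, (isFn_fn x₀ _).comm]

/-- Contractions with fibre coordinates are the basic fibre contractions, and by Euler's formula a
degree-one element of the range of `p` vanishes when they all do. -/
theorem eq_of_ctr_one {y y' : LocalPhase F (center EB x₀)} (hy : (phase EB F x₀).Deg 1 y)
    (hy' : (phase EB F x₀).Deg 1 y') (hp : (phase EB F x₀).p y = y)
    (hp' : (phase EB F x₀).p y' = y') (h : ∀ u : Conormal EB F E, ctr x₀ u y = ctr x₀ u y') :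
    y = y' := by
  refine sub_eq_zero.1 ((hy.sub hy').eq_zero one_ne_zero (by rw [map_sub, hp, hp']) fun j => ?_)
  rw [← ctr_fibreCoord (E := E), map_sub, h, sub_self]

theorem eq_of_ctr_two {y y' : LocalPhase F (center EB x₀)} (hy : (phase EB F x₀).Deg 2 y)
    (hy' : (phase EB F x₀).Deg 2 y') (hp : (phase EB F x₀).p y = y)
    (hp' : (phase EB F x₀).p y' = y')
    (h : ∀ u w : Conormal EB F E, ctr x₀ w (ctr x₀ u y) = ctr x₀ w (ctr x₀ u y')) :
    y = y' := by
  refine sub_eq_zero.1 ((hy.sub hy').eq_zero two_ne_zero (by rw [map_sub, hp, hp']) fun j => ?_)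
  rw [map_sub, sub_eq_zero]
  refine eq_of_ctr_one (E := E) x₀ (hy.i _) (hy'.i _) (by rw [PInfty.PhaseAlgebra.p_i, hp])
    (by rw [PInfty.PhaseAlgebra.p_i, hp']) fun w => ?_
  rw [← ctr_fibreCoord (E := E), ← ctr_fibreCoord (E := E), h]

end

/-! ## Pairings -/

theorem algebraMapInv_map {V V' : Type*} [AddCommGroup V] [Module ℝ V] [AddCommGroup V']
    [Module ℝ V'] (f : V →ₗ[ℝ] V') (x : ExteriorAlgebra ℝ V) :
    ExteriorAlgebra.algebraMapInv (ExteriorAlgebra.map f x) = ExteriorAlgebra.algebraMapInv x := by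
  have : (ExteriorAlgebra.algebraMapInv (R := ℝ)).comp (ExteriorAlgebra.map f) =
      ExteriorAlgebra.algebraMapInv := by
    ext v
    simp [ExteriorAlgebra.algebraMapInv]
  exact DFunLike.congr_fun this x

theorem ev_fn (x₀ : C) (h : TotFun EB F E) :
    SmoothExt.ev F _ (fn E x₀ h) = algebraMap ℝ _ (h ⟨x₀, 0⟩) := by
  rw [fn_apply, SmoothExt.ev_tmul, map_one, one_mul, eval_gm]

theorem ev_i_lc {x₁ : EB} (j) (q : smoothExtAt F x₁) :
    SmoothExt.ev F x₁ ((LocalPhase.phaseAlgebra (Module.finBasis ℝ EB)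
      (Module.finBasis ℝ F)).i (Sum.inr j) (SmoothExt.lc F x₁ q)) =
      ExtAlg.contract ((Module.finBasis ℝ F).coord j) (q.1 x₁) := by
  rw [SmoothExt.i_inr_lc, SmoothExt.ev_lc]
  rfl

variable (F) in
/-- The linear form on the model fibre defined by a section of the conormal bundle. -/
noncomputable def modelForm (u : Conormal EB F E) (x₀ : C) : Module.Dual ℝ F :=
  u.form x₀ ∘ₗ (trivializationAt F E x₀).symmₗ ℝ x₀

theorem modelForm_eq (u : Conormal EB F E) (x₀ : C) :
    modelForm F u x₀ = ∑ j, pairing (frame EB E x₀ j) u x₀ • (Module.finBasis ℝ F).coord j := by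
  refine (Module.finBasis ℝ F).ext fun i => ?_
  simp only [LinearMap.sum_apply, LinearMap.smul_apply, Module.Basis.coord_apply,
    Module.Basis.repr_self, Finsupp.single_apply, smul_eq_mul, mul_ite, mul_one, mul_zero,
    Finset.sum_ite_eq, Finset.mem_univ, if_true]
  change _ = u.toFun ⟨x₀, frame EB E x₀ i x₀⟩
  rw [frame_apply (mem_core x₀)]
  rfl

theorem contract_modelForm (u : Conormal EB F E) (x₀ : C) (y : ExteriorAlgebra ℝ F) :
    ExtAlg.contract (modelForm F u x₀) y = ∑ j, pairing (frame EB E x₀ j) u x₀ •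
      ExtAlg.contract ((Module.finBasis ℝ F).coord j) y := by
  rw [ExtAlg.contract, modelForm_eq, map_sum, LinearMap.sum_apply]
  exact Finset.sum_congr rfl fun j _ => by rw [map_smul]; rfl

theorem ev_ctr_lc (x₀ : C) (u : Conormal EB F E) (q : smoothExtAt F (center EB x₀)) :
    SmoothExt.ev F _ (ctr x₀ u (SmoothExt.lc F _ q)) =
      ExtAlg.contract (modelForm F u x₀) (q.1 (center EB x₀)) := by
  rw [contract_modelForm, ctr_apply, map_sum]
  refine Finset.sum_congr rfl fun j _ => ?_
  rw [map_mul, ev_i_lc, ev_fn, Algebra.algebraMap_eq_smul_one, smul_mul_assoc, one_mul]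
  rfl

theorem ev_ctr_ctr_lc (x₀ : C) (u w : Conormal EB F E) (q : smoothExtAt F (center EB x₀)) :
    SmoothExt.ev F _ (ctr x₀ w (ctr x₀ u (SmoothExt.lc F _ q))) =
      ExtAlg.contract (modelForm F w x₀) (ExtAlg.contract (modelForm F u x₀)
        (q.1 (center EB x₀))) := by
  rw [contract_modelForm u, ctr_apply x₀ u, map_sum, map_sum, map_sum]
  refine Finset.sum_congr rfl fun j _ => ?_
  rw [ctr_fn_mul, map_mul, ev_fn, SmoothExt.i_inr_lc, ev_ctr_lc, Algebra.algebraMap_eq_smul_one,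
    smul_mul_assoc, one_mul, map_smul]
  rfl

/-- Contraction is natural under the trivialization, and the scalar part of a multivector is
unchanged by it. The pairing is hence the value of a contraction of germs. -/
theorem pair₁_eq (a : ExtSec EB F E) (u : Conormal EB F E) (x₀ : C) :
    pair₁ a u x₀ = ExteriorAlgebra.algebraMapInv (SmoothExt.ev F _ (ctr x₀ u (loc x₀ a))) := by
  have h1 := ev_loc x₀ a
  rw [loc, AlgHom.comp_apply, SmoothExt.ev_lc] at h1
  rw [loc, AlgHom.comp_apply, ev_ctr_lc, h1, pair₁, ← extTrivSymm_extTriv (F := F)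
    (mem_baseSet F E x₀) (a.1 x₀), extTriv_extTrivSymm (mem_baseSet F E x₀), extTrivSymm]
  have h2 := ExtAlg.map_contract ((trivializationAt F E x₀).symmₗ ℝ x₀) (u.form x₀)
    (extTriv F x₀ x₀ (a.1 x₀))
  rw [ExtAlg.contract] at h2
  rw [h2, algebraMapInv_map]
  rfl

theorem pair₂_eq (a : ExtSec EB F E) (u w : Conormal EB F E) (x₀ : C) :
    pair₂ a u w x₀ = ExteriorAlgebra.algebraMapInv
      (SmoothExt.ev F _ (ctr x₀ w (ctr x₀ u (loc x₀ a)))) := by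
  have h1 := ev_loc x₀ a
  rw [loc, AlgHom.comp_apply, SmoothExt.ev_lc] at h1
  rw [loc, AlgHom.comp_apply, ev_ctr_ctr_lc, h1, pair₂, ← extTrivSymm_extTriv (F := F)
    (mem_baseSet F E x₀) (a.1 x₀), extTriv_extTrivSymm (mem_baseSet F E x₀), extTrivSymm]
  have h2 := fun u y => ExtAlg.map_contract ((trivializationAt F E x₀).symmₗ ℝ x₀)
    (Conormal.form (EB := EB) (F := F) u x₀) y
  simp only [ExtAlg.contract] at h2
  rw [h2, h2, algebraMapInv_map]
  rfl

end Coiso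

namespace Coiso

variable {EB F C : Type*} [NormedAddCommGroup EB] [NormedSpace ℝ EB] [FiniteDimensional ℝ EB]
    [NormedAddCommGroup F] [NormedSpace ℝ F] [FiniteDimensional ℝ F]
    [TopologicalSpace C] [ChartedSpace EB C] [T2Space C]
    {E : C → Type*} [TopologicalSpace (TotalSpace F E)]
    [∀ x, AddCommGroup (E x)] [∀ x, Module ℝ (E x)] [∀ x, TopologicalSpace (E x)]
    [FiberBundle F E] [VectorBundle ℝ F E]
    [IsManifold 𝓘(ℝ, EB) ∞ C] [ContMDiffVectorBundle ∞ F E 𝓘(ℝ, EB)]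

/-! ## The brackets of generators -/

variable (P : PoissonBracket (TotFun EB F E))

/-- The germs of the higher brackets. -/
noncomputable def germBracket (x₀ : C) (n : ℕ) :
    MultilinearMap ℝ (fun _ : Fin n => ExtSec EB F E) (LocalPhase F (center EB x₀)) :=
  ((phase EB F x₀).lam (bivec P x₀) n).compLinearMap fun _ => (loc x₀).toLinearMap

theorem germBracket_apply (x₀ : C) {n : ℕ} (a : Fin n → ExtSec EB F E) :
    germBracket P x₀ n a = (phase EB F x₀).lam (bivec P x₀) n fun i => loc x₀ (a i) := rfl

theorem ofSec_mem (v : Sec EB F E) : ofSec v ∈ extDeg EB F E 1 := fun x => by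
  change ExteriorAlgebra.ι ℝ (v x) ∈ ⋀[ℝ]^1 (E x)
  rw [ExteriorAlgebra.exteriorPower, pow_one]
  exact ⟨_, rfl⟩

theorem ofFun_mem (f : BaseFun EB C) : ofFun F E f ∈ extDeg EB F E 0 := fun x => by
  change algebraMap ℝ _ (f x) ∈ ⋀[ℝ]^0 (E x)
  rw [ExteriorAlgebra.exteriorPower, pow_zero, Submodule.mem_one]
  exact ⟨_, rfl⟩

theorem deg_germBracket (x₀ : C) {n : ℕ} {d : Fin n → ℤ} {a : Fin n → ExtSec EB F E}
    (ha : ∀ i, a i ∈ extDeg EB F E (d i)) :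
    (phase EB F x₀).Deg (2 - n + ∑ i, d i) (germBracket P x₀ n a) :=
  (deg_bivec P x₀).lam (fun i => deg_loc x₀ (ha i)) fun i => par_loc x₀ (ha i)

section

variable (x₀ : C) {k : ℕ} (v : Fin k → Sec EB F E)

/-- The iterated derivative of the bivector field along vertical vector fields. -/
noncomputable def derivBivec : LocalPhase F (center EB x₀) :=
  (phase EB F x₀).word (List.ofFn fun i => vecField x₀ (v i)) (bivec P x₀)

theorem grad_grad_derivBivec (h l : TotFun EB F E) :
    (phase EB F x₀).grad (fn E x₀ l) ((phase EB F x₀).grad (fn E x₀ h) (derivBivec P x₀ v)) =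
      fn E x₀ (iterLieD P v h l) := grad_grad_iterLieD P x₀ v h l

theorem germBracket_two (f g : BaseFun EB C) :
    germBracket P x₀ (k + 2) (Fin.snoc (Fin.snoc (fun i => ofSec (v i)) (ofFun F E f) :
      Fin (k + 1) → _) (ofFun F E g)) =
      bracketSign (k + 2) • loc x₀ (ofFun F E (restr (iterLieD P v (pull f) (pull g)))) := by
  have h := PInfty.PhaseAlgebra.lam_two_functions (ϖ := bivec P x₀)
    (fun i => isVec_vecField x₀ (v i)) (isFn_fn x₀ (pull f : TotFun EB F E))
    (isFn_fn x₀ (pull g : TotFun EB F E))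
    (p_fn_pull x₀ f) (p_fn_pull x₀ g)
  rw [germBracket_apply, loc_ofFun, ← p_fn, ← grad_grad_iterLieD, ← h]
  congr 1
  funext i
  refine Fin.lastCases ?_ (fun i => ?_) i
  · simp [loc_ofFun]
  · refine Fin.lastCases ?_ (fun i => ?_) i
    · simp [loc_ofFun]
    · simp [loc_ofSec]

theorem germBracket_one (f : BaseFun EB C) :
    germBracket P x₀ (k + 1) (Fin.snoc (fun i => ofSec (v i)) (ofFun F E f)) =
      bracketSign (k + 1) • (phase EB F x₀).p
        ((phase EB F x₀).grad (fn E x₀ (pull f)) (derivBivec P x₀ v)) := by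
  have h := PInfty.PhaseAlgebra.lam_one_function (ϖ := bivec P x₀)
    (fun i => isVec_vecField x₀ (v i)) (isFn_fn x₀ (pull f : TotFun EB F E)) (p_fn_pull x₀ f)
  rw [germBracket_apply, derivBivec, ← h]
  congr 1
  funext i
  refine Fin.lastCases ?_ (fun i => ?_) i
  · simp [loc_ofFun]
  · simp [loc_ofSec]

theorem germBracket_zero :
    germBracket P x₀ k (fun i => ofSec (v i)) =
      bracketSign k • (phase EB F x₀).p (derivBivec P x₀ v) := by
  have h := PInfty.PhaseAlgebra.lam_no_function (ϖ := bivec P x₀)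
    (fun i => isVec_vecField x₀ (v i))
  rw [germBracket_apply, derivBivec, ← h]
  simp only [loc_ofSec]

theorem germBracket_many {l : ℕ} (hl : 3 ≤ l) (f : Fin l → BaseFun EB C) :
    germBracket P x₀ (k + l) (Fin.append (fun i => ofSec (v i)) fun i => ofFun F E (f i)) = 0 := by
  have hv : ∀ w ∈ List.ofFn fun i => vecField x₀ (v i), (phase EB F x₀).IsVec w := by
    simpa [List.forall_mem_ofFn_iff] using fun i => isVec_vecField x₀ (v i)
  refine PInfty.PhaseAlgebra.lam_many_functions (fun i => isVec_vecField x₀ (v i))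
    (l := List.ofFn fun i => fn E x₀ (pull (f i))) ?_ ?_ (by simpa using hl) ?_
  · rw [← List.ofFn_fin_append]
    congr 1
    funext i
    refine Fin.addCases (fun i => ?_) (fun i => ?_) i
    · simp [loc_ofSec]
    · simp [loc_ofFun]
  · simpa [List.forall_mem_ofFn_iff] using fun i => ⟨isFn_fn x₀ _, p_fn_pull x₀ _⟩
  · intro f g hf _ hg _
    refine PInfty.PhaseAlgebra.isFn_grad_grad_word (fun f g hf hg => ?_) hv hf hg
    rw [bivec, PInfty.PhaseAlgebra.grad_grad_bivector (fun _ _ => isFn_fn _ _) (skew_bivec P x₀) hg]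
    exact PInfty.PhaseAlgebra.IsFn.sum fun A _ => PInfty.PhaseAlgebra.IsFn.sum fun B _ =>
      ((isFn_fn _ _).mul (hg.d A)).mul (hf.d B)

theorem ctr_p_grad_derivBivec (h : TotFun EB F E) (u : Conormal EB F E) :
    ctr x₀ u ((phase EB F x₀).p ((phase EB F x₀).grad (fn E x₀ h) (derivBivec P x₀ v))) =
      fn E x₀ (pull (restr (iterLieD P v h u.toFun))) := by
  rw [ctr_p, grad_grad_derivBivec, p_fn]

theorem ctr_ctr_p_derivBivec (u w : Conormal EB F E) :
    ctr x₀ w (ctr x₀ u ((phase EB F x₀).p (derivBivec P x₀ v))) =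
      fn E x₀ (pull (restr (iterLieD P v u.toFun w.toFun))) := by
  rw [ctr_p, ctr_p_grad_derivBivec]

/-- Sections of the conormal bundle are combinations of a local frame. -/
theorem p_grad_conormal {x₀ x : C} (hx : x ∈ core EB F E x₀) (u : Conormal EB F E)
    (y : LocalPhase F (center EB x)) :
    (phase EB F x).p ((phase EB F x).grad (fn E x u.toFun) y) =
      ∑ j, fn E x (pull (pairing (frame EB E x₀ j) u)) *
        (phase EB F x).p ((phase EB F x).grad (fn E x (fibreCoord EB E x₀ j).toFun) y) := by
  have h : fn E x u.toFun = ∑ j, fn E x (pull (pairing (frame EB E x₀ j) u)) *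
      fn E x (fibreCoord EB E x₀ j).toFun := by
    simp only [← map_mul, ← map_sum]
    refine fn_congr ?_
    filter_upwards [(isOpen_core x₀).mem_nhds hx] with x' hx' e
    rw [conormal_eq_sum hx' u e]
    exact (map_sum (⟨⟨fun h => h ⟨x', e⟩, rfl⟩, fun _ _ => rfl⟩ : TotFun EB F E →+ ℝ) (fun j =>
      pull (pairing (frame EB E x₀ j) u) * (fibreCoord EB E x₀ j).toFun) Finset.univ).symm
  rw [h, PInfty.PhaseAlgebra.grad_sum_arg, map_sum]
  refine Finset.sum_congr rfl fun j _ => ?_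
  rw [PInfty.PhaseAlgebra.grad_mul_arg _ (isFn_fn _ _), map_add, map_mul, map_mul, p_fn_pull,
    p_fn_conormal, zero_mul, add_zero]

/-- The local expression for a bracket with values in the sections of the bundle. -/
noncomputable def localSec (x₀ : C) (c : Fin (Module.finrank ℝ F) → BaseFun EB C) : ExtSec EB F E :=
  ∑ j, ofFun F E (c j) * ofSec (frame EB E x₀ j)

/-- The local expression for a bracket with values in the bivectors of the bundle. -/
noncomputable def localBisec (x₀ : C)
    (c : Fin (Module.finrank ℝ F) → Fin (Module.finrank ℝ F) → BaseFun EB C) : ExtSec EB F E :=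
  (1 / 2 : ℝ) • ∑ i, ∑ j,
    ofFun F E (c i j) * (ofSec (frame EB E x₀ i) * ofSec (frame EB E x₀ j))

theorem deg_localSec {x₀ : C} (x : C) (c : Fin (Module.finrank ℝ F) → BaseFun EB C) :
    (phase EB F x).Deg 1 (loc x (localSec (E := E) x₀ c)) := by
  rw [localSec, map_sum]
  refine PInfty.PhaseAlgebra.Deg.sum fun j _ => ?_
  have h := (deg_loc x (ofFun_mem (E := E) (c j))).mul (deg_loc x (ofSec_mem (frame EB E x₀ j)))
  rwa [zero_add, ← map_mul] at h

theorem deg_localBisec {x₀ : C} (x : C)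
    (c : Fin (Module.finrank ℝ F) → Fin (Module.finrank ℝ F) → BaseFun EB C) :
    (phase EB F x).Deg 2 (loc x (localBisec (E := E) x₀ c)) := by
  rw [localBisec, map_smul, map_sum]
  refine PInfty.PhaseAlgebra.Deg.smul (PInfty.PhaseAlgebra.Deg.sum fun i _ => ?_) _
  rw [map_sum]
  refine PInfty.PhaseAlgebra.Deg.sum fun j _ => ?_
  have h := (deg_loc x (ofFun_mem (E := E) (c i j))).mul
    ((deg_loc x (ofSec_mem (frame EB E x₀ i))).mul (deg_loc x (ofSec_mem (frame EB E x₀ j))))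
  rwa [zero_add, one_add_one_eq_two, ← map_mul, ← map_mul] at h

theorem ctr_localSec {x₀ : C} (x : C) (c : Fin (Module.finrank ℝ F) → BaseFun EB C)
    (u : Conormal EB F E) : ctr x u (loc x (localSec (E := E) x₀ c)) =
      ∑ j, fn E x (pull (c j)) * fn E x (pull (pairing (frame EB E x₀ j) u)) := by
  rw [localSec, map_sum, map_sum]
  refine Finset.sum_congr rfl fun j _ => ?_
  rw [map_mul, loc_ofFun, ctr_fn_mul, ctr_loc_ofSec]

/-- Skewness of the coefficients makes the two terms from contracting a product of frame vectors
contribute equally, which absorbs the factor 1/2. -/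
theorem ctr_ctr_localBisec {x₀ : C} (x : C)
    {c : Fin (Module.finrank ℝ F) → Fin (Module.finrank ℝ F) → BaseFun EB C}
    (hc : ∀ i j, fn E x (pull (c i j)) = -fn E x (pull (c j i) : TotFun EB F E))
    (u w : Conormal EB F E) : ctr x w (ctr x u (loc x (localBisec (E := E) x₀ c))) =
      ∑ j, ∑ i, fn E x (pull (pairing (frame EB E x₀ j) w)) *
        (fn E x (pull (pairing (frame EB E x₀ i) u)) * fn E x (pull (c i j))) := by
  let U := fun i : Fin (Module.finrank ℝ F) =>
    fn E x (pull (pairing (frame EB E x₀ i) u) : TotFun EB F E)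
  let W := fun i : Fin (Module.finrank ℝ F) =>
    fn E x (pull (pairing (frame EB E x₀ i) w) : TotFun EB F E)
  have h1 : ∀ i j, ctr x w (ctr x u (loc x (ofFun F E (c i j) *
      (ofSec (frame EB E x₀ i) * ofSec (frame EB E x₀ j))))) =
      W j * (U i * fn E x (pull (c i j))) + W i * (U j * fn E x (pull (c j i))) := fun i j => by
    have hγ : (phase EB F x).γ (loc x (ofSec (frame EB E x₀ i))) = -loc x (ofSec (frame EB E x₀ i)) := by
      rw [loc_ofSec]; exact (isVec_vecField _ _).γ
    rw [map_mul (loc x), map_mul (loc x), loc_ofFun, ctr_fn_mul, ctr_fn_mul, ctr_mul, hγ, ctr_loc_ofSec, map_add,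
      ctr_fn_mul, ctr_loc_ofSec, ctr_loc_ofSec, neg_mul, map_neg,
      ← (isFn_fn x (pull (pairing (frame EB E x₀ j) u))).comm, ctr_fn_mul, ctr_loc_ofSec, hc j i]
    simp only [U, W, ← map_mul, ← map_neg, ← map_add]
    congr 1
    ring
  have h2 : ctr x w (ctr x u (loc x (localBisec (E := E) x₀ c))) = (1 / 2 : ℝ) • ∑ i, ∑ j,
      (W j * (U i * fn E x (pull (c i j))) + W i * (U j * fn E x (pull (c j i)))) := by
    simp only [localBisec, map_smul, map_sum, h1]
  rw [h2]
  simp only [Finset.sum_add_distrib]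
  rw [Finset.sum_comm, ← two_smul ℝ, smul_smul]
  norm_num
  rfl

/-- Both sides have degree one and lie in the range of `p`, so it suffices to contract with conormal
sections, expanded in the frame at `x₀`. One section, built at `x₀`, serves all `x` in the core;
this uniformity is what makes the bracket smooth. -/
theorem germBracket_one_eq {x₀ x : C} (hx : x ∈ core EB F E x₀) (f : BaseFun EB C) :
    germBracket P x (k + 1) (Fin.snoc (fun i => ofSec (v i)) (ofFun F E f)) =
      loc x (bracketSign (k + 1) • localSec (E := E) x₀ fun j =>
        restr (iterLieD P v (pull f) (fibreCoord EB E x₀ j).toFun)) := by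
  -- The degree is read off from the bracket itself; the scalar `bracketSign` squares to one and can
  -- be removed.
  have hd : (phase EB F x).Deg 1 ((phase EB F x).p
        ((phase EB F x).grad (fn E x (pull f)) (derivBivec P x v))) := by
    have h := deg_germBracket P x (d := Fin.snoc (fun _ : Fin k => (1 : ℤ)) 0)
      (a := Fin.snoc (fun i => ofSec (v i)) (ofFun F E f)) (fun i => by
        refine Fin.lastCases ?_ (fun i => ?_) i
        · simpa using ofFun_mem f
        · simpa using ofSec_mem (v i))
    rw [germBracket_one, Fin.sum_univ_castSucc] at h
    simp only [Fin.snoc_castSucc, Fin.snoc_last, Finset.sum_const, Finset.card_univ,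
      Fintype.card_fin, nsmul_eq_mul, mul_one, add_zero] at h
    have h' := h.smul (bracketSign (k + 1))
    rw [smul_smul, bracketSign, PInfty.neg_one_zpow_mul_self, one_smul] at h'
    convert h' using 1
    push_cast
    ring
  rw [germBracket_one, map_smul]
  congr 1
  refine eq_of_ctr_one (E := E) x hd (deg_localSec x _) (PInfty.PhaseAlgebra.p_p _ _) (p_loc x _)
    fun u => ?_
  rw [ctr_localSec, ctr_p_grad_derivBivec, ← p_fn, ← grad_grad_derivBivec, p_grad_conormal hx]
  refine Finset.sum_congr rfl fun j _ => ?_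
  rw [grad_grad_derivBivec, p_fn, (isFn_fn x _).comm]

theorem germBracket_zero_eq {x₀ x : C} (hx : x ∈ core EB F E x₀) :
    germBracket P x k (fun i => ofSec (v i)) =
      loc x (bracketSign k • localBisec (E := E) x₀ fun i j =>
        restr (iterLieD P v (fibreCoord EB E x₀ i).toFun (fibreCoord EB E x₀ j).toFun)) := by
  have hd : (phase EB F x).Deg 2 ((phase EB F x).p (derivBivec P x v)) := by
    have h := deg_germBracket P x (d := fun _ : Fin k => (1 : ℤ))
      (a := fun i => ofSec (v i)) fun i => ofSec_mem (v i)
    rw [germBracket_zero] at h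
    simp only [Finset.sum_const, Finset.card_univ,
      Fintype.card_fin, nsmul_eq_mul, mul_one, sub_add_cancel] at h
    have h' := h.smul (bracketSign k)
    rwa [smul_smul, bracketSign, PInfty.neg_one_zpow_mul_self, one_smul] at h'
  have hskew : ∀ u w : Conormal EB F E, fn E x (pull (restr (iterLieD P v u.toFun w.toFun))) =
      -fn E x (pull (restr (iterLieD P v w.toFun u.toFun))) := fun u w => by
    rw [← p_fn, ← p_fn, ← grad_grad_derivBivec, ← grad_grad_derivBivec,
      PInfty.PhaseAlgebra.grad_anticomm (isFn_fn _ _) (isFn_fn _ _), map_neg]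
  rw [germBracket_zero, map_smul]
  congr 1
  refine eq_of_ctr_two (E := E) x hd (deg_localBisec x _) (PInfty.PhaseAlgebra.p_p _ _) (p_loc x _)
    fun u w => ?_
  rw [ctr_ctr_localBisec x fun i j => hskew _ _, ctr_ctr_p_derivBivec, ← p_fn,
    ← grad_grad_derivBivec, p_grad_conormal hx]
  refine Finset.sum_congr rfl fun j _ => ?_
  rw [PInfty.PhaseAlgebra.grad_anticomm (isFn_fn _ _) (isFn_fn _ _), map_neg, p_grad_conormal hx,
    ← Finset.mul_sum, ← Finset.sum_neg_distrib]
  congr 1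
  refine Finset.sum_congr rfl fun i _ => ?_
  rw [← mul_neg, ← map_neg, ← PInfty.PhaseAlgebra.grad_anticomm (isFn_fn _ _) (isFn_fn _ _),
    grad_grad_derivBivec, p_fn]

theorem append_two {α : Type*} {k : ℕ} (a : Fin k → α) (b : Fin 2 → α) :
    Fin.append a b = Fin.snoc (Fin.snoc a (b 0) : Fin (k + 1) → α) (b 1) := by
  have h : b = Fin.snoc (fun _ : Fin 1 => b 0) (b 1) := by
    funext i
    fin_cases i <;> rfl
  conv_lhs => rw [h, Fin.append_snoc, Fin.append_right_eq_snoc]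

/-- The brackets of generators are locally germs of sections. -/
theorem exists_loc_generators {l : ℕ} (f : Fin l → BaseFun EB C) : ∃ b : ExtSec EB F E,
    ∀ᶠ x in 𝓝 x₀, germBracket P x (k + l)
      (Fin.append (fun i => ofSec (v i)) fun i => ofFun F E (f i)) = loc x b := by
  rcases l with _ | _ | _ | l
  · have : (Fin.append (fun i => ofSec (v i)) fun i => ofFun F E (f i) : Fin k → ExtSec EB F E) =
        fun i => ofSec (v i) := Fin.append_right_nil _ _ rfl
    exact ⟨_, Filter.mem_of_superset (core_mem_nhds (EB := EB) (F := F) (E := E) x₀)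
      fun x hx => (congrArg _ this).trans (germBracket_zero_eq P v hx)⟩
  · have : (Fin.append (fun i => ofSec (v i)) fun i => ofFun F E (f i) :
        Fin (k + 1) → ExtSec EB F E) = Fin.snoc (fun i => ofSec (v i)) (ofFun F E (f 0)) :=
      Fin.append_right_eq_snoc _ _
    exact ⟨_, Filter.mem_of_superset (core_mem_nhds (EB := EB) (F := F) (E := E) x₀)
      fun x hx => (congrArg _ this).trans (germBracket_one_eq P v hx (f 0))⟩
  · refine ⟨bracketSign (k + 2) • ofFun F E (restr (iterLieD P v (pull (f 0)) (pull (f 1)))),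
      Filter.Eventually.of_forall fun x => ?_⟩
    have : (Fin.append (fun i => ofSec (v i)) fun i => ofFun F E (f i) :
        Fin (k + 2) → ExtSec EB F E) = Fin.snoc (Fin.snoc (fun i => ofSec (v i)) (ofFun F E (f 0)) :
      Fin (k + 1) → _) (ofFun F E (f 1)) := append_two _ _
    exact ((congrArg _ this).trans (germBracket_two P x v (f 0) (f 1))).trans
      (map_smul (loc x) _ _).symm
  · exact ⟨0, Filter.Eventually.of_forall fun x => by
      rw [map_zero]; exact germBracket_many P x v (by omega) f⟩

end

end Coiso

/-! ## Multiderivations are determined by their values on generators -/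

namespace PInfty

/-- Sorting by membership in `G₀` brings the arguments into the order in which values on generators
are prescribed; graded skew-symmetry will account for the permutation. -/
theorem exists_perm_append {A : Type*} {G₀ G₁ : Set A} {n : ℕ} {a : Fin n → A}
    (ha : ∀ i, a i ∈ G₀ ∪ G₁) : ∃ (σ : Equiv.Perm (Fin n)) (k l : ℕ) (h : k + l = n)
      (v : Fin k → A) (f : Fin l → A), (∀ i, v i ∈ G₀) ∧ (∀ i, f i ∈ G₁) ∧
        a ∘ σ = Fin.append v f ∘ Fin.cast h.symm := by
  classical
  let key : Fin n → ℕ := fun i => if a i ∈ G₀ then 0 else 1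
  let σ := Tuple.sort key
  have hσ : Monotone (key ∘ σ) := Tuple.monotone_sort key
  obtain ⟨k, hkn, hk0, hk1⟩ : ∃ k ≤ n, (∀ i : Fin n, (i : ℕ) < k → a (σ i) ∈ G₀) ∧
      ∀ i : Fin n, k ≤ i → a (σ i) ∉ G₀ := by
    by_cases h : ∃ k, ∃ hk : k < n, a (σ ⟨k, hk⟩) ∉ G₀
    · obtain ⟨hk, hk'⟩ := Nat.find_spec h
      refine ⟨Nat.find h, hk.le, fun i hi => ?_, fun i hi hi' => ?_⟩
      · by_contra hc
        exact Nat.find_min h hi ⟨i.2, hc⟩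
      · have h1 := hσ (show (⟨Nat.find h, hk⟩ : Fin n) ≤ i from hi)
        simp [key, hk', hi'] at h1
    · push Not at h
      exact ⟨n, le_rfl, fun i _ => h i i.2, fun i hi => absurd i.2 (by omega)⟩
  obtain ⟨l, rfl⟩ := Nat.exists_eq_add_of_le hkn
  refine ⟨σ, k, l, rfl, fun i => a (σ (Fin.castAdd l i)), fun i => a (σ (Fin.natAdd k i)),
    fun i => hk0 _ (by simp), fun i => (ha _).resolve_left (hk1 _ (by simp)), ?_⟩
  funext i
  refine Fin.addCases (fun i => ?_) (fun i => ?_) i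
  · simp
  · simp

/-- The induction is on the set of slots allowed to leave `S`, so that arguments are enlarged one at
a time. -/
theorem slot_induction {A : Type*} {n : ℕ} {S S' : Set A} {p : (Fin n → A) → Prop} (hS : S ⊆ S')
    (hp : ∀ a i, (∀ j, a j ∈ S') → (∀ s ∈ S, p (Function.update a i s)) →
      ∀ s ∈ S', p (Function.update a i s))
    (h0 : ∀ a, (∀ j, a j ∈ S) → p a) (a : Fin n → A) (ha : ∀ j, a j ∈ S') : p a := by
  have key : ∀ (t : Finset (Fin n)) (a : Fin n → A), (∀ j, a j ∈ S') → (∀ j ∉ t, a j ∈ S) → p a := by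
    intro t
    induction t using Finset.induction_on with
    | empty => exact fun a _ h => h0 a fun j => h j (by simp)
    | insert i t _ ih =>
      intro a ha h
      have := hp a i ha (fun s hs => ih _ (fun j => ?_) fun j hj => ?_) (a i) (ha i)
      · rwa [Function.update_eq_self] at this
      · rcases eq_or_ne j i with rfl | hji
        · simpa using hS hs
        · simpa [hji] using ha j
      · rcases eq_or_ne j i with rfl | hji
        · simpa using hs
        · simpa [hji] using h j (by simp [hji, hj])
  exact key Finset.univ a ha (by simp)

variable {A B : Type*} [Ring A] [Algebra ℝ A] [Ring B] [Algebra ℝ B]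

/-- A multilinear map which is graded skew-symmetric and a derivation in each argument, up to
scalar factors. -/
structure IsMultiderivation (𝒜 : ℤ → Submodule ℝ A) (ρ : A →ₐ[ℝ] B) {n : ℕ}
    (N : MultilinearMap ℝ (fun _ : Fin n => A) B) : Prop where
  skew : ∀ (d : Fin n → ℤ) (a : Fin n → A), (∀ i, a i ∈ 𝒜 (d i)) → ∀ i j : Fin n, (i : ℕ) + 1 = j →
    ∃ c : ℝ, N a = c • N (a ∘ Equiv.swap i j)
  derivation : ∀ (d : Fin n → ℤ) (a : Fin n → A), (∀ i, a i ∈ 𝒜 (d i)) → ∀ i : Fin n,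
    (∀ j, j ≤ i) → ∀ (k : ℤ) (b c : A), b ∈ 𝒜 k → ∃ ε : ℝ, N (Function.update a i (b * c)) =
      N (Function.update a i b) * ρ c + ε • (ρ b * N (Function.update a i c))

namespace IsMultiderivation

variable {𝒜 : ℤ → Submodule ℝ A} {ρ : A →ₐ[ℝ] B} {n : ℕ}
  {N : MultilinearMap ℝ (fun _ : Fin n => A) B} (hN : IsMultiderivation 𝒜 ρ N)

include hN

theorem exists_perm_smul {d : Fin n → ℤ} {a : Fin n → A} (ha : ∀ i, a i ∈ 𝒜 (d i))
    (σ : Equiv.Perm (Fin n)) : ∃ c : ℝ, N a = c • N (a ∘ σ) := by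
  cases n with
  | zero => exact ⟨1, by rw [one_smul, Subsingleton.elim (a ∘ σ) a]⟩
  | succ n =>
    have hσ : σ ∈ Submonoid.closure
        (Set.range fun i : Fin n => Equiv.swap i.castSucc i.succ) := by
      rw [Equiv.Perm.mclosure_swap_castSucc_succ]; trivial
    induction hσ using Submonoid.closure_induction_right with
    | one => exact ⟨1, by rw [one_smul]; rfl⟩
    | mul_right x hx y hy ih =>
      obtain ⟨i, rfl⟩ := hy
      obtain ⟨c, hc⟩ := ih
      obtain ⟨c', hc'⟩ := hN.skew (d ∘ x) (a ∘ x) (fun j => ha (x j)) i.castSucc i.succ (by simp)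
      exact ⟨c * c', by rw [hc, hc', smul_smul]; rfl⟩

/-- The product rule is assumed only in the last slot. A transposition carries slot `i` there and
back at the cost of scalars, whose values are irrelevant for membership in a submodule. -/
theorem update_mul {d : Fin n → ℤ} {a : Fin n → A} (ha : ∀ i, a i ∈ 𝒜 (d i)) (i : Fin n)
    {k k' : ℤ} {b c : A} (hb : b ∈ 𝒜 k) (hc : c ∈ 𝒜 k') (hbc : b * c ∈ 𝒜 (k + k')) :
    ∃ ε ε' : ℝ, N (Function.update a i (b * c)) = ε • (N (Function.update a i b) * ρ c) +
      ε' • (ρ b * N (Function.update a i c)) := by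
  obtain ⟨j, hj⟩ : ∃ j : Fin n, ∀ l, l ≤ j := by
    cases n with
    | zero => exact i.elim0
    | succ n => exact ⟨Fin.last n, Fin.le_last⟩
  set τ := Equiv.swap i j
  have hupd : ∀ x, Function.update a i x ∘ τ = Function.update (a ∘ τ) j x := fun x => by
    rw [← Equiv.swap_apply_left i j]
    exact (Function.update_comp_equiv a τ _ x).symm ▸ by simp [τ]
  have hmem : ∀ {x : A} {k : ℤ}, x ∈ 𝒜 k → ∀ l, Function.update a i x l ∈
      𝒜 (Function.update d i k l) := fun {x k} hx l => by
    rcases eq_or_ne l i with rfl | h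
    · simpa using hx
    · simpa [h] using ha l
  obtain ⟨e₁, h₁⟩ := hN.exists_perm_smul (hmem hbc) τ
  have hback : ∀ {x : A} {k : ℤ}, x ∈ 𝒜 k → ∃ e : ℝ, N (Function.update (a ∘ τ) j x) =
      e • N (Function.update a i x) := fun {x k} hx => by
    obtain ⟨e, he⟩ := hN.exists_perm_smul (a := Function.update a i x ∘ τ)
      (d := Function.update d i k ∘ τ) (fun l => hmem hx (τ l)) τ
    refine ⟨e, ?_⟩
    rw [← hupd, he]
    congr 2
    funext l
    simp [τ]
  obtain ⟨e₂, h₂⟩ := hback hb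
  obtain ⟨e₃, h₃⟩ := hback hc
  obtain ⟨e₄, h₄⟩ := hN.derivation (d ∘ τ) (a ∘ τ) (fun l => ha (τ l)) j hj k b c hb
  refine ⟨e₁ * e₂, e₁ * e₄ * e₃, ?_⟩
  rw [h₁, hupd, h₄, h₂, h₃, smul_mul_assoc, mul_smul_comm, smul_add, smul_smul, smul_smul,
    smul_smul]

/-- A multiderivation with values in a submodule on generators takes values in this submodule,
if elements of the algebra are locally polynomials in the generators. -/
theorem mem_of_generators (h𝒜 : IsGradedCommutative 𝒜) {G₀ G₁ : Set A} {I : Set A}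
    {Z : Submodule ℝ B} (hG₀ : G₀ ⊆ 𝒜 1) (hG₁ : G₁ ⊆ 𝒜 0) (h1 : 1 ∈ G₁)
    (hZl : ∀ a, ∀ z ∈ Z, ρ a * z ∈ Z) (hZr : ∀ a, ∀ z ∈ Z, z * ρ a ∈ Z)
    (hIl : ∀ a ∈ I, ∀ y, ρ a * y ∈ Z) (hIr : ∀ a ∈ I, ∀ y, y * ρ a ∈ Z)
    (hloc : ∀ k, ∀ a ∈ 𝒜 k, ∃ a' ∈ Submodule.span ℝ (Submonoid.closure (G₀ ∪ G₁) : Set A),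
      ∃ s t, s ∈ I ∧ t ∈ I ∧ s ∈ 𝒜 0 ∧ t ∈ 𝒜 k ∧ a = a' + s * t)
    (hgen : ∀ (k l : ℕ) (h : k + l = n) (v : Fin k → A) (f : Fin l → A), (∀ i, v i ∈ G₀) →
      (∀ i, f i ∈ G₁) → N (Fin.append v f ∘ Fin.cast h.symm) ∈ Z) (a : Fin n → A) : N a ∈ Z := by
  let S : Set A := {x | ∃ k, x ∈ 𝒜 k}
  have hGS : G₀ ∪ G₁ ⊆ S := by
    rintro x (hx | hx)
    · exact ⟨1, hG₀ hx⟩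
    · exact ⟨0, hG₁ hx⟩
  have hMS : (Submonoid.closure (G₀ ∪ G₁) : Set A) ⊆ S := fun x hx => by
    induction hx using Submonoid.closure_induction with
    | mem x hx => exact hGS hx
    | one => exact ⟨0, h𝒜.one_mem⟩
    | mul x y _ _ hx hy =>
      obtain ⟨k, hk⟩ := hx
      obtain ⟨l, hl⟩ := hy
      exact ⟨k + l, h𝒜.mul_mem hk hl⟩
  have hsum : ∀ (a : Fin n → A) (i : Fin n), ∃ L : A →ₗ[ℝ] B, ∀ x, N (Function.update a i x) = L x :=
    fun a i => ⟨N.toLinearMap a i, fun x => rfl⟩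
  -- The arguments are enlarged in stages: generators, monomials in them, homogeneous elements, and
  -- finally all elements.
  have hG : ∀ a : Fin n → A, (∀ j, a j ∈ G₀ ∪ G₁) → N a ∈ Z := fun a ha => by
    choose d hd using fun j => hGS (ha j)
    obtain ⟨σ, k, l, h, v, f, hv, hf, hvf⟩ := exists_perm_append ha
    obtain ⟨c, hc⟩ := hN.exists_perm_smul hd σ
    rw [hc, hvf]
    exact Z.smul_mem c (hgen k l h v f hv hf)
  have hM : ∀ a : Fin n → A, (∀ j, a j ∈ (Submonoid.closure (G₀ ∪ G₁) : Set A)) → N a ∈ Z := by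
    refine slot_induction Submonoid.subset_closure (fun a i ha hs s hs' => ?_) hG
    choose d hd using fun j => hMS (ha j)
    induction hs' using Submonoid.closure_induction with
    | mem x hx => exact hs x hx
    | one => exact hs 1 (Or.inr h1)
    | mul x y hx' hy' hx hy =>
      obtain ⟨k, hk⟩ := hMS hx'
      obtain ⟨l, hl⟩ := hMS hy'
      obtain ⟨ε, ε', h⟩ := hN.update_mul hd i hk hl (h𝒜.mul_mem hk hl)
      rw [h]
      exact Z.add_mem (Z.smul_mem _ (hZr _ _ hx)) (Z.smul_mem _ (hZl _ _ hy))
  have hS : ∀ a : Fin n → A, (∀ j, a j ∈ S) → N a ∈ Z := by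
    refine slot_induction hMS (fun a i ha hs s hs' => ?_) hM
    choose d hd using ha
    obtain ⟨k, hk⟩ := hs'
    obtain ⟨a', ha', s, t, hsI, htI, hs0, ht0, rfl⟩ := hloc k s hk
    -- Locality: both factors of the remainder lie in `I`, so each term of the product rule still
    -- contains one of them and lies in `Z`.
    obtain ⟨ε, ε', h⟩ := hN.update_mul hd i hs0 ht0 (h𝒜.mul_mem hs0 ht0)
    rw [N.map_update_add, h]
    refine Z.add_mem ?_ (Z.add_mem (Z.smul_mem _ (hIr _ htI _)) (Z.smul_mem _ (hIl _ hsI _)))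
    obtain ⟨L, hL⟩ := hsum a i
    simp only [hL] at hs ⊢
    have : Submodule.span ℝ (Submonoid.closure (G₀ ∪ G₁) : Set A) ≤ Z.comap L :=
      Submodule.span_le.2 hs
    exact this ha'
  refine slot_induction (S' := Set.univ) (Set.subset_univ S) (fun a i _ hs s _ => ?_) hS a
    fun _ => trivial
  obtain ⟨L, hL⟩ := hsum a i
  simp only [hL] at hs ⊢
  have : ⨆ k, 𝒜 k ≤ Z.comap L := iSup_le fun k x hx => hs x ⟨k, hx⟩
  rw [h𝒜.isInternal.submodule_iSup_eq_top] at this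
  exact this trivial

end IsMultiderivation

end PInfty

namespace Coiso

variable {EB F C : Type*} [NormedAddCommGroup EB] [NormedSpace ℝ EB] [FiniteDimensional ℝ EB]
    [NormedAddCommGroup F] [NormedSpace ℝ F] [FiniteDimensional ℝ F]
    [TopologicalSpace C] [ChartedSpace EB C] [T2Space C]
    {E : C → Type*} [TopologicalSpace (TotalSpace F E)]
    [∀ x, AddCommGroup (E x)] [∀ x, Module ℝ (E x)] [∀ x, TopologicalSpace (E x)]
    [FiberBundle F E] [VectorBundle ℝ F E]
    [IsManifold 𝓘(ℝ, EB) ∞ C] [ContMDiffVectorBundle ∞ F E 𝓘(ℝ, EB)]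

/-! ## The graded algebra of sections -/

section homogeneous

variable {V V' : Type*} [AddCommGroup V] [Module ℝ V] [AddCommGroup V'] [Module ℝ V']

theorem proj_of_mem {i j : ℕ} {y : ExteriorAlgebra ℝ V} (hy : y ∈ ⋀[ℝ]^i V) :
    GradedAlgebra.proj (fun k : ℕ => ⋀[ℝ]^k V) j y = if i = j then y else 0 := by
  rw [GradedAlgebra.proj_apply]
  split_ifs with h
  · subst h
    exact DirectSum.decompose_of_mem_same _ hy
  · exact DirectSum.decompose_of_mem_ne _ hy h

theorem map_proj (f : V →ₗ[ℝ] V') (j : ℕ) (y : ExteriorAlgebra ℝ V) :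
    ExteriorAlgebra.map f (GradedAlgebra.proj (fun k : ℕ => ⋀[ℝ]^k V) j y) =
      GradedAlgebra.proj (fun k : ℕ => ⋀[ℝ]^k V') j (ExteriorAlgebra.map f y) := by
  induction y using DirectSum.Decomposition.inductionOn (fun k : ℕ => ⋀[ℝ]^k V) with
  | zero => simp only [map_zero]
  | homogeneous y =>
    rw [proj_of_mem y.2, proj_of_mem (map_mem_exteriorPower f y.2)]
    split_ifs <;> simp
  | add x y hx hy => simp only [map_add, hx, hy]

end homogeneous

/-- The homogeneous components of a section of the exterior algebra bundle. -/
noncomputable def homog (j : ℕ) : ExtSec EB F E →ₗ[ℝ] ExtSec EB F E where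
  toFun a := ⟨fun x => GradedAlgebra.proj (fun k : ℕ => ⋀[ℝ]^k (E x)) j (a.1 x), fun x₀ φ => by
    refine (a.2 x₀ (φ ∘ₗ GradedAlgebra.proj (fun k : ℕ => ⋀[ℝ]^k F) j)).congr_of_eventuallyEq
      (Filter.Eventually.of_forall fun x => ?_)
    exact congrArg φ (map_proj _ _ _)⟩
  map_add' a b := Subtype.ext (funext fun x => map_add _ _ _)
  map_smul' c a := Subtype.ext (funext fun x =>
    map_smul (GradedAlgebra.proj (fun k : ℕ => ⋀[ℝ]^k (E x)) j) c (a.1 x))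

theorem homog_mem (j : ℕ) (a : ExtSec EB F E) : homog j a ∈ extDeg EB F E j := fun x => by
  change GradedAlgebra.proj (fun k : ℕ => ⋀[ℝ]^k (E x)) j (a.1 x) ∈ _
  rw [GradedAlgebra.proj_apply]
  exact SetLike.coe_mem _

theorem homog_of_mem {k : ℤ} {j : ℕ} {a : ExtSec EB F E} (ha : a ∈ extDeg EB F E k) :
    homog j a = if k = j then a else 0 := by
  rcases k with k | k
  · refine Subtype.ext (funext fun x => (proj_of_mem (ha x)).trans ?_)
    simp only [Int.ofNat_eq_natCast, Nat.cast_inj]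
    split_ifs <;> rfl
  · rw [show a = 0 from ha, map_zero, ite_self]

theorem proj_eq_zero (x : C) {j : ℕ} (hj : Module.finrank ℝ F < j) (y : ExteriorAlgebra ℝ (E x)) :
    GradedAlgebra.proj (fun k : ℕ => ⋀[ℝ]^k (E x)) j y = 0 := by
  have hbot : (⋀[ℝ]^j F : Submodule ℝ (ExteriorAlgebra ℝ F)) = ⊥ := by
    have h := exteriorPower.finrank_eq ℝ j (M := F)
    rw [Nat.choose_eq_zero_of_lt hj] at h
    have := finite_exteriorAlgebra F
    exact Submodule.finrank_eq_zero.mp h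
  have hx := FiberBundle.mem_baseSet_trivializationAt F E x
  rw [← extTrivSymm_extTriv (F := F) hx (GradedAlgebra.proj (fun k : ℕ => ⋀[ℝ]^k (E x)) j y)]
  have : extTriv F x x (GradedAlgebra.proj (fun k : ℕ => ⋀[ℝ]^k (E x)) j y) ∈ ⋀[ℝ]^j F :=
    map_mem_exteriorPower _ (by
      rw [GradedAlgebra.proj_apply]; exact SetLike.coe_mem _)
  rw [hbot, Submodule.mem_bot] at this
  rw [this, map_zero]

theorem sum_homog (a : ExtSec EB F E) :
    ∑ j ∈ Finset.range (Module.finrank ℝ F + 1), homog j a = a := by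
  refine Subtype.ext (funext fun x => ?_)
  rw [AddSubmonoidClass.coe_finsetSum, Finset.sum_apply]
  change ∑ j ∈ _, GradedAlgebra.proj (fun k : ℕ => ⋀[ℝ]^k (E x)) j (a.1 x) = a.1 x
  classical
  conv_rhs => rw [← DirectSum.sum_support_decompose (fun k : ℕ => ⋀[ℝ]^k (E x)) (a.1 x)]
  symm
  refine Finset.sum_subset (fun j hj => ?_) fun j _ hj => ?_
  · by_contra h
    rw [DFinsupp.mem_support_iff] at hj
    refine hj (Subtype.ext (proj_eq_zero (F := F) x ?_ (a.1 x)))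
    simpa using h
  · rw [DFinsupp.notMem_support_iff] at hj
    rw [hj]
    rfl

theorem isGradedCommutative_extDeg : PInfty.IsGradedCommutative (extDeg EB F E) where
  one_mem := ofFun_mem (1 : BaseFun EB C)|> fun h => by
    convert h using 1
    exact Subtype.ext (funext fun x => (map_one _).symm)
  mul_mem {i j a b} ha hb := mem_extDeg_of_deg_loc fun x₀ => by
    rw [map_mul]
    exact (deg_loc x₀ ha).mul (deg_loc x₀ hb)
  isInternal := by
    refine DirectSum.isInternal_submodule_of_iSupIndep_of_iSup_eq_top (fun i => ?_) ?_
    · rw [Submodule.disjoint_def]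
      intro a ha ha'
      rcases i with i | i
      · have : ⨆ j, ⨆ _ : j ≠ Int.ofNat i, extDeg EB F E j ≤ LinearMap.ker (homog i) :=
          iSup_le fun j => iSup_le fun hj b hb => by
            exact (homog_of_mem hb).trans (if_neg hj)
        have h := this ha'
        exact ((homog_of_mem ha).trans (if_pos rfl)).symm.trans h
      · exact ha
    · refine eq_top_iff.2 fun a _ => ?_
      rw [← sum_homog a]
      exact Submodule.sum_mem _ fun j _ => Submodule.mem_iSup_of_mem (j : ℤ) (homog_mem j a)
  graded_comm {i j a b} ha hb := Subtype.ext (funext fun x => apply_eq_of_loc_eq (by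
    rw [map_smul, map_mul, map_mul]
    exact (par_loc x ha).comm (par_loc x hb)))

/-! ## Sections are locally polynomials in generators -/

theorem contMDiffAt_section_symm {x₀ x : C} (hx : x ∈ (trivializationAt F E x₀).baseSet) (v : F) :
    ContMDiffAt 𝓘(ℝ, EB) 𝓘(ℝ, F) ∞ (fun y =>
      (trivializationAt F E x₀).linearMapAt ℝ y ((trivializationAt F E x).symmₗ ℝ y v)) x := by
  have h : ContMDiffAt 𝓘(ℝ, EB) (𝓘(ℝ, EB).prod 𝓘(ℝ, F)) ∞
      (fun y => TotalSpace.mk' F y ((trivializationAt F E x).symm y v)) x := by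
    rw [(trivializationAt F E x).contMDiffAt_section_iff (mem_baseSet F E x)]
    refine (contMDiffAt_const (c := v)).congr_of_eventuallyEq ?_
    filter_upwards [(trivializationAt F E x).open_baseSet.mem_nhds (mem_baseSet F E x)] with y hy
    rw [Bundle.Trivialization.apply_mk_symm _ hy]
  refine (((trivializationAt F E x₀).contMDiffAt_section_iff hx).1 h).congr_of_eventuallyEq ?_
  filter_upwards [(trivializationAt F E x₀).open_baseSet.mem_nhds hx,
    (trivializationAt F E x).open_baseSet.mem_nhds (mem_baseSet F E x)] with y hy hy'
  rw [Bundle.Trivialization.linearMapAt_apply, if_pos hy]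
  rw [show (trivializationAt F E x).symmₗ ℝ y v = (trivializationAt F E x).symm y v from
    congrFun (Bundle.Trivialization.coe_symmₗ (R := ℝ) _ hy') v]

theorem contMDiffAt_extTriv_extTrivSymm {x₀ x : C} (hx : x ∈ (trivializationAt F E x₀).baseSet)
    (B : ExteriorAlgebra ℝ F) (φ : Module.Dual ℝ (ExteriorAlgebra ℝ F)) :
    ContMDiffAt 𝓘(ℝ, EB) 𝓘(ℝ, ℝ) ∞
      (fun y => φ (extTriv F x₀ y (extTrivSymm F x y B : ExteriorAlgebra ℝ (E y)))) x := by
  induction B using ExteriorAlgebra.induction generalizing φ with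
  | algebraMap r =>
    simp only [AlgHom.commutes]
    exact contMDiffAt_const
  | ι v =>
    simp only [extTriv, extTrivSymm, ExteriorAlgebra.map_apply_ι]
    exact (LinearMap.toContinuousLinearMap (φ ∘ₗ ExteriorAlgebra.ι ℝ)).contMDiff.contMDiffAt.comp x
      (contMDiffAt_section_symm (EB := EB) hx v)
  | add a b ha hb =>
    simp only [map_add]
    exact (ha φ).add (hb φ)
  | mul a b ha hb =>
    have := finite_exteriorAlgebra F
    let B := Module.finBasis ℝ (ExteriorAlgebra ℝ F)
    have key : ∀ p q : ExteriorAlgebra ℝ F,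
        φ (p * q) = ∑ i, ∑ j, B.coord i p * B.coord j q * φ (B i * B j) := by
      intro p q
      conv_lhs => rw [← B.sum_repr p, ← B.sum_repr q]
      rw [Finset.sum_mul_sum]
      simp only [map_sum, smul_mul_smul_comm, map_smul, smul_eq_mul, Module.Basis.coord_apply]
    simp only [map_mul]
    simp_rw [fun y => key (extTriv F x₀ y (extTrivSymm F x y a : ExteriorAlgebra ℝ (E y)))]
    exact contMDiffAt_finsetSum fun i _ => contMDiffAt_finsetSum fun j _ =>
      ((ha (B.coord i)).mul (hb (B.coord j))).mul contMDiffAt_const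

/-- The definition of smoothness tests the trivialization at each point only at that point.
Smoothness of the transition maps extends this to the whole base set. -/
theorem contMDiffAt_extTriv (a : ExtSec EB F E) {x₀ x : C}
    (hx : x ∈ (trivializationAt F E x₀).baseSet) (φ : Module.Dual ℝ (ExteriorAlgebra ℝ F)) :
    ContMDiffAt 𝓘(ℝ, EB) 𝓘(ℝ, ℝ) ∞ (fun y => φ (extTriv F x₀ y (a.1 y))) x := by
  have := finite_exteriorAlgebra F
  let B := Module.finBasis ℝ (ExteriorAlgebra ℝ F)
  have h : ContMDiffAt 𝓘(ℝ, EB) 𝓘(ℝ, ℝ) ∞ (fun y => ∑ i, B.coord i (extTriv F x y (a.1 y)) *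
      φ (extTriv F x₀ y (extTrivSymm F x y (B i) : ExteriorAlgebra ℝ (E y)))) x :=
    contMDiffAt_finsetSum fun i _ =>
      ContMDiffAt.mul (a.2 x (B.coord i)) (contMDiffAt_extTriv_extTrivSymm hx (B i) φ)
  refine h.congr_of_eventuallyEq ?_
  filter_upwards [(trivializationAt F E x).open_baseSet.mem_nhds (mem_baseSet F E x)] with y hy
  conv_lhs => rw [← extTrivSymm_extTriv hy (a.1 y), ← B.sum_repr (extTriv F x y (a.1 y))]
  simp only [map_sum, map_smul, smul_eq_mul]
  rfl

variable (EB E) in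
/-- The sections of the exterior algebra bundle which are constant in a trivialization. -/
noncomputable def frameHom (x₀ : C) : ExteriorAlgebra ℝ F →ₐ[ℝ] ExtSec EB F E :=
  ExteriorAlgebra.lift ℝ ⟨(Module.finBasis ℝ F).constr ℝ fun j => ofSec (frame EB E x₀ j),
    fun v => Subtype.ext (funext fun y => by
      have h : ((Module.finBasis ℝ F).constr ℝ (fun j => ofSec (frame EB E x₀ j)) v).1 y ∈
          LinearMap.range (ExteriorAlgebra.ι ℝ (M := E y)) := by
        rw [Module.Basis.constr_apply_fintype, AddSubmonoidClass.coe_finsetSum, Finset.sum_apply]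
        exact Submodule.sum_mem _ fun j _ => Submodule.smul_mem _ _ ⟨_, rfl⟩
      obtain ⟨w, hw⟩ := h
      change _ * _ = (0 : ExteriorAlgebra ℝ (E y))
      rw [← hw]
      exact ExteriorAlgebra.ι_sq_zero w)⟩

theorem frameHom_ι (x₀ : C) (j) : frameHom EB E x₀ (ExteriorAlgebra.ι ℝ (Module.finBasis ℝ F j)) =
    ofSec (frame EB E x₀ j) := by
  rw [frameHom, ExteriorAlgebra.lift_ι_apply]
  exact Module.Basis.constr_basis _ _ _ _

theorem frameHom_apply {x₀ x : C} (hx : x ∈ core EB F E x₀) (y : ExteriorAlgebra ℝ F) :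
    (frameHom EB E x₀ y).1 x = extTrivSymm F x₀ x y := by
  have h : ((Pi.evalAlgHom ℝ (fun x => ExteriorAlgebra ℝ (E x)) x).comp
      (ExtSec EB F E).val).comp (frameHom EB E x₀) = extTrivSymm F x₀ x := by
    refine ExteriorAlgebra.hom_ext ((Module.finBasis ℝ F).ext fun j => ?_)
    change (frameHom EB E x₀ (ExteriorAlgebra.ι ℝ (Module.finBasis ℝ F j))).1 x =
      extTrivSymm F x₀ x (ExteriorAlgebra.ι ℝ (Module.finBasis ℝ F j))
    rw [frameHom_ι, extTrivSymm, ExteriorAlgebra.map_apply_ι]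
    change ExteriorAlgebra.ι ℝ (frame EB E x₀ j x) = _
    rw [frame_apply hx]
  exact DFunLike.congr_fun h y

theorem frameHom_mem_adjoin (x₀ : C) (y : ExteriorAlgebra ℝ F) :
    frameHom EB E x₀ y ∈ Algebra.adjoin ℝ (Set.range (ofSec (EB := EB) (F := F) (E := E)) ∪
      Set.range (ofFun (EB := EB) F E)) := by
  induction y using ExteriorAlgebra.induction with
  | algebraMap r =>
    rw [AlgHom.commutes]
    exact Subalgebra.algebraMap_mem _ r
  | ι v =>
    rw [frameHom, ExteriorAlgebra.lift_ι_apply, Module.Basis.constr_apply_fintype]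
    refine Subalgebra.sum_mem _ fun j _ => Subalgebra.smul_mem _ (Algebra.subset_adjoin ?_) _
    exact Or.inl ⟨_, rfl⟩
  | mul a b ha hb =>
    rw [map_mul]
    exact Subalgebra.mul_mem _ ha hb
  | add a b ha hb =>
    rw [map_add]
    exact Subalgebra.add_mem _ ha hb

/-- Let ψ = 1 near `x₀` and χ = 1 on the support of ψ. Then (1 - ψ)(1 - χ) = 1 - χ, so a = χa + (1 -
ψ) · (1 - χ)a. The first term is a polynomial in the local frame and functions. The remainder is
written as a product of two sections vanishing near `x₀` because derivations then visibly kill it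
there. -/
theorem exists_local_decomposition (x₀ : C) {k : ℤ} {a : ExtSec EB F E}
    (ha : a ∈ extDeg EB F E k) :
    ∃ a' ∈ Submodule.span ℝ ((Submonoid.closure (Set.range (ofSec (EB := EB) (F := F) (E := E)) ∪
      Set.range (ofFun (EB := EB) F E)) : Submonoid (ExtSec EB F E)) : Set (ExtSec EB F E)),
      ∃ s t : ExtSec EB F E,
        (∀ᶠ x in 𝓝 x₀, s.1 x = 0) ∧ (∀ᶠ x in 𝓝 x₀, t.1 x = 0) ∧ s ∈ extDeg EB F E 0 ∧
          t ∈ extDeg EB F E k ∧ a = a' + s * t := by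
  obtain ⟨χ, hχ, hχ'⟩ := exists_cutoff (EB := EB)
    (core_mem_nhds (EB := EB) (F := F) (E := E) x₀)
  obtain ⟨ψ, hψ, hψ'⟩ := exists_cutoff (EB := EB) hχ
  have := finite_exteriorAlgebra F
  let B := Module.finBasis ℝ (ExteriorAlgebra ℝ F)
  let c : Fin (Module.finrank ℝ (ExteriorAlgebra ℝ F)) → BaseFun EB C := fun i =>
    ⟨fun x => χ x * B.coord i (extTriv F x₀ x (a.1 x)), contMDiff_cutoff_mul fun x hx =>
      contMDiffAt_extTriv a (core_subset_patch x₀ (hχ' hx)).2 _⟩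
  have hdec : ofFun F E χ * a = ∑ i, ofFun F E (c i) * frameHom EB E x₀ (B i) := by
    refine Subtype.ext (funext fun x => ?_)
    rw [AddSubmonoidClass.coe_finsetSum, Finset.sum_apply]
    change algebraMap ℝ _ (χ x) * a.1 x = ∑ i, algebraMap ℝ _ (χ x * _) *
      (frameHom EB E x₀ (B i)).1 x
    by_cases hx : x ∈ tsupport χ
    · have hx' := hχ' hx
      simp only [frameHom_apply hx']
      conv_lhs => rw [← extTrivSymm_extTriv (core_subset_patch x₀ hx').2 (a.1 x),
        ← B.sum_repr (extTriv F x₀ x (a.1 x))]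
      simp only [map_sum, map_smul, map_mul, Finset.mul_sum, mul_assoc, Algebra.smul_def,
        AlgHom.commutes]
      rfl
    · rw [image_eq_zero_of_notMem_tsupport hx]
      simp only [zero_mul, map_zero, Finset.sum_const_zero]
  have h1 : ∀ f : BaseFun EB C, (1 - ofFun F E f) ∈ extDeg EB F E 0 := fun f =>
    Submodule.sub_mem _ isGradedCommutative_extDeg.one_mem (ofFun_mem f)
  have hz : ∀ {f : BaseFun EB C} {x : C} (b : ExtSec EB F E), f x = 1 →
      ((1 - ofFun F E f) * b).1 x = 0 := fun {f x} b h => by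
    change (1 - algebraMap ℝ _ (f x)) * b.1 x = 0
    rw [h, map_one, sub_self, zero_mul]
  refine ⟨ofFun F E χ * a, ?_, 1 - ofFun F E ψ, (1 - ofFun F E χ) * a, ?_, ?_, h1 ψ, ?_, ?_⟩
  · rw [hdec, ← Algebra.adjoin_eq_span, Subalgebra.mem_toSubmodule]
    exact Subalgebra.sum_mem _ fun i _ => Subalgebra.mul_mem _
      (Algebra.subset_adjoin (Or.inr ⟨_, rfl⟩)) (frameHom_mem_adjoin x₀ _)
  · filter_upwards [hψ] with x hx
    rw [← mul_one (1 - ofFun F E ψ)]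
    exact hz 1 hx
  · filter_upwards [hχ] with x hx
    exact hz a hx
  · have := isGradedCommutative_extDeg.mul_mem (h1 χ) ha
    rwa [zero_add] at this
  · refine Subtype.ext (funext fun x => ?_)
    by_cases hx : x ∈ tsupport ψ
    · have : χ x = 1 := hψ' hx
      change _ = algebraMap ℝ _ (χ x) * a.1 x + (1 - algebraMap ℝ _ (ψ x)) *
        ((1 - algebraMap ℝ _ (χ x)) * a.1 x)
      rw [this, map_one, sub_self, one_mul, zero_mul, mul_zero, add_zero]
    · change _ = algebraMap ℝ _ (χ x) * a.1 x + (1 - algebraMap ℝ _ (ψ x)) *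
        ((1 - algebraMap ℝ _ (χ x)) * a.1 x)
      rw [image_eq_zero_of_notMem_tsupport hx, map_zero, sub_zero, one_mul, sub_mul, one_mul,
        add_sub_cancel]

end Coiso

/-! ### Brackets as multiderivations -/

namespace PInfty

theorem isMultiderivation_of_snoc {A B : Type*} [Ring A] [Algebra ℝ A] [Ring B] [Algebra ℝ B]
    {𝒜 : ℤ → Submodule ℝ A} {ρ : A →ₐ[ℝ] B}
    (L : ∀ n : ℕ, MultilinearMap ℝ (fun _ : Fin n => A) B)
    (skew : ∀ (n : ℕ) (d : Fin n → ℤ) (a : Fin n → A), (∀ i, a i ∈ 𝒜 (d i)) →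
      ∀ i j : Fin n, (i : ℕ) + 1 = j →
        L n a = -((-1 : ℝ) ^ (d i * d j) • L n (a ∘ Equiv.swap i j)))
    (derivation : ∀ (n : ℕ) (d : Fin n → ℤ) (a : Fin n → A), (∀ i, a i ∈ 𝒜 (d i)) →
      ∀ (k : ℤ) (b c : A), b ∈ 𝒜 k →
        L (n + 1) (Fin.snoc a (b * c)) = L (n + 1) (Fin.snoc a b) * ρ c +
          (-1 : ℝ) ^ ((2 - ((n : ℤ) + 1) + ∑ i, d i) * k) • (ρ b * L (n + 1) (Fin.snoc a c)))
    (n : ℕ) : IsMultiderivation 𝒜 ρ (L n) where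
  skew d a ha i j hij := ⟨_, (skew n d a ha i j hij).trans (neg_smul _ _).symm⟩
  derivation d a ha i hi k b c hb := by
    cases n with
    | zero => exact i.elim0
    | succ n =>
      obtain rfl : i = Fin.last n := le_antisymm (Fin.le_last i) (hi _)
      have h : ∀ x, Function.update a (Fin.last n) x = Fin.snoc (Fin.init a) x := fun x => by
        rw [← Fin.update_snoc_last (x := a (Fin.last n)), Fin.snoc_init_self]
      simp only [h]
      exact ⟨_, derivation n (fun j => d j.castSucc) (Fin.init a) (fun j => ha j.castSucc) k b c hb⟩

end PInfty

namespace Coiso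
variable {EB F C : Type*} [NormedAddCommGroup EB] [NormedSpace ℝ EB] [FiniteDimensional ℝ EB]
    [NormedAddCommGroup F] [NormedSpace ℝ F] [FiniteDimensional ℝ F]
    [TopologicalSpace C] [ChartedSpace EB C] [T2Space C]
    {E : C → Type*} [TopologicalSpace (TotalSpace F E)]
    [∀ x, AddCommGroup (E x)] [∀ x, Module ℝ (E x)] [∀ x, TopologicalSpace (E x)]
    [FiberBundle F E] [VectorBundle ℝ F E]
    [IsManifold 𝓘(ℝ, EB) ∞ C] [ContMDiffVectorBundle ∞ F E 𝓘(ℝ, EB)]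

/-! ## Existence of the brackets -/

theorem ext_loc {a b : ExtSec EB F E} (h : ∀ x, loc x a = loc x b) : a = b :=
  Subtype.ext (funext fun x => apply_eq_of_loc_eq (h x))

theorem eventually_loc_eq_zero {x₀ : C} {a : ExtSec EB F E} (h : ∀ᶠ x in 𝓝 x₀, a.1 x = 0) :
    ∀ᶠ x in 𝓝 x₀, loc x a = 0 := by
  filter_upwards [eventually_eventually_nhds.2 h] with x hx
  exact (loc_congr (b := 0) hx).trans (map_zero _)

variable (EB F E) in
/-- The germs of a section at all points. -/
noncomputable def germs : ExtSec EB F E →ₐ[ℝ] ∀ x : C, LocalPhase F (center EB x) :=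
  AlgHom.pi fun x => loc x

theorem germs_apply (a : ExtSec EB F E) (x : C) : germs EB F E a x = loc x a := rfl

variable (EB F E) in
/-- The families of germs which near a point are germs of a section. -/
noncomputable def locallySections (x₀ : C) : Submodule ℝ (∀ x : C, LocalPhase F (center EB x)) where
  carrier := {y | ∃ b : ExtSec EB F E, ∀ᶠ x in 𝓝 x₀, y x = loc x b}
  add_mem' := by
    rintro y z ⟨b, hb⟩ ⟨c, hc⟩
    refine ⟨b + c, ?_⟩
    filter_upwards [hb, hc] with x h1 h2
    rw [Pi.add_apply, h1, h2, map_add]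
  zero_mem' := ⟨0, Filter.Eventually.of_forall fun x => (map_zero (loc x)).symm⟩
  smul_mem' := by
    rintro r y ⟨b, hb⟩
    refine ⟨r • b, ?_⟩
    filter_upwards [hb] with x h1
    rw [Pi.smul_apply, h1, map_smul]

/-- Families of germs which are locally germs of a section are germs of a section. -/
theorem exists_section {y : ∀ x : C, LocalPhase F (center EB x)}
    (hy : ∀ x₀, y ∈ locallySections EB F E x₀) : ∃ b : ExtSec EB F E, ∀ x, y x = loc x b := by
  choose b hb using hy
  -- The global section takes at `x` the value of the local choice made for `x`; near `x₀` this
  -- agrees with the single section chosen for `x₀`.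
  have hself : ∀ x₀, ∀ᶠ x in 𝓝 x₀, (b x).1 x = (b x₀).1 x := fun x₀ => by
    filter_upwards [hb x₀] with x hx
    exact apply_eq_of_loc_eq ((hb x).self_of_nhds.symm.trans hx)
  refine ⟨⟨fun x => (b x).1 x, fun x₀ φ => ((b x₀).2 x₀ φ).congr_of_eventuallyEq ?_⟩, fun x₀ => ?_⟩
  · filter_upwards [hself x₀] with x hx
    rw [hx]
  · rw [(hb x₀).self_of_nhds]
    refine loc_congr ?_
    filter_upwards [hself x₀] with x hx
    exact hx.symm

/-- A multiderivation with values in a submodule of germs on sections and functions takes values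
in this submodule. -/
theorem mem_of_sections {B : Type*} [Ring B] [Algebra ℝ B] {ρ : ExtSec EB F E →ₐ[ℝ] B} {n : ℕ}
    {N : MultilinearMap ℝ (fun _ : Fin n => ExtSec EB F E) B}
    (hN : PInfty.IsMultiderivation (extDeg EB F E) ρ N) {Z : Submodule ℝ B} (x₀ : C)
    (hZl : ∀ a, ∀ z ∈ Z, ρ a * z ∈ Z) (hZr : ∀ a, ∀ z ∈ Z, z * ρ a ∈ Z)
    (hIl : ∀ a : ExtSec EB F E, (∀ᶠ x in 𝓝 x₀, a.1 x = 0) → ∀ y, ρ a * y ∈ Z)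
    (hIr : ∀ a : ExtSec EB F E, (∀ᶠ x in 𝓝 x₀, a.1 x = 0) → ∀ y, y * ρ a ∈ Z)
    (hgen : ∀ (k l : ℕ) (h : k + l = n) (v : Fin k → Sec EB F E) (f : Fin l → BaseFun EB C),
      N (Fin.append (fun i => ofSec (v i)) (fun i => ofFun F E (f i)) ∘ Fin.cast h.symm) ∈ Z)
    (a : Fin n → ExtSec EB F E) : N a ∈ Z := by
  refine hN.mem_of_generators isGradedCommutative_extDeg
    (G₀ := Set.range (ofSec (EB := EB) (F := F) (E := E)))
    (G₁ := Set.range (ofFun (EB := EB) F E)) (I := {a | ∀ᶠ x in 𝓝 x₀, a.1 x = 0}) ?_ ?_ ?_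
    hZl hZr hIl hIr (fun k a ha => ?_) (fun k l h v f hv hf => ?_) a
  · rintro _ ⟨v, rfl⟩
    exact ofSec_mem v
  · rintro _ ⟨f, rfl⟩
    exact ofFun_mem f
  · exact ⟨1, Subtype.ext (funext fun x => map_one (algebraMap ℝ _))⟩
  · exact exists_local_decomposition x₀ ha
  · choose v' hv' using hv
    choose f' hf' using hf
    rw [← funext hv', ← funext hf']
    exact hgen k l h v' f'

variable (P : PoissonBracket (TotFun EB F E))

theorem germBracket_snoc (x : C) {n : ℕ} (a : Fin n → ExtSec EB F E) (b : ExtSec EB F E) :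
    germBracket P x (n + 1) (Fin.snoc a b) =
      (phase EB F x).lam (bivec P x) (n + 1) (Fin.snoc (fun i => loc x (a i)) (loc x b)) := by
  rw [germBracket_apply]
  congr 1
  funext i
  refine Fin.lastCases ?_ (fun i => ?_) i
  · rw [Fin.snoc_last, Fin.snoc_last]
  · rw [Fin.snoc_castSucc, Fin.snoc_castSucc]

theorem germBracket_skew (x : C) {n : ℕ} {d : Fin n → ℤ} {a : Fin n → ExtSec EB F E}
    (ha : ∀ i, a i ∈ extDeg EB F E (d i)) {i j : Fin n} (hij : (i : ℕ) + 1 = j) :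
    germBracket P x n a = -((-1 : ℝ) ^ (d i * d j) • germBracket P x n (a ∘ Equiv.swap i j)) :=
  PInfty.PhaseAlgebra.lam_skew (fun i => p_loc x (a i)) (fun i => par_loc x (ha i)) hij

theorem germBracket_derivation (x : C) {n : ℕ} {d : Fin n → ℤ} {a : Fin n → ExtSec EB F E}
    (ha : ∀ i, a i ∈ extDeg EB F E (d i)) {k : ℤ} {b : ExtSec EB F E} (c : ExtSec EB F E)
    (hb : b ∈ extDeg EB F E k) :
    germBracket P x (n + 1) (Fin.snoc a (b * c)) =
      germBracket P x (n + 1) (Fin.snoc a b) * loc x c +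
        (-1 : ℝ) ^ ((2 - ((n : ℤ) + 1) + ∑ i, d i) * k) •
          (loc x b * germBracket P x (n + 1) (Fin.snoc a c)) := by
  rw [germBracket_snoc, germBracket_snoc, germBracket_snoc, map_mul]
  exact PInfty.PhaseAlgebra.lam_derivation (γ_bivec P x) (fun i => par_loc x (ha i))
    (par_loc x hb) (p_loc x b) (p_loc x c)

/-- The germ brackets at all points together form a multiderivation into the product of the phase
algebras. Families that are locally germs of a section are closed under sums and under
multiplication by germs of sections, so the generators suffice; the local sections are then glued.
-/
theorem exists_bracket (n : ℕ) (a : Fin n → ExtSec EB F E) :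
    ∃ b : ExtSec EB F E, ∀ x, germBracket P x n a = loc x b := by
  let L : ∀ n : ℕ, MultilinearMap ℝ (fun _ : Fin n => ExtSec EB F E)
      (∀ x : C, LocalPhase F (center EB x)) := fun n => MultilinearMap.pi fun x => germBracket P x n
  have hL : PInfty.IsMultiderivation (extDeg EB F E) (germs EB F E) (L n) := by
    exact PInfty.isMultiderivation_of_snoc (ρ := germs EB F E) L
      (fun n d a ha i j hij => funext fun x => germBracket_skew P x ha hij)
      (fun n d a ha k b c hb => funext fun x => germBracket_derivation P x ha c hb) n
  refine exists_section (y := L n a) fun x₀ => ?_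
  refine mem_of_sections hL x₀ ?_ ?_ ?_ ?_ ?_ a
  · rintro a z ⟨b, hb⟩
    refine ⟨a * b, ?_⟩
    filter_upwards [hb] with x hx
    rw [Pi.mul_apply, germs_apply, hx, map_mul]
  · rintro a z ⟨b, hb⟩
    refine ⟨b * a, ?_⟩
    filter_upwards [hb] with x hx
    rw [Pi.mul_apply, germs_apply, hx, map_mul]
  · refine fun a ha y => ⟨0, ?_⟩
    filter_upwards [eventually_loc_eq_zero ha] with x hx
    rw [Pi.mul_apply, germs_apply, hx, zero_mul, map_zero]
  · refine fun a ha y => ⟨0, ?_⟩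
    filter_upwards [eventually_loc_eq_zero ha] with x hx
    rw [Pi.mul_apply, germs_apply, hx, mul_zero, map_zero]
  · rintro k l rfl v f
    exact exists_loc_generators P x₀ v f

/-- The brackets on sections of the exterior algebra bundle defined by a Poisson structure. -/
noncomputable def phaseBracket (n : ℕ) :
    MultilinearMap ℝ (fun _ : Fin n => ExtSec EB F E) (ExtSec EB F E) where
  toFun a := (exists_bracket P n a).choose
  map_update_add' {inst} a i b c := ext_loc fun x => by
    -- A multilinear map must respect updates for every decidability instance, so the instance is
    -- first replaced by the standard one.
    cases Subsingleton.elim inst (instDecidableEqFin n)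
    rw [map_add, ← (exists_bracket P n _).choose_spec x, ← (exists_bracket P n _).choose_spec x,
      ← (exists_bracket P n _).choose_spec x, MultilinearMap.map_update_add]
  map_update_smul' {inst} a i r b := ext_loc fun x => by
    cases Subsingleton.elim inst (instDecidableEqFin n)
    rw [map_smul, ← (exists_bracket P n _).choose_spec x, ← (exists_bracket P n _).choose_spec x,
      MultilinearMap.map_update_smul]

theorem loc_phaseBracket (x : C) {n : ℕ} (a : Fin n → ExtSec EB F E) :
    loc x (phaseBracket P n a) = germBracket P x n a :=
  ((exists_bracket P n a).choose_spec x).symm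

theorem loc_phaseBracket_eq_lam (x : C) {n : ℕ} (a : Fin n → ExtSec EB F E) :
    loc x (phaseBracket P n a) = (phase EB F x).lam (bivec P x) n fun i => loc x (a i) :=
  loc_phaseBracket P x a

theorem loc_jacobiSum (x : C) {n : ℕ} (a : Fin n → ExtSec EB F E) :
    loc x (PInfty.jacobiSum (phaseBracket P) a) =
      PInfty.jacobiSum ((phase EB F x).lam (bivec P x)) fun i => loc x (a i) := by
  rw [PInfty.jacobiSum, PInfty.jacobiSum, map_sum]
  refine Finset.sum_congr rfl fun q _ => ?_
  rw [map_smul, loc_phaseBracket_eq_lam]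
  congr 2
  funext i
  refine Fin.cases ?_ (fun i => rfl) i
  exact loc_phaseBracket_eq_lam P x _

/-- Each axiom is checked on germs at every point. The Jacobi identity of the Poisson bracket is
used through [ϖ,ϖ] = 0. -/
theorem isPInfty_phaseBracket : PInfty.IsPInfty (extDeg EB F E) (phaseBracket P) where
  gradedCommutative := isGradedCommutative_extDeg
  degree n d a ha := mem_extDeg_of_deg_loc fun x => by
    rw [loc_phaseBracket]
    exact deg_germBracket P x ha
  skew n d a ha i j hij := ext_loc fun x => by
    rw [map_neg, map_smul, loc_phaseBracket, loc_phaseBracket]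
    exact germBracket_skew P x ha hij
  derivation n d a ha k b c hb := ext_loc fun x => by
    rw [map_add, map_mul, map_smul, map_mul, loc_phaseBracket, loc_phaseBracket, loc_phaseBracket]
    exact germBracket_derivation P x ha c hb
  jacobi n d a ha := ext_loc fun x => by
    simp only [map_sum, map_smul, map_zero, loc_jacobiSum]
    exact LocalPhase.jacobi_lam (Module.finBasis ℝ EB) (Module.finBasis ℝ F) (d := d)
      (a := fun i => loc x (a i)) (γ_bivec P x) (schouten_bivec P x) (paramContract_bivec P x)
      (fun i => p_loc x (a i)) (fun i => par_loc x (ha i)) fun i k => paramContract_loc x (a i) k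

theorem isInducedBy_phaseBracket : IsInducedBy P (phaseBracket P) where
  two_functions k v f g := ext_loc fun x => by
    rw [loc_phaseBracket, germBracket_two, map_smul]
  one_function k v f u x := by
    rw [pair₁_eq, loc_phaseBracket, germBracket_one, map_smul, ctr_p_grad_derivBivec, map_smul,
      map_smul, ev_fn, ExteriorAlgebra.algebraMap_leftInverse]
    rfl
  no_function k v u w x := by
    rw [pair₂_eq, loc_phaseBracket, germBracket_zero, map_smul, map_smul, ctr_ctr_p_derivBivec,
      map_smul, map_smul, ev_fn, ExteriorAlgebra.algebraMap_leftInverse]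
    rfl

end Coiso

namespace Coiso

variable {EB F C : Type*} [NormedAddCommGroup EB] [NormedSpace ℝ EB] [FiniteDimensional ℝ EB]
    [NormedAddCommGroup F] [NormedSpace ℝ F] [FiniteDimensional ℝ F]
    [TopologicalSpace C] [ChartedSpace EB C] [T2Space C]
    {E : C → Type*} [TopologicalSpace (TotalSpace F E)]
    [∀ x, AddCommGroup (E x)] [∀ x, Module ℝ (E x)] [∀ x, TopologicalSpace (E x)]
    [FiberBundle F E] [VectorBundle ℝ F E]
    [IsManifold 𝓘(ℝ, EB) ∞ C] [ContMDiffVectorBundle ∞ F E 𝓘(ℝ, EB)]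

/-! ## Uniqueness of the brackets -/

theorem contract_mem {V : Type*} [AddCommGroup V] [Module ℝ V] (φ : Module.Dual ℝ V) {k : ℕ}
    {x : ExteriorAlgebra ℝ V} (hx : x ∈ ⋀[ℝ]^(k + 1) V) : ExtAlg.contract φ x ∈ ⋀[ℝ]^k V := by
  -- The induction has to carry along membership of `x` itself and the vanishing of contractions in
  -- degree zero.
  have key : ∀ {n : ℕ} {x : ExteriorAlgebra ℝ V}, x ∈ ⋀[ℝ]^n V →
      x ∈ ⋀[ℝ]^n V ∧ (n = 0 → ExtAlg.contract φ x = 0) ∧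
        ∀ l, n = l + 1 → ExtAlg.contract φ x ∈ ⋀[ℝ]^l V := by
    intro n x hx
    refine ExtAlg.power_induction (P := fun n x => x ∈ ⋀[ℝ]^n V ∧
      (n = 0 → ExtAlg.contract φ x = 0) ∧ ∀ l, n = l + 1 → ExtAlg.contract φ x ∈ ⋀[ℝ]^l V)
      (fun c => ⟨?_, fun _ => ExtAlg.contract_algebraMap φ c, fun l hl => by omega⟩)
      (fun n x y hx hy => ⟨Submodule.add_mem _ hx.1 hy.1, fun h => ?_, fun l hl => ?_⟩)
      (fun n v x hx => ⟨?_, fun h => by omega, fun l hl => ?_⟩) hx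
    · rw [ExteriorAlgebra.exteriorPower, pow_zero, Submodule.mem_one]
      exact ⟨c, rfl⟩
    · rw [map_add, hx.2.1 h, hy.2.1 h, add_zero]
    · rw [map_add]
      exact Submodule.add_mem _ (hx.2.2 l hl) (hy.2.2 l hl)
    · rw [ExteriorAlgebra.exteriorPower, pow_succ']
      exact Submodule.mul_mem_mul ⟨v, rfl⟩ hx.1
    · obtain rfl : n = l := by omega
      rw [ExtAlg.contract_ι_mul]
      refine Submodule.sub_mem _ (Submodule.smul_mem _ _ hx.1) ?_
      cases n with
      | zero => rw [hx.2.1 rfl, mul_zero]; exact Submodule.zero_mem _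
      | succ l =>
        rw [ExteriorAlgebra.exteriorPower, pow_succ']
        exact Submodule.mul_mem_mul ⟨v, rfl⟩ (hx.2.2 l rfl)
  exact (key hx).2.2 k rfl

/-- Combine the fibre coordinates at `x` with constant coefficients; their cutoff is one at `x`. -/
theorem exists_form_eq (x : C) (φ : Module.Dual ℝ (E x)) :
    ∃ u : Conormal EB F E, u.form x = φ := by
  let c : Fin (Module.finrank ℝ F) → ℝ := fun j =>
    φ ((trivializationAt F E x).symmₗ ℝ x (Module.finBasis ℝ F j))
  let f : TotFun EB F E := ∑ j, c j • (fibreCoord EB E x j).toFun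
  have hf : ∀ m, f m = ∑ j, c j * (fibreCoord EB E x j).toFun m := fun m =>
    map_sum (⟨⟨fun h => h m, rfl⟩, fun _ _ => rfl⟩ : TotFun EB F E →+ ℝ) _ Finset.univ
  refine ⟨⟨f, fun y => ?_⟩, LinearMap.ext fun e => ?_⟩
  · have : (fun e : E y => f ⟨y, e⟩) = ∑ j, c j • (fibreCoord EB E x j).form y :=
      funext fun e => by
        rw [LinearMap.sum_apply]
        exact hf _
    rw [this]
    exact LinearMap.isLinear _
  · refine (hf ⟨x, e⟩).trans ?_
    have h : ∀ j, (fibreCoord EB E x j).toFun ⟨x, e⟩ =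
        (Module.finBasis ℝ F).repr ((trivializationAt F E x).linearMapAt ℝ x e) j := fun j => by
      change bump (EB := EB) F E x x * (Module.finBasis ℝ F).coord j (trivializationAt F E x ⟨x, e⟩).2 = _
      rw [bump_of_mem_core (mem_core x), one_mul, Bundle.Trivialization.linearMapAt_apply,
        if_pos (mem_baseSet F E x)]
      rfl
    simp only [h, c]
    conv_rhs => rw [← Bundle.Trivialization.symmₗ_linearMapAt (R := ℝ) _ (mem_baseSet F E x) e,
      ← (Module.finBasis ℝ F).sum_repr ((trivializationAt F E x).linearMapAt ℝ x e)]
    simp only [map_sum, map_smul, smul_eq_mul]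
    exact Finset.sum_congr rfl fun j _ => mul_comm _ _

variable (F) in
/-- A basis of a fibre. -/
noncomputable def fibreBasis (x : C) : Module.Basis (Fin (Module.finrank ℝ F)) ℝ (E x) :=
  (Module.finBasis ℝ F).map
    ((trivializationAt F E x).linearEquivAt ℝ x (mem_baseSet F E x)).symm

theorem eq_zero_of_pair₁ {a : ExtSec EB F E} (ha : a ∈ extDeg EB F E 1)
    (h : ∀ u x, pair₁ a u x = 0) : a = 0 := by
  refine Subtype.ext (funext fun x => ExtAlg.eq_zero_of_contract (b := fibreBasis F x) (k := 1)
    one_ne_zero (ha x) fun φ => ?_)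
  obtain ⟨u, rfl⟩ := exists_form_eq (EB := EB) (F := F) x φ
  rw [ExtAlg.eq_algebraMap_of_mem (contract_mem (k := 0) (u.form x) (ha x))]
  exact (congrArg _ (h u x)).trans (map_zero _)

theorem eq_zero_of_pair₂ {a : ExtSec EB F E} (ha : a ∈ extDeg EB F E 2)
    (h : ∀ u w x, pair₂ a u w x = 0) : a = 0 := by
  refine Subtype.ext (funext fun x => ExtAlg.eq_zero_of_contract (b := fibreBasis F x) (k := 2)
    two_ne_zero (ha x) fun φ => ?_)
  obtain ⟨u, rfl⟩ := exists_form_eq (EB := EB) (F := F) x φ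
  have hu := contract_mem (k := 1) (u.form x) (ha x)
  refine ExtAlg.eq_zero_of_contract (b := fibreBasis F x) one_ne_zero hu fun φ => ?_
  obtain ⟨w, rfl⟩ := exists_form_eq (EB := EB) (F := F) x φ
  rw [ExtAlg.eq_algebraMap_of_mem (contract_mem (k := 0) (w.form x) hu)]
  exact (congrArg _ (h u w x)).trans (map_zero _)

theorem eq_zero_of_mem_neg {k : ℤ} (hk : k < 0) {a : ExtSec EB F E} (ha : a ∈ extDeg EB F E k) :
    a = 0 := by
  rcases k with k | k
  · exact absurd hk (by simp)
  · exact ha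

theorem pair₁_sub (a b : ExtSec EB F E) (u : Conormal EB F E) (x : C) :
    pair₁ (a - b) u x = pair₁ a u x - pair₁ b u x := by
  change ExteriorAlgebra.algebraMapInv (CliffordAlgebra.contractLeft (u.form x) (a.1 x - b.1 x)) = _
  rw [map_sub, map_sub]
  rfl

theorem pair₂_sub (a b : ExtSec EB F E) (u w : Conormal EB F E) (x : C) :
    pair₂ (a - b) u w x = pair₂ a u w x - pair₂ b u w x := by
  change ExteriorAlgebra.algebraMapInv (CliffordAlgebra.contractLeft (w.form x)
    (CliffordAlgebra.contractLeft (u.form x) (a.1 x - b.1 x))) = _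
  rw [map_sub, map_sub, map_sub]
  rfl

/-- A multiderivation is determined by its values on sections and functions. -/
theorem eq_zero_of_sections {n : ℕ}
    {N : MultilinearMap ℝ (fun _ : Fin n => ExtSec EB F E) (ExtSec EB F E)}
    (hN : PInfty.IsMultiderivation (extDeg EB F E) (AlgHom.id ℝ (ExtSec EB F E)) N)
    (hgen : ∀ (k l : ℕ) (h : k + l = n) (v : Fin k → Sec EB F E) (f : Fin l → BaseFun EB C),
      N (Fin.append (fun i => ofSec (v i)) (fun i => ofFun F E (f i)) ∘ Fin.cast h.symm) = 0) :
    N = 0 := by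
  refine MultilinearMap.ext fun a => Subtype.ext (funext fun x => ?_)
  let Z : Submodule ℝ (ExtSec EB F E) :=
    LinearMap.ker (LinearMap.proj x ∘ₗ (ExtSec EB F E).val.toLinearMap)
  refine mem_of_sections hN (Z := Z) x ?_ ?_ ?_ ?_ ?_ a
  · intro a z hz
    change a.1 x * z.1 x = 0
    rw [show z.1 x = 0 from hz, mul_zero]
  · intro a z hz
    change z.1 x * a.1 x = 0
    rw [show z.1 x = 0 from hz, zero_mul]
  · intro a ha y
    change a.1 x * y.1 x = 0
    rw [ha.self_of_nhds, zero_mul]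
  · intro a ha y
    change y.1 x * a.1 x = 0
    rw [ha.self_of_nhds, mul_zero]
  · intro k l h v f
    rw [hgen k l h v f]
    exact Z.zero_mem

section

variable {lam lam' : ∀ n : ℕ, MultilinearMap ℝ (fun _ : Fin n => ExtSec EB F E) (ExtSec EB F E)}

/-- Each section raises the sum of degrees by one and lowers the degree of the bracket by one, so
only the number of functions counts. -/
theorem lam_append_mem (h : PInfty.IsPInfty (extDeg EB F E) lam) {k l : ℕ} (v : Fin k → Sec EB F E)
    (f : Fin l → BaseFun EB C) :
    lam (k + l) (Fin.append (fun i => ofSec (v i)) fun i => ofFun F E (f i)) ∈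
      extDeg EB F E (2 - l) := by
  have h1 := h.degree (k + l) (Fin.append (fun _ => 1) fun _ => 0)
    (Fin.append (fun i => ofSec (v i)) fun i => ofFun F E (f i)) fun i => by
      refine Fin.addCases (fun i => ?_) (fun i => ?_) i
      · simpa using ofSec_mem (v i)
      · simpa using ofFun_mem (f i)
  rw [Fin.sum_univ_add] at h1
  simp only [Fin.append_left, Fin.append_right, Finset.sum_const, Finset.card_univ,
    Fintype.card_fin, nsmul_eq_mul, mul_one, mul_zero, add_zero] at h1
  convert h1 using 2
  push_cast
  ring

/-- The axioms in play are linear in the brackets, so the difference of the two structures is a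
multiderivation and only its values on generators matter. For at most two functions they are
prescribed, and for more their degree is negative. -/
theorem IsInducedBy.unique {P : PoissonBracket (TotFun EB F E)}
    (h : PInfty.IsPInfty (extDeg EB F E) lam) (hP : IsInducedBy P lam)
    (h' : PInfty.IsPInfty (extDeg EB F E) lam') (hP' : IsInducedBy P lam') : lam = lam' := by
  funext n
  rw [← sub_eq_zero]
  let L : ∀ n : ℕ, MultilinearMap ℝ (fun _ : Fin n => ExtSec EB F E) (ExtSec EB F E) :=
    fun n => lam n - lam' n
  refine eq_zero_of_sections (N := L n) (PInfty.isMultiderivation_of_snoc L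
    (fun n d a ha i j hij => ?_) (fun n d a ha k b c hb => ?_) n) fun k l hkl v f => ?_
  · simp only [L, sub_apply, smul_sub]
    rw [h.skew n d a ha i j hij, h'.skew n d a ha i j hij]
    abel
  · simp only [L, sub_apply, AlgHom.id_apply]
    rw [h.derivation n d a ha k b c hb, h'.derivation n d a ha k b c hb, mul_sub, sub_mul, smul_sub]
    abel
  · subst hkl
    change lam (k + l) (Fin.append (fun i => ofSec (v i)) fun i => ofFun F E (f i)) -
      lam' (k + l) (Fin.append (fun i => ofSec (v i)) fun i => ofFun F E (f i)) = 0
    have hm := Submodule.sub_mem _ (lam_append_mem h v f) (lam_append_mem h' v f)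
    rcases l with _ | _ | _ | l
    · have ha : (Fin.append (fun i => ofSec (v i)) fun i => ofFun F E (f i) :
          Fin k → ExtSec EB F E) = fun i => ofSec (v i) := Fin.append_right_nil _ _ rfl
      refine eq_zero_of_pair₂ hm fun u w x => ?_
      rw [pair₂_sub, sub_eq_zero]
      exact ((congrArg (fun b => pair₂ (lam k b) u w x) ha).trans (hP.no_function k v u w x)).trans
        ((congrArg (fun b => pair₂ (lam' k b) u w x) ha).trans (hP'.no_function k v u w x)).symm
    · refine eq_zero_of_pair₁ hm fun u x => ?_
      rw [pair₁_sub, Fin.append_right_eq_snoc, sub_eq_zero]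
      exact (hP.one_function k v (f 0) u x).trans (hP'.one_function k v (f 0) u x).symm
    · rw [append_two, sub_eq_zero]
      exact (hP.two_functions k v (f 0) (f 1)).trans (hP'.two_functions k v (f 0) (f 1)).symm
    · exact eq_zero_of_mem_neg (by push_cast; omega) hm

end

/-- The difference, seen as a multilinear map in one argument, is a multiderivation that vanishes on
functions and on sections. -/
theorem IsLieAlgebroidDifferential.unique {P : PoissonBracket (TotFun EB F E)}
    {δ δ' : ExtSec EB F E →ₗ[ℝ] ExtSec EB F E} (h : IsLieAlgebroidDifferential P δ)
    (h' : IsLieAlgebroidDifferential P δ') : δ = δ' := by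
  let N : MultilinearMap ℝ (fun _ : Fin 1 => ExtSec EB F E) (ExtSec EB F E) :=
    MultilinearMap.ofSubsingleton ℝ (ExtSec EB F E) (ExtSec EB F E) 0 (δ - δ')
  have hN : N = 0 := by
    refine eq_zero_of_sections ⟨fun d a ha i j hij => ?_, fun d a ha i _ k b c hb => ?_⟩ ?_
    · exact absurd hij (by omega)
    · refine ⟨(-1 : ℝ) ^ k, ?_⟩
      obtain rfl := Subsingleton.elim 0 i
      simp only [N, MultilinearMap.ofSubsingleton_apply_apply, Function.update_self,
        LinearMap.sub_apply, AlgHom.id_apply]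
      rw [h.leibniz k b c hb, h'.leibniz k b c hb, mul_sub, sub_mul, smul_sub]
      abel
    · intro k l hkl v f
      simp only [N, MultilinearMap.ofSubsingleton_apply_apply, LinearMap.sub_apply]
      rcases k with _ | k
      · obtain rfl : l = 1 := by omega
        have ha : (Fin.append (fun i => ofSec (v i)) (fun i => ofFun F E (f i)) ∘ Fin.cast hkl.symm :
            Fin 1 → ExtSec EB F E) 0 = ofFun F E (f 0) := rfl
        rw [ha]
        refine eq_zero_of_pair₁ (Submodule.sub_mem _ ?_ ?_) fun u x => ?_
        · exact h.degree 0 _ (ofFun_mem _)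
        · exact h'.degree 0 _ (ofFun_mem _)
        · rw [pair₁_sub, h.on_functions (f 0) (pull (f 0)) rfl, h'.on_functions (f 0) (pull (f 0)) rfl,
            sub_self]
      · obtain rfl : l = 0 := by omega
        obtain rfl : k = 0 := by omega
        have ha : (Fin.append (fun i => ofSec (v i)) (fun i => ofFun F E (f i)) ∘ Fin.cast hkl.symm :
            Fin 1 → ExtSec EB F E) 0 = ofSec (v 0) := rfl
        rw [ha]
        refine eq_zero_of_pair₂ (Submodule.sub_mem _ ?_ ?_) fun u w x => ?_
        · exact h.degree 1 _ (ofSec_mem _)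
        · exact h'.degree 1 _ (ofSec_mem _)
        · rw [pair₂_sub, h.on_sections, h'.on_sections, sub_self]
  refine LinearMap.ext fun a => sub_eq_zero.1 ?_
  exact DFunLike.congr_fun hN fun _ => a

end Coiso

namespace Coiso

variable {EB F C : Type*} [NormedAddCommGroup EB] [NormedSpace ℝ EB] [FiniteDimensional ℝ EB]
    [NormedAddCommGroup F] [NormedSpace ℝ F] [FiniteDimensional ℝ F]
    [TopologicalSpace C] [ChartedSpace EB C] [T2Space C]
    {E : C → Type*} [TopologicalSpace (TotalSpace F E)]
    [∀ x, AddCommGroup (E x)] [∀ x, Module ℝ (E x)] [∀ x, TopologicalSpace (E x)]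
    [FiberBundle F E] [VectorBundle ℝ F E]
    [IsManifold 𝓘(ℝ, EB) ∞ C] [ContMDiffVectorBundle ∞ F E 𝓘(ℝ, EB)]

/-! ## The Lie algebroid differential -/

theorem snoc_zero {α : Type*} (b : Fin 0 → α) (c : α) :
    (Fin.snoc b c : Fin (0 + 1) → α) = fun _ => c :=
  funext fun i => by
    rw [Subsingleton.elim (α := Fin 1) i (Fin.last 0)]
    exact Fin.snoc_last (α := fun _ => α) c b

theorem mem_vanishingIdeal {h : TotFun EB F E} :
    h ∈ vanishingIdeal (EB := EB) (F := F) (E := E) ↔ restr h = 0 :=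
  ⟨fun H => ContMDiffMap.ext H, fun H x => DFunLike.congr_fun H x⟩

theorem Conormal.mem_vanishingIdeal (u : Conormal EB F E) :
    u.toFun ∈ vanishingIdeal (EB := EB) (F := F) (E := E) := fun x => (u.linear x).map_zero

theorem vert_conormal (v : Sec EB F E) (u : Conormal EB F E) :
    vert v u.toFun = pull (pairing v u) := by
  refine ContMDiffMap.ext fun m => ?_
  change deriv (fun t : ℝ => u.toFun ⟨m.1, m.2 + t • v m.1⟩) 0 = u.toFun ⟨m.1, v m.1⟩
  have : (fun t : ℝ => u.toFun ⟨m.1, m.2 + t • v m.1⟩) =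
      fun t => u.toFun ⟨m.1, m.2⟩ + t * u.toFun ⟨m.1, v m.1⟩ := funext fun t => by
    rw [(u.linear m.1).map_add, (u.linear m.1).map_smul, smul_eq_mul]
  rw [this]
  simp

theorem vert_apply_zero (v : Sec EB F E) (h : TotFun EB F E) (x : C) :
    vert v h ⟨x, 0⟩ = fibreDifferential h ⟨x, v x⟩ := by
  change deriv (fun t : ℝ => h ⟨x, 0 + t • v x⟩) 0 = deriv (fun t : ℝ => h ⟨x, t • v x⟩) 0
  simp only [zero_add]

section

variable {P : PoissonBracket (TotFun EB F E)} (hC : IsCoisotropic P)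

theorem sub_pull_mem {f : BaseFun EB C} {f' : TotFun EB F E} (hf : restr f' = f) :
    f' - pull f ∈ vanishingIdeal (EB := EB) (F := F) (E := E) := by
  refine mem_vanishingIdeal.2 (ContMDiffMap.ext fun x => ?_)
  change f' ⟨x, 0⟩ - f x = 0
  rw [← hf]
  exact sub_self _

include hC

/-- Hamiltonian vector fields of functions in the ideal are tangent to the zero section. -/
theorem restr_bracket_congr {h : TotFun EB F E}
    (hh : h ∈ vanishingIdeal (EB := EB) (F := F) (E := E)) {f g : TotFun EB F E}
    (hfg : restr f = restr g) : restr (P.bracket h f) = restr (P.bracket h g) := by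
  refine ContMDiffMap.ext fun x => ?_
  have h1 := hC h hh (f - g) (mem_vanishingIdeal.2 (ContMDiffMap.ext fun x =>
    sub_eq_zero.2 (DFunLike.congr_fun hfg x))) x
  rw [map_sub] at h1
  exact sub_eq_zero.1 h1

theorem bracket_congr_left {h : TotFun EB F E}
    (hh : h ∈ vanishingIdeal (EB := EB) (F := F) (E := E)) {f g : TotFun EB F E}
    (hfg : restr f = restr g) (x : C) : P.bracket f h ⟨x, 0⟩ = P.bracket g h ⟨x, 0⟩ := by
  rw [P.skew f, P.skew g]
  exact congrArg Neg.neg (DFunLike.congr_fun (restr_bracket_congr hC hh hfg) x)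

variable {lam : ∀ n : ℕ, MultilinearMap ℝ (fun _ : Fin n => ExtSec EB F E) (ExtSec EB F E)}
  (h : PInfty.IsPInfty (extDeg EB F E) lam) (hP : IsInducedBy P lam)

include h hP

/-- The pairing of λ_0 with u ⊗ w is {u, w} on the zero section, up to sign. Fibrewise linear
functions lie in the ideal, so this vanishes by coisotropy. -/
theorem isFlat : PInfty.IsFlat lam := by
  refine MultilinearMap.ext fun a => ?_
  have h1 := h.degree 0 (fun i => i.elim0) a fun i => i.elim0
  refine eq_zero_of_pair₂ (by simpa using h1) fun u w x => ?_
  have h2 := hP.no_function 0 (fun i => i.elim0) u w x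
  rw [Subsingleton.elim a, h2]
  have h3 : iterLieD P (fun i : Fin 0 => i.elim0) u.toFun w.toFun ⟨x, 0⟩ = 0 :=
    hC _ u.mem_vanishingIdeal _ w.mem_vanishingIdeal x
  rw [h3, mul_zero]

-- The Jacobi identity in one argument reads λ_2(λ_0, a) + λ_1(λ_1 a) = 0.
omit hC hP in
theorem lam_one_sq_zero (hflat : lam 0 = 0) {k : ℤ} {a : ExtSec EB F E}
    (ha : a ∈ extDeg EB F E k) : lam 1 (fun _ => lam 1 fun _ => a) = 0 := by
  have h1 := h.jacobi 1 (fun _ => k) (fun _ => a) fun _ => ha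
  rw [Fintype.sum_unique] at h1
  have h2 : PInfty.koszulSign (fun _ : Fin 1 => k) default = 1 := by simp [PInfty.koszulSign]
  rw [show (default : Equiv.Perm (Fin 1)) = 1 from rfl] at h1 h2
  rw [h2, Equiv.Perm.sign_one, Units.val_one, Int.cast_one, mul_one, one_smul] at h1
  have h3 : lam 2 (Fin.cons (lam 0 fun i : Fin 0 => a) fun _ : Fin 1 => a) = 0 :=
    (lam 2).map_coord_zero (0 : Fin 2) (by rw [hflat]; rfl)
  have h4 : PInfty.jacobiSum lam (fun _ : Fin 1 => a) =
      ((-1 : ℝ) ^ (0 * (1 - 0)) / ((Nat.factorial 0 : ℝ) * (Nat.factorial (1 - 0) : ℝ))) •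
        lam 2 (Fin.cons (lam 0 fun i : Fin 0 => a) fun _ : Fin 1 => a) +
      ((-1 : ℝ) ^ (1 * (1 - 1)) / ((Nat.factorial 1 : ℝ) * (Nat.factorial (1 - 1) : ℝ))) •
        lam 1 (Fin.cons (lam 1 fun _ : Fin 1 => a) fun _ : Fin 0 => a) := Fin.sum_univ_two _
  have h5 : (fun _ : Fin 1 => lam 1 fun _ => a) =
      Fin.cons (lam 1 fun _ : Fin 1 => a) fun _ : Fin 0 => a := by
    funext i
    obtain rfl := Subsingleton.elim 0 i
    rfl
  have h6 : PInfty.jacobiSum lam (fun _ : Fin 1 => a) = 0 := h1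
  rw [h4, h3, smul_zero, zero_add] at h6
  rw [h5]
  simpa using h6

variable (lam) in
/-- The unary bracket. -/
noncomputable def unaryBracket : ExtSec EB F E →ₗ[ℝ] ExtSec EB F E :=
  (MultilinearMap.ofSubsingleton ℝ (ExtSec EB F E) (ExtSec EB F E) (0 : Fin 1)).symm (lam 1)

omit hC h hP in
theorem unaryBracket_apply (a : ExtSec EB F E) : unaryBracket lam a = lam 1 fun _ => a := rfl

omit h in
theorem pair₁_lam_one_ofFun {f : BaseFun EB C} {f' : TotFun EB F E} (hf : restr f' = f)
    (u : Conormal EB F E) (x : C) :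
    pair₁ (lam 1 fun _ => ofFun F E f) u x = P.bracket f' u.toFun ⟨x, 0⟩ := by
  have h1 := hP.one_function 0 (fun i => i.elim0) f u x
  rw [snoc_zero] at h1
  rw [bracket_congr_left hC u.mem_vanishingIdeal (g := pull f) hf]
  refine h1.trans ?_
  have h3 : bracketSign (0 + 1) = 1 := by simp [bracketSign]
  rw [h3, one_mul]
  rfl

theorem isLieAlgebroidDifferential_unaryBracket :
    IsLieAlgebroidDifferential P (unaryBracket lam) where
  degree k a ha := by
    have h1 := h.degree 1 (fun _ => k) (fun _ => a) fun _ => ha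
    rw [Fin.sum_univ_one, show (2 - ((1 : ℕ) : ℤ) + k) = k + 1 by push_cast; ring] at h1
    exact h1
  leibniz k a b ha := by
    have h1 := h.derivation 0 (fun i => i.elim0) (fun i => i.elim0) (fun i => i.elim0) k a b ha
    rw [snoc_zero, snoc_zero, snoc_zero] at h1
    rw [unaryBracket_apply, unaryBracket_apply, unaryBracket_apply]
    refine h1.trans ?_
    congr 3
    simp
  sq_zero a := by
    rw [← sum_homog a, map_sum, map_sum]
    exact Finset.sum_eq_zero fun j _ => lam_one_sq_zero h (isFlat hC h hP) (homog_mem j a)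
  on_functions f f' hf u x := pair₁_lam_one_ofFun hC hP hf u x
  on_sections v u w x := by
    have h1 := hP.no_function 1 (fun _ => v) u w x
    have h2 : bracketSign 1 = 1 := by simp [bracketSign]
    rw [h2, one_mul] at h1
    refine h1.trans ?_
    -- Both sides are now explicit: `v` applied to a linear function is the pullback of a pairing,
    -- so the last two terms of the Lie derivative are anchor terms and the first is the conormal
    -- bracket.
    change vert v (P.bracket u.toFun w.toFun) ⟨x, 0⟩ - P.bracket (vert v u.toFun) w.toFun ⟨x, 0⟩ -
      P.bracket u.toFun (vert v w.toFun) ⟨x, 0⟩ = fibreDifferential _ ⟨x, v x⟩ -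
        P.bracket u.toFun (pull (pairing v w)) ⟨x, 0⟩ + P.bracket w.toFun (pull (pairing v u)) ⟨x, 0⟩
    rw [vert_apply_zero, vert_conormal, vert_conormal, P.skew (pull (pairing v u))]
    change _ - -(P.bracket w.toFun (pull (pairing v u)) ⟨x, 0⟩) - _ = _
    ring

end

/-! ## The reduced phase space -/

theorem exists_ofFun {a : ExtSec EB F E} (ha : a ∈ extDeg EB F E 0) :
    ∃ f : BaseFun EB C, a = ofFun F E f := by
  have h : ∀ x, a.1 x = algebraMap ℝ _ (ExteriorAlgebra.algebraMapInv (a.1 x)) := fun x =>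
    ExtAlg.eq_algebraMap_of_mem (ha x)
  refine ⟨⟨fun x => ExteriorAlgebra.algebraMapInv (a.1 x), fun x₀ => ?_⟩, Subtype.ext (funext h)⟩
  refine (a.2 x₀ ExteriorAlgebra.algebraMapInv.toLinearMap).congr_of_eventuallyEq
    (Filter.Eventually.of_forall fun x => ?_)
  exact (algebraMapInv_map _ _).symm

/-- A derivation vanishing on linear functions vanishes on the ideal of the zero section. -/
theorem derivation_eq_zero {x : C} (D : TotFun EB F E →ₗ[ℝ] ℝ)
    (hD : ∀ f g, D (f * g) = D f * g ⟨x, 0⟩ + f ⟨x, 0⟩ * D g) (h0 : ∀ u : Conormal EB F E, D u.toFun = 0)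
    {h : TotFun EB F E} (hh : h ∈ vanishingIdeal (EB := EB) (F := F) (E := E)) : D h = 0 := by
  rw [derivation_eq (m := ⟨x, 0⟩) (mem_core x) D hD h]
  refine Finset.sum_eq_zero fun A _ => ?_
  rcases A with μ | j
  · refine mul_eq_zero_of_right _ ?_
    have hz : coord (EB := EB) (F := F) x (⟨x, 0⟩ : TotalSpace F E) = (center EB x, 0) :=
      Prod.ext rfl (show (trivializationAt F E x ⟨x, 0⟩).2 = 0 from
        congrArg Prod.snd ((trivializationAt F E x).zeroSection ℝ (mem_baseSet F E x)))
    have hb : coordBasis EB F (Sum.inl μ) = (Module.finBasis ℝ EB μ, (0 : F)) := by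
      simp [coordBasis]
    rw [hz, hb]
    -- Along the horizontal line through the centre the function vanishes near zero, so its
    -- horizontal derivative is zero. Where `fderiv` takes its default value it is zero anyway,
    -- which avoids proving differentiability.
    by_cases hd : DifferentiableAt ℝ (fun z => h (coordInv F E x z)) (center EB x, (0 : F))
    · have hl : HasDerivAt (fun t : ℝ => (center EB x, (0 : F)) + t • (Module.finBasis ℝ EB μ, (0 : F)))
          (Module.finBasis ℝ EB μ, (0 : F)) 0 := by
        simpa using ((hasDerivAt_id (0 : ℝ)).smul_const (Module.finBasis ℝ EB μ, (0 : F))).const_add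
          (center EB x, (0 : F))
      have hd' : HasFDerivAt (fun z => h (coordInv F E x z))
          (fderiv ℝ (fun z => h (coordInv F E x z)) (center EB x, (0 : F)))
          ((center EB x, (0 : F)) + (0 : ℝ) • (Module.finBasis ℝ EB μ, (0 : F))) := by
        rw [zero_smul, add_zero]
        exact hd.hasFDerivAt
      refine (hd'.comp_hasDerivAt (0 : ℝ) hl).unique
        ((hasDerivAt_const (0 : ℝ) (0 : ℝ)).congr_of_eventuallyEq ?_)
      have hc := hl.continuousAt
      rw [ContinuousAt, zero_smul, add_zero] at hc
      filter_upwards [hc.eventually (eventually_patchTarget (F := F) (E := E) x)] with t ht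
      change h (coordInv F E x _) = 0
      rw [coordInv_eq ht]
      have : ((center EB x, (0 : F)) + t • (Module.finBasis ℝ EB μ, (0 : F))).2 = 0 := by simp
      rw [this, ← Bundle.Trivialization.coe_symmₗ (R := ℝ) _ ht.2, map_zero]
      exact hh _
    · rw [fderiv_zero_of_not_differentiableAt hd]
      rfl
  · exact mul_eq_zero_of_left (h0 (fibreCoord EB E x j)) _

section

variable {P : PoissonBracket (TotFun EB F E)} (hC : IsCoisotropic P)
  {lam : ∀ n : ℕ, MultilinearMap ℝ (fun _ : Fin n => ExtSec EB F E) (ExtSec EB F E)}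
  (h : PInfty.IsPInfty (extDeg EB F E) lam) (hP : IsInducedBy P lam)

include hC h hP

/-- The pairings of λ_1 f test the derivation {f', ·} on fibrewise linear functions only, and by
`derivation_eq_zero` this decides its values on the whole ideal along C. -/
theorem lam_one_ofFun_eq_zero_iff (f : BaseFun EB C) :
    lam 1 (fun _ => ofFun F E f) = 0 ↔ f ∈ reducedFunctions P := by
  constructor
  · intro h0 k hk f' hf
    refine ContMDiffMap.ext fun x => ?_
    let D : TotFun EB F E →ₗ[ℝ] ℝ :=
      (⟨⟨fun h => h ⟨x, 0⟩, fun _ _ => rfl⟩, fun _ _ => rfl⟩ : TotFun EB F E →ₗ[ℝ] ℝ) ∘ₗ P.bracket f'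
    have h1 : D k = 0 := derivation_eq_zero (x := x) D
      (fun g g' => congrArg (fun h : TotFun EB F E => h ⟨x, 0⟩) (P.leibniz f' g g')) (fun u => by
        refine (pair₁_lam_one_ofFun hC hP hf u x).symm.trans ?_
        rw [h0]
        rw [← sub_self (0 : ExtSec EB F E), pair₁_sub, sub_self])
      hk
    rw [P.skew]
    exact neg_eq_zero.2 h1
  · intro hf
    have hm := h.degree 1 (fun _ => 0) (fun _ => ofFun F E f) fun _ => ofFun_mem f
    refine eq_zero_of_pair₁ (by simpa using hm) fun u x => ?_
    rw [pair₁_lam_one_ofFun hC hP (restr_pull f), P.skew]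
    exact neg_eq_zero.2 (DFunLike.congr_fun (hf u.toFun u.mem_vanishingIdeal (pull f) rfl) x)

theorem lam_one_eq_zero_iff {a : ExtSec EB F E} (ha : a ∈ extDeg EB F E 0) :
    lam 1 (fun _ => a) = 0 ↔ ∃ f ∈ reducedFunctions P, a = ofFun F E f := by
  constructor
  · intro h0
    obtain ⟨f, rfl⟩ := exists_ofFun ha
    exact ⟨f, (lam_one_ofFun_eq_zero_iff hC h hP f).1 h0, rfl⟩
  · rintro ⟨f, hf, rfl⟩
    exact (lam_one_ofFun_eq_zero_iff hC h hP f).2 hf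

omit h hC in
theorem lam_two_ofFun (f g : BaseFun EB C) : lam 2 ![ofFun F E f, ofFun F E g] =
    ofFun F E (restr (P.bracket (pull f) (pull g))) := by
  have h1 := hP.two_functions 0 (fun i => i.elim0) f g
  have h2 : (Fin.snoc (Fin.snoc (fun i : Fin 0 => ofSec (i.elim0 : Sec EB F E)) (ofFun F E f) :
      Fin 1 → ExtSec EB F E) (ofFun F E g) : Fin 2 → ExtSec EB F E) =
        ![ofFun F E f, ofFun F E g] := by
    funext i
    fin_cases i <;> rfl
  have h3 : bracketSign (0 + 2) = 1 := by simp [bracketSign]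
  rw [h3, one_smul] at h1
  rw [← h2]
  exact h1

-- The extensions are changed one at a time: changing f' adds an element of the ideal bracketed with
-- g', which restricts to zero as g is reduced, and likewise for g' since f is reduced.
omit h hP lam hC in
theorem restr_bracket_reduced {f g : BaseFun EB C} (hf : f ∈ reducedFunctions P)
    (hg : g ∈ reducedFunctions P) {f' g' : TotFun EB F E} (hf' : restr f' = f) (hg' : restr g' = g) :
    restr (P.bracket f' g') = restr (P.bracket (pull f) (pull g)) := by
  refine ContMDiffMap.ext fun x => ?_
  have h1 := DFunLike.congr_fun (hg _ (sub_pull_mem hf') g' hg') x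
  have h2 := DFunLike.congr_fun (hf _ (sub_pull_mem hg') (pull f) rfl) x
  rw [map_sub, LinearMap.sub_apply] at h1
  rw [P.skew, map_sub] at h2
  have h1' : P.bracket f' g' ⟨x, 0⟩ - P.bracket (pull f) g' ⟨x, 0⟩ = 0 := h1
  have h2' : -(P.bracket (pull f) g' ⟨x, 0⟩ - P.bracket (pull f) (pull g) ⟨x, 0⟩) = 0 := h2
  change P.bracket f' g' ⟨x, 0⟩ = P.bracket (pull f) (pull g) ⟨x, 0⟩
  linarith

-- Coisotropy reduces to the pulled-back extension. For k in the ideal, the Jacobi identity writes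
-- {k, {f, g}} through {f, {g, k}} and {g, {k, f}}; the inner brackets lie in the ideal because f
-- and g are reduced, and then the outer ones do for the same reason.
omit h hP lam in
theorem restr_bracket_mem {f g : BaseFun EB C} (hf : f ∈ reducedFunctions P)
    (hg : g ∈ reducedFunctions P) :
    restr (P.bracket (pull f) (pull g)) ∈ reducedFunctions P := by
  intro k hk h' hh'
  rw [restr_bracket_congr hC hk hh']
  refine mem_vanishingIdeal.1 ?_
  have h1 := P.jacobi k (pull f) (pull g)
  have hfk : P.bracket k (pull f) ∈ vanishingIdeal (EB := EB) (F := F) (E := E) :=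
    mem_vanishingIdeal.2 (hf k hk _ rfl)
  have hgk : P.bracket (pull g) k ∈ vanishingIdeal (EB := EB) (F := F) (E := E) := by
    rw [P.skew]
    exact Ideal.neg_mem_iff _ |>.2 (mem_vanishingIdeal.2 (hg k hk _ rfl))
  have h2 : P.bracket (pull f) (P.bracket (pull g) k) ∈
      vanishingIdeal (EB := EB) (F := F) (E := E) := by
    rw [P.skew]
    exact Ideal.neg_mem_iff _ |>.2 (mem_vanishingIdeal.2 (hf _ hgk _ rfl))
  have h3 : P.bracket (pull g) (P.bracket k (pull f)) ∈
      vanishingIdeal (EB := EB) (F := F) (E := E) := by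
    rw [P.skew]
    exact Ideal.neg_mem_iff _ |>.2 (mem_vanishingIdeal.2 (hg _ hfk _ rfl))
  have h4 : P.bracket k (P.bracket (pull f) (pull g)) =
      -(P.bracket (pull f) (P.bracket (pull g) k) + P.bracket (pull g) (P.bracket k (pull f))) := by
    rw [eq_neg_iff_add_eq_zero, ← add_assoc]
    exact h1
  rw [h4]
  exact Ideal.neg_mem_iff _ |>.2 (Ideal.add_mem _ h2 h3)

end

end Coiso

/-! ### The main theorem -/

theorem mainTheorem8 {EB F C : Type*} [NormedAddCommGroup EB] [NormedSpace ℝ EB]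
    [FiniteDimensional ℝ EB] [NormedAddCommGroup F] [NormedSpace ℝ F] [FiniteDimensional ℝ F]
    [TopologicalSpace C] [T2Space C] [SigmaCompactSpace C] [ChartedSpace EB C]
    [IsManifold 𝓘(ℝ, EB) ∞ C]
    (E : C → Type*) [TopologicalSpace (TotalSpace F E)]
    [∀ x, AddCommGroup (E x)] [∀ x, Module ℝ (E x)] [∀ x, TopologicalSpace (E x)]
    [FiberBundle F E] [VectorBundle ℝ F E] [ContMDiffVectorBundle ∞ F E 𝓘(ℝ, EB)]
    (P : PoissonBracket (Coiso.TotFun EB F E)) (hC : Coiso.IsCoisotropic P) :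
    -- existence and uniqueness of the induced structure
    (∃! lam : ∀ n : ℕ, MultilinearMap ℝ (fun _ : Fin n => Coiso.ExtSec EB F E)
        (Coiso.ExtSec EB F E),
      PInfty.IsPInfty (Coiso.extDeg EB F E) lam ∧ Coiso.IsInducedBy P lam) ∧
    -- existence and uniqueness of the Lie algebroid differential
    (∃! δ : Coiso.ExtSec EB F E →ₗ[ℝ] Coiso.ExtSec EB F E,
      Coiso.IsLieAlgebroidDifferential P δ) ∧
    ∀ lam : ∀ n : ℕ, MultilinearMap ℝ (fun _ : Fin n => Coiso.ExtSec EB F E)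
        (Coiso.ExtSec EB F E),
      PInfty.IsPInfty (Coiso.extDeg EB F E) lam → Coiso.IsInducedBy P lam →
      -- the structure is flat
      PInfty.IsFlat lam ∧
      -- its unary bracket is the Lie algebroid differential
      (∀ δ : Coiso.ExtSec EB F E →ₗ[ℝ] Coiso.ExtSec EB F E,
        Coiso.IsLieAlgebroidDifferential P δ → ∀ a, lam 1 (fun _ => a) = δ a) ∧
      -- its cohomology in degree zero is the algebra of functions on the reduced phase space
      (∀ a ∈ Coiso.extDeg EB F E 0,
        lam 1 (fun _ => a) = 0 ↔ ∃ f ∈ Coiso.reducedFunctions P, a = Coiso.ofFun F E f) ∧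
      -- its binary bracket induces there the Poisson bracket of the reduced phase space
      (∀ f ∈ Coiso.reducedFunctions P, ∀ g ∈ Coiso.reducedFunctions P,
        ∃ h ∈ Coiso.reducedFunctions P,
          lam 2 ![Coiso.ofFun F E f, Coiso.ofFun F E g] = Coiso.ofFun F E h ∧
          ∀ f' g' : Coiso.TotFun EB F E, Coiso.restr f' = f → Coiso.restr g' = g →
            Coiso.restr (P.bracket f' g') = h) := by
  refine ⟨⟨Coiso.phaseBracket P, ⟨Coiso.isPInfty_phaseBracket P, Coiso.isInducedBy_phaseBracket P⟩,
    fun lam h => Coiso.IsInducedBy.unique h.1 h.2 (Coiso.isPInfty_phaseBracket P)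
      (Coiso.isInducedBy_phaseBracket P)⟩,
    ⟨Coiso.unaryBracket (Coiso.phaseBracket P), Coiso.isLieAlgebroidDifferential_unaryBracket hC
      (Coiso.isPInfty_phaseBracket P) (Coiso.isInducedBy_phaseBracket P), fun δ h => h.unique
        (Coiso.isLieAlgebroidDifferential_unaryBracket hC (Coiso.isPInfty_phaseBracket P)
          (Coiso.isInducedBy_phaseBracket P))⟩, fun lam h hP => ⟨Coiso.isFlat hC h hP,
      fun δ hδ a => ?_, fun a ha => Coiso.lam_one_eq_zero_iff hC h hP ha, fun f hf g hg => ?_⟩⟩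
  · exact DFunLike.congr_fun
      ((Coiso.isLieAlgebroidDifferential_unaryBracket hC h hP).unique hδ) a
  · exact ⟨_, Coiso.restr_bracket_mem hC hf hg, Coiso.lam_two_ofFun hP f g, fun f' g' hf' hg' =>
      Coiso.restr_bracket_reduced hf hg hf' hg'⟩
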